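/- **Notation.** Let $\Delta,\varepsilon>0$, $\mu=(\mu_1,\mu_2,\mu_3)\in\mathbb C^3$ with $\mu_1+\mu_2+\mu_3=0$, $y=(y_1,y_2)\in(\mathbb R\setminus\{0\})^2$, $v=(\operatorname{sign}y_1,\operatorname{sign}y_2)$, $B(a,b)=\Gamma(a)\Gamma(b)/\Gamma(a+b)$. Put $$M_{\rm poly}(a,b,c;\mu)=|1+i\,\mathrm{Im}(\mu_1-\mu_2)|^a|1+i\,\mathrm{Im}(\mu_1-\mu_3)|^b|1+i\,\mathrm{Im}(\mu_2-\mu_3)|^c,$$ $$M_{\rm sym}(\kappa,\delta;\mu)=\sum_{w\in S_3}M_{\rm poly}\Big(\tfrac{\kappa-\delta}2+\varepsilon,\tfrac{\kappa-\delta}2+\varepsilon,\delta+\varepsilon;\mu^w\Big),$$ where $\mu^w$ runs over the permutations of $\mu$. Put $$\Lambda(\mu)=\pi^{-\frac32+\mu_3-\mu_1}\Gamma(\tfrac{1+\mu_1-\mu_2}2)\Gamma(\tfrac{1+\mu_1-\mu_3}2)\Gamma(\tfrac{1+\mu_2-\mu_3}2),\qquad G^*(u,\mu)=\frac{\prod_{i=1}^3\Gamma(\frac{u_1-\mu_i}2)\Gamma(\frac{u_2+\mu_i}2)}{\Gamma(\frac{u_1+u_2}2)\,\Lambda(\mu)}.$$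 Let $G^*_l(u_2,\mu)$, $G^*_r(u_1,\mu)$ and $G^*_b(\mu)$ be the residues of $G^*(u,\mu)$ at $u_1=\mu_1$, at $u_2=-\mu_2$, and at both; explicitly $$G^*_l(u_2,\mu)=\frac{2\,\Gamma(\frac{\mu_1-\mu_2}2)\Gamma(\frac{\mu_1-\mu_3}2)\Gamma(\frac{u_2+\mu_2}2)\Gamma(\frac{u_2+\mu_3}2)}{\Lambda(\mu)},\quad G^*_r(u_1,\mu)=\frac{2\,\Gamma(\frac{\mu_1-\mu_2}2)\Gamma(\frac{\mu_3-\mu_2}2)\Gamma(\frac{u_1-\mu_1}2)\Gamma(\frac{u_1-\mu_3}2)}{\Lambda(\mu)},$$ $$G^*_b(\mu)=\frac{4\,\Gamma(\frac{\mu_1-\mu_2}2)\Gamma(\frac{\mu_1-\mu_3}2)\Gamma(\frac{\mu_3-\mu_2}2)}{\Lambda(\mu)}.$$ Finally let $$Q(\mu)=\frac4{\pi^2}\prod_{j<k}\Big(-\tfrac\pi2(\mu_j-\mu_k)\tan\tfrac\pi2(\mu_j-\mu_k)\Big)\prod_{j<k}\big((3+2\Delta)^2-(\mu_j-\mu_k)^2\big)^{-\Delta/2}$$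 (this is $k_{\rm adj}(\mu)/|c_3(\mu)|^2$; principal branch). **Mellin–Barnes integrals.** All line integrals are upwards; $\mathfrak s,\mathfrak t,\mathfrak r,\mathfrak u$ denote the real parts of $s,t,r,u$. Put $$\begin{aligned}A_{w_l}={}&\sin\tfrac\pi2\big(v_1t_1+v_2(s_2-u_2)-r_1+s_2-t_1-t_2\big)\sin\tfrac\pi2\big(v_1(s_1-t_1-u_1)+t_1+t_2-r_2+s_1\big)\\&+\sin\tfrac\pi2\big(-v_1t_1+v_2(s_2-u_2)-r_1+s_2-t_1-t_2\big)\sin\tfrac\pi2\big(v_1(s_1-t_1-u_1)-t_1-t_2-r_2+s_1\big),\end{aligned}$$ $$\begin{aligned}N_2(r,s,u,v,t_1)=\frac{2^{r_1+r_2+u_1+u_2}}{2\pi^2(2\pi i)}\int_{\mathrm{Re}\,t_2=\mathfrak t_2}&A_{w_l}\,\Gamma(t_1+t_2)\,\Gamma(1-r_1+s_2-t_1-t_2)\,B\big(\tfrac{r_1-2s_2+t_2+u_2}2,\tfrac{1-r_1-t_2+u_1-u_2}2\big)\\&\times B\big(\tfrac{r_2-2s_1-t_2+u_1}2,\tfrac{r_1-r_2+t_2-u_1}2\big)\,B\big(\tfrac{1-2t_1-t_2}2,\tfrac{1-r_1-u_1}2\big)\,dt_2,\end{aligned}$$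 $$R(s,u,v,t_1)=\frac1{(2\pi i)^2}\int_{\mathrm{Re}\,r=\mathfrak r}G^*\big((1+2\Delta+r_1,\Delta+r_2),-\mu\big)\Gamma(1+s_1-r_2)N_2(r,s,u,v,t_1)\,dr,$$ $$N_1(s,u,v)=\frac1{2\pi i}\int_{\mathrm{Re}\,t_1=\mathfrak t_1}\Gamma(t_1)\Gamma(s_1-u_1-t_1)R(s,u,v,t_1)\,dt_1,$$ $$T(u,y)=\frac1{(2\pi i)^2}\int_{\mathrm{Re}\,s=\mathfrak s}|4\pi^2y_1|^{-s_1}|4\pi^2y_2|^{-s_2}\Gamma(s_2-u_2)N_1(s,u,v)\,ds .$$ **Error terms.** With $u^0=(\mu_1,-\mu_2)$, $$E_1=\tfrac{-3i}{128\pi^6}Q(\mu)\int G^*_r(u_1,\mu)\,T((u_1,-\mu_2),y)\,du_1,\qquad E_2=\tfrac{-3i}{128\pi^6}Q(\mu)\int G^*_l(u_2,\mu)\,T((\mu_1,u_2),y)\,du_2,$$ $$E_3=\tfrac{-3}{2^8\cdot3\,\pi^7}Q(\mu)\iint G^*(u,\mu)\,T(u,y)\,du,$$ $$E_4=\tfrac{3}{32\pi^5(2\pi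 i)}G^*_b(\mu)Q(\mu)\int|4\pi^2y_1|^{-s_1}|4\pi^2y_2|^{\mu_2}N_1((s_1,-\mu_2),u^0,v)\,ds_1,$$ $$E_5=\tfrac{3}{32\pi^5(2\pi i)^2}G^*_b(\mu)Q(\mu)\int|4\pi^2y_2|^{-s_2}\Gamma(s_2+\mu_2)\int|4\pi^2y_1|^{-\mu_1-t_1}\Gamma(t_1)R((\mu_1+t_1,s_2),u^0,v,t_1)\,dt_1\,ds_2,$$ $$E_6=\tfrac{3}{32\pi^5(2\pi i)^2}G^*_b(\mu)Q(\mu)\iint|4\pi^2y_1|^{-s_1}|4\pi^2y_2|^{-s_2}\Gamma(s_2+\mu_2)N_1(s,u^0,v)\,ds,$$ $$E_7=\tfrac{3}{32\pi^5(2\pi i)}G^*_b(\mu)Q(\mu)\int|4\pi^2y_1|^{-\mu_1-t_1}|4\pi^2y_2|^{\mu_2}\Gamma(t_1)R((\mu_1+t_1,-\mu_2),u^0,v,t_1)\,dt_1 .$$ The contours, and $\eta=\mathrm{Re}(\mu_1,\mu_2)$, are as follows, with $\mathfrak s=(-\frac12-\varepsilon,-\frac12-\varepsilon)$ throughout (a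 single number in the columns $\mathfrak u$, $\mathfrak r$, $\mathfrak t$ means that both entries equal it). | $j$ | $\eta$ | $\mathfrak u$ | $\mathfrak r$ | $\mathfrak t$ | |---|---|---|---|---| | 1 | $(-3\varepsilon,\frac12+3\varepsilon)$ | $\mathfrak u_1=-\frac12-3\varepsilon$ | $(\frac12-4\varepsilon,100\varepsilon)$ | $\varepsilon$ | | 2 | $(-\frac12-3\varepsilon,3\varepsilon)$ | $\mathfrak u_2=-\frac12-3\varepsilon$ | $(\frac12-4\varepsilon,100\varepsilon)$ | $\varepsilon$ | | 3 | $(-3\varepsilon,3\varepsilon)$ | $-\frac12-3\varepsilon$ | $(\frac12-4\varepsilon,100\varepsilon)$ | $\varepsilon$ | | 4 | $(-\varepsilon,\frac12+3\varepsilon)$ | – | $(-4\varepsilon,100\varepsilon)$ | $(\varepsilon,\frac12-\varepsilon)$ | | 5 | $(-\frac12-3\varepsilon,\varepsilon)$ | – | $(-3\varepsilon,7\varepsilon)$ | $(6\varepsilon,\frac12-6\varepsilon)$ | | 6 | $(-\varepsilon,\varepsilon)$ | – | $0$ | $\varepsilon$ | | 7 | $(-\varepsilon,\frac12+3\varepsilon)$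 | – | $(\varepsilon,4\varepsilon)$ | $(-\frac12+5\varepsilon,1-10\varepsilon)$ | **Proposition.** There are absolute constants $\Delta_0,c>0$ such that for all $0<\Delta<\Delta_0$ and $0<\varepsilon\le c\Delta$ there is a constant $C=C(\Delta,\varepsilon)$ with the following property. Let $1\le j\le7$, let $\mu$ satisfy $\mathrm{Re}(\mu_1,\mu_2)=\eta$ as in row $j$, and let $y\in(\mathbb R\setminus\{0\})^2$. Then the multiple integral defining $E_j(\mu,y)$ converges absolutely (jointly in all its variables), and, with $$(\kappa_j,\delta_j)_{j=1,\dots,7}=(2,0),\ (2,0),\ (\tfrac52,\tfrac12),\ (\tfrac32,0),\ (\tfrac32,0),\ (2,\tfrac12),\ (\tfrac32,0),$$ one has $$|E_j(\mu,y)|\le C\,|y_1|^{\frac12+\varepsilon}|y_2|^{\frac12+\varepsilon}\,M_{\rm sym}(\kappa_j,\delta_j;\mu),$$ for all such $y$ if $j\ne4,7$, and for all such $y$ with $|y_2|\le1$ if $j\in\{4,7\}$. For $j\in\{4,7\}$ and all such $y$ one has $|E_j(\mu,y)|\le C\,|y_1|^{\frac12+\varepsilon}|y_2|^{\frac12+3\varepsilon}\,M_{\rm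 sym}(\kappa_j,\delta_j;\mu)$. -/

import Mathlib

open MeasureTheory Complex

noncomputable section

namespace SL3

/-! ## Gamma-function notation and polynomial majorants

The triple `(μ₁, μ₂, μ₃)` is `μ : Fin 3 → ℂ` with indices `0, 1, 2`; in the theorem `μ 0 + μ 1 + μ 2 = 0`. -/

/-- `M_poly(a, b, c; μ)`. -/
def Mpoly (a b c : ℝ) (μ : Fin 3 → ℂ) : ℝ :=
  ‖1 + I * ((μ 0 - μ 1).im : ℂ)‖ ^ a * ‖1 + I * ((μ 0 - μ 2).im : ℂ)‖ ^ b *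
    ‖1 + I * ((μ 1 - μ 2).im : ℂ)‖ ^ c

/-- `M_sym(κ, δ; μ)`, the sum over the Weyl group, which permutes the coordinates of `μ`. -/
def Msym (ε κ δ : ℝ) (μ : Fin 3 → ℂ) : ℝ :=
  ∑ w : Equiv.Perm (Fin 3),
    Mpoly ((κ - δ) / 2 + ε) ((κ - δ) / 2 + ε) (δ + ε) (fun i => μ (w i))

/-- The beta function `Γ(a)Γ(b)/Γ(a+b)`, for all complex arguments. -/
def betaFn (a b : ℂ) : ℂ := Gamma a * Gamma b / Gamma (a + b)

/-- The factor `Λ(μ)` that completes the Whittaker function. -/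
def Lam (μ : Fin 3 → ℂ) : ℂ :=
  (Real.pi : ℂ) ^ (-(3 / 2 : ℂ) + μ 2 - μ 0) * Gamma ((1 + μ 0 - μ 1) / 2) *
    Gamma ((1 + μ 0 - μ 2) / 2) * Gamma ((1 + μ 1 - μ 2) / 2)

/-- `G(u, μ)`, the Mellin transform of the completed Whittaker function. -/
def G (u : ℂ × ℂ) (μ : Fin 3 → ℂ) : ℂ :=
  Gamma ((u.1 - μ 0) / 2) * Gamma ((u.1 - μ 1) / 2) * Gamma ((u.1 - μ 2) / 2) *
    Gamma ((u.2 + μ 0) / 2) * Gamma ((u.2 + μ 1) / 2) * Gamma ((u.2 + μ 2) / 2) /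
      Gamma ((u.1 + u.2) / 2)

/-- `G*(u, μ) = G(u, μ) / Λ(μ)`. -/
def Gstar (u : ℂ × ℂ) (μ : Fin 3 → ℂ) : ℂ := G u μ / Lam μ

/-- `G*_l(u₂, μ)`, the residue of `G*(u, μ)` at `u₁ = μ₁`. -/
def GstarL (u₂ : ℂ) (μ : Fin 3 → ℂ) : ℂ :=
  2 * (Real.pi : ℂ) ^ ((3 / 2 : ℂ) + μ 0 - μ 2) *
    (Gamma ((μ 0 - μ 1) / 2) * Gamma ((μ 0 - μ 2) / 2) /
      (Gamma ((1 + μ 0 - μ 1) / 2) * Gamma ((1 + μ 0 - μ 2) / 2))) *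
    (Gamma ((u₂ + μ 1) / 2) * Gamma ((u₂ + μ 2) / 2) / Gamma ((1 + μ 1 - μ 2) / 2))

/-- `G*_r(u₁, μ)`, the residue of `G*(u, μ)` at `u₂ = -μ₂`. -/
def GstarR (u₁ : ℂ) (μ : Fin 3 → ℂ) : ℂ :=
  2 * (Real.pi : ℂ) ^ ((3 / 2 : ℂ) + μ 0 - μ 2) *
    (Gamma ((μ 0 - μ 1) / 2) * Gamma ((μ 2 - μ 1) / 2) /
      (Gamma ((1 + μ 0 - μ 1) / 2) * Gamma ((1 + μ 1 - μ 2) / 2))) *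
    (Gamma ((u₁ - μ 0) / 2) * Gamma ((u₁ - μ 2) / 2) / Gamma ((1 + μ 0 - μ 2) / 2))

/-- `G*_b(μ)`, the double residue of `G*(u, μ)` at `u = (μ₁, -μ₂)`. -/
def GstarB (μ : Fin 3 → ℂ) : ℂ :=
  4 * (Real.pi : ℂ) ^ ((3 / 2 : ℂ) + μ 0 - μ 2) *
    (Gamma ((μ 0 - μ 1) / 2) * Gamma ((μ 0 - μ 2) / 2) * Gamma ((μ 2 - μ 1) / 2) /
      (Gamma ((1 + μ 0 - μ 1) / 2) * Gamma ((1 + μ 0 - μ 2) / 2) *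
        Gamma ((1 + μ 1 - μ 2) / 2)))

/-- One factor `-(π/2) z tan(π z / 2)` of `|c₃(μ)|⁻²`. -/
def tanFactor (z : ℂ) : ℂ := -(Real.pi / 2 * z) * tan (Real.pi / 2 * z)

/-- The meromorphic function `|c₃(μ)|⁻²`. -/
def c3InvSq (μ : Fin 3 → ℂ) : ℂ :=
  4 / (Real.pi : ℂ) ^ 2 *
    (tanFactor (μ 0 - μ 1) * tanFactor (μ 0 - μ 2) * tanFactor (μ 1 - μ 2))

/-- One factor `((3+2Δ)² - z²)^(-Δ/2)` of `k_adj`; on `|Re z| < 3 + 2Δ` the base avoids the cut of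
the principal branch. -/
def adjFactor (Δ : ℝ) (z : ℂ) : ℂ := ((3 + 2 * Δ : ℂ) ^ 2 - z ^ 2) ^ (-(Δ : ℂ) / 2)

/-- `k_adj(μ)`. -/
def kadj (Δ : ℝ) (μ : Fin 3 → ℂ) : ℂ :=
  adjFactor Δ (μ 0 - μ 1) * adjFactor Δ (μ 0 - μ 2) * adjFactor Δ (μ 1 - μ 2)

/-! ## Contours -/

/-- The point `c + iτ` of the vertical line `Re = c`. -/
def pt (c τ : ℝ) : ℂ := (c : ℂ) + (τ : ℂ) * I

/-- The line integral `∫_{Re z = c} f(z) dz`, upwards. -/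
def lineInt (c : ℝ) (f : ℂ → ℂ) : ℂ := I * ∫ τ : ℝ, f (pt c τ)

/-- Real parts of the lines of integration, and `η = Re (μ₁, μ₂)`. -/
structure Contours where
  η : ℝ × ℝ
  u : ℝ × ℝ
  s : ℝ × ℝ
  r : ℝ × ℝ
  t : ℝ × ℝ

/-- The table of contours; entry `j` (from `0` to `6`) belongs to the error term `E_{j+1}`.
Everywhere `𝔰₁ = 𝔰₂ = -1/2 - ε`. A component of `u` over which the term has no integral is set to
`0` and is not used. -/
def contourTable (ε : ℝ) : Fin 7 → Contours :=
  ![{ η := (-3 * ε, 1 / 2 + 3 * ε), u := (-(1 / 2) - 3 * ε, 0),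
      s := (-(1 / 2) - ε, -(1 / 2) - ε), r := (1 / 2 - 4 * ε, 100 * ε), t := (ε, ε) },
    { η := (-(1 / 2) - 3 * ε, 3 * ε), u := (0, -(1 / 2) - 3 * ε),
      s := (-(1 / 2) - ε, -(1 / 2) - ε), r := (1 / 2 - 4 * ε, 100 * ε), t := (ε, ε) },
    { η := (-3 * ε, 3 * ε), u := (-(1 / 2) - 3 * ε, -(1 / 2) - 3 * ε),
      s := (-(1 / 2) - ε, -(1 / 2) - ε), r := (1 / 2 - 4 * ε, 100 * ε), t := (ε, ε) },
    { η := (-ε, 1 / 2 + 3 * ε), u := (0, 0),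
      s := (-(1 / 2) - ε, -(1 / 2) - ε), r := (-4 * ε, 100 * ε), t := (ε, 1 / 2 - ε) },
    { η := (-(1 / 2) - 3 * ε, ε), u := (0, 0),
      s := (-(1 / 2) - ε, -(1 / 2) - ε), r := (-3 * ε, 7 * ε),
      t := (6 * ε, 1 / 2 - 6 * ε) },
    { η := (-ε, ε), u := (0, 0),
      s := (-(1 / 2) - ε, -(1 / 2) - ε), r := (0, 0), t := (ε, ε) },
    { η := (-ε, 1 / 2 + 3 * ε), u := (0, 0),
      s := (-(1 / 2) - ε, -(1 / 2) - ε), r := (ε, 4 * ε),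
      t := (-(1 / 2) + 5 * ε, 1 - 10 * ε) }]

/-! ## The Mellin-Barnes integrals for the long Weyl element -/

/-- The sign pair `v = sign(y)`. -/
def sgn (y : ℝ × ℝ) : ℂ × ℂ := ((Real.sign y.1 : ℂ), (Real.sign y.2 : ℂ))

/-- `A_{w_l}(r, s, t, u, v)`. -/
def Awl (v u s r : ℂ × ℂ) (t₁ t₂ : ℂ) : ℂ :=
  sin (Real.pi / 2 * (v.1 * t₁ + v.2 * (s.2 - u.2) - r.1 + s.2 - t₁ - t₂)) *
      sin (Real.pi / 2 * (v.1 * (s.1 - t₁ - u.1) + t₁ + t₂ - r.2 + s.1)) +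
    sin (Real.pi / 2 * (-(v.1 * t₁) + v.2 * (s.2 - u.2) - r.1 + s.2 - t₁ - t₂)) *
      sin (Real.pi / 2 * (v.1 * (s.1 - t₁ - u.1) - t₁ - t₂ - r.2 + s.1))

/-- The integrand of `N_{w_l,2}` in `t₂`. -/
def kerN2 (v u s r : ℂ × ℂ) (t₁ t₂ : ℂ) : ℂ :=
  Awl v u s r t₁ t₂ * Gamma (t₁ + t₂) * Gamma (1 - r.1 + s.2 - t₁ - t₂) *
    betaFn ((r.1 - 2 * s.2 + t₂ + u.2) / 2) ((1 - r.1 - t₂ + u.1 - u.2) / 2) *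
    betaFn ((r.2 - 2 * s.1 - t₂ + u.1) / 2) ((r.1 - r.2 + t₂ - u.1) / 2) *
    betaFn ((1 - 2 * t₁ - t₂) / 2) ((1 - r.1 - u.1) / 2)

/-- `N_{w_l,2}(r, s, u, v, t₁)`. -/
def N2 (c : Contours) (v u s r : ℂ × ℂ) (t₁ : ℂ) : ℂ :=
  (2 : ℂ) ^ (r.1 + r.2 + u.1 + u.2) / (2 * (Real.pi : ℂ) ^ 2 * (2 * Real.pi * I)) *
    lineInt c.t.2 (fun t₂ => kerN2 v u s r t₁ t₂)

/-- The factor of the integrand of `R_{w_l}` in front of `N_{w_l,2}`. -/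
def kerR (Δ : ℝ) (μ : Fin 3 → ℂ) (s r : ℂ × ℂ) : ℂ :=
  Gstar (1 + 2 * Δ + r.1, Δ + r.2) (fun i => -μ i) * Gamma (1 + s.1 - r.2)

/-- `R_{w_l}(s, u, v, t₁)`. -/
def R (Δ : ℝ) (c : Contours) (μ : Fin 3 → ℂ) (v u s : ℂ × ℂ) (t₁ : ℂ) : ℂ :=
  1 / (2 * Real.pi * I) ^ 2 *
    lineInt c.r.1 (fun r₁ => lineInt c.r.2 (fun r₂ =>
      kerR Δ μ s (r₁, r₂) * N2 c v u s (r₁, r₂) t₁))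

/-- The factor of the integrand of `N_{w_l,1}` in front of `R_{w_l}`. -/
def kerN1 (u s : ℂ × ℂ) (t₁ : ℂ) : ℂ := Gamma t₁ * Gamma (s.1 - u.1 - t₁)

/-- `N_{w_l,1}(s, u, v)`. -/
def N1 (Δ : ℝ) (c : Contours) (μ : Fin 3 → ℂ) (v u s : ℂ × ℂ) : ℂ :=
  1 / (2 * Real.pi * I) *
    lineInt c.t.1 (fun t₁ => kerN1 u s t₁ * R Δ c μ v u s t₁)

/-- `|4π²y₁|^{-s₁} |4π²y₂|^{-s₂}`. -/
def yPow (y : ℝ × ℝ) (s : ℂ × ℂ) : ℂ :=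
  ((4 * Real.pi ^ 2 * |y.1| : ℝ) : ℂ) ^ (-s.1) * ((4 * Real.pi ^ 2 * |y.2| : ℝ) : ℂ) ^ (-s.2)

/-- `T_{w_l,μ}(u, y)`. -/
def T (Δ : ℝ) (c : Contours) (μ : Fin 3 → ℂ) (u : ℂ × ℂ) (y : ℝ × ℝ) : ℂ :=
  1 / (2 * Real.pi * I) ^ 2 *
    lineInt c.s.1 (fun s₁ => lineInt c.s.2 (fun s₂ =>
      yPow y (s₁, s₂) * Gamma (s₂ - u.2) * N1 Δ c μ (sgn y) u (s₁, s₂)))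

/-! ## The error terms -/

/-- `E_{w_l,1}(μ, y)`. -/
def E1 (Δ : ℝ) (c : Contours) (μ : Fin 3 → ℂ) (y : ℝ × ℝ) : ℂ :=
  -3 * I / (128 * (Real.pi : ℂ) ^ 6) * (kadj Δ μ * c3InvSq μ) *
    lineInt c.u.1 (fun u₁ => GstarR u₁ μ * T Δ c μ (u₁, -μ 1) y)

/-- `E_{w_l,2}(μ, y)`. -/
def E2 (Δ : ℝ) (c : Contours) (μ : Fin 3 → ℂ) (y : ℝ × ℝ) : ℂ :=
  -3 * I / (128 * (Real.pi : ℂ) ^ 6) * (kadj Δ μ * c3InvSq μ) *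
    lineInt c.u.2 (fun u₂ => GstarL u₂ μ * T Δ c μ (μ 0, u₂) y)

/-- `E_{w_l,3}(μ, y)`. -/
def E3 (Δ : ℝ) (c : Contours) (μ : Fin 3 → ℂ) (y : ℝ × ℝ) : ℂ :=
  -3 / (2 ^ 8 * 3 * (Real.pi : ℂ) ^ 7) * (kadj Δ μ * c3InvSq μ) *
    lineInt c.u.1 (fun u₁ => lineInt c.u.2 (fun u₂ =>
      Gstar (u₁, u₂) μ * T Δ c μ (u₁, u₂) y))

/-- `E_{w_l,4}(μ, y)`: here `s₂ = -μ₂`. -/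
def E4 (Δ : ℝ) (c : Contours) (μ : Fin 3 → ℂ) (y : ℝ × ℝ) : ℂ :=
  3 / (32 * (Real.pi : ℂ) ^ 5 * (2 * Real.pi * I)) * GstarB μ * (kadj Δ μ * c3InvSq μ) *
    lineInt c.s.1 (fun s₁ =>
      yPow y (s₁, -μ 1) * N1 Δ c μ (sgn y) (μ 0, -μ 1) (s₁, -μ 1))

/-- `E_{w_l,5}(μ, y)`: here `s₁ = μ₁ + t₁`. -/
def E5 (Δ : ℝ) (c : Contours) (μ : Fin 3 → ℂ) (y : ℝ × ℝ) : ℂ :=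
  3 / (32 * (Real.pi : ℂ) ^ 5 * (2 * Real.pi * I) ^ 2) * GstarB μ * (kadj Δ μ * c3InvSq μ) *
    lineInt c.s.2 (fun s₂ => Gamma (s₂ + μ 1) * lineInt c.t.1 (fun t₁ =>
      yPow y (μ 0 + t₁, s₂) * Gamma t₁ *
        R Δ c μ (sgn y) (μ 0, -μ 1) (μ 0 + t₁, s₂) t₁))

/-- `E_{w_l,6}(μ, y)`. -/
def E6 (Δ : ℝ) (c : Contours) (μ : Fin 3 → ℂ) (y : ℝ × ℝ) : ℂ :=
  3 / (32 * (Real.pi : ℂ) ^ 5 * (2 * Real.pi * I) ^ 2) * GstarB μ * (kadj Δ μ * c3InvSq μ) *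
    lineInt c.s.1 (fun s₁ => lineInt c.s.2 (fun s₂ =>
      yPow y (s₁, s₂) * Gamma (s₂ + μ 1) *
        N1 Δ c μ (sgn y) (μ 0, -μ 1) (s₁, s₂)))

/-- `E_{w_l,7}(μ, y)`: here `s = (μ₁ + t₁, -μ₂)`. -/
def E7 (Δ : ℝ) (c : Contours) (μ : Fin 3 → ℂ) (y : ℝ × ℝ) : ℂ :=
  3 / (32 * (Real.pi : ℂ) ^ 5 * (2 * Real.pi * I)) * GstarB μ * (kadj Δ μ * c3InvSq μ) *
    lineInt c.t.1 (fun t₁ =>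
      yPow y (μ 0 + t₁, -μ 1) * Gamma t₁ *
        R Δ c μ (sgn y) (μ 0, -μ 1) (μ 0 + t₁, -μ 1) t₁)

/-- The error term `E_{w_l,j+1}(μ, y)` for the contours of the table. -/
def errorTerm (Δ ε : ℝ) (j : Fin 7) (μ : Fin 3 → ℂ) (y : ℝ × ℝ) : ℂ :=
  (![E1, E2, E3, E4, E5, E6, E7] : Fin 7 → ℝ → Contours → (Fin 3 → ℂ) → ℝ × ℝ → ℂ)
    j Δ (contourTable ε j) μ y

/-! ## Absolute convergence

Each error term, written out, is a constant times one multiple integral over a product of vertical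
lines. `absConv` says that its integrand is absolutely integrable over all variables jointly. -/

/-- The joint integrand of `R_{w_l}` in `(r₁, r₂, t₂)`. -/
def core (Δ : ℝ) (μ : Fin 3 → ℂ) (v u s : ℂ × ℂ) (t₁ r₁ r₂ t₂ : ℂ) : ℂ :=
  kerR Δ μ s (r₁, r₂) * (2 : ℂ) ^ (r₁ + r₂ + u.1 + u.2) * kerN2 v u s (r₁, r₂) t₁ t₂

/-- The joint integrand of `T_{w_l,μ}(u, y)` in `(s₁, s₂, t₁, r₁, r₂, t₂)`. -/
def coreT (Δ : ℝ) (μ : Fin 3 → ℂ) (u : ℂ × ℂ) (y : ℝ × ℝ) (s₁ s₂ t₁ r₁ r₂ t₂ : ℂ) : ℂ :=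
  yPow y (s₁, s₂) * Gamma (s₂ - u.2) * kerN1 u (s₁, s₂) t₁ *
    core Δ μ (sgn y) u (s₁, s₂) t₁ r₁ r₂ t₂

def absConv1 (Δ : ℝ) (c : Contours) (μ : Fin 3 → ℂ) (y : ℝ × ℝ) : Prop :=
  Integrable (fun p : ℝ × ℝ × ℝ × ℝ × ℝ × ℝ × ℝ =>
    GstarR (pt c.u.1 p.1) μ *
      coreT Δ μ (pt c.u.1 p.1, -μ 1) y (pt c.s.1 p.2.1) (pt c.s.2 p.2.2.1)
        (pt c.t.1 p.2.2.2.1) (pt c.r.1 p.2.2.2.2.1) (pt c.r.2 p.2.2.2.2.2.1)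
        (pt c.t.2 p.2.2.2.2.2.2))

def absConv2 (Δ : ℝ) (c : Contours) (μ : Fin 3 → ℂ) (y : ℝ × ℝ) : Prop :=
  Integrable (fun p : ℝ × ℝ × ℝ × ℝ × ℝ × ℝ × ℝ =>
    GstarL (pt c.u.2 p.1) μ *
      coreT Δ μ (μ 0, pt c.u.2 p.1) y (pt c.s.1 p.2.1) (pt c.s.2 p.2.2.1)
        (pt c.t.1 p.2.2.2.1) (pt c.r.1 p.2.2.2.2.1) (pt c.r.2 p.2.2.2.2.2.1)
        (pt c.t.2 p.2.2.2.2.2.2))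

def absConv3 (Δ : ℝ) (c : Contours) (μ : Fin 3 → ℂ) (y : ℝ × ℝ) : Prop :=
  Integrable (fun p : ℝ × ℝ × ℝ × ℝ × ℝ × ℝ × ℝ × ℝ =>
    Gstar (pt c.u.1 p.1, pt c.u.2 p.2.1) μ *
      coreT Δ μ (pt c.u.1 p.1, pt c.u.2 p.2.1) y (pt c.s.1 p.2.2.1) (pt c.s.2 p.2.2.2.1)
        (pt c.t.1 p.2.2.2.2.1) (pt c.r.1 p.2.2.2.2.2.1) (pt c.r.2 p.2.2.2.2.2.2.1)
        (pt c.t.2 p.2.2.2.2.2.2.2))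

def absConv4 (Δ : ℝ) (c : Contours) (μ : Fin 3 → ℂ) (y : ℝ × ℝ) : Prop :=
  Integrable (fun p : ℝ × ℝ × ℝ × ℝ × ℝ =>
    yPow y (pt c.s.1 p.1, -μ 1) *
      kerN1 (μ 0, -μ 1) (pt c.s.1 p.1, -μ 1) (pt c.t.1 p.2.1) *
      core Δ μ (sgn y) (μ 0, -μ 1) (pt c.s.1 p.1, -μ 1) (pt c.t.1 p.2.1)
        (pt c.r.1 p.2.2.1) (pt c.r.2 p.2.2.2.1) (pt c.t.2 p.2.2.2.2))

def absConv5 (Δ : ℝ) (c : Contours) (μ : Fin 3 → ℂ) (y : ℝ × ℝ) : Prop :=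
  Integrable (fun p : ℝ × ℝ × ℝ × ℝ × ℝ =>
    Gamma (pt c.s.2 p.1 + μ 1) * yPow y (μ 0 + pt c.t.1 p.2.1, pt c.s.2 p.1) *
      Gamma (pt c.t.1 p.2.1) *
      core Δ μ (sgn y) (μ 0, -μ 1) (μ 0 + pt c.t.1 p.2.1, pt c.s.2 p.1) (pt c.t.1 p.2.1)
        (pt c.r.1 p.2.2.1) (pt c.r.2 p.2.2.2.1) (pt c.t.2 p.2.2.2.2))

def absConv6 (Δ : ℝ) (c : Contours) (μ : Fin 3 → ℂ) (y : ℝ × ℝ) : Prop :=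
  Integrable (fun p : ℝ × ℝ × ℝ × ℝ × ℝ × ℝ =>
    coreT Δ μ (μ 0, -μ 1) y (pt c.s.1 p.1) (pt c.s.2 p.2.1) (pt c.t.1 p.2.2.1)
      (pt c.r.1 p.2.2.2.1) (pt c.r.2 p.2.2.2.2.1) (pt c.t.2 p.2.2.2.2.2))

def absConv7 (Δ : ℝ) (c : Contours) (μ : Fin 3 → ℂ) (y : ℝ × ℝ) : Prop :=
  Integrable (fun p : ℝ × ℝ × ℝ × ℝ =>
    yPow y (μ 0 + pt c.t.1 p.1, -μ 1) * Gamma (pt c.t.1 p.1) *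
      core Δ μ (sgn y) (μ 0, -μ 1) (μ 0 + pt c.t.1 p.1, -μ 1) (pt c.t.1 p.1)
        (pt c.r.1 p.2.1) (pt c.r.2 p.2.2.1) (pt c.t.2 p.2.2.2))

/-- Absolute convergence of `E_{w_l,j+1}(μ, y)` for the contours of the table. -/
def absConv (Δ ε : ℝ) (j : Fin 7) (μ : Fin 3 → ℂ) (y : ℝ × ℝ) : Prop :=
  (![absConv1, absConv2, absConv3, absConv4, absConv5, absConv6, absConv7] :
      Fin 7 → ℝ → Contours → (Fin 3 → ℂ) → ℝ × ℝ → Prop)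
    j Δ (contourTable ε j) μ y

/-- The parameters `(κ, δ)` of the majorant `M_sym(κ, δ; μ)` of `E_{w_l,j+1}`. -/
def majorantParams : Fin 7 → ℝ × ℝ :=
  ![(2, 0), (2, 0), (5 / 2, 1 / 2), (3 / 2, 0), (3 / 2, 0), (2, 1 / 2), (3 / 2, 0)]

end SL3

end

/-! On the prescribed contours all real parts are fixed, so the question is how large a product of
gamma factors is as a function of the imaginary parts. Two-sided Stirling bounds (`norm_Gamma_le`,
`norm_inv_Gamma_le`) turn every factor into the exponential of a linear combination of weights `lg x
= log (1 + |x|)` and of absolute values. The proof then becomes linear arithmetic with these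
weights.

The exponential parts are settled first. The sines in `Awl` grow no faster than six gamma factors
decay (`norm_Awl_le`), and the beta functions are bounded by powers alone (`norm_betaFn_le`), so the
kernel of the inner integrals is polynomially bounded. In `Gstar` the exponentials add up to
exp(-(π/4) `defect`). Write m for the imaginary parts of μ, q for the index of the middle one and p,
s for the other two. The defect is nonnegative, and for one of the two labellings of the extremes it
vanishes only when Im r₁ lies between -m_q and -m_s and Im r₂ between m_q and m_p (`label_or`). Away
from this box the exponential decay absorbs any power.

One tool does nearly all the integrations, `lintegral_weights`: a product of powers (1 + |x -
a_k|)^(-c_k) of total degree above 1 has a bounded integral, and the surplus of the degree over 1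
may be exchanged for decay in the distances of the centres. The variables s, t₁, t₂ are integrated
out uniformly in r and u (`lintegral_innerA` and its variants), in some cases with a small remaining
decay that ties r to u. The integrals over r (`lintegral_spec`), and over u where present
(`lintegral_outer`, `lintegral_GstarR_le`, `lintegral_GstarL_le`, `lintegral_outer_le`), then leave
powers of the three root sizes 1 + |m_i - m_j|. The powers of exponent proportional to Δ in `Gstar`
are compensated by those in `kadj`.

The largest root size is comparable with the larger of the other two, so comparison with `Msym`
reduces, for each ordering of the coordinates, to three linear inequalities between exponents
(`DominatedAt`, `lin_le_max`).

The dependence on y is |y|^(-Re s). For `E5` and `E7` the tabulated line of t₁ would give |y₁| the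
exponents 1/2 - 3ε and 1/2 - 4ε, so that line is moved to the left (`integral_pt_prod_eq`). For `E4`
and `E7` the value s₂ = -μ₂ forces the exponent 1/2 + 3ε of |y₂|, whence the restriction |y₂| ≤ 1 in
the common bound. Absolute convergence is the finiteness of the same integrals of absolute values.
-/

namespace SL3

section

/-! ## Logarithmic weights and one-dimensional integrals -/

/-- The logarithmic size `log (1 + |x|)`. -/
noncomputable def lg (x : ℝ) : ℝ := Real.log (1 + |x|)

lemma lg_nonneg (x : ℝ) : 0 ≤ lg x := Real.log_nonneg (by linarith [abs_nonneg x])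

lemma lg_neg (x : ℝ) : lg (-x) = lg x := by simp [lg]

lemma lg_sub_comm (x y : ℝ) : lg (x - y) = lg (y - x) := by rw [← lg_neg, neg_sub]

lemma exp_lg (x : ℝ) : Real.exp (lg x) = 1 + |x| :=
  Real.exp_log (by linarith [abs_nonneg x])

lemma lg_mono {x y : ℝ} (h : |x| ≤ |y|) : lg x ≤ lg y :=
  Real.log_le_log (by linarith [abs_nonneg x]) (by linarith)

lemma continuous_lg : Continuous lg := by
  unfold lg
  exact Continuous.log (by fun_prop) (fun x => by linarith [abs_nonneg x])

@[fun_prop]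
lemma measurable_lg : Measurable lg := continuous_lg.measurable

/-- A bound `|x| ≤ c (1 + |y|) (1 + Φ) - 1` in logarithmic form. -/
lemma lg_le_add {x y : ℝ} {c : ℝ} (hc : 0 < c) (h : 1 + |x| ≤ c * (1 + |y|)) :
    lg x ≤ lg y + Real.log c := by
  have h1 : 0 < 1 + |x| := by linarith [abs_nonneg x]
  have h2 : 0 < 1 + |y| := by linarith [abs_nonneg y]
  unfold lg
  rw [← Real.log_mul h2.ne' hc.ne']
  exact Real.log_le_log h1 (by linarith [mul_comm c (1 + |y|)])

lemma lg_add_le_max (x y : ℝ) : lg (x + y) ≤ max (lg x) (lg y) + Real.log 2 := by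
  rcases le_total |x| |y| with h | h
  · exact (lg_le_add two_pos (by linarith [abs_add_le x y, abs_nonneg x])).trans
      (by gcongr; exact le_max_right _ _)
  · exact (lg_le_add two_pos (by linarith [abs_add_le x y, abs_nonneg y])).trans
      (by gcongr; exact le_max_left _ _)

lemma lg_half_le (x : ℝ) : lg (x / 2) ≤ lg x :=
  lg_mono (by rw [abs_div, abs_two]; linarith [abs_nonneg x])

lemma lg_le_lg_half (x : ℝ) : lg x ≤ lg (x / 2) + Real.log 2 :=
  lg_le_add two_pos (by rw [abs_div, abs_two]; linarith [abs_nonneg x])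

lemma lg_le_lg_two_mul (x : ℝ) : lg x ≤ lg (2 * x) :=
  lg_mono (by rw [abs_mul, abs_two]; linarith [abs_nonneg x])

/-- `∫ (1 + |x|)^(-Λ) dx` is finite for `Λ > 1`. -/
lemma lintegral_exp_lg_lt_top {Λ : ℝ} (hΛ : 1 < Λ) :
    ∫⁻ x : ℝ, ENNReal.ofReal (Real.exp (-(Λ * lg x))) < ⊤ := by
  have h := integrable_one_add_norm (E := ℝ) (μ := volume) (r := Λ) (by simpa using hΛ)
  have h2 := h.lintegral_lt_top
  convert h2 using 3 with x
  rw [Real.rpow_def_of_pos (by positivity), lg, Real.norm_eq_abs]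
  ring_nf

/-- The basic one-dimensional estimate: a product of weights `(1 + |x - a k|)^(-c k)` of total
degree more than `1` has bounded integral, and the excess may be traded for decay in the
distances of the centres. -/
lemma lintegral_weights {n : ℕ} (c : Fin n → ℝ) (γ : Fin n → Fin n → ℝ)
    (hγ : ∀ i j, 0 ≤ γ i j) (hc : ∀ k, ∑ j, (γ k j + γ j k) ≤ c k)
    (hs : 1 < ∑ k, c k - ∑ i, ∑ j, γ i j) :
    ∃ K : ℝ, 0 < K ∧ ∀ a : Fin n → ℝ,
      ∫⁻ x : ℝ, ENNReal.ofReal (Real.exp (-∑ k, c k * lg (x - a k))) ≤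
        ENNReal.ofReal (K * Real.exp (-∑ i, ∑ j, γ i j * lg (a i - a j))) := by
  set Λ := ∑ k, c k - ∑ i, ∑ j, γ i j with hΛ
  set Γ := ∑ i, ∑ j, γ i j with hΓ
  have hI := lintegral_exp_lg_lt_top hs
  set I := ∫⁻ x : ℝ, ENNReal.ofReal (Real.exp (-(Λ * lg x))) with hIdef
  refine ⟨Real.exp (Γ * Real.log 2) * (n * I.toReal + 1), by positivity, fun a => ?_⟩
  have hn : 0 < n := by
    rcases Nat.eq_zero_or_pos n with h | h
    · subst h
      simp [hΛ, hΓ] at hs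
      linarith
    · exact h
  have hpt : ∀ x : ℝ, Real.exp (-∑ k, c k * lg (x - a k)) ≤
      Real.exp (Γ * Real.log 2) * Real.exp (-∑ i, ∑ j, γ i j * lg (a i - a j)) *
        ∑ k, Real.exp (-(Λ * lg (x - a k))) := by
    intro x
    have : Nonempty (Fin n) := ⟨⟨0, hn⟩⟩
    obtain ⟨k₀, -, hk₀⟩ := Finset.exists_min_image Finset.univ (fun k => lg (x - a k))
      ⟨⟨0, hn⟩, Finset.mem_univ _⟩
    have hmin : ∀ k, lg (x - a k₀) ≤ lg (x - a k) := fun k => hk₀ k (Finset.mem_univ _)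
    calc Real.exp (-∑ k, c k * lg (x - a k))
        ≤ Real.exp (Γ * Real.log 2 + -∑ i, ∑ j, γ i j * lg (a i - a j) +
            -(Λ * lg (x - a k₀))) := by
          apply Real.exp_le_exp.2
          -- The left side is at most the larger of the two distances to x, up to log 2. The smaller
          -- one is at least the distance to the nearest centre `a k₀`, so it may be added and the
          -- minimum subtracted.
          have h1 : ∀ i j, lg (a i - a j) ≤
              lg (x - a i) + lg (x - a j) - lg (x - a k₀) + Real.log 2 := by
            intro i j
            have h := lg_add_le_max (x - a j) (-(x - a i))
            rw [lg_neg, show x - a j + -(x - a i) = a i - a j by ring] at h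
            rcases max_cases (lg (x - a j)) (lg (x - a i)) with ⟨h2, -⟩ | ⟨h2, -⟩ <;>
              rw [h2] at h <;> linarith [hmin i, hmin j]
          have h2 : ∑ i, ∑ j, γ i j * lg (a i - a j) ≤
              ∑ i, ∑ j, γ i j *
                (lg (x - a i) + lg (x - a j) - lg (x - a k₀) + Real.log 2) :=
            Finset.sum_le_sum fun i _ => Finset.sum_le_sum fun j _ =>
              mul_le_mul_of_nonneg_left (h1 i j) (hγ i j)
          have h3 : ∑ i, ∑ j, γ i j *
                (lg (x - a i) + lg (x - a j) - lg (x - a k₀) + Real.log 2) =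
              ∑ k, (∑ j, (γ k j + γ j k)) * lg (x - a k) - Γ * lg (x - a k₀) +
                Γ * Real.log 2 := by
            have e1 : ∑ i, ∑ j, γ i j * lg (x - a j) = ∑ k, (∑ j, γ j k) * lg (x - a k) := by
              rw [Finset.sum_comm]
              simp [Finset.sum_mul]
            simp only [mul_add, mul_sub, Finset.sum_add_distrib, Finset.sum_sub_distrib, e1,
              ← Finset.sum_mul, add_mul, hΓ]
          -- The exponents left after the exchange are nonnegative and can all be moved to the
          -- nearest centre. They amount to `Λ - Γ` there, and `h3` returns another `Γ`, so the
          -- degree that remains is exactly `Λ`.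
          have h4 : ∑ k, (c k - ∑ j, (γ k j + γ j k)) * lg (x - a k₀) ≤
              ∑ k, (c k - ∑ j, (γ k j + γ j k)) * lg (x - a k) :=
            Finset.sum_le_sum fun k _ =>
              mul_le_mul_of_nonneg_left (hmin k) (sub_nonneg.2 (hc k))
          have h5 : ∑ k, (c k - ∑ j, (γ k j + γ j k)) = Λ - Γ := by
            rw [Finset.sum_sub_distrib]
            simp only [Finset.sum_add_distrib]
            rw [Finset.sum_comm (f := fun k j => γ j k)]
            simp only [hΛ, hΓ]
            ring
          rw [← Finset.sum_mul, h5] at h4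
          simp only [sub_mul, Finset.sum_sub_distrib] at h4
          linarith
      _ = Real.exp (Γ * Real.log 2) * Real.exp (-∑ i, ∑ j, γ i j * lg (a i - a j)) *
            Real.exp (-(Λ * lg (x - a k₀))) := by
          rw [Real.exp_add, Real.exp_add]
      _ ≤ _ := by
          gcongr
          exact Finset.single_le_sum (f := fun k => Real.exp (-(Λ * lg (x - a k))))
            (fun k _ => (Real.exp_pos _).le) (Finset.mem_univ k₀)
  calc ∫⁻ x : ℝ, ENNReal.ofReal (Real.exp (-∑ k, c k * lg (x - a k)))
      ≤ ∫⁻ x : ℝ, ENNReal.ofReal (Real.exp (Γ * Real.log 2) *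
          Real.exp (-∑ i, ∑ j, γ i j * lg (a i - a j))) *
            ∑ k, ENNReal.ofReal (Real.exp (-(Λ * lg (x - a k)))) := by
        refine lintegral_mono fun x => ?_
        rw [← ENNReal.ofReal_sum_of_nonneg (fun k _ => (Real.exp_pos _).le),
          ← ENNReal.ofReal_mul (by positivity)]
        exact ENNReal.ofReal_le_ofReal (hpt x)
    _ = ENNReal.ofReal (Real.exp (Γ * Real.log 2) *
          Real.exp (-∑ i, ∑ j, γ i j * lg (a i - a j))) * (n * I) := by
        rw [lintegral_const_mul' _ _ ENNReal.ofReal_ne_top, lintegral_finsetSum]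
        · congr 1
          rw [Finset.sum_congr rfl (fun k _ => lintegral_sub_right_eq_self
            (fun x => ENNReal.ofReal (Real.exp (-(Λ * lg x)))) (a k))]
          simp [hIdef]
        · intro k _
          fun_prop
    _ ≤ _ := by
        rw [← ENNReal.ofReal_toReal hI.ne, ← ENNReal.ofReal_natCast,
          ← ENNReal.ofReal_mul (by positivity), ← ENNReal.ofReal_mul (by positivity)]
        apply ENNReal.ofReal_le_ofReal
        have : 0 ≤ Real.exp (Γ * Real.log 2) *
          Real.exp (-∑ i, ∑ j, γ i j * lg (a i - a j)) := by positivity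
        rw [ENNReal.toReal_ofReal ENNReal.toReal_nonneg]
        nlinarith

end

section

/-! ## Stirling bounds in vertical strips -/

/-- Since log(1 + b/w) = b/w + O(|w|⁻²), the function b ↦ log ‖w + b‖ is affine on [0, 1] up to an
error that is summable over w = z + j. -/
lemma log_norm_interpolation {w : ℂ} (hw : 2 ≤ ‖w‖) {a : ℝ} (ha0 : 0 ≤ a) (ha1 : a ≤ 1) :
    a * (Real.log ‖w + 1‖ - Real.log ‖w‖) - (Real.log ‖w + a‖ - Real.log ‖w‖) ≤
      2 / ‖w‖ ^ 2 := by
  have hw0 : w ≠ 0 := by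
    rintro rfl
    simp at hw
    linarith
  have key : ∀ b : ℝ, 0 ≤ b → b ≤ 1 →
      |Real.log ‖w + b‖ - Real.log ‖w‖ - b * (1 / w).re| ≤ 1 / ‖w‖ ^ 2 := by
    intro b hb0 hb1
    set u : ℂ := b / w with hu
    have hun : ‖u‖ ≤ 1 / ‖w‖ := by
      rw [hu, norm_div, Complex.norm_real, Real.norm_of_nonneg hb0]
      gcongr
    have hu2 : ‖u‖ ≤ 1 / 2 := hun.trans (one_div_le_one_div_of_le two_pos hw)
    have h1 : Real.log ‖w + b‖ - Real.log ‖w‖ = (Complex.log (1 + u)).re := by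
      rw [Complex.log_re, ← Real.log_div _ (norm_ne_zero_iff.2 hw0), ← norm_div]
      · congr 2
        rw [hu]
        field_simp
      · have : w + b = w * (1 + u) := by
          rw [hu]
          field_simp
        rw [this, norm_mul]
        refine mul_ne_zero (norm_ne_zero_iff.2 hw0) (norm_ne_zero_iff.2 fun h => ?_)
        have h3 : u = -1 := by linear_combination h
        rw [h3] at hu2
        norm_num at hu2
    have h2 : b * (1 / w).re = u.re := by
      rw [hu, div_eq_mul_one_div (b : ℂ) w, re_ofReal_mul]
    rw [h1, h2, ← Complex.sub_re]
    refine (Complex.abs_re_le_norm _).trans ?_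
    refine (Complex.norm_log_one_add_sub_self_le (by linarith)).trans ?_
    have h3 : (1 - ‖u‖)⁻¹ ≤ 2 := by
      rw [inv_le_comm₀ (by linarith) two_pos]
      linarith
    have h4 : ‖u‖ ^ 2 ≤ 1 / ‖w‖ ^ 2 := by
      rw [← one_div_pow]
      gcongr
    nlinarith [sq_nonneg ‖u‖]
  have k1 := abs_le.1 (key 1 zero_le_one le_rfl)
  have k2 := abs_le.1 (key a ha0 ha1)
  have h0 : 0 ≤ 1 / ‖w‖ ^ 2 := by positivity
  rw [Complex.ofReal_one] at k1
  have h3 : 2 / ‖w‖ ^ 2 = 2 * (1 / ‖w‖ ^ 2) := by ring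
  nlinarith [k1.2, k2.1]

lemma norm_GammaSeq (z : ℂ) {n : ℕ} (hn : n ≠ 0) :
    ‖GammaSeq z n‖ = (n : ℝ) ^ z.re * n.factorial / ∏ j ∈ Finset.range (n + 1), ‖z + j‖ := by
  have : (0 : ℝ) < n := by positivity
  rw [GammaSeq, norm_div, norm_mul, norm_prod, ← Complex.ofReal_natCast n,
    Complex.norm_cpow_eq_rpow_re_of_pos this]
  simp

/-- The constant in the comparison of `Γ(z + a)` with `Γ(z)`. -/
noncomputable def gammaRatioConst : ℝ := Real.exp (∑' j : ℕ, 2 / ((j : ℝ) ^ 2 + 1))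

/-- In Euler's limit the ratio of the two sides is n^a ∏ |z + j| / |z + j + a|. Affine interpolation
of each logarithm replaces the product by the a-th power of a telescoping one, at the cost of a
convergent sum. -/
lemma norm_Gamma_add_le {z : ℂ} (hz : 0 ≤ z.re) (hτ : 2 ≤ |z.im|) {a : ℝ} (ha0 : 0 ≤ a)
    (ha1 : a ≤ 1) : ‖Gamma (z + a)‖ ≤ gammaRatioConst * ‖z‖ ^ a * ‖Gamma z‖ := by
  have hsum : Summable fun j : ℕ => 2 / ((j : ℝ) ^ 2 + 1) := by
    have h := ((summable_nat_add_iff 1).2 (Real.summable_one_div_nat_pow.2 one_lt_two)).mul_left 4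
    refine Summable.of_nonneg_of_le (fun j => by positivity) (fun j => ?_) h
    rw [mul_one_div, div_le_div_iff₀ (by positivity) (by positivity)]
    push_cast
    nlinarith [sq_nonneg ((j : ℝ) - 1)]
  refine le_of_tendsto_of_tendsto (GammaSeq_tendsto_Gamma (z + a)).norm
    ((GammaSeq_tendsto_Gamma z).norm.const_mul (gammaRatioConst * ‖z‖ ^ a)) ?_
  filter_upwards [Filter.eventually_ne_atTop 0] with n hn
  have hn' : (0 : ℝ) < n := by positivity
  have hzj : ∀ b : ℝ, ∀ j : ℕ, 2 ≤ ‖z + j + b‖ := fun b j => by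
    refine hτ.trans ?_
    simpa using Complex.abs_im_le_norm (z + j + b)
  have hzj0 : ∀ j : ℕ, 2 ≤ ‖z + j‖ := fun j => by simpa using hzj 0 j
  have hz0 : 2 ≤ ‖z‖ := by simpa using hzj 0 0
  have hj2 : ∀ j : ℕ, (j : ℝ) ^ 2 + 1 ≤ ‖z + j‖ ^ 2 := fun j => by
    rw [Complex.sq_norm, Complex.normSq_apply]
    have h1 : (z + j).re = z.re + j := by simp
    have h2 : (z + j).im = z.im := by simp
    rw [h1, h2]
    have : 4 ≤ z.im * z.im := by
      rw [← abs_mul_abs_self]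
      nlinarith
    nlinarith [(Nat.cast_nonneg j : (0 : ℝ) ≤ j)]
  -- The interpolation errors 2/‖z + j‖² are summed by means of ‖z + j‖² ≥ j² + 1, where Re z ≥ 0
  -- and |Im z| ≥ 2 enter.
  have hE : ∑ j ∈ Finset.range (n + 1), (a * (Real.log ‖z + j + 1‖ - Real.log ‖z + j‖) -
      (Real.log ‖z + j + a‖ - Real.log ‖z + j‖)) ≤ ∑' j : ℕ, 2 / ((j : ℝ) ^ 2 + 1) := by
    refine le_trans (Finset.sum_le_sum fun j _ => ?_)
      (hsum.sum_le_tsum (Finset.range (n + 1)) fun j _ => by positivity)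
    refine (log_norm_interpolation (hzj0 j) ha0 ha1).trans ?_
    gcongr
    exact hj2 j
  have htel : ∑ j ∈ Finset.range (n + 1), (Real.log ‖z + j + 1‖ - Real.log ‖z + j‖) =
      Real.log ‖z + (n + 1 : ℕ)‖ - Real.log ‖z‖ := by
    have := Finset.sum_range_sub (fun j : ℕ => Real.log ‖z + j‖) (n + 1)
    simp only [Nat.cast_zero, add_zero] at this
    rw [← this]
    refine Finset.sum_congr rfl fun j _ => ?_
    push_cast
    rw [add_assoc]
  have hP : ∀ b : ℝ, 0 < ∏ j ∈ Finset.range (n + 1), ‖z + j + b‖ := fun b =>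
    Finset.prod_pos fun j _ => by linarith [hzj b j]
  have hP0 : 0 < ∏ j ∈ Finset.range (n + 1), ‖z + j‖ := by simpa using hP 0
  have hlogP : Real.log (∏ j ∈ Finset.range (n + 1), ‖z + j‖) -
      Real.log (∏ j ∈ Finset.range (n + 1), ‖z + j + a‖) ≤
      ∑' j : ℕ, 2 / ((j : ℝ) ^ 2 + 1) - a * (Real.log n - Real.log ‖z‖) := by
    rw [Real.log_prod fun j _ => by linarith [hzj0 j],
      Real.log_prod fun j _ => by linarith [hzj a j]]
    have h1 : Real.log n ≤ Real.log ‖z + (n + 1 : ℕ)‖ := by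
      apply Real.log_le_log hn'
      have := Complex.re_le_norm (z + (n + 1 : ℕ))
      simp at this ⊢
      linarith
    rw [Finset.sum_sub_distrib, ← Finset.mul_sum, htel, Finset.sum_sub_distrib] at hE
    nlinarith
  rw [norm_GammaSeq _ hn, norm_GammaSeq _ hn]
  have e1 : ∏ j ∈ Finset.range (n + 1), ‖z + a + j‖ = ∏ j ∈ Finset.range (n + 1), ‖z + j + a‖ :=
    Finset.prod_congr rfl fun j _ => by rw [add_right_comm]
  rw [e1, add_re, ofReal_re, Real.rpow_add hn', div_le_iff₀ (hP a), gammaRatioConst,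
    Real.rpow_def_of_pos (by linarith : 0 < ‖z‖), Real.rpow_def_of_pos hn' a]
  have h2 : ∏ j ∈ Finset.range (n + 1), ‖z + j‖ ≤
      Real.exp (∑' j : ℕ, 2 / ((j : ℝ) ^ 2 + 1) - a * (Real.log n - Real.log ‖z‖)) *
        ∏ j ∈ Finset.range (n + 1), ‖z + j + a‖ := by
    rw [← Real.log_le_log_iff hP0 (mul_pos (Real.exp_pos _) (hP a)),
      Real.log_mul (Real.exp_pos _).ne' (hP a).ne', Real.log_exp]
    linarith
  have h3 : Real.exp (Real.log n * a) * (∏ j ∈ Finset.range (n + 1), ‖z + j‖) ≤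
      Real.exp (∑' j : ℕ, 2 / ((j : ℝ) ^ 2 + 1)) * Real.exp (Real.log ‖z‖ * a) *
        ∏ j ∈ Finset.range (n + 1), ‖z + j + a‖ := by
    calc _ ≤ Real.exp (Real.log n * a) * _ := mul_le_mul_of_nonneg_left h2 (Real.exp_pos _).le
      _ = _ := by
        rw [← mul_assoc, ← Real.exp_add, ← Real.exp_add]
        congr 2
        ring
  clear hlogP h2 hE hP e1
  generalize (∏ j ∈ Finset.range (n + 1), ‖z + (j : ℂ) + (a : ℂ)‖) = Q at h3 ⊢
  calc (n : ℝ) ^ z.re * Real.exp (Real.log n * a) * n.factorial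
      = (n : ℝ) ^ z.re * n.factorial / (∏ j ∈ Finset.range (n + 1), ‖z + j‖) *
        (Real.exp (Real.log n * a) * (∏ j ∈ Finset.range (n + 1), ‖z + j‖)) := by
        field_simp
    _ ≤ _ := mul_le_mul_of_nonneg_left h3 (by positivity)
    _ = _ := by ring

/-- The exponent of `|Γ(z)|`. -/
noncomputable def gexp (z : ℂ) : ℝ := (z.re - 1 / 2) * lg z.im - Real.pi / 2 * |z.im|

lemma norm_Gamma_half {z : ℂ} (hz : z.re = 1 / 2) :
    ‖Gamma z‖ ^ 2 = Real.pi / Real.cosh (Real.pi * z.im) := by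
  have h1 : 1 - z = (starRingEnd ℂ) z := by
    apply Complex.ext <;> simp
    linarith
  have h2 := Complex.Gamma_mul_Gamma_one_sub z
  rw [h1, Gamma_conj] at h2
  have h3 := congrArg norm h2
  rw [norm_mul, Complex.norm_conj, ← sq] at h3
  rw [h3, norm_div, Complex.norm_real, Real.norm_of_nonneg Real.pi_pos.le]
  congr 1
  have h4 : (Real.pi : ℂ) * z = ((Real.pi * z.im : ℝ) : ℂ) * I + Real.pi / 2 := by
    conv_lhs => rw [← Complex.re_add_im z]
    rw [hz]
    push_cast
    ring
  rw [h4, Complex.sin_add_pi_div_two, Complex.cos_mul_I, ← Complex.ofReal_cosh,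
    Complex.norm_real, Real.norm_of_nonneg (Real.cosh_pos _).le]

lemma norm_Gamma_half_bounds {z : ℂ} (hz : z.re = 1 / 2) :
    Real.exp (-(Real.pi / 2 * |z.im|)) ≤ ‖Gamma z‖ ∧
      ‖Gamma z‖ ≤ 3 * Real.exp (-(Real.pi / 2 * |z.im|)) := by
  have h := norm_Gamma_half hz
  have hc1 : Real.cosh (Real.pi * z.im) ≤ Real.exp (Real.pi * |z.im|) := by
    rw [← Real.cosh_abs, abs_mul, abs_of_pos Real.pi_pos, Real.cosh_eq]
    have : Real.exp (-(Real.pi * |z.im|)) ≤ Real.exp (Real.pi * |z.im|) :=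
      Real.exp_le_exp.2 (by nlinarith [Real.pi_pos, abs_nonneg z.im])
    linarith
  have hc2 : Real.exp (Real.pi * |z.im|) ≤ 2 * Real.cosh (Real.pi * z.im) := by
    rw [← Real.cosh_abs, abs_mul, abs_of_pos Real.pi_pos, Real.cosh_eq]
    linarith [Real.exp_pos (-(Real.pi * |z.im|))]
  have hsq : Real.exp (-(Real.pi / 2 * |z.im|)) ^ 2 = (Real.exp (Real.pi * |z.im|))⁻¹ := by
    rw [← Real.exp_neg, ← Real.exp_nat_mul]
    congr 1
    push_cast
    ring
  have hcp := Real.cosh_pos (Real.pi * z.im)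
  have hep := Real.exp_pos (Real.pi * |z.im|)
  constructor
  · refine le_of_sq_le_sq ?_ (norm_nonneg _)
    rw [h, hsq, inv_eq_one_div]
    exact div_le_div₀ Real.pi_pos.le (by linarith [Real.pi_gt_three]) hcp hc1
  · refine le_of_sq_le_sq ?_ (by positivity)
    rw [h, mul_pow, hsq, ← div_eq_mul_inv]
    rw [div_le_div_iff₀ hcp hep]
    nlinarith [Real.pi_lt_d2, Real.pi_pos]

end

/-! ### From the line Re z = 1/2 to vertical strips. -/

section

lemma log_norm_bounds {z : ℂ} (h1 : |z.re| ≤ 4) (h2 : 2 ≤ |z.im|) :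
    lg z.im - Real.log 4 ≤ Real.log ‖z‖ ∧ Real.log ‖z‖ ≤ lg z.im + Real.log 4 := by
  have hi := Complex.abs_im_le_norm z
  have hn := Complex.norm_le_abs_re_add_abs_im z
  have hz : 0 < ‖z‖ := by linarith
  have h5 : 0 < 1 + |z.im| := by linarith
  constructor
  · have : lg z.im ≤ Real.log (‖z‖ * 4) := Real.log_le_log h5 (by linarith)
    rw [Real.log_mul hz.ne' (by norm_num)] at this
    linarith
  · unfold lg
    rw [← Real.log_mul h5.ne' (by norm_num)]
    exact Real.log_le_log hz (by linarith)

lemma Gamma_ne_zero_of_im_ne_zero {z : ℂ} (h : z.im ≠ 0) : Gamma z ≠ 0 :=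
  Gamma_ne_zero fun m hm => h (by rw [hm]; simp)

lemma log_norm_Gamma_add_le {z : ℂ} (hz : 0 ≤ z.re) (hτ : 2 ≤ |z.im|) {a : ℝ} (ha0 : 0 ≤ a)
    (ha1 : a ≤ 1) :
    Real.log ‖Gamma (z + a)‖ ≤
      Real.log gammaRatioConst + a * Real.log ‖z‖ + Real.log ‖Gamma z‖ := by
  have hi : z.im ≠ 0 := fun h => by rw [h] at hτ; norm_num at hτ
  have hz0 : 0 < ‖z‖ := by linarith [Complex.abs_im_le_norm z]
  have h1 : 0 < ‖Gamma z‖ := norm_pos_iff.2 (Gamma_ne_zero_of_im_ne_zero hi)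
  have h2 : 0 < ‖Gamma (z + a)‖ :=
    norm_pos_iff.2 (Gamma_ne_zero_of_im_ne_zero (by simpa using hi))
  have hc : 0 < gammaRatioConst := Real.exp_pos _
  have h3 := Real.log_le_log h2 (norm_Gamma_add_le hz hτ ha0 ha1)
  rwa [Real.log_mul (by positivity) h1.ne', Real.log_mul hc.ne' (by positivity),
    Real.log_rpow hz0] at h3

lemma log_norm_Gamma_add_one {z : ℂ} (hτ : 2 ≤ |z.im|) :
    Real.log ‖Gamma (z + 1)‖ = Real.log ‖z‖ + Real.log ‖Gamma z‖ := by
  have hi : z.im ≠ 0 := fun h => by rw [h] at hτ; norm_num at hτ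
  have hz0 : z ≠ 0 := by
    rintro rfl
    simp at hi
  rw [Gamma_add_one z hz0, norm_mul, Real.log_mul (norm_ne_zero_iff.2 hz0)
    (norm_ne_zero_iff.2 (Gamma_ne_zero_of_im_ne_zero hi))]

lemma gexp_add_one (z : ℂ) : gexp (z + 1) = gexp z + lg z.im := by
  simp [gexp]
  ring

/-- Let z₀ have real part 1/2 and the height of z. Moving right from z₀ to z bounds Γ(z) from above;
moving right from z to z₀ + 1, where Γ is known by the functional equation, bounds it from below. -/
lemma abs_log_norm_Gamma_sub_le_aux : ∃ C : ℝ, ∀ z : ℂ, 1 / 2 ≤ z.re → z.re ≤ 3 / 2 →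
    2 ≤ |z.im| → |Real.log ‖Gamma z‖ - gexp z| ≤ C := by
  refine ⟨|Real.log gammaRatioConst| + 2 * Real.log 4 + Real.log 3, fun z hz1 hz2 hτ => ?_⟩
  set z₀ : ℂ := ⟨1 / 2, z.im⟩ with hz₀
  have hz₀i : 2 ≤ |z₀.im| := hτ
  have l4 : 0 < Real.log 4 := Real.log_pos (by norm_num)
  have l3 : 0 < Real.log 3 := Real.log_pos (by norm_num)
  have hi : z.im ≠ 0 := fun h => by rw [h] at hτ; norm_num at hτ
  have hhalf := norm_Gamma_half_bounds (z := z₀) rfl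
  have hΓ₀ : 0 < ‖Gamma z₀‖ := norm_pos_iff.2 (Gamma_ne_zero_of_im_ne_zero hi)
  have hh1 := Real.log_le_log (Real.exp_pos _) hhalf.1
  have hh2 := Real.log_le_log hΓ₀ hhalf.2
  rw [Real.log_mul (by norm_num) (Real.exp_pos _).ne', Real.log_exp] at hh2
  rw [Real.log_exp] at hh1
  have hzi : z₀.im = z.im := rfl
  have n0 := log_norm_bounds (z := z₀) (by simp [hz₀]; norm_num [abs_of_pos]) hτ
  have n1 := log_norm_bounds (z := z) (by rw [abs_of_pos] <;> linarith) hτ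
  rw [hzi] at n0 hh1 hh2
  have hlg := lg_nonneg z.im
  have e1 : z₀ + ((z.re - 1 / 2 : ℝ) : ℂ) = z := by apply Complex.ext <;> simp [hz₀]
  have e2 : z + ((3 / 2 - z.re : ℝ) : ℂ) = z₀ + 1 := by
    apply Complex.ext <;> simp [hz₀]
    norm_num
  have u := log_norm_Gamma_add_le (z := z₀) (by simp [hz₀]) hτ (a := z.re - 1 / 2)
    (by linarith) (by linarith)
  have v := log_norm_Gamma_add_le (z := z) (by linarith) hτ (a := 3 / 2 - z.re)
    (by linarith) (by linarith)
  rw [e1] at u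
  rw [e2, log_norm_Gamma_add_one (z := z₀) hz₀i] at v
  have hg : gexp z = (z.re - 1 / 2) * lg z.im - Real.pi / 2 * |z.im| := rfl
  have la := le_abs_self (Real.log gammaRatioConst)
  rw [abs_le]
  constructor
  · have : (3 / 2 - z.re) * Real.log ‖z‖ ≤ (3 / 2 - z.re) * (lg z.im + Real.log 4) :=
      mul_le_mul_of_nonneg_left n1.2 (by linarith)
    nlinarith
  · have : (z.re - 1 / 2) * Real.log ‖z₀‖ ≤ (z.re - 1 / 2) * (lg z.im + Real.log 4) :=
      mul_le_mul_of_nonneg_left n0.2 (by linarith)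
    nlinarith

/-- Under z ↦ z + 1 both log ‖Γ‖ and `gexp` grow by log |Im z| up to a constant, so finitely many
unit shifts carry the estimate from the strip of width 1 to the wider one. -/
lemma abs_log_norm_Gamma_sub_le : ∃ C : ℝ, ∀ z : ℂ, -1 ≤ z.re → z.re ≤ 3 →
    2 ≤ |z.im| → |Real.log ‖Gamma z‖ - gexp z| ≤ C := by
  obtain ⟨C, hC⟩ := abs_log_norm_Gamma_sub_le_aux
  have up : ∀ z : ℂ, |z.re| ≤ 4 → 2 ≤ |z.im| →
      |(Real.log ‖Gamma (z + 1)‖ - gexp (z + 1)) - (Real.log ‖Gamma z‖ - gexp z)| ≤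
        Real.log 4 := by
    intro z h1 h2
    rw [log_norm_Gamma_add_one h2, gexp_add_one, abs_le]
    have := log_norm_bounds h1 h2
    constructor <;> linarith
  have l4 : 0 < Real.log 4 := Real.log_pos (by norm_num)
  have tri : ∀ a b c d : ℝ, |a - b| ≤ c → |b| ≤ d → |a| ≤ c + d := fun a b c d h1 h2 => by
    have := abs_add_le (a - b) b
    rw [sub_add_cancel] at this
    linarith
  have tri' : ∀ a b c d : ℝ, |a - b| ≤ c → |a| ≤ d → |b| ≤ c + d := fun a b c d h1 h2 =>
    tri b a c d (by rwa [abs_sub_comm]) h2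
  have s0 : ∀ z : ℂ, -1 / 2 ≤ z.re → z.re ≤ 3 / 2 → 2 ≤ |z.im| →
      |Real.log ‖Gamma z‖ - gexp z| ≤ Real.log 4 + C := fun z h1 h2 h3 => by
    rcases le_total (1 / 2) z.re with h | h
    · linarith [hC z h h2 h3]
    · exact tri' _ _ _ _ (up z (abs_le.2 ⟨by linarith, by linarith⟩) h3)
        (hC (z + 1) (by simp; linarith) (by simp; linarith) (by simpa using h3))
  have s1 : ∀ z : ℂ, -1 ≤ z.re → z.re ≤ 3 / 2 → 2 ≤ |z.im| →
      |Real.log ‖Gamma z‖ - gexp z| ≤ Real.log 4 + (Real.log 4 + C) := fun z h1 h2 h3 => by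
    rcases le_total (-1 / 2) z.re with h | h
    · linarith [s0 z h h2 h3]
    · exact tri' _ _ _ _ (up z (abs_le.2 ⟨by linarith, by linarith⟩) h3)
        (s0 (z + 1) (by simp; linarith) (by simp; linarith) (by simpa using h3))
  have s2 : ∀ z : ℂ, -1 ≤ z.re → z.re ≤ 5 / 2 → 2 ≤ |z.im| →
      |Real.log ‖Gamma z‖ - gexp z| ≤ Real.log 4 + (Real.log 4 + (Real.log 4 + C)) :=
    fun z h1 h2 h3 => by
    rcases le_total z.re (3 / 2) with h | h
    · linarith [s1 z h1 h h3]
    · have := tri _ _ _ _ (up (z - 1) (abs_le.2 ⟨by simp; linarith, by simp; linarith⟩)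
        (by simpa using h3)) (s1 (z - 1) (by simp; linarith) (by simp; linarith)
          (by simpa using h3))
      rwa [sub_add_cancel] at this
  refine ⟨Real.log 4 + (Real.log 4 + (Real.log 4 + (Real.log 4 + C))), fun z h1 h2 h3 => ?_⟩
  rcases le_total z.re (5 / 2) with h | h
  · linarith [s2 z h1 h h3]
  · have := tri _ _ _ _ (up (z - 1) (abs_le.2 ⟨by simp; linarith, by simp; linarith⟩)
      (by simpa using h3)) (s2 (z - 1) (by simp; linarith) (by simp; linarith)
        (by simpa using h3))
    rwa [sub_add_cancel] at this

/-- The set on which `Γ` is bounded by Stirling's formula. -/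
def gammaRange (δ : ℝ) (σ : ℝ) : Prop := (δ ≤ σ ∧ σ ≤ 3) ∨ (-1 + δ ≤ σ ∧ σ ≤ -δ)

/-- Lower bound for `gexp` in bounded regions. -/
lemma abs_gexp_le {z : ℂ} (h1 : -1 ≤ z.re) (h2 : z.re ≤ 3) (h3 : |z.im| ≤ 2) :
    |gexp z| ≤ 3 * Real.log 3 + 4 := by
  have hl : lg z.im ≤ Real.log 3 :=
    Real.log_le_log (by linarith [abs_nonneg z.im]) (by linarith)
  have h0 := lg_nonneg z.im
  have l3 : 0 < Real.log 3 := Real.log_pos (by norm_num)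
  have hp : Real.pi / 2 * |z.im| ≤ 4 := by
    nlinarith [Real.pi_lt_four, abs_nonneg z.im, Real.pi_pos]
  have hp0 : 0 ≤ Real.pi / 2 * |z.im| := by positivity
  unfold gexp
  rw [abs_le]
  constructor <;> nlinarith

/-- **Stirling's upper bound**, uniform in vertical strips away from the poles. -/
theorem norm_Gamma_le {δ : ℝ} (hδ : 0 < δ) : ∃ C : ℝ, 0 < C ∧ ∀ z : ℂ, gammaRange δ z.re →
    ‖Gamma z‖ ≤ C * Real.exp (gexp z) := by
  obtain ⟨C₁, hC₁⟩ := abs_log_norm_Gamma_sub_le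
  -- For bounded height a compactness argument suffices: the two strips keep distance δ from the
  -- poles 0 and -1, and `gexp` is bounded there.
  have hK : IsCompact ((Set.Icc δ 3 ∪ Set.Icc (-1 + δ) (-δ)) ×ℂ Set.Icc (-2) 2) :=
    (isCompact_Icc.union isCompact_Icc).reProdIm isCompact_Icc
  have hcont : ContinuousOn Gamma ((Set.Icc δ 3 ∪ Set.Icc (-1 + δ) (-δ)) ×ℂ Set.Icc (-2) 2) := by
    intro z hz
    refine (continuousAt_Gamma z fun m hm => ?_).continuousWithinAt
    have h := hz.1
    have hre : z.re = -m := by rw [hm]; simp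
    rcases m with _ | m
    · simp at hre
      simp [hre] at h
      rcases h with h | h <;> linarith
    · have h5 : (0 : ℝ) ≤ m := Nat.cast_nonneg m
      push_cast at hre
      rcases h with h | h <;> linarith [h.1]
  obtain ⟨C₂, hC₂⟩ := hK.exists_bound_of_continuousOn hcont
  refine ⟨Real.exp C₁ + |C₂| * Real.exp (3 * Real.log 3 + 4), by positivity, fun z hz => ?_⟩
  have hz' : -1 ≤ z.re ∧ z.re ≤ 3 := by
    rcases hz with h | h <;> constructor <;> linarith [h.1, h.2]
  rcases le_total 2 |z.im| with h | h
  · have hi : z.im ≠ 0 := fun h0 => by rw [h0] at h; norm_num at h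
    have h1 := (abs_le.1 (hC₁ z hz'.1 hz'.2 h)).2
    have h2 : 0 < ‖Gamma z‖ := norm_pos_iff.2 (Gamma_ne_zero_of_im_ne_zero hi)
    calc ‖Gamma z‖ = Real.exp (Real.log ‖Gamma z‖) := (Real.exp_log h2).symm
      _ ≤ Real.exp (C₁ + gexp z) := Real.exp_le_exp.2 (by linarith)
      _ = Real.exp C₁ * Real.exp (gexp z) := Real.exp_add _ _
      _ ≤ _ := by
        gcongr
        have : 0 ≤ |C₂| * Real.exp (3 * Real.log 3 + 4) := by positivity
        linarith
  · have h1 := hC₂ z ⟨hz, abs_le.1 h⟩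
    have h2 := abs_le.1 (abs_gexp_le hz'.1 hz'.2 h)
    calc ‖Gamma z‖ ≤ |C₂| := h1.trans (le_abs_self _)
      _ = |C₂| * (Real.exp (3 * Real.log 3 + 4) * Real.exp (-(3 * Real.log 3 + 4))) := by
        rw [← Real.exp_add, add_neg_cancel, Real.exp_zero, mul_one]
      _ ≤ |C₂| * (Real.exp (3 * Real.log 3 + 4) * Real.exp (gexp z)) := by
        gcongr
        exact h2.1
      _ ≤ _ := by
        rw [add_mul, mul_assoc]
        linarith [mul_pos (Real.exp_pos C₁) (Real.exp_pos (gexp z))]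

/-- **Stirling's lower bound**, uniform in vertical strips. -/
theorem norm_inv_Gamma_le : ∃ C : ℝ, 0 < C ∧ ∀ z : ℂ, -1 ≤ z.re → z.re ≤ 3 →
    ‖(Gamma z)⁻¹‖ ≤ C * Real.exp (-gexp z) := by
  obtain ⟨C₁, hC₁⟩ := abs_log_norm_Gamma_sub_le
  have hK : IsCompact ((Set.Icc (-1 : ℝ) 3) ×ℂ Set.Icc (-2) 2) :=
    isCompact_Icc.reProdIm isCompact_Icc
  obtain ⟨C₂, hC₂⟩ := hK.exists_bound_of_continuousOn
    (differentiable_one_div_Gamma.continuous.continuousOn)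
  refine ⟨Real.exp C₁ + |C₂| * Real.exp (3 * Real.log 3 + 4), by positivity,
    fun z hz1 hz2 => ?_⟩
  rcases le_total 2 |z.im| with h | h
  · have hi : z.im ≠ 0 := fun h0 => by rw [h0] at h; norm_num at h
    have h1 := (abs_le.1 (hC₁ z hz1 hz2 h)).1
    have h2 : 0 < ‖Gamma z‖ := norm_pos_iff.2 (Gamma_ne_zero_of_im_ne_zero hi)
    calc ‖(Gamma z)⁻¹‖ = Real.exp (-Real.log ‖Gamma z‖) := by
          rw [norm_inv, Real.exp_neg, Real.exp_log h2]
      _ ≤ Real.exp (C₁ + -gexp z) := Real.exp_le_exp.2 (by linarith)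
      _ = Real.exp C₁ * Real.exp (-gexp z) := Real.exp_add _ _
      _ ≤ _ := by
        gcongr
        have : 0 ≤ |C₂| * Real.exp (3 * Real.log 3 + 4) := by positivity
        linarith
  · have h1 := hC₂ z ⟨⟨hz1, hz2⟩, abs_le.1 h⟩
    have h2 := abs_le.1 (abs_gexp_le hz1 hz2 h)
    calc ‖(Gamma z)⁻¹‖ ≤ |C₂| := h1.trans (le_abs_self _)
      _ = |C₂| * (Real.exp (3 * Real.log 3 + 4) * Real.exp (-(3 * Real.log 3 + 4))) := by
        rw [← Real.exp_add, add_neg_cancel, Real.exp_zero, mul_one]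
      _ ≤ |C₂| * (Real.exp (3 * Real.log 3 + 4) * Real.exp (-gexp z)) := by
        gcongr
        exact h2.2
      _ ≤ _ := by
        rw [add_mul, mul_assoc]
        linarith [mul_pos (Real.exp_pos C₁) (Real.exp_pos (-gexp z))]

-- Γ is discontinuous at its poles, but its pointwise inverse, with value 0 at the poles, is entire.
@[fun_prop]
lemma measurable_Gamma : Measurable Gamma := by
  have h : Gamma = fun z => ((Gamma z)⁻¹)⁻¹ := by
    funext z
    rw [inv_inv]
  rw [h]
  exact differentiable_one_div_Gamma.continuous.measurable.inv

end

section

/-! ## Bounds for the factors of the integrands -/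

/-- The tangent line of the logarithm at c. This is how exponential decay absorbs an arbitrary
power. -/
lemma mul_lg_le (x : ℝ) {c : ℝ} (hc : 0 < c) : c * lg x ≤ |x| + (c * Real.log c + 1) := by
  have h0 : 0 < 1 + |x| := by linarith [abs_nonneg x]
  have h1 := Real.log_le_sub_one_of_pos (div_pos h0 hc)
  rw [Real.log_div h0.ne' hc.ne'] at h1
  have h2 : c * (Real.log (1 + |x|) - Real.log c) ≤ c * ((1 + |x|) / c - 1) := by gcongr
  have h3 : c * ((1 + |x|) / c - 1) = 1 + |x| - c := by field_simp
  unfold lg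
  linarith

lemma lg_div_two_mul_le {x a : ℝ} (ha : |a| ≤ 4) : a * lg (x / 2) ≤ a * lg x + 4 * Real.log 2 := by
  have h1 := lg_half_le x
  have h2 := lg_le_lg_half x
  have h3 : 0 < Real.log 2 := Real.log_pos one_lt_two
  rcases le_total 0 a with h | h
  · nlinarith
  · have := (abs_le.1 ha).1
    nlinarith

lemma norm_Gamma_le_exp {δ : ℝ} (hδ : 0 < δ) : ∃ K : ℝ, ∀ z : ℂ, ∀ w : ℝ, gammaRange δ z.re →
    w ≤ 1 / 2 - z.re → ‖Gamma z‖ ≤ Real.exp (K - w * lg z.im - Real.pi / 2 * |z.im|) := by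
  obtain ⟨C, hC, h⟩ := norm_Gamma_le hδ
  refine ⟨Real.log C, fun z w hz hw => (h z hz).trans ?_⟩
  rw [show C * Real.exp (gexp z) = Real.exp (Real.log C + gexp z) by
    rw [Real.exp_add, Real.exp_log hC]]
  apply Real.exp_le_exp.2
  unfold gexp
  nlinarith [lg_nonneg z.im]

lemma norm_Gamma_half_le_exp {δ : ℝ} (hδ : 0 < δ) : ∃ K : ℝ, ∀ z : ℂ, gammaRange δ (z.re / 2) →
    ‖Gamma (z / 2)‖ ≤ Real.exp (K + (z.re / 2 - 1 / 2) * lg z.im - Real.pi / 4 * |z.im|) := by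
  obtain ⟨K, h⟩ := norm_Gamma_le_exp hδ
  refine ⟨K + 4 * Real.log 2, fun z hz => ?_⟩
  have e1 : (z / 2).re = z.re / 2 := by simp
  have e2 : (z / 2).im = z.im / 2 := by simp
  refine (h (z / 2) (1 / 2 - z.re / 2) (by rwa [e1]) (by rw [e1])).trans ?_
  apply Real.exp_le_exp.2
  rw [e2, abs_div, abs_two]
  have := lg_div_two_mul_le (x := z.im) (a := z.re / 2 - 1 / 2)
    (by rw [abs_le]; rcases hz with h | h <;> constructor <;> linarith [h.1, h.2])
  linarith

lemma norm_inv_Gamma_half_le_exp : ∃ K : ℝ, ∀ z : ℂ, -1 ≤ z.re / 2 → z.re / 2 ≤ 3 →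
    ‖(Gamma (z / 2))⁻¹‖ ≤
      Real.exp (K - (z.re / 2 - 1 / 2) * lg z.im + Real.pi / 4 * |z.im|) := by
  obtain ⟨C, hC, h⟩ := norm_inv_Gamma_le
  refine ⟨Real.log C + 4 * Real.log 2, fun z h1 h2 => ?_⟩
  have e1 : (z / 2).re = z.re / 2 := by simp
  have e2 : (z / 2).im = z.im / 2 := by simp
  refine (h (z / 2) (by rwa [e1]) (by rwa [e1])).trans ?_
  rw [show C * Real.exp (-gexp (z / 2)) = Real.exp (Real.log C + -gexp (z / 2)) by
    rw [Real.exp_add, Real.exp_log hC]]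
  apply Real.exp_le_exp.2
  unfold gexp
  rw [e1, e2, abs_div, abs_two]
  have := lg_div_two_mul_le (x := z.im) (a := -(z.re / 2 - 1 / 2))
    (by rw [abs_le]; constructor <;> linarith)
  linarith

/-- The exponent of the beta function is at most that of its weights. -/
lemma beta_exponent_le {x y a b p q : ℝ} (ha : 0 ≤ a) (hb : 0 ≤ b) (ha' : a ≤ 3 / 2)
    (hb' : b ≤ 3 / 2) (hp : p ≤ b) (hq : q ≤ a) (hpq : p + q ≤ 1 / 2) :
    (a - 1 / 2) * lg x + (b - 1 / 2) * lg y - (a + b - 1 / 2) * lg (x + y) -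
        Real.pi / 4 * (|x| + |y| - |x + y|) ≤
      6 * Real.log 6 + 1 + 3 * Real.log 2 - p * lg x - q * lg y := by
  wlog hxy : |y| ≤ |x| generalizing x y a b p q
  · have := this hb ha hb' ha' hq hp (by linarith) (le_of_not_ge hxy)
    rw [add_comm y x, add_comm b a] at this
    linarith
  have l2 : 0 < Real.log 2 := Real.log_pos one_lt_two
  have l6 : 0 < Real.log 6 := Real.log_pos (by norm_num)
  have h0 := lg_nonneg y
  have h1 : lg y ≤ lg x := lg_mono hxy
  have h2 : lg (x + y) ≤ lg x + Real.log 2 := by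
    have := lg_add_le_max x y
    rwa [max_eq_left h1] at this
  have hπ := Real.pi_gt_three
  have h3 : (p - b) * lg x ≤ (p - b) * lg y := by nlinarith
  -- Equal signs: there is no exponential decay, but |x + y| is comparable with |x|. About -b lg x +
  -- (b - 1/2) lg y remains, and p ≤ b together with p + q ≤ 1/2 is what is needed.
  rcases le_total 0 (x * y) with h | h
  · have h4 : |x + y| = |x| + |y| := by
      rw [abs_add_eq_add_abs_iff]
      rcases mul_nonneg_iff.1 h with h | h
      · exact Or.inl h
      · exact Or.inr h
    have h5 : lg x ≤ lg (x + y) := lg_mono (by rw [h4]; linarith [abs_nonneg y])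
    rw [h4, sub_self, mul_zero]
    have h6 : (a + b - 1 / 2) * (lg x - lg (x + y)) ≤ 3 * Real.log 2 := by
      rcases le_total 0 (a + b - 1 / 2) with h | h <;> nlinarith
    have h7 : (p + q - 1 / 2) * lg y ≤ 0 := by nlinarith
    nlinarith
  -- Opposite signs: the decay exp(-(π/2)|y|) absorbs every power of 1 + |y|, including the loss in
  -- comparing lg (x + y) with lg x.
  · have h4 : |x + y| = |x| - |y| := by
      rcases mul_nonpos_iff.1 h with h | h
      · rw [abs_of_nonneg h.1, abs_of_nonpos h.2] at *
        rw [abs_of_nonneg] <;> linarith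
      · rw [abs_of_nonpos h.1, abs_of_nonneg h.2] at *
        rw [abs_of_nonpos] <;> linarith
    have h5 : lg x ≤ lg (x + y) + lg y := by
      unfold lg
      rw [← Real.log_mul (by positivity) (by positivity)]
      apply Real.log_le_log (by positivity)
      have : 0 ≤ |x + y| * |y| := by positivity
      nlinarith
    have h6 : (a + b - 1 / 2) * (lg x - lg (x + y)) ≤ 3 * lg y + 3 * Real.log 2 := by
      rcases le_total 0 (a + b - 1 / 2) with h | h <;> nlinarith
    have h7 := mul_lg_le y (c := 6) (by norm_num)
    have h8 : Real.pi / 4 * (|x| + |y| - |x + y|) = Real.pi / 2 * |y| := by rw [h4]; ring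
    have h9 : (p + q - 1 / 2) * lg y ≤ 0 := by nlinarith
    have h10 : 1 * |y| ≤ Real.pi / 2 * |y| :=
      mul_le_mul_of_nonneg_right (by linarith) (abs_nonneg y)
    rw [h8]
    nlinarith

/-- The range of the beta function bounds. -/
def BetaRange (δ : ℝ) (X Y : ℂ) (p q : ℝ) : Prop :=
  δ ≤ X.re / 2 ∧ X.re / 2 ≤ 3 / 2 ∧ δ ≤ Y.re / 2 ∧ Y.re / 2 ≤ 3 / 2 ∧
    p ≤ Y.re / 2 ∧ q ≤ X.re / 2 ∧ p + q ≤ 1 / 2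

lemma norm_betaFn_le {δ : ℝ} (hδ : 0 < δ) : ∃ K : ℝ, ∀ X Y : ℂ, ∀ p q : ℝ,
    BetaRange δ X Y p q → ‖betaFn (X / 2) (Y / 2)‖ ≤ Real.exp (K - p * lg X.im - q * lg Y.im) := by
  obtain ⟨K₁, h₁⟩ := norm_Gamma_half_le_exp hδ
  obtain ⟨K₂, h₂⟩ := norm_inv_Gamma_half_le_exp
  refine ⟨K₁ + K₁ + K₂ + (6 * Real.log 6 + 1 + 3 * Real.log 2),
    fun X Y p q h => ?_⟩
  obtain ⟨hX, hX', hY, hY', hp, hq, hpq⟩ := h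
  have a1 := h₁ X (Or.inl ⟨hX, by linarith⟩)
  have a2 := h₁ Y (Or.inl ⟨hY, by linarith⟩)
  have a3 := h₂ (X + Y) (by simp; linarith) (by simp; linarith)
  rw [betaFn, div_eq_mul_inv, norm_mul, norm_mul, ← add_div]
  calc _ ≤ Real.exp _ * Real.exp _ * Real.exp _ := by gcongr
    _ = Real.exp _ := by rw [← Real.exp_add, ← Real.exp_add]
    _ ≤ _ := by
      apply Real.exp_le_exp.2
      have := beta_exponent_le (x := X.im) (y := Y.im) (by linarith) (by linarith) hX' hY'
        hp hq hpq
      simp only [add_re, add_im]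
      linarith

lemma norm_sin_pi_half_mul_le (z : ℂ) : ‖sin (Real.pi / 2 * z)‖ ≤
    Real.exp (Real.pi / 2 * |z.im|) := by
  have hπ := Real.pi_pos
  have e1 : (((Real.pi / 2 : ℂ) * z) * I).re = -(Real.pi / 2 * z.im) := by
    simp [mul_re]
  have e2 : (-((Real.pi / 2 : ℂ) * z) * I).re = Real.pi / 2 * z.im := by
    simp [mul_re]
  have h1 : ‖cexp (((Real.pi / 2 : ℂ) * z) * I)‖ ≤ Real.exp (Real.pi / 2 * |z.im|) := by
    rw [norm_exp, e1]
    apply Real.exp_le_exp.2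
    nlinarith [neg_abs_le z.im]
  have h2 : ‖cexp (-((Real.pi / 2 : ℂ) * z) * I)‖ ≤ Real.exp (Real.pi / 2 * |z.im|) := by
    rw [norm_exp, e2]
    apply Real.exp_le_exp.2
    nlinarith [le_abs_self z.im]
  rw [sin, norm_div, norm_mul, norm_I, mul_one]
  simp only [Complex.norm_ofNat]
  have := norm_sub_le (cexp (-((Real.pi / 2 : ℂ) * z) * I)) (cexp (((Real.pi / 2 : ℂ) * z) * I))
  linarith

/-- A pair of signs. -/
def IsSigns (v : ℂ × ℂ) : Prop := ∃ a b : ℝ, |a| ≤ 1 ∧ |b| ≤ 1 ∧ v = ((a : ℂ), (b : ℂ))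

lemma isSigns_sgn (y : ℝ × ℝ) : IsSigns (sgn y) := by
  have : ∀ x : ℝ, |Real.sign x| ≤ 1 := fun x => by
    rcases Real.sign_apply_eq x with h | h | h <;> rw [h] <;> norm_num
  exact ⟨_, _, this y.1, this y.2, rfl⟩

/-- Up to real constants the arguments of the sines are combinations, with coefficients in [-1, 1],
of the arguments of Γ(t₁), Γ(s₂ - u₂), Γ(1 - r₁ + s₂ - t₁ - t₂) in the first factor and Γ(s₁ - u₁ -
t₁), Γ(t₁ + t₂), Γ(1 + s₁ - r₂) in the second. The growth is therefore at most the combined decay of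
these six gamma factors. -/
lemma norm_Awl_le {v : ℂ × ℂ} (hv : IsSigns v) (u s r : ℂ × ℂ) (t₁ t₂ : ℂ) :
    ‖Awl v u s r t₁ t₂‖ ≤ Real.exp (1 + Real.pi / 2 * (|t₁.im| + |(s.2 - u.2).im| +
      |(1 - r.1 + s.2 - t₁ - t₂).im| + |(s.1 - u.1 - t₁).im| + |(t₁ + t₂).im| +
      |(1 + s.1 - r.2).im|)) := by
  obtain ⟨a, b, ha, hb, rfl⟩ := hv
  have hπ := Real.pi_pos
  have hab : ∀ c x : ℝ, |c| ≤ 1 → |c * x| ≤ |x| := fun c x h => by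
    rw [abs_mul]
    nlinarith [abs_nonneg x]
  have k1 : |((a : ℂ) * t₁ + b * (s.2 - u.2) - r.1 + s.2 - t₁ - t₂).im| ≤
      |t₁.im| + |(s.2 - u.2).im| + |(1 - r.1 + s.2 - t₁ - t₂).im| := by
    have e : ((a : ℂ) * t₁ + b * (s.2 - u.2) - r.1 + s.2 - t₁ - t₂).im =
      a * t₁.im + b * (s.2 - u.2).im + (1 - r.1 + s.2 - t₁ - t₂).im := by simp; ring
    rw [e]
    refine (abs_add_le _ _).trans (add_le_add ((abs_add_le _ _).trans ?_) le_rfl)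
    exact add_le_add (hab _ _ ha) (hab _ _ hb)
  have k2 : |(-((a : ℂ) * t₁) + b * (s.2 - u.2) - r.1 + s.2 - t₁ - t₂).im| ≤
      |t₁.im| + |(s.2 - u.2).im| + |(1 - r.1 + s.2 - t₁ - t₂).im| := by
    have e : (-((a : ℂ) * t₁) + b * (s.2 - u.2) - r.1 + s.2 - t₁ - t₂).im =
      (-a) * t₁.im + b * (s.2 - u.2).im + (1 - r.1 + s.2 - t₁ - t₂).im := by simp; ring
    rw [e]
    refine (abs_add_le _ _).trans (add_le_add ((abs_add_le _ _).trans ?_) le_rfl)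
    exact add_le_add (hab _ _ (by rwa [abs_neg])) (hab _ _ hb)
  have k3 : |((a : ℂ) * (s.1 - t₁ - u.1) + t₁ + t₂ - r.2 + s.1).im| ≤
      |(s.1 - u.1 - t₁).im| + |(t₁ + t₂).im| + |(1 + s.1 - r.2).im| := by
    have e : ((a : ℂ) * (s.1 - t₁ - u.1) + t₁ + t₂ - r.2 + s.1).im =
      a * (s.1 - u.1 - t₁).im + (t₁ + t₂).im + (1 + s.1 - r.2).im := by simp; ring
    rw [e]
    refine (abs_add_le _ _).trans (add_le_add ((abs_add_le _ _).trans ?_) le_rfl)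
    exact add_le_add (hab _ _ ha) le_rfl
  have k4 : |((a : ℂ) * (s.1 - t₁ - u.1) - t₁ - t₂ - r.2 + s.1).im| ≤
      |(s.1 - u.1 - t₁).im| + |(t₁ + t₂).im| + |(1 + s.1 - r.2).im| := by
    have e : ((a : ℂ) * (s.1 - t₁ - u.1) - t₁ - t₂ - r.2 + s.1).im =
      a * (s.1 - u.1 - t₁).im + -(t₁ + t₂).im + (1 + s.1 - r.2).im := by simp; ring
    rw [e]
    refine (abs_add_le _ _).trans (add_le_add ((abs_add_le _ _).trans ?_) le_rfl)
    exact add_le_add (hab _ _ ha) (abs_neg _).le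
  have key : ∀ z w : ℂ, ∀ c d : ℝ, |z.im| ≤ c → |w.im| ≤ d →
      ‖sin (Real.pi / 2 * z) * sin (Real.pi / 2 * w)‖ ≤ Real.exp (Real.pi / 2 * (c + d)) := by
    intro z w c d h1 h2
    rw [norm_mul, mul_add, Real.exp_add]
    gcongr
    · exact (norm_sin_pi_half_mul_le z).trans (by gcongr)
    · exact (norm_sin_pi_half_mul_le w).trans (by gcongr)
  unfold Awl
  refine (norm_add_le _ _).trans ((add_le_add (key _ _ _ _ k1 k3) (key _ _ _ _ k2 k4)).trans ?_)
  rw [Real.exp_add 1, ← two_mul]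
  -- The summand 1 of the exponent pays for the two products of sines.
  have : (2 : ℝ) ≤ Real.exp 1 := by linarith [Real.add_one_le_exp 1]
  exact mul_le_mul this (Real.exp_le_exp.2 (by linarith)) (Real.exp_pos _).le (Real.exp_pos _).le

/-- The bound for `Γ(1 + s₁ - r₂)` times the integrand of `N_{w_l,2}`. -/
lemma norm_kerN2_le {δ : ℝ} (hδ : 0 < δ) : ∃ K : ℝ, ∀ v u s r : ℂ × ℂ, ∀ t₁ t₂ : ℂ,
    ∀ wa wb wc p₇ q₇ p₈ q₈ p₉ q₉ : ℝ, IsSigns v →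
    gammaRange δ (t₁ + t₂).re → wa ≤ 1 / 2 - (t₁ + t₂).re →
    gammaRange δ (1 - r.1 + s.2 - t₁ - t₂).re → wb ≤ 1 / 2 - (1 - r.1 + s.2 - t₁ - t₂).re →
    gammaRange δ (1 + s.1 - r.2).re → wc ≤ 1 / 2 - (1 + s.1 - r.2).re →
    BetaRange δ (r.1 - 2 * s.2 + t₂ + u.2) (1 - r.1 - t₂ + u.1 - u.2) p₇ q₇ →
    BetaRange δ (r.2 - 2 * s.1 - t₂ + u.1) (r.1 - r.2 + t₂ - u.1) p₈ q₈ →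
    BetaRange δ (1 - 2 * t₁ - t₂) (1 - r.1 - u.1) p₉ q₉ →
    ‖kerN2 v u s r t₁ t₂ * Gamma (1 + s.1 - r.2)‖ ≤ Real.exp (K +
      Real.pi / 2 * (|t₁.im| + |(s.2 - u.2).im| + |(s.1 - u.1 - t₁).im|) -
      wa * lg (t₁ + t₂).im - wb * lg (1 - r.1 + s.2 - t₁ - t₂).im -
      wc * lg (1 + s.1 - r.2).im -
      p₇ * lg (r.1 - 2 * s.2 + t₂ + u.2).im - q₇ * lg (1 - r.1 - t₂ + u.1 - u.2).im -
      p₈ * lg (r.2 - 2 * s.1 - t₂ + u.1).im - q₈ * lg (r.1 - r.2 + t₂ - u.1).im -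
      p₉ * lg (1 - 2 * t₁ - t₂).im - q₉ * lg (1 - r.1 - u.1).im) := by
  obtain ⟨K₁, h₁⟩ := norm_Gamma_le_exp hδ
  obtain ⟨K₂, h₂⟩ := norm_betaFn_le hδ
  refine ⟨1 + 3 * K₁ + 3 * K₂, ?_⟩
  intro v u s r t₁ t₂ wa wb wc p₇ q₇ p₈ q₈ p₉ q₉ hv ra ha rb hb rc hc β₇ β₈ β₉
  have a0 := norm_Awl_le hv u s r t₁ t₂
  have a1 := h₁ _ _ ra ha
  have a2 := h₁ _ _ rb hb
  have a3 := h₁ _ _ rc hc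
  have b1 := h₂ _ _ _ _ β₇
  have b2 := h₂ _ _ _ _ β₈
  have b3 := h₂ _ _ _ _ β₉
  unfold kerN2
  simp only [norm_mul]
  calc _ ≤ Real.exp _ * Real.exp _ * Real.exp _ * Real.exp _ * Real.exp _ * Real.exp _ *
        Real.exp _ := by gcongr
    _ = Real.exp _ := by
      rw [← Real.exp_add, ← Real.exp_add, ← Real.exp_add, ← Real.exp_add, ← Real.exp_add,
        ← Real.exp_add]
    _ ≤ _ := by
      apply Real.exp_le_exp.2
      linarith

end

section

/-! ## The spectral variables: labels and log-linear arithmetic -/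

lemma lg_le_add_lg {a b c : ℝ} (h : |a| ≤ |b| + |c|) : lg a ≤ lg b + lg c := by
  unfold lg
  rw [← Real.log_mul (by positivity) (by positivity)]
  apply Real.log_le_log (by positivity)
  have : 0 ≤ |b| * |c| := by positivity
  nlinarith

/-- `q` is the index of the middle entry of `m`. -/
structure Mid (m : Fin 3 → ℝ) (p q s : Fin 3) : Prop where
  pq : p ≠ q
  qs : q ≠ s
  ps : p ≠ s
  mid : m s ≤ m q ∧ m q ≤ m p ∨ m p ≤ m q ∧ m q ≤ m s

lemma Mid.symm {m : Fin 3 → ℝ} {p q s : Fin 3} (h : Mid m p q s) : Mid m s q p :=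
  ⟨h.qs.symm, h.pq.symm, h.ps.symm, h.mid.symm⟩

lemma Mid.neg {m : Fin 3 → ℝ} {p q s : Fin 3} (h : Mid m p q s) :
    Mid (fun i => -m i) p q s := by
  refine ⟨h.pq, h.qs, h.ps, ?_⟩
  rcases h.mid with h | h
  · right; constructor <;> linarith [h.1, h.2]
  · left; constructor <;> linarith [h.1, h.2]

lemma exists_mid (m : Fin 3 → ℝ) : ∃ p q s, Mid m p q s := by
  rcases le_total (m 0) (m 1) with h1 | h1 <;> rcases le_total (m 1) (m 2) with h2 | h2 <;>
    rcases le_total (m 0) (m 2) with h3 | h3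
  · exact ⟨0, 1, 2, by decide, by decide, by decide, Or.inr ⟨h1, h2⟩⟩
  · exact ⟨0, 1, 2, by decide, by decide, by decide, Or.inr ⟨h1, h2⟩⟩
  · exact ⟨0, 2, 1, by decide, by decide, by decide, Or.inr ⟨h3, h2⟩⟩
  · exact ⟨2, 0, 1, by decide, by decide, by decide, Or.inr ⟨h3, h1⟩⟩
  · exact ⟨1, 0, 2, by decide, by decide, by decide, Or.inr ⟨h1, h3⟩⟩
  · exact ⟨1, 2, 0, by decide, by decide, by decide, Or.inr ⟨h2, h3⟩⟩
  · exact ⟨0, 1, 2, by decide, by decide, by decide, Or.inl ⟨h2, h1⟩⟩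
  · exact ⟨0, 1, 2, by decide, by decide, by decide, Or.inl ⟨h2, h1⟩⟩

lemma perm_cases {p q s : Fin 3} (h1 : p ≠ q) (h2 : q ≠ s) (h3 : p ≠ s) :
    (p = 0 ∧ q = 1 ∧ s = 2) ∨ (p = 0 ∧ q = 2 ∧ s = 1) ∨ (p = 1 ∧ q = 0 ∧ s = 2) ∨
      (p = 1 ∧ q = 2 ∧ s = 0) ∨ (p = 2 ∧ q = 0 ∧ s = 1) ∨ (p = 2 ∧ q = 1 ∧ s = 0) := by
  revert p q s
  decide

lemma sum_eq_of_distinct {p q s : Fin 3} (h1 : p ≠ q) (h2 : q ≠ s) (h3 : p ≠ s) (f : Fin 3 → ℝ) :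
    ∑ i, f i = f p + f q + f s := by
  rw [Fin.sum_univ_three]
  rcases perm_cases h1 h2 h3 with h | h | h | h | h | h <;> obtain ⟨rfl, rfl, rfl⟩ := h <;> ring

lemma pair_sum_eq_of_distinct {p q s : Fin 3} (h1 : p ≠ q) (h2 : q ≠ s) (h3 : p ≠ s)
    (f : ℝ → ℝ) (hf : ∀ a b, f (a - b) = f (b - a)) (m : Fin 3 → ℝ) :
    f (m 0 - m 1) + f (m 0 - m 2) + f (m 1 - m 2) =
      f (m p - m q) + f (m p - m s) + f (m q - m s) := by
  rcases perm_cases h1 h2 h3 with h | h | h | h | h | h <;> obtain ⟨rfl, rfl, rfl⟩ := h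
  · ring
  · rw [hf (m 1) (m 2)]; ring
  · rw [hf (m 0) (m 1)]; ring
  · rw [hf (m 0) (m 1), hf (m 0) (m 2)]; ring
  · rw [hf (m 1) (m 2), hf (m 0) (m 2)]; ring
  · rw [hf (m 1) (m 2), hf (m 0) (m 2), hf (m 0) (m 1)]; ring

/-- The exponential defect of `G*`. -/
noncomputable def defect (m : Fin 3 → ℝ) (x z : ℝ) : ℝ :=
  ∑ i, |x + m i| + ∑ i, |z - m i| - |x + z| -
    (|m 0 - m 1| + |m 0 - m 2| + |m 1 - m 2|)

/-- The relative position of the spectral variables, up to an error `e` in logarithms. -/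
structure Label (m : Fin 3 → ℝ) (p q s : Fin 3) (x z e : ℝ) : Prop where
  e_ge : Real.log 2 ≤ e
  Aq : lg (x + m q) ≤ lg (m q - m s) + e
  As : lg (x + m s) ≤ lg (m q - m s) + e
  Ap : lg (x + m p) ≤ lg (m p - m s) + e
  Bq : lg (z - m q) ≤ lg (m p - m q) + e
  Bp : lg (z - m p) ≤ lg (m p - m q) + e
  AqS : lg (x + m q) ≤ lg (x + z) + e
  BqS : lg (z - m q) ≤ lg (x + z) + e
  BqBs : lg (z - m q) ≤ lg (z - m s) + e
  XBs : lg (m q - m s) ≤ lg (z - m s) + e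
  AqAp : lg (x + m q) ≤ lg (x + m p) + e
  YAp : lg (m p - m q) ≤ lg (x + m p) + e
  Ap_max : lg (x + m p) ≤ max (lg (m p - m q)) (lg (x + m q)) + e
  Bs_max : lg (z - m s) ≤ max (lg (m q - m s)) (lg (z - m q)) + e
  Z_max : lg (m p - m s) ≤ max (lg (m q - m s)) (lg (m p - m q)) + e
  XZ : lg (m q - m s) ≤ lg (m p - m s)
  YZ : lg (m p - m q) ≤ lg (m p - m s)
  defect_nonneg : 0 ≤ defect m x z

lemma defect_neg (m : Fin 3 → ℝ) (x z : ℝ) :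
    defect (fun i => -m i) (-x) (-z) = defect m x z := by
  have e : ∀ a b : ℝ, |-a + -b| = |a + b| := fun a b => by rw [← abs_neg]; congr 1; ring
  have e' : ∀ a b : ℝ, |-a - -b| = |a - b| := fun a b => by rw [← abs_neg]; congr 1; ring
  simp only [defect, e, e']

/-- The defect is what is lost in (x + m_p) + (z - m_s) ≤ |x + m_p| + |z - m_s|, |x + m_q| + |x +
m_s| ≥ m_q - m_s and |z - m_p| + |z - m_q| ≥ m_p - m_q. It bounds the departure of x from [-m_q,
-m_s] and of z from [m_q, m_p], so the comparisons needed take the form |a| ≤ |b| + D, or follow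
directly from the ordering of m and the triangle inequality. -/
lemma label_aux {m : Fin 3 → ℝ} {p q s : Fin 3} (h1 : p ≠ q) (h2 : q ≠ s) (h3 : p ≠ s)
    (hqs : m s ≤ m q) (hpq : m q ≤ m p) {x z : ℝ} (hxz : 0 ≤ x + z) :
    Label m p q s x z (Real.log 2 + lg (defect m x z)) := by
  set D := defect m x z with hD
  have hd : D = |x + m p| + |x + m q| + |x + m s| + (|z - m p| + |z - m q| + |z - m s|) -
      (x + z) - 2 * (m p - m s) := by
    rw [hD, defect, sum_eq_of_distinct h1 h2 h3, sum_eq_of_distinct h1 h2 h3,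
      pair_sum_eq_of_distinct h1 h2 h3 (fun a => |a|) abs_sub_comm, abs_of_nonneg hxz,
      abs_of_nonneg (by linarith : 0 ≤ m p - m q), abs_of_nonneg (by linarith : 0 ≤ m p - m s),
      abs_of_nonneg (by linarith : 0 ≤ m q - m s)]
    ring
  have a1 := le_abs_self (x + m p)
  have a2 := le_abs_self (x + m q)
  have a3 := le_abs_self (x + m s)
  have a4 := neg_abs_le (x + m p)
  have a5 := neg_abs_le (x + m q)
  have a6 := neg_abs_le (x + m s)
  have b1 := le_abs_self (z - m p)
  have b2 := le_abs_self (z - m q)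
  have b3 := le_abs_self (z - m s)
  have b4 := neg_abs_le (z - m p)
  have b5 := neg_abs_le (z - m q)
  have b6 := neg_abs_le (z - m s)
  have hD0 : 0 ≤ D := by linarith
  have l2 : 0 < Real.log 2 := Real.log_pos one_lt_two
  have key : ∀ a b : ℝ, |a| ≤ |b| + D → lg a ≤ lg b + (Real.log 2 + lg D) := fun a b h => by
    have := lg_le_add_lg (a := a) (b := b) (c := D) (by rwa [abs_of_nonneg hD0])
    linarith
  have keym : ∀ a b c : ℝ, a = b + c → lg a ≤ max (lg b) (lg c) + (Real.log 2 + lg D) :=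
    fun a b c h => by
    have := lg_add_le_max b c
    rw [h]
    linarith [lg_nonneg D]
  have n1 : |m p - m q| = m p - m q := abs_of_nonneg (by linarith)
  have n2 : |m p - m s| = m p - m s := abs_of_nonneg (by linarith)
  have n3 : |m q - m s| = m q - m s := abs_of_nonneg (by linarith)
  refine ⟨by linarith [lg_nonneg D], key _ _ ?_, key _ _ ?_, key _ _ ?_, key _ _ ?_, key _ _ ?_,
    key _ _ ?_, key _ _ ?_, key _ _ ?_, key _ _ ?_, key _ _ ?_, key _ _ ?_,
    keym _ _ _ (by ring), ?_, keym _ _ _ (by ring), lg_mono ?_, lg_mono ?_, hD0⟩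
  · rw [n3, abs_le]; constructor <;> linarith
  · rw [n3, abs_le]; constructor <;> linarith
  · rw [n2, abs_le]; constructor <;> linarith
  · rw [n1, abs_le]; constructor <;> linarith
  · rw [n1, abs_le]; constructor <;> linarith
  · rw [abs_of_nonneg hxz, abs_le]; constructor <;> linarith
  · rw [abs_of_nonneg hxz, abs_le]; constructor <;> linarith
  · rw [abs_le]; constructor <;> linarith
  · rw [n3]; linarith
  · rw [abs_le]; constructor <;> linarith
  · rw [n1]; linarith
  · exact keym _ _ _ (by ring)
  · rw [n2, n3]; linarith
  · rw [n2, n1]; linarith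

/-- The defect is invariant under changing the sign of m, x and z together. This reduces x + z ≤ 0
to x + z ≥ 0 and interchanges the two extreme coordinates, hence the two labellings. -/
lemma label_or {m : Fin 3 → ℝ} {p q s : Fin 3} (h : Mid m p q s) (x z : ℝ) :
    Label m p q s x z (Real.log 2 + lg (defect m x z)) ∨
      Label m s q p x z (Real.log 2 + lg (defect m x z)) := by
  have neg : ∀ {p q s : Fin 3}, p ≠ q → q ≠ s → p ≠ s → m p ≤ m q → m q ≤ m s → x + z ≤ 0 →
      Label m p q s x z (Real.log 2 + lg (defect m x z)) := by
    intro p q s h1 h2 h3 hpq hqs hxz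
    have H := label_aux (m := fun i => -m i) h1 h2 h3 (by linarith) (by linarith)
      (x := -x) (z := -z) (by linarith)
    rw [defect_neg] at H
    have e1 : ∀ a b : ℝ, lg (-a + -b) = lg (a + b) := fun a b => by
      rw [← lg_neg]; congr 1; ring
    have e2 : ∀ a b : ℝ, lg (-a - -b) = lg (a - b) := fun a b => by
      rw [← lg_neg]; congr 1; ring
    obtain ⟨c0, c1, c2, c3, c4, c5, c6, c7, c8, c9, c10, c11, c12, c13, c14, c15, c16, c17⟩ := H
    simp only [e1, e2] at *
    exact ⟨c0, c1, c2, c3, c4, c5, c6, c7, c8, c9, c10, c11, c12, c13, c14, c15, c16,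
      by rwa [defect_neg] at c17⟩
  rcases h.mid with hm | hm <;> rcases le_total 0 (x + z) with hx | hx
  · exact Or.inl (label_aux h.pq h.qs h.ps hm.1 hm.2 hx)
  · exact Or.inr (neg h.qs.symm h.pq.symm h.ps.symm hm.1 hm.2 hx)
  · exact Or.inr (label_aux h.qs.symm h.pq.symm h.ps.symm hm.1 hm.2 hx)
  · exact Or.inl (neg h.pq h.qs h.ps hm.1 hm.2 hx)

/-- The exponent of the spectral part of the integrand. -/
noncomputable def specExp (Δ : ℝ) (ρ σ : Fin 3 → ℝ) (τ : ℝ) (m : Fin 3 → ℝ) (x z : ℝ) : ℝ :=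
  ∑ i, (Δ + ρ i) * lg (x + m i) + ∑ i, (Δ / 2 - σ i) * lg (z - m i) -
    (3 * Δ / 2 + τ) * lg (x + z) - Real.pi / 4 * defect m x z -
    Δ * (lg (m 0 - m 1) + lg (m 0 - m 2) + lg (m 1 - m 2))

/-- The exponents for which the `r`-integrals are estimated. -/
structure SpecParams (ρ σ : Fin 3 → ℝ) (τ κ γ : ℝ) : Prop where
  τ0 : 0 ≤ τ
  τ1 : τ ≤ 1
  ρlo : ∀ i, -(3 / 10) ≤ ρ i
  ρhi : ∀ i, ρ i ≤ 1
  σlo : ∀ i, 0 ≤ σ i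
  σhi : ∀ i, σ i ≤ 1
  σσ : ∀ i j, i ≠ j → σ i + σ j ≤ 7 / 5
  σd : ∀ i j, σ i - σ j ≤ 27 / 50
  κ0 : 0 < κ
  κ1 : κ ≤ 1 / 100
  γ0 : 0 ≤ γ
  γ1 : γ ≤ 1 / 100
  ρρ : ∀ i j, i ≠ j → τ + γ ≤ 7 / 10 + ρ i
  ρρ' : ∀ i j, i ≠ j → τ + γ ≤ 7 / 10 + ρ i + ρ j

/-- The exponent left after the label is known. -/
noncomputable def labelExp (ρ σ : Fin 3 → ℝ) (τ κ γ : ℝ) (m : Fin 3 → ℝ) (p q s : Fin 3)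
    (x z : ℝ) : ℝ :=
  (1 + κ - γ + ρ q + ρ s - τ - σ s) * lg (m q - m s) + ρ p * lg (m p - m s) +
    (7 / 5 - σ p - σ q) * lg (m p - m q) - (7 / 10 + κ - γ) * lg (x + m q) -
    3 / 10 * lg (x + m s) - (7 / 10 + (σ p - σ q) / 2) * lg (z - m p) -
    (7 / 10 + (σ q - σ p) / 2) * lg (z - m q)

/-- On a label the relevant sizes are bounded by root sizes up to e. Hence the exponents in x and z
can be lowered to a fixed integrable pattern: in x the total is 1 + κ - γ (with γ to come from
another factor), in z it is 7/5. The price is powers of the root sizes. -/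
lemma Label.exp_le {Δ : ℝ} (hΔ0 : 0 ≤ Δ) (hΔ1 : Δ ≤ 1) {ρ σ : Fin 3 → ℝ} {τ κ γ : ℝ}
    (P : SpecParams ρ σ τ κ γ) {m : Fin 3 → ℝ} {p q s : Fin 3} (h1 : p ≠ q) (h2 : q ≠ s)
    (h3 : p ≠ s) {x z e : ℝ} (L : Label m p q s x z e) :
    specExp Δ ρ σ τ m x z ≤ labelExp ρ σ τ κ γ m p q s x z + 20 * e -
      Real.pi / 4 * defect m x z := by
  rw [specExp, labelExp, sum_eq_of_distinct h1 h2 h3, sum_eq_of_distinct h1 h2 h3,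
    pair_sum_eq_of_distinct h1 h2 h3 lg lg_sub_comm]
  obtain ⟨c0, c1, c2, c3, c4, c5, c6, c7, c8, c9, c10, c11, c12, c13, c14, c15, c16, c17⟩ := L
  have l2 : 0 < Real.log 2 := Real.log_pos one_lt_two
  generalize Real.pi / 4 * defect m x z = Φ
  set X := lg (m q - m s)
  set Y := lg (m p - m q)
  set Z := lg (m p - m s)
  set Ap := lg (x + m p)
  set Aq := lg (x + m q)
  set As := lg (x + m s)
  set Bp := lg (z - m p)
  set Bq := lg (z - m q)
  set Bs := lg (z - m s)
  set S := lg (x + z)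
  have he0 : 0 ≤ e := by linarith
  -- The Δ-powers of G* are balanced by those of the adjustment factor: the bracket is O(e) on every
  -- label, so Δ does not affect the final exponents.
  have hΔ : Δ * (Ap + Aq + As + (Bp + Bq + Bs) / 2 - 3 / 2 * S - (X + Y + Z)) ≤ 8 * e := by
    have : Ap + Aq + As + (Bp + Bq + Bs) / 2 - 3 / 2 * S - (X + Y + Z) ≤ 8 * e := by
      rcases max_cases Y Aq with ⟨h, h'⟩ | ⟨h, h'⟩ <;> rw [h] at c12 <;>
      rcases max_cases X Bq with ⟨g, g'⟩ | ⟨g, g'⟩ <;> rw [g] at c13 <;>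
      linarith
    nlinarith
  have k1 : (3 / 10 + ρ s) * (As - X) ≤ (3 / 10 + ρ s) * e :=
    mul_le_mul_of_nonneg_left (by linarith) (by linarith [P.ρlo s])
  have k2 : σ s * (X - Bs) ≤ σ s * e := mul_le_mul_of_nonneg_left (by linarith) (P.σlo s)
  have k3 : τ * (Aq - S) ≤ τ * e := mul_le_mul_of_nonneg_left (by linarith) P.τ0
  have k4 : (7 / 5 - σ p - σ q) / 2 * (Bp + Bq - 2 * Y) ≤ (7 / 5 - σ p - σ q) / 2 * (2 * e) :=
    mul_le_mul_of_nonneg_left (by linarith) (by linarith [P.σσ p q h1])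
  -- The sizes at q and p must be treated together: if ρ p < 0, the factor in x + m_p grows relative
  -- to the root size Z, and this growth is charged to the decay in x + m_q through Z - X + Aq ≤ Ap
  -- + 3e.
  have k5 : (7 / 10 + κ - γ + ρ q - τ) * (Aq - X) + ρ p * (Ap - Z) ≤ 6 * e := by
    have q1 := P.ρρ q p h1.symm
    have q2 := P.ρρ' q p h1.symm
    have q3 := P.ρhi q
    have q4 := P.ρlo p
    have q5 := P.κ0
    have q6 := P.κ1
    have q7 := P.γ0
    have q8 := P.τ0
    have q9 := P.ρhi p
    rcases le_total 0 (ρ p) with h | h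
    · have t1 : (7 / 10 + κ - γ + ρ q - τ) * (Aq - X) ≤ (7 / 10 + κ - γ + ρ q - τ) * e :=
        mul_le_mul_of_nonneg_left (by linarith) (by linarith)
      have t2 : ρ p * (Ap - Z) ≤ ρ p * e := mul_le_mul_of_nonneg_left (by linarith) h
      have t3 : (7 / 10 + κ - γ + ρ q - τ + ρ p) * e ≤ 6 * e :=
        mul_le_mul_of_nonneg_right (by linarith) he0
      linarith
    · have hz : Z - X + Aq ≤ Ap + 3 * e := by
        rcases max_cases X Y with ⟨h, h'⟩ | ⟨h, h'⟩ <;> rw [h] at c14 <;> linarith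
      have t2 : -ρ p * (Z - X + Aq - Ap) ≤ -ρ p * (3 * e) :=
        mul_le_mul_of_nonneg_left (by linarith) (by linarith)
      have t1 : (7 / 10 + κ - γ + ρ q - τ + ρ p) * (Aq - X) ≤
          (7 / 10 + κ - γ + ρ q - τ + ρ p) * e :=
        mul_le_mul_of_nonneg_left (by linarith) (by linarith)
      have t3 : (7 / 10 + κ - γ + ρ q - τ + ρ p + -ρ p * 3) * e ≤ 6 * e :=
        mul_le_mul_of_nonneg_right (by linarith) he0
      linarith
  have he : (3 / 10 + ρ s) * e + σ s * e + τ * e + (7 / 5 - σ p - σ q) / 2 * (2 * e) ≤ 6 * e := by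
    have t : (3 / 10 + ρ s + σ s + τ + (7 / 5 - σ p - σ q)) * e ≤ 6 * e :=
      mul_le_mul_of_nonneg_right
        (by linarith [P.ρhi s, P.σhi s, P.τ1, P.σlo p, P.σlo q]) he0
    linarith
  linarith

/-- Either labelling bounds the spectral part. -/
lemma specExp_le {Δ : ℝ} (hΔ0 : 0 ≤ Δ) (hΔ1 : Δ ≤ 1) {ρ σ : Fin 3 → ℝ} {τ κ γ : ℝ}
    (P : SpecParams ρ σ τ κ γ) : ∃ K : ℝ, ∀ m : Fin 3 → ℝ, ∀ p q s : Fin 3, Mid m p q s →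
    ∀ x z : ℝ, specExp Δ ρ σ τ m x z ≤ K + labelExp ρ σ τ κ γ m p q s x z ∨
      specExp Δ ρ σ τ m x z ≤ K + labelExp ρ σ τ κ γ m s q p x z := by
  -- The error 20e contains 20 lg D. By the tangent inequality with c = 40 this is at most D/2 plus
  -- a constant, and D/2 ≤ (π/4) D.
  refine ⟨20 * Real.log 2 + (40 * Real.log 40 + 1) / 2, fun m p q s h x z => ?_⟩
  have key : ∀ {p q s : Fin 3}, p ≠ q → q ≠ s → p ≠ s →
      Label m p q s x z (Real.log 2 + lg (defect m x z)) → specExp Δ ρ σ τ m x z ≤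
        20 * Real.log 2 + (40 * Real.log 40 + 1) / 2 + labelExp ρ σ τ κ γ m p q s x z := by
    intro p q s h1 h2 h3 L
    have h4 := L.exp_le hΔ0 hΔ1 P h1 h2 h3
    have h5 := mul_lg_le (defect m x z) (c := 40) (by norm_num)
    rw [abs_of_nonneg L.defect_nonneg] at h5
    have h6 : 1 / 2 * defect m x z ≤ Real.pi / 4 * defect m x z :=
      mul_le_mul_of_nonneg_right (by linarith [Real.pi_gt_three]) L.defect_nonneg
    linarith
  rcases label_or h x z with L | L
  · exact Or.inl (key h.pq h.qs h.ps L)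
  · exact Or.inr (key h.qs.symm h.pq.symm h.ps.symm L)

end

section

/-! ## Integrals of exponentials of logarithmic weights -/

/-- The extended nonnegative exponential. -/
noncomputable def xp (x : ℝ) : ENNReal := ENNReal.ofReal (Real.exp x)

lemma xp_add (a b : ℝ) : xp (a + b) = xp a * xp b := by
  rw [xp, Real.exp_add, ENNReal.ofReal_mul (Real.exp_pos _).le, xp, xp]

lemma xp_mono {a b : ℝ} (h : a ≤ b) : xp a ≤ xp b :=
  ENNReal.ofReal_le_ofReal (Real.exp_le_exp.2 h)

lemma xp_lt_top (a : ℝ) : xp a < ⊤ := ENNReal.ofReal_lt_top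

@[fun_prop]
lemma measurable_xp : Measurable xp := by
  unfold xp
  fun_prop

/-- Form of `lintegral_weights` suited to iteration: the integrand enters only through a pointwise
bound of its exponent, and the outcome is again an exponential of weights. -/
lemma lintegral_xp_four {c₁ c₂ c₃ c₄ : ℝ} (g₁₂ g₁₃ g₁₄ g₂₃ g₂₄ g₃₄ : ℝ)
    (h₁₂ : 0 ≤ g₁₂) (h₁₃ : 0 ≤ g₁₃) (h₁₄ : 0 ≤ g₁₄) (h₂₃ : 0 ≤ g₂₃) (h₂₄ : 0 ≤ g₂₄)
    (h₃₄ : 0 ≤ g₃₄) (h₁ : g₁₂ + g₁₃ + g₁₄ ≤ c₁) (h₂ : g₁₂ + g₂₃ + g₂₄ ≤ c₂)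
    (h₃ : g₁₃ + g₂₃ + g₃₄ ≤ c₃) (h₄ : g₁₄ + g₂₄ + g₃₄ ≤ c₄)
    (hs : 1 < c₁ + c₂ + c₃ + c₄ - (g₁₂ + g₁₃ + g₁₄ + g₂₃ + g₂₄ + g₃₄)) :
    ∃ K : ℝ, ∀ a₁ a₂ a₃ a₄ e : ℝ, ∀ f : ℝ → ℝ,
      (∀ x, f x ≤ e - (c₁ * lg (x - a₁) + c₂ * lg (x - a₂) + c₃ * lg (x - a₃) +
        c₄ * lg (x - a₄))) →
      ∫⁻ x, xp (f x) ≤ xp (K + e - (g₁₂ * lg (a₁ - a₂) + g₁₃ * lg (a₁ - a₃) +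
        g₁₄ * lg (a₁ - a₄) + g₂₃ * lg (a₂ - a₃) + g₂₄ * lg (a₂ - a₄) + g₃₄ * lg (a₃ - a₄))) := by
  obtain ⟨K, hK, H⟩ := lintegral_weights ![c₁, c₂, c₃, c₄]
    ![![0, g₁₂, g₁₃, g₁₄], ![0, 0, g₂₃, g₂₄], ![0, 0, 0, g₃₄], ![0, 0, 0, 0]]
    (by intro i j; fin_cases i <;> fin_cases j <;> simp <;> assumption)
    (by intro k; fin_cases k <;> simp [Fin.sum_univ_four] <;> linarith)
    (by simp [Fin.sum_univ_four]; linarith)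
  refine ⟨Real.log K, fun a₁ a₂ a₃ a₄ e f hf => ?_⟩
  have H' := H ![a₁, a₂, a₃, a₄]
  simp [Fin.sum_univ_four] at H'
  have h5 : ∫⁻ x, xp (f x) ≤ ∫⁻ x, xp e * ENNReal.ofReal (Real.exp (-(c₄ * lg (x - a₄)) +
      (-(c₃ * lg (x - a₃)) + (-(c₂ * lg (x - a₂)) + -(c₁ * lg (x - a₁)))))) := by
    refine lintegral_mono fun x => ?_
    rw [← xp, ← xp_add]
    exact xp_mono (by linarith [hf x])
  rw [lintegral_const_mul' _ _ (xp_lt_top e).ne] at h5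
  refine (h5.trans (mul_le_mul' le_rfl H')).trans (le_of_eq ?_)
  rw [xp, ← ENNReal.ofReal_mul (Real.exp_pos _).le, xp]
  congr 1
  nth_rw 1 [← Real.exp_log hK]
  rw [← Real.exp_add, ← Real.exp_add]
  congr 1
  ring

lemma lintegral_xp_three {c₁ c₂ c₃ : ℝ} (g₁₂ g₁₃ g₂₃ : ℝ) (h₁₂ : 0 ≤ g₁₂) (h₁₃ : 0 ≤ g₁₃)
    (h₂₃ : 0 ≤ g₂₃) (h₁ : g₁₂ + g₁₃ ≤ c₁) (h₂ : g₁₂ + g₂₃ ≤ c₂) (h₃ : g₁₃ + g₂₃ ≤ c₃)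
    (hs : 1 < c₁ + c₂ + c₃ - (g₁₂ + g₁₃ + g₂₃)) :
    ∃ K : ℝ, ∀ a₁ a₂ a₃ e : ℝ, ∀ f : ℝ → ℝ,
      (∀ x, f x ≤ e - (c₁ * lg (x - a₁) + c₂ * lg (x - a₂) + c₃ * lg (x - a₃))) →
      ∫⁻ x, xp (f x) ≤ xp (K + e - (g₁₂ * lg (a₁ - a₂) + g₁₃ * lg (a₁ - a₃) +
        g₂₃ * lg (a₂ - a₃))) := by
  obtain ⟨K, H⟩ := lintegral_xp_four (c₁ := c₁) (c₂ := c₂) (c₃ := c₃)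
    (c₄ := 0) g₁₂ g₁₃ 0 g₂₃ 0 0 h₁₂ h₁₃ le_rfl h₂₃ le_rfl le_rfl
    (by linarith) (by linarith) (by linarith) (by linarith) (by linarith)
  refine ⟨K, fun a₁ a₂ a₃ e f hf => (H a₁ a₂ a₃ 0 e f fun x => ?_).trans (xp_mono ?_)⟩
  · linarith [hf x]
  · linarith

lemma lintegral_xp_two {c₁ c₂ : ℝ} (g₁₂ : ℝ) (h₁₂ : 0 ≤ g₁₂) (h₁ : g₁₂ ≤ c₁) (h₂ : g₁₂ ≤ c₂)
    (hs : 1 < c₁ + c₂ - g₁₂) :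
    ∃ K : ℝ, ∀ a₁ a₂ e : ℝ, ∀ f : ℝ → ℝ,
      (∀ x, f x ≤ e - (c₁ * lg (x - a₁) + c₂ * lg (x - a₂))) →
      ∫⁻ x, xp (f x) ≤ xp (K + e - g₁₂ * lg (a₁ - a₂)) := by
  obtain ⟨K, H⟩ := lintegral_xp_three (c₁ := c₁) (c₂ := c₂) (c₃ := 0) g₁₂ 0 0 h₁₂ le_rfl le_rfl
    (by linarith) (by linarith) (by linarith) (by linarith)
  refine ⟨K, fun a₁ a₂ e f hf => (H a₁ a₂ 0 e f fun x => ?_).trans (xp_mono ?_)⟩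
  · linarith [hf x]
  · linarith

/-! ### The spectral integrals -/

/-- What is left of `labelExp` after the integration over `r₁`. -/
noncomputable def labelExpZ (ρ σ : Fin 3 → ℝ) (τ κ γ : ℝ) (m : Fin 3 → ℝ) (p q s : Fin 3)
    (z : ℝ) : ℝ :=
  (1 + κ - γ + ρ q + ρ s - τ - σ s) * lg (m q - m s) + ρ p * lg (m p - m s) +
    (7 / 5 - σ p - σ q) * lg (m p - m q) - (7 / 10 + (σ p - σ q) / 2) * lg (z - m p) -
    (7 / 10 + (σ q - σ p) / 2) * lg (z - m q)

/-- What is left of `labelExp` after the integration over `r₁` and `r₂`. -/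
noncomputable def labelMain (ρ σ : Fin 3 → ℝ) (τ κ γ : ℝ) (m : Fin 3 → ℝ) (p q s : Fin 3) : ℝ :=
  (1 + κ - γ + ρ q + ρ s - τ - σ s) * lg (m q - m s) + ρ p * lg (m p - m s) +
    (1 + κ - σ p - σ q) * lg (m p - m q)

@[fun_prop]
lemma Measurable.lg {α : Type*} [MeasurableSpace α] {f : α → ℝ} (hf : Measurable f) :
    Measurable fun x => lg (f x) := measurable_lg.comp hf

@[fun_prop]
lemma Measurable.xp {α : Type*} [MeasurableSpace α] {f : α → ℝ} (hf : Measurable f) :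
    Measurable fun x => xp (f x) := measurable_xp.comp hf

/-- The centres -m_q, -m_s and b carry total degree 1 + κ. The decay γ in x - b replaces as much
decay of the spectral factor, and this lowers the exponent of the root size by γ, wherever b lies.
-/
lemma lintegral_spec_fst {Δ : ℝ} (hΔ0 : 0 ≤ Δ) (hΔ1 : Δ ≤ 1) {ρ σ : Fin 3 → ℝ} {τ κ γ : ℝ}
    (P : SpecParams ρ σ τ κ γ) : ∃ K : ℝ, ∀ m : Fin 3 → ℝ, ∀ p q s : Fin 3, Mid m p q s →
    ∀ z b : ℝ, ∫⁻ x, xp (specExp Δ ρ σ τ m x z - γ * lg (x - b)) ≤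
      xp (K + labelExpZ ρ σ τ κ γ m p q s z) + xp (K + labelExpZ ρ σ τ κ γ m s q p z) := by
  obtain ⟨K₁, h₁⟩ := specExp_le hΔ0 hΔ1 P
  have := P.κ0
  have := P.γ0
  have := P.γ1
  obtain ⟨K₂, h₂⟩ := lintegral_xp_three (c₁ := 7 / 10 + κ - γ) (c₂ := 3 / 10) (c₃ := γ) 0 0 0
    le_rfl le_rfl le_rfl (by linarith) (by linarith) (by linarith) (by linarith)
  refine ⟨K₂ + K₁, fun m p q s h z b => ?_⟩
  have key : ∀ p q s : Fin 3, ∫⁻ x, xp (K₁ + labelExp ρ σ τ κ γ m p q s x z - γ * lg (x - b)) ≤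
      xp (K₂ + K₁ + labelExpZ ρ σ τ κ γ m p q s z) := by
    intro p q s
    refine (h₂ (-m q) (-m s) b (K₁ + labelExpZ ρ σ τ κ γ m p q s z) _ fun x => ?_).trans
      (xp_mono (by linarith))
    rw [labelExp, labelExpZ, sub_neg_eq_add, sub_neg_eq_add]
    linarith
  refine le_trans ?_ (add_le_add (key p q s) (key s q p))
  rw [← lintegral_add_left (by unfold labelExp; fun_prop)]
  refine lintegral_mono fun x => ?_
  rcases h₁ m p q s h x z with h | h
  · exact (xp_mono (by linarith)).trans le_self_add
  · exact (xp_mono (by linarith)).trans le_add_self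

/-- The two centres m_p, m_q carry degree 7/5; the surplus 2/5 - κ over 1 + κ - κ - ... is spent on
their distance, leaving degree 1 + κ to integrate. -/
lemma lintegral_spec_snd {ρ σ : Fin 3 → ℝ} {τ κ γ : ℝ} (P : SpecParams ρ σ τ κ γ) :
    ∃ K : ℝ, ∀ m : Fin 3 → ℝ, ∀ p q s : Fin 3,
      ∫⁻ z, xp (labelExpZ ρ σ τ κ γ m p q s z) ≤ xp (K + labelMain ρ σ τ κ γ m p q s) := by
  have k0 := P.κ0
  have k1 := P.κ1
  have : ∀ p q : Fin 3, ∃ K : ℝ, ∀ m : Fin 3 → ℝ, ∀ s : Fin 3,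
      ∫⁻ z, xp (labelExpZ ρ σ τ κ γ m p q s z) ≤ xp (K + labelMain ρ σ τ κ γ m p q s) := by
    intro p q
    have := P.σd p q
    have := P.σd q p
    obtain ⟨K, h⟩ := lintegral_xp_two (c₁ := 7 / 10 + (σ p - σ q) / 2)
      (c₂ := 7 / 10 + (σ q - σ p) / 2) (2 / 5 - κ) (by linarith) (by linarith) (by linarith)
      (by linarith)
    refine ⟨K, fun m s => ?_⟩
    refine (h (m p) (m q) ((1 + κ - γ + ρ q + ρ s - τ - σ s) * lg (m q - m s) +
      ρ p * lg (m p - m s) + (7 / 5 - σ p - σ q) * lg (m p - m q)) _ fun z => ?_).trans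
      (xp_mono ?_)
    · unfold labelExpZ
      linarith
    · unfold labelMain
      linarith
  choose K h using this
  refine ⟨∑ p, ∑ q, |K p q|, fun m p q s => (h p q m s).trans (xp_mono ?_)⟩
  have h1 : |K p q| ≤ ∑ q, |K p q| :=
    Finset.single_le_sum (f := fun q => |K p q|) (fun _ _ => abs_nonneg _) (Finset.mem_univ q)
  have h2 : ∑ q, |K p q| ≤ ∑ p, ∑ q, |K p q| :=
    Finset.single_le_sum (f := fun p => ∑ q, |K p q|)
      (fun _ _ => Finset.sum_nonneg fun _ _ => abs_nonneg _) (Finset.mem_univ p)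
  linarith [le_abs_self (K p q)]

/-! ### The inner integrals -/

/-- The exponent of `Γ(1 + s₁ - r₂)` times the integrand of `N_{w_l,2}`, in the imaginary parts. -/
noncomputable def kerExp (wa wb wc p₇ q₇ p₈ q₈ p₉ : ℝ) (u₁ u₂ s₁ s₂ r₁ r₂ t₁ t₂ : ℝ) : ℝ :=
  wa * lg (t₁ + t₂) + wb * lg (s₂ - r₁ - t₁ - t₂) + wc * lg (s₁ - r₂) +
    p₇ * lg (r₁ - 2 * s₂ + t₂ + u₂) + q₇ * lg (u₁ - u₂ - r₁ - t₂) +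
    p₈ * lg (r₂ - 2 * s₁ - t₂ + u₁) + q₈ * lg (r₁ - r₂ + t₂ - u₁) + p₉ * lg (2 * t₁ + t₂)

lemma lg_sub_half_le (x a : ℝ) : lg (x - a / 2) ≤ lg (2 * x - a) := by
  have := lg_le_lg_two_mul (x - a / 2)
  rwa [show 2 * (x - a / 2) = 2 * x - a by ring] at this

lemma lg_congr_neg {a b : ℝ} (h : a = -b) : lg a = lg b := by rw [h, lg_neg]

/-- The inner exponent on the lines of the terms with integrals over `u`. -/
noncomputable def innerA (ε u₁ u₂ s₁ s₂ r₁ r₂ t₁ t₂ : ℝ) : ℝ :=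
  -((1 / 2 - ε) * lg t₁ + (1 / 2 - ε) * lg (s₁ - u₁ - t₁) + (1 / 2 - 2 * ε) * lg (s₂ - u₂) +
    kerExp (1 / 2 - 2 * ε) (1 / 2 - ε) (101 * ε) (4 * ε) (1 / 2 - 4 * ε) (1 / 2 - 50 * ε)
      (50 * ε) (1 / 2) u₁ u₂ s₁ s₂ r₁ r₂ t₁ t₂)

/-- In each of the four integrations the degree left after the exchange is 1 + ε. The two remaining
decays of 45ε tie r₂ to u₁ and r₁ to r₂ + u₁; they are what the later integrals over r and u
consume. -/
lemma lintegral_innerA {ε : ℝ} (h0 : 0 < ε) (h1 : ε ≤ 1 / 100000) :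
    ∃ K : ℝ, ∀ u₁ u₂ r₁ r₂ : ℝ,
      ∫⁻ t₂, ∫⁻ t₁, ∫⁻ s₂, ∫⁻ s₁, xp (innerA ε u₁ u₂ s₁ s₂ r₁ r₂ t₁ t₂) ≤
        xp (K - 45 * ε * lg (r₂ - u₁) - 45 * ε * lg (r₁ - (r₂ + u₁))) := by
  obtain ⟨K₁, k₁⟩ := lintegral_xp_three (c₁ := 1 / 2 - ε) (c₂ := 101 * ε) (c₃ := 1 / 2 - 50 * ε)
    (49 * ε) 0 0 (by linarith) le_rfl le_rfl (by linarith) (by linarith) (by linarith)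
    (by linarith)
  obtain ⟨K₂, k₂⟩ := lintegral_xp_three (c₁ := 1 / 2 - 2 * ε) (c₂ := 1 / 2 - ε) (c₃ := 4 * ε)
    0 0 0 le_rfl le_rfl le_rfl (by linarith) (by linarith) (by linarith) (by linarith)
  -- The centres 0, -t₂ and -t₂/2 have all their mutual distances comparable with t₂, so three
  -- exchanges of 1/6 yield the decay 1/2 in t₂; 45ε of the gain in s₁ passes to r₂ - u₁.
  obtain ⟨K₃, k₃⟩ := lintegral_xp_four (c₁ := 1 / 2 - ε) (c₂ := 49 * ε) (c₃ := 1 / 2 - 2 * ε)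
    (c₄ := 1 / 2) (45 * ε) (1 / 6) (1 / 6) 0 0 (1 / 6) (by linarith) (by norm_num) (by norm_num)
    le_rfl le_rfl (by norm_num) (by linarith) (by linarith) (by linarith) (by linarith)
    (by linarith)
  obtain ⟨K₄, k₄⟩ := lintegral_xp_three (c₁ := 1 / 2) (c₂ := 1 / 2 - 4 * ε) (c₃ := 50 * ε)
    0 (45 * ε) 0 le_rfl (by linarith) le_rfl (by linarith) (by linarith) (by linarith)
    (by linarith)
  refine ⟨K₁ + K₂ + K₃ + K₄ + Real.log 2, fun u₁ u₂ r₁ r₂ => ?_⟩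
  refine (lintegral_mono fun t₂ => lintegral_mono fun t₁ => lintegral_mono fun s₂ =>
    k₁ (u₁ + t₁) r₂ ((r₂ + u₁ - t₂) / 2) (-((1 / 2 - ε) * lg t₁ +
      (1 / 2 - 2 * ε) * lg (s₂ - u₂) + (1 / 2 - 2 * ε) * lg (t₁ + t₂) +
      (1 / 2 - ε) * lg (s₂ - r₁ - t₁ - t₂) + 4 * ε * lg (r₁ - 2 * s₂ + t₂ + u₂) +
      (1 / 2 - 4 * ε) * lg (u₁ - u₂ - r₁ - t₂) + 50 * ε * lg (r₁ - r₂ + t₂ - u₁) +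
      1 / 2 * lg (2 * t₁ + t₂))) _ fun s₁ => ?_).trans ?_
  · have e1 : lg (r₂ - 2 * s₁ - t₂ + u₁) = lg (2 * s₁ - (r₂ + u₁ - t₂)) :=
      lg_congr_neg (by ring)
    have e2 := mul_le_mul_of_nonneg_left (lg_sub_half_le s₁ (r₂ + u₁ - t₂))
      (by linarith : 0 ≤ 1 / 2 - 50 * ε)
    rw [innerA, kerExp, e1, sub_sub s₁ u₁ t₁]
    linarith
  refine (lintegral_mono fun t₂ => lintegral_mono fun t₁ =>
    k₂ u₂ (r₁ + t₁ + t₂) ((r₁ + t₂ + u₂) / 2) (K₁ - ((1 / 2 - ε) * lg t₁ +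
      (1 / 2 - 2 * ε) * lg (t₁ + t₂) + (1 / 2 - 4 * ε) * lg (u₁ - u₂ - r₁ - t₂) +
      50 * ε * lg (r₁ - r₂ + t₂ - u₁) + 1 / 2 * lg (2 * t₁ + t₂) +
      49 * ε * lg (u₁ + t₁ - r₂))) _ fun s₂ => ?_).trans ?_
  · have e1 : lg (r₁ - 2 * s₂ + t₂ + u₂) = lg (2 * s₂ - (r₁ + t₂ + u₂)) :=
      lg_congr_neg (by ring)
    have e2 := mul_le_mul_of_nonneg_left (lg_sub_half_le s₂ (r₁ + t₂ + u₂))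
      (by linarith : 0 ≤ 4 * ε)
    rw [e1, show s₂ - r₁ - t₁ - t₂ = s₂ - (r₁ + t₁ + t₂) by ring]
    linarith
  refine (lintegral_mono fun t₂ => k₃ 0 (r₂ - u₁) (-t₂) (-t₂ / 2) (K₁ + K₂ -
      ((1 / 2 - 4 * ε) * lg (u₁ - u₂ - r₁ - t₂) + 50 * ε * lg (r₁ - r₂ + t₂ - u₁))) _
      fun t₁ => ?_).trans ?_
  · have e2 := lg_sub_half_le t₁ (-t₂)
    rw [sub_neg_eq_add] at e2
    rw [sub_zero, sub_neg_eq_add, show t₁ - (r₂ - u₁) = u₁ + t₁ - r₂ by ring]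
    linarith
  refine (k₄ 0 (u₁ - u₂ - r₁) (r₂ + u₁ - r₁)
    (K₁ + K₂ + K₃ + Real.log 2 - 45 * ε * lg (r₂ - u₁)) _ fun t₂ => ?_).trans (xp_mono ?_)
  · have e1 : lg (u₁ - u₂ - r₁ - t₂) = lg (t₂ - (u₁ - u₂ - r₁)) := lg_congr_neg (by ring)
    have e2 : lg (0 - (r₂ - u₁)) = lg (r₂ - u₁) := lg_congr_neg (by ring)
    have e3 : lg (0 - -t₂ / 2) = lg (t₂ / 2) := by congr 1; ring
    have e4 : lg (-t₂ - -t₂ / 2) = lg (t₂ / 2) := lg_congr_neg (by ring)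
    have e5 : lg (0 - -t₂) = lg t₂ := by congr 1; ring
    have := lg_le_lg_half t₂
    have l2 : 0 < Real.log 2 := Real.log_pos one_lt_two
    rw [e1, e2, e3, e4, e5, sub_zero, show r₁ - r₂ + t₂ - u₁ = t₂ - (r₂ + u₁ - r₁) by ring]
    linarith
  · rw [show lg (0 - (r₂ + u₁ - r₁)) = lg (r₁ - (r₂ + u₁)) by congr 1; ring]
    linarith

end

/-! ### Inner integrals on the contours of the double-residue terms. -/

section

/-- The inner exponent when `s₂ = u₂`. -/
noncomputable def innerB (ε u₁ u₂ s₁ r₁ r₂ t₁ t₂ : ℝ) : ℝ :=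
  -((1 / 2 - ε) * lg t₁ + (1 + ε) * lg (s₁ - u₁ - t₁) +
    kerExp 0 (1 / 2 - ε) (101 * ε) 0 (1 / 2 - ε) 0 (1 / 4) (1 / 2) u₁ u₂ s₁ u₂ r₁ r₂ t₁ t₂)

/-- Γ(s₁ - u₁ - t₁) alone makes the s₁-integral converge, so the whole 101ε of the weight in s₁ - r₂
becomes decay in u₁ + t₁ - r₂. The t₁-integration hands 95ε of it on to r₂ - u₁. -/
lemma lintegral_innerB {ε : ℝ} (h0 : 0 < ε) (h1 : ε ≤ 1 / 100000) :
    ∃ K : ℝ, ∀ u₁ u₂ r₁ r₂ : ℝ,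
      ∫⁻ t₂, ∫⁻ t₁, ∫⁻ s₁, xp (innerB ε u₁ u₂ s₁ r₁ r₂ t₁ t₂) ≤
        xp (K - 95 * ε * lg (r₂ - u₁)) := by
  obtain ⟨K₁, k₁⟩ := lintegral_xp_two (c₁ := 1 + ε) (c₂ := 101 * ε) (101 * ε) (by linarith)
    (by linarith) (by linarith) (by linarith)
  obtain ⟨K₃, k₃⟩ := lintegral_xp_four (c₁ := 1 / 2 - ε) (c₂ := 101 * ε) (c₃ := 1 / 2 - ε)
    (c₄ := 1 / 2) (95 * ε) (1 / 5) (1 / 5) 0 0 0 (by linarith) (by norm_num) (by norm_num)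
    le_rfl le_rfl le_rfl (by linarith) (by linarith) (by linarith) (by linarith) (by linarith)
  obtain ⟨K₄, k₄⟩ := lintegral_xp_four (c₁ := 1 / 5) (c₂ := 1 / 5) (c₃ := 1 / 2 - ε)
    (c₄ := 1 / 4) 0 0 0 0 0 0 le_rfl le_rfl le_rfl le_rfl le_rfl le_rfl (by linarith)
    (by linarith) (by linarith) (by linarith) (by linarith)
  refine ⟨K₁ + K₃ + K₄ + Real.log 2, fun u₁ u₂ r₁ r₂ => ?_⟩
  refine (lintegral_mono fun t₂ => lintegral_mono fun t₁ =>
    k₁ (u₁ + t₁) r₂ (-((1 / 2 - ε) * lg t₁ + (1 / 2 - ε) * lg (u₂ - r₁ - t₁ - t₂) +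
      (1 / 2 - ε) * lg (u₁ - u₂ - r₁ - t₂) + 1 / 4 * lg (r₁ - r₂ + t₂ - u₁) +
      1 / 2 * lg (2 * t₁ + t₂))) _ fun s₁ => ?_).trans ?_
  · rw [innerB, kerExp, sub_sub s₁ u₁ t₁]
    linarith
  refine (lintegral_mono fun t₂ => k₃ 0 (r₂ - u₁) (u₂ - r₁ - t₂) (-t₂ / 2) (K₁ -
      ((1 / 2 - ε) * lg (u₁ - u₂ - r₁ - t₂) + 1 / 4 * lg (r₁ - r₂ + t₂ - u₁))) _
      fun t₁ => ?_).trans ?_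
  · have e2 := lg_sub_half_le t₁ (-t₂)
    rw [sub_neg_eq_add] at e2
    rw [sub_zero, show t₁ - (r₂ - u₁) = u₁ + t₁ - r₂ by ring,
      show lg (u₂ - r₁ - t₁ - t₂) = lg (t₁ - (u₂ - r₁ - t₂)) from lg_congr_neg (by ring)]
    linarith
  refine (k₄ 0 (u₂ - r₁) (u₁ - u₂ - r₁) (r₂ + u₁ - r₁)
    (K₁ + K₃ + Real.log 2 - 95 * ε * lg (r₂ - u₁)) _ fun t₂ => ?_).trans (xp_mono (by linarith))
  have e1 : lg (u₁ - u₂ - r₁ - t₂) = lg (t₂ - (u₁ - u₂ - r₁)) := lg_congr_neg (by ring)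
  have e2 : lg (0 - (r₂ - u₁)) = lg (r₂ - u₁) := lg_congr_neg (by ring)
  have e3 : lg (0 - -t₂ / 2) = lg (t₂ / 2) := by congr 1; ring
  have e5 : lg (0 - (u₂ - r₁ - t₂)) = lg (t₂ - (u₂ - r₁)) := by congr 1; ring
  have := lg_le_lg_half t₂
  have l2 : 0 < Real.log 2 := Real.log_pos one_lt_two
  rw [e1, e2, e3, e5, sub_zero, show r₁ - r₂ + t₂ - u₁ = t₂ - (r₂ + u₁ - r₁) by ring]
  linarith

/-- The inner exponent when `s₁ = u₁ + t₁`. -/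
noncomputable def innerC (u₁ u₂ s₂ r₁ r₂ t₁ t₂ : ℝ) : ℝ :=
  -(2 / 5 * lg t₁ + lg (s₂ - u₂) +
    kerExp 0 (23 / 50) 0 0 (1 / 2) (9 / 20) 0 (1 / 2) u₁ u₂ (u₁ + t₁) s₂ r₁ r₂ t₁ t₂)

/-- Γ(t₁) contributes only the degree 2/5, so t₂ is integrated before t₁: its surplus 2/5 + 3/10
becomes the missing decay in t₁. -/
lemma lintegral_innerC : ∃ K : ℝ, ∀ u₁ u₂ r₁ r₂ : ℝ,
    ∫⁻ t₁, ∫⁻ t₂, ∫⁻ s₂, xp (innerC u₁ u₂ s₂ r₁ r₂ t₁ t₂) ≤ xp K := by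
  obtain ⟨K₁, k₁⟩ := lintegral_xp_two (c₁ := 1) (c₂ := 23 / 50) (9 / 20) (by norm_num)
    (by norm_num) (by norm_num) (by norm_num)
  obtain ⟨K₃, k₃⟩ := lintegral_xp_four (c₁ := 9 / 20) (c₂ := 1 / 2) (c₃ := 1 / 2)
    (c₄ := 9 / 20) (2 / 5) 0 0 0 0 (3 / 10) (by norm_num) le_rfl le_rfl le_rfl le_rfl
    (by norm_num) (by norm_num) (by norm_num) (by norm_num) (by norm_num) (by norm_num)
  obtain ⟨K₄, k₄⟩ := lintegral_xp_three (c₁ := 2 / 5) (c₂ := 2 / 5) (c₃ := 3 / 10)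
    0 0 0 le_rfl le_rfl le_rfl (by norm_num) (by norm_num) (by norm_num) (by norm_num)
  refine ⟨K₁ + K₃ + K₄, fun u₁ u₂ r₁ r₂ => ?_⟩
  refine (lintegral_mono fun t₁ => lintegral_mono fun t₂ =>
    k₁ u₂ (r₁ + t₁ + t₂) (-(2 / 5 * lg t₁ + 1 / 2 * lg (u₁ - u₂ - r₁ - t₂) +
      9 / 20 * lg (r₂ - 2 * (u₁ + t₁) - t₂ + u₁) + 1 / 2 * lg (2 * t₁ + t₂))) _
      fun s₂ => ?_).trans ?_
  · rw [innerC, kerExp, show s₂ - r₁ - t₁ - t₂ = s₂ - (r₁ + t₁ + t₂) by ring]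
    linarith
  refine (lintegral_mono fun t₁ => k₃ (u₂ - r₁ - t₁) (-(2 * t₁)) (u₁ - u₂ - r₁)
    (r₂ - u₁ - 2 * t₁) (K₁ - 2 / 5 * lg t₁) _ fun t₂ => ?_).trans ?_
  · rw [show lg (u₁ - u₂ - r₁ - t₂) = lg (t₂ - (u₁ - u₂ - r₁)) from lg_congr_neg (by ring),
      show lg (r₂ - 2 * (u₁ + t₁) - t₂ + u₁) = lg (t₂ - (r₂ - u₁ - 2 * t₁)) from
        lg_congr_neg (by ring), show 2 * t₁ + t₂ = t₂ - -(2 * t₁) by ring,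
      show lg (u₂ - (r₁ + t₁ + t₂)) = lg (t₂ - (u₂ - r₁ - t₁)) from lg_congr_neg (by ring)]
    linarith
  refine (k₄ 0 (r₁ - u₂) ((r₁ + r₂ + u₂ - 2 * u₁) / 2) (K₁ + K₃) _ fun t₁ => ?_).trans
    (xp_mono (by linarith))
  have e2 := lg_sub_half_le t₁ (r₁ + r₂ + u₂ - 2 * u₁)
  rw [sub_zero, show u₂ - r₁ - t₁ - -(2 * t₁) = t₁ - (r₁ - u₂) by ring,
    show u₁ - u₂ - r₁ - (r₂ - u₁ - 2 * t₁) = 2 * t₁ - (r₁ + r₂ + u₂ - 2 * u₁) by ring]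
  linarith

/-- The inner exponent for residual contours in `u` only. -/
noncomputable def innerD (ε u₁ u₂ s₁ s₂ r₁ r₂ t₁ t₂ : ℝ) : ℝ :=
  -((1 / 2 - ε) * lg t₁ + (1 + ε) * lg (s₁ - u₁ - t₁) + lg (s₂ - u₂) +
    kerExp (1 / 2 - 2 * ε) (3 * ε) 0 0 (1 / 2) 0 (1 / 10) (1 / 2) u₁ u₂ s₁ s₂ r₁ r₂ t₁ t₂)

lemma lintegral_innerD {ε : ℝ} (h0 : 0 < ε) (h1 : ε ≤ 1 / 100000) :
    ∃ K : ℝ, ∀ u₁ u₂ r₁ r₂ : ℝ,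
      ∫⁻ t₂, ∫⁻ t₁, ∫⁻ s₂, ∫⁻ s₁, xp (innerD ε u₁ u₂ s₁ s₂ r₁ r₂ t₁ t₂) ≤ xp K := by
  obtain ⟨K₁, k₁⟩ := lintegral_xp_two (c₁ := 1 + ε) (c₂ := 0) 0 le_rfl (by linarith) (by linarith)
    (by linarith)
  obtain ⟨K₂, k₂⟩ := lintegral_xp_two (c₁ := 1) (c₂ := 3 * ε) 0 le_rfl (by linarith) (by linarith)
    (by linarith)
  obtain ⟨K₃, k₃⟩ := lintegral_xp_three (c₁ := 1 / 2 - ε) (c₂ := 1 / 2 - 2 * ε) (c₃ := 1 / 2)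
    (1 / 2 - 4 * ε) 0 0 (by linarith) le_rfl le_rfl (by linarith) (by linarith) (by linarith)
    (by linarith)
  obtain ⟨K₄, k₄⟩ := lintegral_xp_three (c₁ := 1 / 2 - 4 * ε) (c₂ := 1 / 2) (c₃ := 1 / 10)
    0 0 0 le_rfl le_rfl le_rfl (by linarith) (by linarith) (by linarith) (by linarith)
  refine ⟨K₁ + K₂ + K₃ + K₄, fun u₁ u₂ r₁ r₂ => ?_⟩
  refine (lintegral_mono fun t₂ => lintegral_mono fun t₁ => lintegral_mono fun s₂ =>
    k₁ (u₁ + t₁) 0 (-((1 / 2 - ε) * lg t₁ + lg (s₂ - u₂) + (1 / 2 - 2 * ε) * lg (t₁ + t₂) +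
      3 * ε * lg (s₂ - r₁ - t₁ - t₂) + 1 / 2 * lg (u₁ - u₂ - r₁ - t₂) +
      1 / 10 * lg (r₁ - r₂ + t₂ - u₁) + 1 / 2 * lg (2 * t₁ + t₂))) _ fun s₁ => ?_).trans ?_
  · rw [innerD, kerExp, sub_sub s₁ u₁ t₁]
    linarith
  refine (lintegral_mono fun t₂ => lintegral_mono fun t₁ =>
    k₂ u₂ (r₁ + t₁ + t₂) (K₁ - ((1 / 2 - ε) * lg t₁ + (1 / 2 - 2 * ε) * lg (t₁ + t₂) +
      1 / 2 * lg (u₁ - u₂ - r₁ - t₂) + 1 / 10 * lg (r₁ - r₂ + t₂ - u₁) +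
      1 / 2 * lg (2 * t₁ + t₂))) _ fun s₂ => ?_).trans ?_
  · rw [show s₂ - r₁ - t₁ - t₂ = s₂ - (r₁ + t₁ + t₂) by ring]
    linarith
  refine (lintegral_mono fun t₂ => k₃ 0 (-t₂) (-t₂ / 2) (K₁ + K₂ -
      (1 / 2 * lg (u₁ - u₂ - r₁ - t₂) + 1 / 10 * lg (r₁ - r₂ + t₂ - u₁))) _
      fun t₁ => ?_).trans ?_
  · have e2 := lg_sub_half_le t₁ (-t₂)
    rw [sub_neg_eq_add] at e2
    rw [sub_zero, sub_neg_eq_add]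
    linarith
  refine (k₄ 0 (u₁ - u₂ - r₁) (r₂ + u₁ - r₁) (K₁ + K₂ + K₃) _ fun t₂ => ?_).trans
    (xp_mono (by linarith))
  have e1 : lg (u₁ - u₂ - r₁ - t₂) = lg (t₂ - (u₁ - u₂ - r₁)) := lg_congr_neg (by ring)
  have e5 : lg (0 - -t₂) = lg t₂ := by congr 1; ring
  rw [e1, e5, sub_zero, show r₁ - r₂ + t₂ - u₁ = t₂ - (r₂ + u₁ - r₁) by ring]
  linarith

/-- The inner exponent when `s₁ = u₁ + t₁` and `s₂ = u₂`. -/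
noncomputable def innerE (u₁ u₂ r₁ r₂ t₁ t₂ : ℝ) : ℝ :=
  -(9 / 10 * lg t₁ +
    kerExp 0 (2 / 5) 0 0 (1 / 2) 0 0 (1 / 2) u₁ u₂ (u₁ + t₁) u₂ r₁ r₂ t₁ t₂)

lemma lintegral_innerE : ∃ K : ℝ, ∀ u₁ u₂ r₁ r₂ : ℝ,
    ∫⁻ t₂, ∫⁻ t₁, xp (innerE u₁ u₂ r₁ r₂ t₁ t₂) ≤ xp K := by
  obtain ⟨K₃, k₃⟩ := lintegral_xp_three (c₁ := 9 / 10) (c₂ := 2 / 5) (c₃ := 1 / 2)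
    (3 / 10) (3 / 10) 0 (by norm_num) (by norm_num) le_rfl (by norm_num) (by norm_num)
    (by norm_num) (by norm_num)
  obtain ⟨K₄, k₄⟩ := lintegral_xp_three (c₁ := 3 / 10) (c₂ := 3 / 10) (c₃ := 1 / 2)
    0 0 0 le_rfl le_rfl le_rfl (by norm_num) (by norm_num) (by norm_num) (by norm_num)
  refine ⟨K₃ + K₄ + Real.log 2, fun u₁ u₂ r₁ r₂ => ?_⟩
  refine (lintegral_mono fun t₂ => k₃ 0 (u₂ - r₁ - t₂) (-t₂ / 2)
    (-(1 / 2 * lg (u₁ - u₂ - r₁ - t₂))) _ fun t₁ => ?_).trans ?_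
  · have e2 := lg_sub_half_le t₁ (-t₂)
    rw [sub_neg_eq_add] at e2
    rw [innerE, kerExp, sub_zero,
      show lg (u₂ - r₁ - t₁ - t₂) = lg (t₁ - (u₂ - r₁ - t₂)) from lg_congr_neg (by ring)]
    linarith
  refine (k₄ 0 (u₂ - r₁) (u₁ - u₂ - r₁) (K₃ + Real.log 2) _ fun t₂ => ?_).trans
    (xp_mono (by linarith))
  have e1 : lg (u₁ - u₂ - r₁ - t₂) = lg (t₂ - (u₁ - u₂ - r₁)) := lg_congr_neg (by ring)
  have e3 : lg (0 - -t₂ / 2) = lg (t₂ / 2) := by congr 1; ring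
  have e5 : lg (0 - (u₂ - r₁ - t₂)) = lg (t₂ - (u₂ - r₁)) := by congr 1; ring
  have := lg_le_lg_half t₂
  have l2 : 0 < Real.log 2 := Real.log_pos one_lt_two
  rw [e1, e3, e5, sub_zero]
  linarith

end

section

/-! ## Bounds for the kernels -/

@[simp] lemma pt_re (c τ : ℝ) : (pt c τ).re = c := by simp [pt]

@[simp] lemma pt_im (c τ : ℝ) : (pt c τ).im = τ := by simp [pt]

lemma norm_kerN2_le_kerExp {δ : ℝ} (hδ : 0 < δ) : ∃ K : ℝ, ∀ v u s r : ℂ × ℂ, ∀ t₁ t₂ : ℂ,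
    ∀ wa wb wc p₇ q₇ p₈ q₈ p₉ : ℝ, IsSigns v →
    gammaRange δ (t₁ + t₂).re → wa ≤ 1 / 2 - (t₁ + t₂).re →
    gammaRange δ (1 - r.1 + s.2 - t₁ - t₂).re → wb ≤ 1 / 2 - (1 - r.1 + s.2 - t₁ - t₂).re →
    gammaRange δ (1 + s.1 - r.2).re → wc ≤ 1 / 2 - (1 + s.1 - r.2).re →
    BetaRange δ (r.1 - 2 * s.2 + t₂ + u.2) (1 - r.1 - t₂ + u.1 - u.2) p₇ q₇ →
    BetaRange δ (r.2 - 2 * s.1 - t₂ + u.1) (r.1 - r.2 + t₂ - u.1) p₈ q₈ →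
    BetaRange δ (1 - 2 * t₁ - t₂) (1 - r.1 - u.1) p₉ 0 →
    ‖kerN2 v u s r t₁ t₂ * Gamma (1 + s.1 - r.2)‖ ≤ Real.exp (K +
      Real.pi / 2 * (|t₁.im| + |(s.2 - u.2).im| + |(s.1 - u.1 - t₁).im|) -
      kerExp wa wb wc p₇ q₇ p₈ q₈ p₉ u.1.im u.2.im s.1.im s.2.im r.1.im r.2.im t₁.im t₂.im) := by
  obtain ⟨K, h⟩ := norm_kerN2_le hδ
  refine ⟨K, fun v u s r t₁ t₂ wa wb wc p₇ q₇ p₈ q₈ p₉ hv ra ha rb hb rc hc β₇ β₈ β₉ => ?_⟩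
  refine (h v u s r t₁ t₂ wa wb wc p₇ q₇ p₈ q₈ p₉ 0 hv ra ha rb hb rc hc β₇ β₈ β₉).trans
    (Real.exp_le_exp.2 (le_of_eq ?_))
  have e1 : (t₁ + t₂).im = t₁.im + t₂.im := by simp
  have e2 : (1 - r.1 + s.2 - t₁ - t₂).im = s.2.im - r.1.im - t₁.im - t₂.im := by simp; ring
  have e3 : (1 + s.1 - r.2).im = s.1.im - r.2.im := by simp
  have e4 : (r.1 - 2 * s.2 + t₂ + u.2).im = r.1.im - 2 * s.2.im + t₂.im + u.2.im := by simp
  have e5 : (1 - r.1 - t₂ + u.1 - u.2).im = u.1.im - u.2.im - r.1.im - t₂.im := by simp; ring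
  have e6 : (r.2 - 2 * s.1 - t₂ + u.1).im = r.2.im - 2 * s.1.im - t₂.im + u.1.im := by simp
  have e7 : (r.1 - r.2 + t₂ - u.1).im = r.1.im - r.2.im + t₂.im - u.1.im := by simp
  have e8 : lg (1 - 2 * t₁ - t₂).im = lg (2 * t₁.im + t₂.im) :=
    lg_congr_neg (by simp; ring)
  rw [e1, e2, e3, e4, e5, e6, e7, e8, kerExp]
  ring

/-- The three gamma factors outside `kerN2` cancel exactly the exponential growth that its bound
still carries. What remains is to read off the real parts on these lines. -/
lemma norm_kerA_le {ε : ℝ} (h0 : 0 < ε) (h1 : ε ≤ 1 / 100000) : ∃ K : ℝ,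
    ∀ v u s r : ℂ × ℂ, ∀ t₁ t₂ : ℂ, IsSigns v → u.1.re = -(1 / 2) - 3 * ε →
    u.2.re = -(1 / 2) - 3 * ε → s.1.re = -(1 / 2) - ε → s.2.re = -(1 / 2) - ε →
    r.1.re = 1 / 2 - 4 * ε → r.2.re = 100 * ε → t₁.re = ε → t₂.re = ε →
    ‖kerN2 v u s r t₁ t₂ * Gamma (1 + s.1 - r.2) * Gamma t₁ * Gamma (s.1 - u.1 - t₁) *
      Gamma (s.2 - u.2)‖ ≤
    Real.exp (K + innerA ε u.1.im u.2.im s.1.im s.2.im r.1.im r.2.im t₁.im t₂.im) := by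
  obtain ⟨K₁, h₁⟩ := norm_kerN2_le_kerExp (δ := ε / 2) (by linarith)
  obtain ⟨K₂, h₂⟩ := norm_Gamma_le_exp (δ := ε / 2) (by linarith)
  refine ⟨K₁ + 3 * K₂, fun v u s r t₁ t₂ hv hu1 hu2 hs1 hs2 hr1 hr2 ht1 ht2 => ?_⟩
  have a0 := h₁ v u s r t₁ t₂ (1 / 2 - 2 * ε) (1 / 2 - ε) (101 * ε) (4 * ε) (1 / 2 - 4 * ε)
    (1 / 2 - 50 * ε) (50 * ε) (1 / 2) hv
    (Or.inl (by simp only [add_re, ht1, ht2]; constructor <;> linarith))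
    (by simp only [add_re, ht1, ht2]; linarith)
    (Or.inl (by simp [ht1, ht2, hs2, hr1]; constructor <;> linarith))
    (by simp [ht1, ht2, hs2, hr1]; linarith)
    (Or.inl (by simp [hs1, hr2]; constructor <;> linarith))
    (by simp [hs1, hr2]; linarith)
    (by refine ⟨?_, ?_, ?_, ?_, ?_, ?_, ?_⟩ <;> simp [hr1, hs2, ht2, hu1, hu2] <;> linarith)
    (by refine ⟨?_, ?_, ?_, ?_, ?_, ?_, ?_⟩ <;> simp [hr1, hr2, hs1, ht2, hu1] <;> linarith)
    (by refine ⟨?_, ?_, ?_, ?_, ?_, ?_, ?_⟩ <;> simp [hr1, hu1, ht1, ht2] <;> linarith)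
  have a1 := h₂ t₁ (1 / 2 - ε) (Or.inl (by rw [ht1]; constructor <;> linarith))
    (by rw [ht1])
  have a2 := h₂ (s.1 - u.1 - t₁) (1 / 2 - ε)
    (Or.inl (by simp [ht1, hs1, hu1]; constructor <;> linarith)) (by simp [ht1, hs1, hu1]; linarith)
  have a3 := h₂ (s.2 - u.2) (1 / 2 - 2 * ε)
    (Or.inl (by simp [hs2, hu2]; constructor <;> linarith)) (by simp [hs2, hu2]; linarith)
  rw [norm_mul, norm_mul, norm_mul]
  calc _ ≤ Real.exp _ * Real.exp _ * Real.exp _ * Real.exp _ := by gcongr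
    _ = Real.exp _ := by rw [← Real.exp_add, ← Real.exp_add, ← Real.exp_add]
    _ ≤ _ := by
      apply Real.exp_le_exp.2
      have e1 : (s.1 - u.1 - t₁).im = s.1.im - u.1.im - t₁.im := by simp
      have e2 : (s.2 - u.2).im = s.2.im - u.2.im := by simp
      rw [innerA, e1, e2]
      linarith

/-- With s₂ = u₂ the growth in s₂ - u₂ disappears together with the factor Γ(s₂ - u₂). The argument
of Γ(s₁ - u₁ - t₁) now lies to the left of the pole 0. -/
lemma norm_kerB_le {ε : ℝ} (h0 : 0 < ε) (h1 : ε ≤ 1 / 100000) : ∃ K : ℝ,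
    ∀ v u s r : ℂ × ℂ, ∀ t₁ t₂ : ℂ, IsSigns v → s.2 = u.2 → u.1.re = -ε →
    u.2.re = -(1 / 2) - 3 * ε → s.1.re = -(1 / 2) - ε → r.1.re = -4 * ε → r.2.re = 100 * ε →
    t₁.re = ε → t₂.re = 1 / 2 - ε →
    ‖kerN2 v u s r t₁ t₂ * Gamma (1 + s.1 - r.2) * Gamma t₁ * Gamma (s.1 - u.1 - t₁)‖ ≤
    Real.exp (K + innerB ε u.1.im u.2.im s.1.im r.1.im r.2.im t₁.im t₂.im) := by
  obtain ⟨K₁, h₁⟩ := norm_kerN2_le_kerExp (δ := ε / 2) (by linarith)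
  obtain ⟨K₂, h₂⟩ := norm_Gamma_le_exp (δ := ε / 2) (by linarith)
  refine ⟨K₁ + 2 * K₂, fun v u s r t₁ t₂ hv hs2 hu1 hu2 hs1 hr1 hr2 ht1 ht2 => ?_⟩
  have a0 := h₁ v u s r t₁ t₂ 0 (1 / 2 - ε) (101 * ε) 0 (1 / 2 - ε) 0 (1 / 4) (1 / 2) hv
    (Or.inl (by simp only [add_re, ht1, ht2]; constructor <;> linarith))
    (by simp only [add_re, ht1, ht2]; linarith)
    (Or.inl (by simp [ht1, ht2, hs2, hu2, hr1]; constructor <;> linarith))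
    (by simp [ht1, ht2, hs2, hu2, hr1]; linarith)
    (Or.inl (by simp [hs1, hr2]; constructor <;> linarith))
    (by simp [hs1, hr2]; linarith)
    (by refine ⟨?_, ?_, ?_, ?_, ?_, ?_, ?_⟩ <;> simp [hr1, hs2, ht2, hu1, hu2] <;> linarith)
    (by refine ⟨?_, ?_, ?_, ?_, ?_, ?_, ?_⟩ <;> simp [hr1, hr2, hs1, ht2, hu1] <;> linarith)
    (by refine ⟨?_, ?_, ?_, ?_, ?_, ?_, ?_⟩ <;> simp [hr1, hu1, ht1, ht2] <;> linarith)
  have a1 := h₂ t₁ (1 / 2 - ε) (Or.inl (by rw [ht1]; constructor <;> linarith))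
    (by rw [ht1])
  have a2 := h₂ (s.1 - u.1 - t₁) (1 + ε)
    (Or.inr (by simp [ht1, hs1, hu1]; constructor <;> linarith)) (by simp [ht1, hs1, hu1]; linarith)
  rw [norm_mul, norm_mul]
  calc _ ≤ Real.exp _ * Real.exp _ * Real.exp _ := by gcongr
    _ = Real.exp _ := by rw [← Real.exp_add, ← Real.exp_add]
    _ ≤ _ := by
      apply Real.exp_le_exp.2
      have e1 : (s.1 - u.1 - t₁).im = s.1.im - u.1.im - t₁.im := by simp
      rw [innerB, e1, hs2, sub_self, zero_im, abs_zero]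
      linarith

/-- With s₁ = u₁ + t₁ neither Γ(s₁ - u₁ - t₁) nor its growth is present. Re t₁ ranges over an
interval so that the line of t₁ can be moved from 6ε to 2ε. -/
lemma norm_kerC_le {ε : ℝ} (h0 : 0 < ε) (h1 : ε ≤ 1 / 100000) : ∃ K : ℝ,
    ∀ v u s r : ℂ × ℂ, ∀ t₁ t₂ : ℂ, IsSigns v → s.1 = u.1 + t₁ → u.1.re = -(1 / 2) - 3 * ε →
    u.2.re = -ε → s.2.re = -(1 / 2) - ε → r.1.re = -3 * ε → r.2.re = 7 * ε →
    2 * ε ≤ t₁.re → t₁.re ≤ 6 * ε → t₂.re = 1 / 2 - 6 * ε →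
    ‖kerN2 v u s r t₁ t₂ * Gamma (1 + s.1 - r.2) * Gamma t₁ * Gamma (s.2 - u.2)‖ ≤
    Real.exp (K + innerC u.1.im u.2.im s.2.im r.1.im r.2.im t₁.im t₂.im) := by
  obtain ⟨K₁, h₁⟩ := norm_kerN2_le_kerExp (δ := ε / 2) (by linarith)
  obtain ⟨K₂, h₂⟩ := norm_Gamma_le_exp (δ := ε / 2) (by linarith)
  refine ⟨K₁ + 2 * K₂, fun v u s r t₁ t₂ hv hs1 hu1 hu2 hs2 hr1 hr2 ht1 ht1' ht2 => ?_⟩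
  have a0 := h₁ v u s r t₁ t₂ 0 (23 / 50) 0 0 (1 / 2) (9 / 20) 0 (1 / 2) hv
    (Or.inl (by simp only [add_re, ht2]; constructor <;> linarith))
    (by simp only [add_re, ht2]; linarith)
    (Or.inl (by simp [ht2, hs2, hr1]; constructor <;> linarith))
    (by simp [ht2, hs2, hr1]; linarith)
    (Or.inl (by simp [hs1, hr2, hu1]; constructor <;> linarith))
    (by simp [hs1, hr2, hu1]; linarith)
    (by refine ⟨?_, ?_, ?_, ?_, ?_, ?_, ?_⟩ <;> simp [hr1, hs2, ht2, hu1, hu2] <;> linarith)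
    (by refine ⟨?_, ?_, ?_, ?_, ?_, ?_, ?_⟩ <;> simp [hr1, hr2, hs1, ht2, hu1] <;> linarith)
    (by refine ⟨?_, ?_, ?_, ?_, ?_, ?_, ?_⟩ <;> simp [hr1, hu1, ht2] <;> linarith)
  have a1 := h₂ t₁ (2 / 5) (Or.inl (by constructor <;> linarith)) (by linarith)
  have a3 := h₂ (s.2 - u.2) 1
    (Or.inr (by rw [sub_re, hs2, hu2]; constructor <;> linarith)) (by simp [hs2, hu2]; linarith)
  rw [norm_mul, norm_mul]
  calc _ ≤ Real.exp _ * Real.exp _ * Real.exp _ := by gcongr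
    _ = Real.exp _ := by rw [← Real.exp_add, ← Real.exp_add]
    _ ≤ _ := by
      apply Real.exp_le_exp.2
      have e2 : (s.2 - u.2).im = s.2.im - u.2.im := by simp
      have e3 : (s.1 - u.1 - t₁).im = 0 := by rw [hs1]; simp
      have e4 : s.1.im = u.1.im + t₁.im := by rw [hs1]; simp
      rw [innerC, e2, e3, e4, abs_zero]
      linarith

lemma norm_kerD_le {ε : ℝ} (h0 : 0 < ε) (h1 : ε ≤ 1 / 100000) : ∃ K : ℝ,
    ∀ v u s r : ℂ × ℂ, ∀ t₁ t₂ : ℂ, IsSigns v → u.1.re = -ε →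
    u.2.re = -ε → s.1.re = -(1 / 2) - ε → s.2.re = -(1 / 2) - ε →
    r.1.re = 0 → r.2.re = 0 → t₁.re = ε → t₂.re = ε →
    ‖kerN2 v u s r t₁ t₂ * Gamma (1 + s.1 - r.2) * Gamma t₁ * Gamma (s.1 - u.1 - t₁) *
      Gamma (s.2 - u.2)‖ ≤
    Real.exp (K + innerD ε u.1.im u.2.im s.1.im s.2.im r.1.im r.2.im t₁.im t₂.im) := by
  obtain ⟨K₁, h₁⟩ := norm_kerN2_le_kerExp (δ := ε / 2) (by linarith)
  obtain ⟨K₂, h₂⟩ := norm_Gamma_le_exp (δ := ε / 2) (by linarith)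
  refine ⟨K₁ + 3 * K₂, fun v u s r t₁ t₂ hv hu1 hu2 hs1 hs2 hr1 hr2 ht1 ht2 => ?_⟩
  have a0 := h₁ v u s r t₁ t₂ (1 / 2 - 2 * ε) (3 * ε) 0 0 (1 / 2) 0 (1 / 10) (1 / 2) hv
    (Or.inl (by simp only [add_re, ht1, ht2]; constructor <;> linarith))
    (by simp only [add_re, ht1, ht2]; linarith)
    (Or.inl (by simp [ht1, ht2, hs2, hr1]; constructor <;> linarith))
    (by simp [ht1, ht2, hs2, hr1]; linarith)
    (Or.inl (by simp [hs1, hr2]; constructor <;> linarith))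
    (by simp [hs1, hr2]; linarith)
    (by refine ⟨?_, ?_, ?_, ?_, ?_, ?_, ?_⟩ <;> simp [hr1, hs2, ht2, hu1, hu2] <;> linarith)
    (by refine ⟨?_, ?_, ?_, ?_, ?_, ?_, ?_⟩ <;> simp [hr1, hr2, hs1, ht2, hu1] <;> linarith)
    (by refine ⟨?_, ?_, ?_, ?_, ?_, ?_, ?_⟩ <;> simp [hr1, hu1, ht1, ht2] <;> linarith)
  have a1 := h₂ t₁ (1 / 2 - ε) (Or.inl (by rw [ht1]; constructor <;> linarith))
    (by rw [ht1])
  have a2 := h₂ (s.1 - u.1 - t₁) (1 + ε)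
    (Or.inr (by simp [ht1, hs1, hu1]; constructor <;> linarith)) (by simp [ht1, hs1, hu1]; linarith)
  have a3 := h₂ (s.2 - u.2) 1
    (Or.inr (by simp [hs2, hu2]; constructor <;> linarith)) (by simp [hs2, hu2]; linarith)
  rw [norm_mul, norm_mul, norm_mul]
  calc _ ≤ Real.exp _ * Real.exp _ * Real.exp _ * Real.exp _ := by gcongr
    _ = Real.exp _ := by rw [← Real.exp_add, ← Real.exp_add, ← Real.exp_add]
    _ ≤ _ := by
      apply Real.exp_le_exp.2
      have e1 : (s.1 - u.1 - t₁).im = s.1.im - u.1.im - t₁.im := by simp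
      have e2 : (s.2 - u.2).im = s.2.im - u.2.im := by simp
      rw [innerD, e1, e2]
      linarith

/-- Again Re t₁ ranges over an interval, for the move of the line of t₁ from -1/2 + 5ε to -1/2. -/
lemma norm_kerE_le {ε : ℝ} (h0 : 0 < ε) (h1 : ε ≤ 1 / 100000) : ∃ K : ℝ,
    ∀ v u s r : ℂ × ℂ, ∀ t₁ t₂ : ℂ, IsSigns v → s.1 = u.1 + t₁ → s.2 = u.2 → u.1.re = -ε →
    u.2.re = -(1 / 2) - 3 * ε → r.1.re = ε → r.2.re = 4 * ε →
    -(1 / 2) ≤ t₁.re → t₁.re ≤ -(1 / 2) + 5 * ε → t₂.re = 1 - 10 * ε →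
    ‖kerN2 v u s r t₁ t₂ * Gamma (1 + s.1 - r.2) * Gamma t₁‖ ≤
    Real.exp (K + innerE u.1.im u.2.im r.1.im r.2.im t₁.im t₂.im) := by
  obtain ⟨K₁, h₁⟩ := norm_kerN2_le_kerExp (δ := ε / 2) (by linarith)
  obtain ⟨K₂, h₂⟩ := norm_Gamma_le_exp (δ := ε / 2) (by linarith)
  refine ⟨K₁ + K₂, fun v u s r t₁ t₂ hv hs1 hs2 hu1 hu2 hr1 hr2 ht1 ht1' ht2 => ?_⟩
  have a0 := h₁ v u s r t₁ t₂ 0 (2 / 5) 0 0 (1 / 2) 0 0 (1 / 2) hv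
    (Or.inl (by simp only [add_re, ht2]; constructor <;> linarith))
    (by simp only [add_re, ht2]; linarith)
    (Or.inl (by simp [ht2, hs2, hu2, hr1]; constructor <;> linarith))
    (by simp [ht2, hs2, hu2, hr1]; linarith)
    (Or.inl (by simp [hs1, hr2, hu1]; constructor <;> linarith))
    (by simp [hs1, hr2, hu1]; linarith)
    (by refine ⟨?_, ?_, ?_, ?_, ?_, ?_, ?_⟩ <;> simp [hr1, hs2, ht2, hu1, hu2] <;> linarith)
    (by refine ⟨?_, ?_, ?_, ?_, ?_, ?_, ?_⟩ <;> simp [hr1, hr2, hs1, ht2, hu1] <;> linarith)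
    (by refine ⟨?_, ?_, ?_, ?_, ?_, ?_, ?_⟩ <;> simp [hr1, hu1, ht2] <;> linarith)
  have a1 := h₂ t₁ (9 / 10) (Or.inr (by constructor <;> linarith)) (by linarith)
  rw [norm_mul]
  calc _ ≤ Real.exp _ * Real.exp _ := by gcongr
    _ = Real.exp _ := by rw [← Real.exp_add]
    _ ≤ _ := by
      apply Real.exp_le_exp.2
      have e3 : (s.1 - u.1 - t₁).im = 0 := by rw [hs1]; simp
      have e4 : s.1.im = u.1.im + t₁.im := by rw [hs1]; simp
      rw [innerE, e3, e4, hs2, sub_self, zero_im, abs_zero]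
      linarith

end

section

/-! ## Bounds for the spectral factors -/

lemma norm_inv_Lam_le : ∃ K : ℝ, ∀ ν : Fin 3 → ℂ, (∀ i j, |(ν i).re - (ν j).re| ≤ 2) →
    ‖(Lam ν)⁻¹‖ ≤ Real.exp (K - ((ν 0).re - (ν 1).re) / 2 * lg ((ν 0).im - (ν 1).im) -
      ((ν 0).re - (ν 2).re) / 2 * lg ((ν 0).im - (ν 2).im) -
      ((ν 1).re - (ν 2).re) / 2 * lg ((ν 1).im - (ν 2).im) +
      Real.pi / 4 * (|(ν 0).im - (ν 1).im| + |(ν 0).im - (ν 2).im| +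
        |(ν 1).im - (ν 2).im|)) := by
  obtain ⟨K, h⟩ := norm_inv_Gamma_half_le_exp
  refine ⟨4 * Real.log Real.pi + 3 * K, fun ν hν => ?_⟩
  have key : ∀ i j, ‖(Gamma ((1 + ν i - ν j) / 2))⁻¹‖ ≤ Real.exp (K -
      ((ν i).re - (ν j).re) / 2 * lg ((ν i).im - (ν j).im) +
        Real.pi / 4 * |(ν i).im - (ν j).im|) := by
    intro i j
    have hij := abs_le.1 (hν i j)
    have := h (1 + ν i - ν j) (by simp; linarith) (by simp; linarith)
    refine this.trans (Real.exp_le_exp.2 ?_)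
    have e1 : (1 + ν i - ν j).im = (ν i).im - (ν j).im := by simp
    have e2 : (1 + ν i - ν j).re = 1 + (ν i).re - (ν j).re := by simp
    rw [e1, e2]
    linarith
  have hπ : ‖((Real.pi : ℂ) ^ (-(3 / 2 : ℂ) + ν 2 - ν 0))⁻¹‖ ≤
      Real.exp (4 * Real.log Real.pi) := by
    rw [norm_inv, norm_cpow_eq_rpow_re_of_pos Real.pi_pos, ← Real.rpow_neg Real.pi_pos.le,
      Real.rpow_def_of_pos Real.pi_pos]
    have e : (-(3 / 2 : ℂ) + ν 2 - ν 0).re = -(3 / 2) + (ν 2).re - (ν 0).re := by simp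
    have h1 : 0 < Real.log Real.pi := Real.log_pos (by linarith [Real.pi_gt_three])
    have h2 := abs_le.1 (hν 0 2)
    rw [e]
    apply Real.exp_le_exp.2
    nlinarith
  rw [Lam, mul_inv, mul_inv, mul_inv, norm_mul, norm_mul, norm_mul]
  calc _ ≤ Real.exp _ * Real.exp _ * Real.exp _ * Real.exp _ :=
        mul_le_mul (mul_le_mul (mul_le_mul hπ (key 0 1) (norm_nonneg _) (Real.exp_pos _).le)
          (key 0 2) (norm_nonneg _) (by positivity)) (key 1 2) (norm_nonneg _) (by positivity)
    _ = Real.exp _ := by rw [← Real.exp_add, ← Real.exp_add, ← Real.exp_add]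
    _ ≤ _ := Real.exp_le_exp.2 (by linarith)

/-- The exponentials of the six numerators, of the denominator and of Λ combine to the defect. The
powers from Λ are the three separate terms at the end. -/
lemma norm_Gstar_le {δ : ℝ} (hδ : 0 < δ) : ∃ K : ℝ, ∀ w : ℂ × ℂ, ∀ ν : Fin 3 → ℂ,
    (∀ i, gammaRange δ ((w.1 - ν i).re / 2)) → (∀ i, gammaRange δ ((w.2 + ν i).re / 2)) →
    -1 ≤ (w.1 + w.2).re / 2 → (w.1 + w.2).re / 2 ≤ 3 → (∀ i j, |(ν i).re - (ν j).re| ≤ 2) →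
    ‖Gstar w ν‖ ≤ Real.exp (K + specExp 0 (fun i => (w.1.re - (ν i).re) / 2 - 1 / 2)
      (fun i => 1 / 2 - (w.2.re + (ν i).re) / 2) ((w.1.re + w.2.re) / 2 - 1 / 2)
      (fun i => -(ν i).im) w.1.im w.2.im -
      ((ν 0).re - (ν 1).re) / 2 * lg ((ν 0).im - (ν 1).im) -
      ((ν 0).re - (ν 2).re) / 2 * lg ((ν 0).im - (ν 2).im) -
      ((ν 1).re - (ν 2).re) / 2 * lg ((ν 1).im - (ν 2).im)) := by
  obtain ⟨K₁, h₁⟩ := norm_Gamma_half_le_exp hδ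
  obtain ⟨K₂, h₂⟩ := norm_inv_Gamma_half_le_exp
  obtain ⟨K₃, h₃⟩ := norm_inv_Lam_le
  refine ⟨6 * K₁ + K₂ + K₃, fun w ν r1 r2 r3 r4 r5 => ?_⟩
  have a := fun i => h₁ (w.1 - ν i) (r1 i)
  have b := fun i => h₁ (w.2 + ν i) (r2 i)
  have c := h₂ (w.1 + w.2) r3 r4
  have d := h₃ ν r5
  rw [Gstar, G, div_eq_mul_inv _ (Lam ν), div_eq_mul_inv _ (Gamma _)]
  simp only [norm_mul]
  calc _ ≤ Real.exp _ * Real.exp _ * Real.exp _ * Real.exp _ * Real.exp _ * Real.exp _ *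
        Real.exp _ * Real.exp _ := by
        gcongr
        · exact a 0
        · exact a 1
        · exact a 2
        · exact b 0
        · exact b 1
        · exact b 2
    _ = Real.exp _ := by
      rw [← Real.exp_add, ← Real.exp_add, ← Real.exp_add, ← Real.exp_add, ← Real.exp_add,
        ← Real.exp_add, ← Real.exp_add]
    _ ≤ _ := by
      apply Real.exp_le_exp.2
      have e1 : ∀ a b : ℝ, |-a + b| = |a - b| := fun a b => by rw [← abs_neg]; congr 1; ring
      simp only [specExp, defect, Fin.sum_univ_three, sub_re, sub_im, add_re, add_im,
        ← sub_eq_add_neg, sub_neg_eq_add, e1]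
      linarith

/-- The sum of the logarithmic sizes of the root values. -/
noncomputable def rootSum (m : Fin 3 → ℝ) : ℝ :=
  lg (m 0 - m 1) + lg (m 0 - m 2) + lg (m 1 - m 2)

/-- The bound for the factor `G*` in the integrals over `r`. -/
lemma norm_Gstar_spec_le {δ Δ a₁ a₂ : ℝ} {η : Fin 3 → ℝ} (hδ : 0 < δ)
    (h1 : ∀ i, gammaRange δ ((1 + 2 * Δ + a₁ + η i) / 2))
    (h2 : ∀ i, gammaRange δ ((Δ + a₂ - η i) / 2))
    (h3 : -1 ≤ (1 + 3 * Δ + a₁ + a₂) / 2) (h4 : (1 + 3 * Δ + a₁ + a₂) / 2 ≤ 3)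
    (h5 : ∀ i j, |η i - η j| ≤ 2) : ∃ K : ℝ, ∀ μ : Fin 3 → ℂ, (∀ i, (μ i).re = η i) →
    ∀ r₁ r₂ : ℂ, r₁.re = a₁ → r₂.re = a₂ →
    ‖Gstar (1 + 2 * Δ + r₁, Δ + r₂) (fun i => -μ i)‖ ≤
      Real.exp (K + specExp Δ (fun i => (a₁ + η i) / 2) (fun i => (1 + η i - a₂) / 2)
        ((a₁ + a₂) / 2) (fun i => (μ i).im) r₁.im r₂.im + Δ * rootSum (fun i => (μ i).im) +
        ((η 0 - η 1) / 2 * lg ((μ 0).im - (μ 1).im) + (η 0 - η 2) / 2 * lg ((μ 0).im - (μ 2).im) +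
        (η 1 - η 2) / 2 * lg ((μ 1).im - (μ 2).im))) := by
  obtain ⟨K, h⟩ := norm_Gstar_le hδ
  refine ⟨K, fun μ hμ r₁ r₂ hr1 hr2 => ?_⟩
  refine (h _ _ (fun i => ?_) (fun i => ?_) ?_ ?_ fun i j => ?_).trans
    (Real.exp_le_exp.2 (le_of_eq ?_))
  · convert h1 i using 2
    simp [hr1, hμ]
  · convert h2 i using 2
    simp [hr2, hμ]
    ring
  · convert h3 using 2
    simp [hr1, hr2]
    ring
  · convert h4 using 2
    simp [hr1, hr2]
    ring
  · simp only [neg_re, hμ]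
    rw [abs_sub_comm]
    convert h5 i j using 2
    ring
  · have e : ∀ a b : ℝ, lg (-a - -b) = lg (a - b) := fun a b => lg_congr_neg (by ring)
    have e1 : (1 + 2 * (Δ : ℂ) + r₁).re = 1 + 2 * Δ + a₁ := by simp [hr1]
    have e2 : (1 + 2 * (Δ : ℂ) + r₁).im = r₁.im := by simp
    have e3 : ((Δ : ℂ) + r₂).re = Δ + a₂ := by simp [hr2]
    have e4 : ((Δ : ℂ) + r₂).im = r₂.im := by simp
    simp only [specExp, rootSum, Fin.sum_univ_three, neg_re, neg_im, hμ, e, e1, e2, e3, e4, neg_neg]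
    ring

/-- |sin z|² = sin² x + sinh² y and |cos z|² = cos² x + sinh² y, so the quotient is largest relative
to 1 at y = 0 and in any case at most 1/cos² x. -/
lemma norm_tan_le {z : ℂ} (hz : Real.cos z.re ≠ 0) : ‖tan z‖ ≤ |Real.cos z.re|⁻¹ := by
  have hs : ‖sin z‖ ^ 2 = Real.sin z.re ^ 2 + Real.sinh z.im ^ 2 := by
    have e : sin z = ((Real.sin z.re * Real.cosh z.im : ℝ) : ℂ) +
        ((Real.cos z.re * Real.sinh z.im : ℝ) : ℂ) * I := by
      rw [sin_eq]
      push_cast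
      ring
    rw [e, Complex.sq_norm, normSq_add_mul_I]
    linear_combination (Real.sin z.re) ^ 2 * Real.cosh_sq z.im +
      (Real.sinh z.im) ^ 2 * Real.sin_sq_add_cos_sq z.re
  have hc : ‖cos z‖ ^ 2 = Real.cos z.re ^ 2 + Real.sinh z.im ^ 2 := by
    have e : cos z = ((Real.cos z.re * Real.cosh z.im : ℝ) : ℂ) +
        ((-(Real.sin z.re * Real.sinh z.im) : ℝ) : ℂ) * I := by
      rw [cos_eq]
      push_cast
      ring
    rw [e, Complex.sq_norm, normSq_add_mul_I]
    linear_combination (Real.cos z.re) ^ 2 * Real.cosh_sq z.im +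
      (Real.sinh z.im) ^ 2 * Real.sin_sq_add_cos_sq z.re
  have hpos : 0 < |Real.cos z.re| := abs_pos.2 hz
  have hcpos : 0 < ‖cos z‖ := by
    have : 0 < ‖cos z‖ ^ 2 := by rw [hc]; positivity
    exact lt_of_le_of_ne (norm_nonneg _) fun h => by rw [← h] at this; simp at this
  rw [tan, norm_div, div_le_iff₀ hcpos, inv_mul_eq_div, le_div_iff₀ hpos]
  refine le_of_sq_le_sq ?_ hcpos.le
  rw [mul_pow, hs, hc, sq_abs]
  have h1 := Real.sin_sq_add_cos_sq z.re
  nlinarith [sq_nonneg (Real.cos z.re), sq_nonneg (Real.sinh z.im), sq_nonneg (Real.sin z.re),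
    mul_nonneg (sq_nonneg (Real.sin z.re)) (sq_nonneg (Real.sinh z.im)),
    mul_nonneg (sq_nonneg (Real.sin z.re)) (sq_nonneg (Real.cos z.re))]

lemma cos_pi_half_mul_ne_zero {x : ℝ} (h1 : |x| < 2) (h2 : |x| ≠ 1) :
    Real.cos (Real.pi / 2 * x) ≠ 0 := by
  have hπ := Real.pi_pos
  rw [← Real.cos_abs, abs_mul, abs_of_pos (by positivity : 0 < Real.pi / 2)]
  have h0 := abs_nonneg x
  rcases lt_or_gt_of_ne h2 with h | h
  · exact (Real.cos_pos_of_mem_Ioo ⟨by nlinarith, by nlinarith⟩).ne'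
  · exact (Real.cos_neg_of_pi_div_two_lt_of_lt (by nlinarith) (by nlinarith)).ne

lemma norm_tanFactor_le {x : ℝ} (h1 : |x| < 2) (h2 : |x| ≠ 1) : ∃ K : ℝ, ∀ z : ℂ, z.re = x →
    ‖tanFactor z‖ ≤ Real.exp (K + lg z.im) := by
  have hc := cos_pi_half_mul_ne_zero h1 h2
  have hp : 0 < Real.pi * |Real.cos (Real.pi / 2 * x)|⁻¹ :=
    mul_pos Real.pi_pos (inv_pos.2 (abs_pos.2 hc))
  refine ⟨Real.log (Real.pi * |Real.cos (Real.pi / 2 * x)|⁻¹), fun z hz => ?_⟩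
  have e1 : ((Real.pi : ℂ) / 2 * z).re = Real.pi / 2 * x := by
    have : (Real.pi : ℂ) / 2 * z = ((Real.pi / 2 : ℝ) : ℂ) * z := by push_cast; ring
    rw [this, re_ofReal_mul, hz]
  have h3 := norm_tan_le (z := Real.pi / 2 * z) (by rwa [e1])
  rw [e1] at h3
  have h4 : ‖z‖ ≤ 2 * (1 + |z.im|) := by
    have := norm_le_abs_re_add_abs_im z
    rw [hz] at this
    linarith [abs_nonneg z.im]
  rw [tanFactor, norm_mul, norm_neg, Real.exp_add, Real.exp_log hp, exp_lg, norm_mul, norm_div,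
    norm_real, Real.norm_of_nonneg Real.pi_pos.le]
  simp only [Complex.norm_ofNat]
  calc _ ≤ Real.pi / 2 * (2 * (1 + |z.im|)) * |Real.cos (Real.pi / 2 * x)|⁻¹ := by gcongr
    _ = _ := by ring

lemma norm_adjFactor_le {Δ : ℝ} (h0 : 0 ≤ Δ) (h1 : Δ ≤ 1) : ∀ z : ℂ, |z.re| ≤ 2 →
    ‖adjFactor Δ z‖ ≤ Real.exp (Real.log 2 - Δ * lg z.im) := by
  intro z hz
  have hz' := abs_le.1 hz
  have hpos : 0 < (1 + |z.im|) / 2 := by positivity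
  -- Both linear factors of the base have real part at least 1 because |Re z| ≤ 2.
  have b1 : (1 + |z.im|) / 2 ≤ ‖(3 + 2 * Δ : ℂ) - z‖ := by
    have a1 := abs_im_le_norm ((3 + 2 * Δ : ℂ) - z)
    have a2 := re_le_norm ((3 + 2 * Δ : ℂ) - z)
    simp at a1 a2
    linarith
  have b2 : (1 + |z.im|) / 2 ≤ ‖(3 + 2 * Δ : ℂ) + z‖ := by
    have a1 := abs_im_le_norm ((3 + 2 * Δ : ℂ) + z)
    have a2 := re_le_norm ((3 + 2 * Δ : ℂ) + z)
    simp at a1 a2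
    linarith
  have b3 : ((1 + |z.im|) / 2) ^ 2 ≤ ‖(3 + 2 * Δ : ℂ) ^ 2 - z ^ 2‖ := by
    rw [show (3 + 2 * Δ : ℂ) ^ 2 - z ^ 2 = ((3 + 2 * Δ) - z) * ((3 + 2 * Δ) + z) by ring, norm_mul,
      sq]
    gcongr
  have hne : (3 + 2 * Δ : ℂ) ^ 2 - z ^ 2 ≠ 0 :=
    norm_pos_iff.1 (lt_of_lt_of_le (by positivity) b3)
  -- The exponent is real, so the norm of the power is the power of the norm and the branch plays no
  -- role.
  have e : -(Δ : ℂ) / 2 = ((-Δ / 2 : ℝ) : ℂ) := by push_cast; ring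
  rw [adjFactor, e, norm_cpow_of_ne_zero hne]
  simp only [ofReal_re, ofReal_im, mul_zero, Real.exp_zero, div_one]
  calc _ ≤ (((1 + |z.im|) / 2) ^ 2) ^ (-Δ / 2) :=
        Real.rpow_le_rpow_of_nonpos (by positivity) b3 (by linarith)
    _ = Real.exp (Δ * Real.log 2 - Δ * lg z.im) := by
        rw [Real.rpow_def_of_pos (by positivity), Real.log_pow,
          Real.log_div (by positivity) two_ne_zero,
          lg]
        congr 1
        push_cast
        ring
    _ ≤ _ := by
        apply Real.exp_le_exp.2
        have := Real.log_pos one_lt_two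
        nlinarith

/-- The bound for `k_adj / |c₃|²`. -/
lemma norm_kadj_mul_c3InvSq_le {Δ : ℝ} {η : Fin 3 → ℝ} (h0 : 0 ≤ Δ) (h1 : Δ ≤ 1)
    (h2 : ∀ i j, |η i - η j| < 2) (h3 : ∀ i j, |η i - η j| ≠ 1) : ∃ K : ℝ, ∀ μ : Fin 3 → ℂ,
    (∀ i, (μ i).re = η i) → ‖kadj Δ μ * c3InvSq μ‖ ≤
      Real.exp (K + (1 - Δ) * rootSum (fun i => (μ i).im)) := by
  have := fun i j => norm_tanFactor_le (h2 i j) (h3 i j)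
  choose K hK using this
  refine ⟨3 * Real.log 2 + (K 0 1 + K 0 2 + K 1 2), fun μ hμ => ?_⟩
  have ht : ∀ i j, ‖tanFactor (μ i - μ j)‖ ≤ Real.exp (K i j + lg ((μ i).im - (μ j).im)) :=
    fun i j => by simpa using hK i j (μ i - μ j) (by simp [hμ])
  have ha : ∀ i j, ‖adjFactor Δ (μ i - μ j)‖ ≤
      Real.exp (Real.log 2 - Δ * lg ((μ i).im - (μ j).im)) := fun i j => by
    simpa using norm_adjFactor_le h0 h1 (μ i - μ j) (by simpa [hμ] using (h2 i j).le)
  have h4 : ‖(4 : ℂ) / (Real.pi : ℂ) ^ 2‖ ≤ 1 := by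
    rw [norm_div, norm_pow, norm_real, Real.norm_of_nonneg Real.pi_pos.le]
    simp only [Complex.norm_ofNat]
    rw [div_le_one (by positivity)]
    nlinarith [Real.pi_gt_three]
  rw [kadj, c3InvSq]
  simp only [norm_mul]
  calc _ ≤ Real.exp _ * Real.exp _ * Real.exp _ * (1 * (Real.exp _ * Real.exp _ * Real.exp _)) := by
        gcongr
        · exact ha 0 1
        · exact ha 0 2
        · exact ha 1 2
        · exact ht 0 1
        · exact ht 0 2
        · exact ht 1 2
    _ = Real.exp _ := by
      rw [one_mul, ← Real.exp_add, ← Real.exp_add, ← Real.exp_add, ← Real.exp_add, ← Real.exp_add]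
    _ ≤ _ := Real.exp_le_exp.2 (by rw [rootSum]; linarith)

end

/-! ### Bounds for the residues of G*. -/

section

/-- Bounds for the gamma factors of the residues of `G*`. -/
lemma norm_Gamma_roots_le {δ : ℝ} (hδ : 0 < δ) : ∃ K : ℝ, 0 ≤ K ∧ ∀ η : Fin 3 → ℝ,
    (∀ i j, |η i - η j| ≤ 2) → ∀ μ : Fin 3 → ℂ, (∀ i, (μ i).re = η i) →
    (∀ i j, gammaRange δ ((η i - η j) / 2) → ‖Gamma ((μ i - μ j) / 2)‖ ≤
      Real.exp (K + ((η i - η j) / 2 - 1 / 2) * lg ((μ i).im - (μ j).im) -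
        Real.pi / 4 * |(μ i).im - (μ j).im|)) ∧
    (∀ i j, ‖(Gamma ((1 + μ i - μ j) / 2))⁻¹‖ ≤
      Real.exp (K - (η i - η j) / 2 * lg ((μ i).im - (μ j).im) +
        Real.pi / 4 * |(μ i).im - (μ j).im|)) ∧
    ‖(Real.pi : ℂ) ^ ((3 / 2 : ℂ) + μ 0 - μ 2)‖ ≤ Real.exp K := by
  obtain ⟨K₁, h₁⟩ := norm_Gamma_half_le_exp hδ
  obtain ⟨K₂, h₂⟩ := norm_inv_Gamma_half_le_exp
  have hl : 0 < Real.log Real.pi := Real.log_pos (by linarith [Real.pi_gt_three])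
  refine ⟨|K₁| + |K₂| + 4 * Real.log Real.pi, by positivity, fun η hη μ hμ =>
    ⟨fun i j hij => ?_, fun i j => ?_, ?_⟩⟩
  · refine (h₁ (μ i - μ j) (by simpa [hμ] using hij)).trans (Real.exp_le_exp.2 ?_)
    simp only [sub_re, sub_im, hμ]
    linarith [le_abs_self K₁, abs_nonneg K₂]
  · have hij := abs_le.1 (hη i j)
    refine (h₂ (1 + μ i - μ j) (by simp [hμ]; linarith) (by simp [hμ]; linarith)).trans
      (Real.exp_le_exp.2 ?_)
    have e1 : (1 + μ i - μ j).im = (μ i).im - (μ j).im := by simp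
    have e2 : (1 + μ i - μ j).re = 1 + η i - η j := by simp [hμ]
    rw [e1, e2]
    linarith [le_abs_self K₂, abs_nonneg K₁]
  · rw [norm_cpow_eq_rpow_re_of_pos Real.pi_pos, Real.rpow_def_of_pos Real.pi_pos]
    have e : ((3 / 2 : ℂ) + μ 0 - μ 2).re = 3 / 2 + η 0 - η 2 := by simp [hμ]
    have h2 := abs_le.1 (hη 0 2)
    rw [e]
    apply Real.exp_le_exp.2
    nlinarith [abs_nonneg K₁, abs_nonneg K₂]

lemma two_le_exp_one : (2 : ℝ) ≤ Real.exp 1 := by linarith [Real.add_one_le_exp 1]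

/-- The exponentials in μ₁ - μ₂ and μ₂ - μ₃ cancel between Γ's and Λ. The growth in μ₁ - μ₃ is
covered by the decay in u - μ₁ and u - μ₃ by the triangle inequality. -/
lemma norm_GstarR_le {δ a : ℝ} {η : Fin 3 → ℝ} (hδ : 0 < δ) (hη : ∀ i j, |η i - η j| ≤ 2)
    (r1 : gammaRange δ ((η 0 - η 1) / 2)) (r2 : gammaRange δ ((η 2 - η 1) / 2))
    (r3 : gammaRange δ ((a - η 0) / 2)) (r4 : gammaRange δ ((a - η 2) / 2)) :
    ∃ K : ℝ, ∀ μ : Fin 3 → ℂ, (∀ i, (μ i).re = η i) → ∀ u : ℂ, u.re = a →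
    ‖GstarR u μ‖ ≤ Real.exp (K + (-(1 / 2) * lg ((μ 0).im - (μ 1).im) -
      (η 0 - η 2) / 2 * lg ((μ 0).im - (μ 2).im) +
      (η 2 - η 1 - 1 / 2) * lg ((μ 1).im - (μ 2).im)) +
      ((a - η 0) / 2 - 1 / 2) * lg (u.im - (μ 0).im) +
      ((a - η 2) / 2 - 1 / 2) * lg (u.im - (μ 2).im)) := by
  obtain ⟨K₁, h₁⟩ := norm_Gamma_half_le_exp hδ
  obtain ⟨K₂, -, h₂⟩ := norm_Gamma_roots_le hδ
  refine ⟨1 + 6 * K₂ + 2 * K₁, fun μ hμ u hu => ?_⟩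
  obtain ⟨b1, b2, b3⟩ := h₂ η hη μ hμ
  have c := fun i (hi : gammaRange δ ((a - η i) / 2)) =>
    h₁ (u - μ i) (by simpa [hu, hμ] using hi)
  rw [GstarR, div_eq_mul_inv _ (Gamma _ * Gamma _), div_eq_mul_inv _ (Gamma ((1 + μ 0 - μ 2) / 2)),
    mul_inv]
  simp only [norm_mul, Complex.norm_ofNat]
  calc _ ≤ Real.exp 1 * Real.exp _ * (Real.exp _ * Real.exp _ * (Real.exp _ * Real.exp _)) *
        (Real.exp _ * Real.exp _ * Real.exp _) := by
        gcongr
        · exact two_le_exp_one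
        · exact b1 0 1 r1
        · exact b1 2 1 r2
        · exact b2 0 1
        · exact b2 1 2
        · exact c 0 r3
        · exact c 2 r4
        · exact b2 0 2
    _ = Real.exp _ := by
      rw [← Real.exp_add, ← Real.exp_add, ← Real.exp_add, ← Real.exp_add, ← Real.exp_add,
        ← Real.exp_add, ← Real.exp_add, ← Real.exp_add]
    _ ≤ _ := by
      apply Real.exp_le_exp.2
      simp only [sub_re, sub_im, hu, hμ]
      rw [lg_sub_comm (μ 2).im (μ 1).im, abs_sub_comm (μ 2).im (μ 1).im]
      have h := abs_sub_le (u.im - (μ 2).im) 0 (u.im - (μ 0).im)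
      rw [show u.im - (μ 2).im - (u.im - (μ 0).im) = (μ 0).im - (μ 2).im by ring, sub_zero,
        zero_sub, abs_neg] at h
      have := mul_le_mul_of_nonneg_left h (by positivity : 0 ≤ Real.pi / 4)
      linarith

/-- Here the growth left over from Λ is in μ₂ - μ₃, and the decay in u + μ₂ and u + μ₃ covers it. -/
lemma norm_GstarL_le {δ a : ℝ} {η : Fin 3 → ℝ} (hδ : 0 < δ) (hη : ∀ i j, |η i - η j| ≤ 2)
    (r1 : gammaRange δ ((η 0 - η 1) / 2)) (r2 : gammaRange δ ((η 0 - η 2) / 2))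
    (r3 : gammaRange δ ((a + η 1) / 2)) (r4 : gammaRange δ ((a + η 2) / 2)) :
    ∃ K : ℝ, ∀ μ : Fin 3 → ℂ, (∀ i, (μ i).re = η i) → ∀ u : ℂ, u.re = a →
    ‖GstarL u μ‖ ≤ Real.exp (K + (-(1 / 2) * lg ((μ 0).im - (μ 1).im) -
      1 / 2 * lg ((μ 0).im - (μ 2).im) - (η 1 - η 2) / 2 * lg ((μ 1).im - (μ 2).im)) +
      ((a + η 1) / 2 - 1 / 2) * lg (u.im + (μ 1).im) +
      ((a + η 2) / 2 - 1 / 2) * lg (u.im + (μ 2).im)) := by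
  obtain ⟨K₁, h₁⟩ := norm_Gamma_half_le_exp hδ
  obtain ⟨K₂, -, h₂⟩ := norm_Gamma_roots_le hδ
  refine ⟨1 + 6 * K₂ + 2 * K₁, fun μ hμ u hu => ?_⟩
  obtain ⟨b1, b2, b3⟩ := h₂ η hη μ hμ
  have c := fun i (hi : gammaRange δ ((a + η i) / 2)) =>
    h₁ (u + μ i) (by simpa [hu, hμ] using hi)
  rw [GstarL, div_eq_mul_inv _ (Gamma _ * Gamma _), div_eq_mul_inv _ (Gamma ((1 + μ 1 - μ 2) / 2)),
    mul_inv]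
  simp only [norm_mul, Complex.norm_ofNat]
  calc _ ≤ Real.exp 1 * Real.exp _ * (Real.exp _ * Real.exp _ * (Real.exp _ * Real.exp _)) *
        (Real.exp _ * Real.exp _ * Real.exp _) := by
        gcongr
        · exact two_le_exp_one
        · exact b1 0 1 r1
        · exact b1 0 2 r2
        · exact b2 0 1
        · exact b2 0 2
        · exact c 1 r3
        · exact c 2 r4
        · exact b2 1 2
    _ = Real.exp _ := by
      rw [← Real.exp_add, ← Real.exp_add, ← Real.exp_add, ← Real.exp_add, ← Real.exp_add,
        ← Real.exp_add, ← Real.exp_add, ← Real.exp_add]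
    _ ≤ _ := by
      apply Real.exp_le_exp.2
      simp only [add_re, add_im, hu, hμ]
      have h := abs_sub_le (u.im + (μ 1).im) 0 (u.im + (μ 2).im)
      rw [show u.im + (μ 1).im - (u.im + (μ 2).im) = (μ 1).im - (μ 2).im by ring, sub_zero,
        zero_sub, abs_neg] at h
      have := mul_le_mul_of_nonneg_left h (by positivity : 0 ≤ Real.pi / 4)
      linarith

/-- All exponentials cancel root by root, so the double residue is a pure power. -/
lemma norm_GstarB_le {δ : ℝ} {η : Fin 3 → ℝ} (hδ : 0 < δ) (hη : ∀ i j, |η i - η j| ≤ 2)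
    (r1 : gammaRange δ ((η 0 - η 1) / 2)) (r2 : gammaRange δ ((η 0 - η 2) / 2))
    (r3 : gammaRange δ ((η 2 - η 1) / 2)) :
    ∃ K : ℝ, ∀ μ : Fin 3 → ℂ, (∀ i, (μ i).re = η i) →
    ‖GstarB μ‖ ≤ Real.exp (K + (-(1 / 2) * lg ((μ 0).im - (μ 1).im) -
      1 / 2 * lg ((μ 0).im - (μ 2).im) + (η 2 - η 1 - 1 / 2) * lg ((μ 1).im - (μ 2).im))) := by
  obtain ⟨K₂, -, h₂⟩ := norm_Gamma_roots_le hδ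
  refine ⟨2 + 7 * K₂, fun μ hμ => ?_⟩
  obtain ⟨b1, b2, b3⟩ := h₂ η hη μ hμ
  have h4 : (4 : ℝ) ≤ Real.exp 2 := by
    have := two_le_exp_one
    rw [show (2 : ℝ) = 1 + 1 by norm_num, Real.exp_add]
    nlinarith
  rw [GstarB, div_eq_mul_inv _ (Gamma _ * Gamma _ * Gamma _), mul_inv, mul_inv]
  simp only [norm_mul, Complex.norm_ofNat]
  calc _ ≤ Real.exp 2 * Real.exp _ * (Real.exp _ * Real.exp _ * Real.exp _ *
        (Real.exp _ * Real.exp _ * Real.exp _)) := by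
        gcongr
        · exact b1 0 1 r1
        · exact b1 0 2 r2
        · exact b1 2 1 r3
        · exact b2 0 1
        · exact b2 0 2
        · exact b2 1 2
    _ = Real.exp _ := by
      rw [← Real.exp_add, ← Real.exp_add, ← Real.exp_add, ← Real.exp_add, ← Real.exp_add,
        ← Real.exp_add, ← Real.exp_add]
    _ ≤ _ := by
      apply Real.exp_le_exp.2
      rw [lg_sub_comm (μ 2).im (μ 1).im, abs_sub_comm (μ 2).im (μ 1).im]
      linarith

/-- The logarithm of `|4π²y|`. -/
noncomputable def ylog (y : ℝ) : ℝ := Real.log (4 * Real.pi ^ 2 * |y|)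

lemma norm_yPow {y : ℝ × ℝ} (h1 : y.1 ≠ 0) (h2 : y.2 ≠ 0) (s : ℂ × ℂ) :
    ‖yPow y s‖ = Real.exp (-s.1.re * ylog y.1 + -s.2.re * ylog y.2) := by
  have p1 : 0 < 4 * Real.pi ^ 2 * |y.1| := by have := abs_pos.2 h1; positivity
  have p2 : 0 < 4 * Real.pi ^ 2 * |y.2| := by have := abs_pos.2 h2; positivity
  rw [yPow, norm_mul, norm_cpow_eq_rpow_re_of_pos p1, norm_cpow_eq_rpow_re_of_pos p2,
    Real.rpow_def_of_pos p1, Real.rpow_def_of_pos p2, Real.exp_add, neg_re, neg_re, ylog, ylog,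
    mul_comm (-s.1.re), mul_comm (-s.2.re)]

lemma norm_two_cpow (z : ℂ) : ‖(2 : ℂ) ^ z‖ = Real.exp (Real.log 2 * z.re) := by
  have := norm_cpow_eq_rpow_re_of_pos two_pos z
  rw [Real.rpow_def_of_pos two_pos] at this
  simpa using this

end

section

/-! ## Comparison with the majorant -/

/-- The exponents left after all integrations are dominated by those of the majorant, for the
ordering `p, q, s` of the coordinates. -/
def DominatedAt (ρ σ : Fin 3 → ℝ) (τ κ γ : ℝ) (W : Fin 3 → ℝ) (A B : ℝ) (p q s : Fin 3) : Prop :=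
    (1 + κ - γ + ρ q + ρ s - τ - σ s + W p) + (ρ p + W q) ≤ 2 * A ∧
    (1 + κ - σ p - σ q + W s) + (ρ p + W q) ≤ 2 * A ∧
    (1 + κ - γ + ρ q + ρ s - τ - σ s + W p) + (1 + κ - σ p - σ q + W s) + (ρ p + W q) ≤
      2 * A + B ∧
    |ρ p + W q - A| ≤ 10

/-- Domination for every ordering of the coordinates. -/
def Dominated (ρ σ : Fin 3 → ℝ) (τ κ γ : ℝ) (W : Fin 3 → ℝ) (A B : ℝ) : Prop :=
  ∀ p q s : Fin 3, p ≠ q → q ≠ s → p ≠ s → DominatedAt ρ σ τ κ γ W A B p q s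

/-- A linear combination of the root sizes, indexed by the opposite coordinate. -/
noncomputable def rootLin (W : Fin 3 → ℝ) (m : Fin 3 → ℝ) : ℝ :=
  W 2 * lg (m 0 - m 1) + W 1 * lg (m 0 - m 2) + W 0 * lg (m 1 - m 2)

lemma rootLin_eq {p q s : Fin 3} (h1 : p ≠ q) (h2 : q ≠ s) (h3 : p ≠ s) (W m : Fin 3 → ℝ) :
    rootLin W m = W s * lg (m p - m q) + W p * lg (m q - m s) + W q * lg (m p - m s) := by
  have e1 := lg_sub_comm (m 1) (m 0)
  have e2 := lg_sub_comm (m 2) (m 0)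
  have e3 := lg_sub_comm (m 2) (m 1)
  rw [rootLin]
  rcases perm_cases h1 h2 h3 with h | h | h | h | h | h <;> obtain ⟨rfl, rfl, rfl⟩ := h <;>
    (try simp only [e1, e2, e3]) <;> ring

lemma Mid.lg_le {m : Fin 3 → ℝ} {p q s : Fin 3} (h : Mid m p q s) :
    lg (m q - m s) ≤ lg (m p - m s) ∧ lg (m p - m q) ≤ lg (m p - m s) := by
  constructor <;> apply lg_mono <;> rcases h.mid with ⟨h1, h2⟩ | ⟨h1, h2⟩
  · rw [abs_of_nonneg, abs_of_nonneg] <;> linarith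
  · rw [abs_of_nonpos, abs_of_nonpos] <;> linarith
  · rw [abs_of_nonneg, abs_of_nonneg] <;> linarith
  · rw [abs_of_nonpos, abs_of_nonpos] <;> linarith

/-- Up to log 2 one has Z = max X Y, and the admissible (X, Y, Z) are spanned by (1, 0, 1), (0, 1,
1) and (1, 1, 1). The three inequalities `h1`, `h2`, `h3` are the comparison on these rays; `h4`
only controls the effect of the log 2. -/
lemma lin_le_max {X Y Z cX cY cZ A B : ℝ} (hX : 0 ≤ X) (hY : 0 ≤ Y) (hXZ : X ≤ Z) (hYZ : Y ≤ Z)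
    (hZ : Z ≤ max X Y + Real.log 2) (h1 : cX + cZ ≤ 2 * A) (h2 : cY + cZ ≤ 2 * A)
    (h3 : cX + cY + cZ ≤ 2 * A + B) (h4 : |cZ - A| ≤ 10) :
    cX * X + cY * Y + cZ * Z ≤
      10 * Real.log 2 + max (A * (X + Z) + B * Y) (A * (Y + Z) + B * X) := by
  have l2 : 0 < Real.log 2 := Real.log_pos one_lt_two
  have h4' := abs_le.1 h4
  have key : ∀ W : ℝ, 0 ≤ Z - W → Z - W ≤ Real.log 2 → (cZ - A) * (Z - W) ≤ 10 * Real.log 2 := by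
    intro W ha hb
    have : (cZ - A) * (Z - W) ≤ 10 * (Z - W) := mul_le_mul_of_nonneg_right h4'.2 ha
    linarith
  rcases le_total Y X with h | h
  · rw [max_eq_left h] at hZ
    have k := key X (by linarith) (by linarith)
    have k2 : (cX + cZ - 2 * A) * (X - Y) ≤ 0 :=
      mul_nonpos_of_nonpos_of_nonneg (by linarith) (by linarith)
    have k3 : (cX + cY + cZ - 2 * A - B) * Y ≤ 0 :=
      mul_nonpos_of_nonpos_of_nonneg (by linarith) hY
    have := le_max_left (A * (X + Z) + B * Y) (A * (Y + Z) + B * X)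
    linarith
  · rw [max_eq_right h] at hZ
    have k := key Y (by linarith) (by linarith)
    have k2 : (cY + cZ - 2 * A) * (Y - X) ≤ 0 :=
      mul_nonpos_of_nonpos_of_nonneg (by linarith) (by linarith)
    have k3 : (cX + cY + cZ - 2 * A - B) * X ≤ 0 :=
      mul_nonpos_of_nonpos_of_nonneg (by linarith) hX
    have := le_max_right (A * (X + Z) + B * Y) (A * (Y + Z) + B * X)
    linarith

lemma Mpoly_ge {a b c : ℝ} (ha : 0 ≤ a) (hb : 0 ≤ b) (hc : 0 ≤ c) (μ : Fin 3 → ℂ) :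
    Real.exp (a * lg ((μ 0).im - (μ 1).im) + b * lg ((μ 0).im - (μ 2).im) +
      c * lg ((μ 1).im - (μ 2).im) - (a + b + c) * Real.log 2) ≤ Mpoly a b c μ := by
  have key : ∀ (x a : ℝ), 0 ≤ a → Real.exp (a * lg x - a * Real.log 2) ≤ ‖1 + I * (x : ℂ)‖ ^ a := by
    intro x a ha
    have h1 : (1 + |x|) / 2 ≤ ‖1 + I * (x : ℂ)‖ := by
      have a1 := abs_re_le_norm (1 + I * (x : ℂ))
      have a2 := abs_im_le_norm (1 + I * (x : ℂ))
      simp at a1 a2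
      linarith
    have h2 : 0 < (1 + |x|) / 2 := by positivity
    calc _ = ((1 + |x|) / 2) ^ a := by
          rw [Real.rpow_def_of_pos h2, Real.log_div (by positivity) two_ne_zero, lg]
          congr 1
          ring
      _ ≤ _ := Real.rpow_le_rpow h2.le h1 ha
  rw [Mpoly]
  simp only [sub_im]
  calc _ = Real.exp (a * lg ((μ 0).im - (μ 1).im) - a * Real.log 2) *
        Real.exp (b * lg ((μ 0).im - (μ 2).im) - b * Real.log 2) *
        Real.exp (c * lg ((μ 1).im - (μ 2).im) - c * Real.log 2) := by
        rw [← Real.exp_add, ← Real.exp_add]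
        congr 1
        ring
    _ ≤ _ := by
        gcongr
        · exact key _ a ha
        · exact key _ b hb
        · exact key _ c hc

lemma Msym_ge {ε κ δ : ℝ} (h1 : 0 ≤ (κ - δ) / 2 + ε) (h2 : 0 ≤ δ + ε) (μ : Fin 3 → ℂ)
    {i j k : Fin 3} (hij : i ≠ j) (hjk : j ≠ k) (hik : i ≠ k) :
    Real.exp (((κ - δ) / 2 + ε) * (lg ((μ i).im - (μ j).im) + lg ((μ i).im - (μ k).im)) +
      (δ + ε) * lg ((μ j).im - (μ k).im) - (κ + 3 * ε) * Real.log 2) ≤ Msym ε κ δ μ := by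
  have hinj : Function.Bijective ![i, j, k] := by
    rw [← Finite.injective_iff_bijective]
    revert i j k
    decide
  have h := Mpoly_ge h1 h1 h2 (fun a => μ (Equiv.ofBijective _ hinj a))
  have hs : Mpoly ((κ - δ) / 2 + ε) ((κ - δ) / 2 + ε) (δ + ε)
      (fun a => μ (Equiv.ofBijective _ hinj a)) ≤ Msym ε κ δ μ :=
    Finset.single_le_sum (f := fun w : Equiv.Perm (Fin 3) =>
      Mpoly ((κ - δ) / 2 + ε) ((κ - δ) / 2 + ε) (δ + ε) (fun i => μ (w i)))
      (fun w _ => by unfold Mpoly; positivity) (Finset.mem_univ _)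
  refine le_trans (Real.exp_le_exp.2 (le_of_eq ?_)) (h.trans hs)
  simp
  ring

/-- The outcome of the spectral integrations is bounded by the majorant. -/
lemma exp_labelMain_le {ρ σ : Fin 3 → ℝ} {τ κ γ ε κ' δ' : ℝ} {W : Fin 3 → ℝ}
    (h1 : 0 ≤ (κ' - δ') / 2 + ε) (h2 : 0 ≤ δ' + ε)
    {p q s : Fin 3} (D : DominatedAt ρ σ τ κ γ W ((κ' - δ') / 2 + ε) (δ' + ε) p q s)
    (μ : Fin 3 → ℂ) (h : Mid (fun i => (μ i).im) p q s) :
    Real.exp (labelMain ρ σ τ κ γ (fun i => (μ i).im) p q s + rootLin W (fun i => (μ i).im)) ≤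
      Real.exp ((10 + κ' + 3 * ε) * Real.log 2) * Msym ε κ' δ' μ := by
  obtain ⟨d1, d2, d3, d4⟩ := D
  obtain ⟨hX, hY⟩ := h.lg_le
  have hZ := lg_add_le_max ((μ q).im - (μ s).im) ((μ p).im - (μ q).im)
  rw [show (μ q).im - (μ s).im + ((μ p).im - (μ q).im) = (μ p).im - (μ s).im by ring] at hZ
  have L := lin_le_max (lg_nonneg _) (lg_nonneg _) hX hY hZ d1 d2 d3 d4
  rw [rootLin_eq h.pq h.qs h.ps, labelMain]
  -- The two branches of the maximum in `lin_le_max` are two summands of `Msym`: those in which s,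
  -- respectively p, takes the first place.
  have M1 := Msym_ge h1 h2 μ h.qs.symm h.pq.symm h.ps.symm
  have M2 := Msym_ge h1 h2 μ h.pq h.qs h.ps
  rw [lg_sub_comm (μ s).im, lg_sub_comm (μ s).im, lg_sub_comm (μ q).im (μ p).im] at M1
  rw [← inv_mul_le_iff₀ (Real.exp_pos _), ← Real.exp_neg, ← Real.exp_add]
  rcases le_max_iff.1 (sub_le_iff_le_add'.2 L) with L | L
  · refine le_trans (Real.exp_le_exp.2 ?_) M1
    linarith
  · refine le_trans (Real.exp_le_exp.2 ?_) M2
    linarith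

/-! ## Iterated integrals -/

lemma lintegral_pop {X : Type*} [MeasureSpace X] [SFinite (volume : Measure X)]
    {f : ℝ × X → ENNReal} (hf : Measurable f) :
    ∫⁻ p, f p = ∫⁻ y, ∫⁻ a, f (a, y) ∧ Measurable fun y => ∫⁻ a, f (a, y) :=
  ⟨lintegral_prod_symm' f hf, hf.lintegral_prod_left'⟩

/-- The joint integrands end with (r₁, r₂, t₂), while the estimates integrate r₂ last, r₁ before it,
and all other variables inside. The longer versions peel further leading variables into the
innermost places. -/
lemma lintegral_order_three {f : ℝ × ℝ × ℝ → ENNReal} (hf : Measurable f) :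
    ∫⁻ p, f p = ∫⁻ z, ∫⁻ x, ∫⁻ t, f (x, z, t) := by
  obtain ⟨h1, h2⟩ := lintegral_pop hf
  rw [h1, Measure.volume_eq_prod, lintegral_prod _ h2.aemeasurable]
  refine lintegral_congr fun z => ?_
  rw [lintegral_lintegral_swap]
  exact (hf.comp (by fun_prop : Measurable fun q : ℝ × ℝ => (q.2, z, q.1))).aemeasurable

lemma lintegral_order_four {f : ℝ × ℝ × ℝ × ℝ → ENNReal} (hf : Measurable f) :
    ∫⁻ p, f p = ∫⁻ z, ∫⁻ x, ∫⁻ t, ∫⁻ a, f (a, x, z, t) := by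
  obtain ⟨h1, h2⟩ := lintegral_pop hf
  rw [h1, lintegral_order_three h2]

lemma lintegral_order_five {f : ℝ × ℝ × ℝ × ℝ × ℝ → ENNReal} (hf : Measurable f) :
    ∫⁻ p, f p = ∫⁻ z, ∫⁻ x, ∫⁻ t, ∫⁻ a, ∫⁻ b, f (b, a, x, z, t) := by
  obtain ⟨h1, h2⟩ := lintegral_pop hf
  rw [h1, lintegral_order_four h2]

lemma lintegral_order_six {f : ℝ × ℝ × ℝ × ℝ × ℝ × ℝ → ENNReal} (hf : Measurable f) :
    ∫⁻ p, f p = ∫⁻ z, ∫⁻ x, ∫⁻ t, ∫⁻ a, ∫⁻ b, ∫⁻ c, f (c, b, a, x, z, t) := by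
  obtain ⟨h1, h2⟩ := lintegral_pop hf
  rw [h1, lintegral_order_five h2]

lemma enorm_lineInt_le (c : ℝ) (f : ℂ → ℂ) : ‖lineInt c f‖ₑ ≤ ∫⁻ τ, ‖f (pt c τ)‖ₑ := by
  rw [lineInt, enorm_mul]
  have : ‖I‖ₑ = 1 := by rw [← ofReal_norm, norm_I, ENNReal.ofReal_one]
  rw [this, one_mul]
  exact enorm_integral_le_lintegral_enorm _

lemma enorm_mul_lintegral {α : Type*} [MeasurableSpace α] (ν : Measure α) (a : ℂ)
    (f : α → ENNReal) : ‖a‖ₑ * ∫⁻ x, f x ∂ν = ∫⁻ x, ‖a‖ₑ * f x ∂ν :=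
  (lintegral_const_mul' _ _ enorm_ne_top).symm

lemma enorm_le_one_of_norm {z : ℂ} (h : ‖z‖ ≤ 1) : ‖z‖ₑ ≤ 1 := by
  rw [← ofReal_norm, ← ENNReal.ofReal_one]
  exact ENNReal.ofReal_le_ofReal h

lemma norm_inv_two_pi_I_le : ‖1 / (2 * (Real.pi : ℂ) * I)‖ ≤ 1 := by
  rw [norm_div, norm_mul, norm_mul, norm_I, norm_real, Real.norm_of_nonneg Real.pi_pos.le]
  simp only [norm_one, Complex.norm_ofNat, mul_one]
  rw [div_le_one (by positivity)]
  linarith [Real.pi_gt_three]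

lemma norm_inv_two_pi_I_sq_le : ‖1 / (2 * (Real.pi : ℂ) * I) ^ 2‖ ≤ 1 := by
  rw [← one_div_pow, norm_pow]
  exact pow_le_one₀ (norm_nonneg _) norm_inv_two_pi_I_le

lemma norm_N2_const_le : ‖1 / (2 * (Real.pi : ℂ) ^ 2 * (2 * Real.pi * I))‖ ≤ 1 := by
  simp only [norm_div, norm_mul, norm_pow, norm_I, norm_real, Real.norm_of_nonneg Real.pi_pos.le,
    norm_one, Complex.norm_ofNat, mul_one]
  have := Real.pi_gt_three
  rw [div_le_one (by positivity)]
  nlinarith [sq_nonneg Real.pi]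

variable (Δ : ℝ) (c : Contours) (μ : Fin 3 → ℂ) (v u s : ℂ × ℂ)

/-- For extended norms the integral of a norm dominates the norm of the integral without any
integrability assumption. The free factor a lets the bounds for the nested integrals be chained. -/
lemma enorm_mul_R_le (a t₁ : ℂ) : ‖a * R Δ c μ v u s t₁‖ₑ ≤
    ∫⁻ x, ∫⁻ z, ∫⁻ t, ‖a * core Δ μ v u s t₁ (pt c.r.1 x) (pt c.r.2 z) (pt c.t.2 t)‖ₑ := by
  have hN : ∀ r₁ r₂ : ℂ, ‖kerR Δ μ s (r₁, r₂) * N2 c v u s (r₁, r₂) t₁‖ₑ ≤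
      ∫⁻ t, ‖core Δ μ v u s t₁ r₁ r₂ (pt c.t.2 t)‖ₑ := by
    intro r₁ r₂
    rw [N2, div_eq_mul_one_div, enorm_mul, enorm_mul, enorm_mul]
    calc _ ≤ ‖kerR Δ μ s (r₁, r₂)‖ₑ * (‖(2 : ℂ) ^ (r₁ + r₂ + u.1 + u.2)‖ₑ * 1 *
          ∫⁻ t, ‖kerN2 v u s (r₁, r₂) t₁ (pt c.t.2 t)‖ₑ) := by
          gcongr
          · exact enorm_le_one_of_norm norm_N2_const_le
          · exact enorm_lineInt_le _ _
      _ = _ := by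
          rw [mul_one, ← mul_assoc, ← enorm_mul, enorm_mul_lintegral]
          refine lintegral_congr fun t => ?_
          rw [← enorm_mul, core]
  rw [R, enorm_mul, enorm_mul]
  calc _ ≤ ‖a‖ₑ * (1 * ∫⁻ x, ∫⁻ z, ∫⁻ t,
        ‖core Δ μ v u s t₁ (pt c.r.1 x) (pt c.r.2 z) (pt c.t.2 t)‖ₑ) := by
        gcongr
        · exact enorm_le_one_of_norm norm_inv_two_pi_I_sq_le
        · refine (enorm_lineInt_le _ _).trans (lintegral_mono fun x => ?_)
          exact (enorm_lineInt_le _ _).trans (lintegral_mono fun z => hN _ _)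
    _ = _ := by simp only [one_mul, enorm_mul_lintegral, ← enorm_mul]

lemma enorm_mul_N1_le (a : ℂ) : ‖a * N1 Δ c μ v u s‖ₑ ≤
    ∫⁻ b, ∫⁻ x, ∫⁻ z, ∫⁻ t, ‖a * kerN1 u s (pt c.t.1 b) *
      core Δ μ v u s (pt c.t.1 b) (pt c.r.1 x) (pt c.r.2 z) (pt c.t.2 t)‖ₑ := by
  rw [N1, enorm_mul, enorm_mul]
  calc _ ≤ ‖a‖ₑ * (1 * ∫⁻ b, ‖kerN1 u s (pt c.t.1 b) * R Δ c μ v u s (pt c.t.1 b)‖ₑ) := by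
        gcongr
        · exact enorm_le_one_of_norm norm_inv_two_pi_I_le
        · exact enorm_lineInt_le _ _
    _ = ∫⁻ b, ‖a * kerN1 u s (pt c.t.1 b) * R Δ c μ v u s (pt c.t.1 b)‖ₑ := by
        simp only [one_mul, enorm_mul_lintegral, ← enorm_mul, ← mul_assoc]
    _ ≤ _ := lintegral_mono fun b => enorm_mul_R_le Δ c μ v u s _ _

lemma enorm_mul_T_le (a : ℂ) (y : ℝ × ℝ) : ‖a * T Δ c μ u y‖ₑ ≤
    ∫⁻ d, ∫⁻ e, ∫⁻ b, ∫⁻ x, ∫⁻ z, ∫⁻ t, ‖a * coreT Δ μ u y (pt c.s.1 d) (pt c.s.2 e)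
      (pt c.t.1 b) (pt c.r.1 x) (pt c.r.2 z) (pt c.t.2 t)‖ₑ := by
  rw [T, enorm_mul, enorm_mul]
  calc _ ≤ ‖a‖ₑ * (1 * ∫⁻ d, ∫⁻ e, ‖yPow y (pt c.s.1 d, pt c.s.2 e) * Gamma (pt c.s.2 e - u.2) *
        N1 Δ c μ (sgn y) u (pt c.s.1 d, pt c.s.2 e)‖ₑ) := by
        gcongr
        · exact enorm_le_one_of_norm norm_inv_two_pi_I_sq_le
        · refine (enorm_lineInt_le _ _).trans (lintegral_mono fun x => ?_)
          exact enorm_lineInt_le _ _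
    _ = ∫⁻ d, ∫⁻ e, ‖a * (yPow y (pt c.s.1 d, pt c.s.2 e) * Gamma (pt c.s.2 e - u.2)) *
        N1 Δ c μ (sgn y) u (pt c.s.1 d, pt c.s.2 e)‖ₑ := by
        simp only [one_mul, enorm_mul_lintegral, ← enorm_mul, ← mul_assoc]
    _ ≤ _ := by
        refine lintegral_mono fun d => lintegral_mono fun e => ?_
        refine (enorm_mul_N1_le Δ c μ _ u _ _).trans (le_of_eq ?_)
        simp only [coreT, mul_assoc]

end

/-! ### Measurability, the spectral double integral, and passage to the majorant. -/

section

@[fun_prop]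
lemma Measurable.cGamma {α : Type*} [MeasurableSpace α] {f : α → ℂ} (hf : Measurable f) :
    Measurable fun x => Gamma (f x) := measurable_Gamma.comp hf

@[fun_prop]
lemma Measurable.pt {α : Type*} [MeasurableSpace α] (c : ℝ) {f : α → ℝ} (hf : Measurable f) :
    Measurable fun x => pt c (f x) := by
  unfold SL3.pt
  fun_prop

@[fun_prop]
lemma Measurable.core {α : Type*} [MeasurableSpace α] (Δ : ℝ) (μ : Fin 3 → ℂ) (v : ℂ × ℂ)
    {u₁ u₂ s₁ s₂ t₁ r₁ r₂ t₂ : α → ℂ} (h1 : Measurable u₁) (h2 : Measurable u₂)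
    (h3 : Measurable s₁) (h4 : Measurable s₂) (h5 : Measurable t₁) (h6 : Measurable r₁)
    (h7 : Measurable r₂) (h8 : Measurable t₂) :
    Measurable fun x => core Δ μ v (u₁ x, u₂ x) (s₁ x, s₂ x) (t₁ x) (r₁ x) (r₂ x) (t₂ x) := by
  unfold SL3.core kerR kerN2 Awl betaFn Gstar G
  fun_prop

@[fun_prop]
lemma Measurable.kerN1 {α : Type*} [MeasurableSpace α]
    {u₁ u₂ s₁ s₂ t₁ : α → ℂ} (h1 : Measurable u₁) (h3 : Measurable s₁) (h5 : Measurable t₁) :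
    Measurable fun x => kerN1 (u₁ x, u₂ x) (s₁ x, s₂ x) (t₁ x) := by
  unfold SL3.kerN1
  fun_prop

@[fun_prop]
lemma Measurable.yPow {α : Type*} [MeasurableSpace α] (y : ℝ × ℝ) {s₁ s₂ : α → ℂ}
    (h3 : Measurable s₁) (h4 : Measurable s₂) : Measurable fun x => yPow y (s₁ x, s₂ x) := by
  unfold SL3.yPow
  fun_prop

@[fun_prop]
lemma Measurable.coreT {α : Type*} [MeasurableSpace α] (Δ : ℝ) (μ : Fin 3 → ℂ) (y : ℝ × ℝ)
    {u₁ u₂ s₁ s₂ t₁ r₁ r₂ t₂ : α → ℂ} (h1 : Measurable u₁) (h2 : Measurable u₂)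
    (h3 : Measurable s₁) (h4 : Measurable s₂) (h5 : Measurable t₁) (h6 : Measurable r₁)
    (h7 : Measurable r₂) (h8 : Measurable t₂) :
    Measurable fun x => coreT Δ μ (u₁ x, u₂ x) y (s₁ x) (s₂ x) (t₁ x) (r₁ x) (r₂ x) (t₂ x) := by
  unfold SL3.coreT
  fun_prop

lemma enorm_le_xp {z : ℂ} {a : ℝ} (h : ‖z‖ ≤ Real.exp a) : ‖z‖ₑ ≤ xp a := by
  rw [← ofReal_norm]
  exact ENNReal.ofReal_le_ofReal h

/-- The double integral over the spectral variables. -/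
lemma lintegral_spec {Δ : ℝ} (hΔ0 : 0 ≤ Δ) (hΔ1 : Δ ≤ 1) {ρ σ : Fin 3 → ℝ} {τ κ γ : ℝ}
    (P : SpecParams ρ σ τ κ γ) : ∃ K : ℝ, ∀ m : Fin 3 → ℝ, ∀ p q s : Fin 3, Mid m p q s →
    ∀ e : ℝ, ∀ b : ℝ → ℝ, ∀ Φ : ℝ → ℝ → ENNReal,
      (∀ z x, Φ z x ≤ xp (e + specExp Δ ρ σ τ m x z - γ * lg (x - b z))) →
      ∫⁻ z, ∫⁻ x, Φ z x ≤
        xp (K + e + labelMain ρ σ τ κ γ m p q s) + xp (K + e + labelMain ρ σ τ κ γ m s q p) := by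
  obtain ⟨K₁, h₁⟩ := lintegral_spec_fst hΔ0 hΔ1 P
  obtain ⟨K₂, h₂⟩ := lintegral_spec_snd P
  refine ⟨K₁ + K₂, fun m p q s h e b Φ hΦ => ?_⟩
  calc ∫⁻ z, ∫⁻ x, Φ z x
      ≤ ∫⁻ z, xp (e + K₁) * (xp (labelExpZ ρ σ τ κ γ m p q s z) +
          xp (labelExpZ ρ σ τ κ γ m s q p z)) := by
        refine lintegral_mono fun z => ?_
        have h5 : ∫⁻ x, Φ z x ≤ ∫⁻ x, xp e * xp (specExp Δ ρ σ τ m x z - γ * lg (x - b z)) := by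
          refine lintegral_mono fun x => ?_
          rw [← xp_add, ← add_sub_assoc]
          exact hΦ z x
        rw [lintegral_const_mul' _ _ (xp_lt_top e).ne] at h5
        refine (h5.trans (mul_le_mul' le_rfl (h₁ m p q s h z (b z)))).trans (le_of_eq ?_)
        rw [xp_add, xp_add, xp_add, ← mul_add, ← mul_assoc]
    _ ≤ xp (e + K₁) * (xp (K₂ + labelMain ρ σ τ κ γ m p q s) +
          xp (K₂ + labelMain ρ σ τ κ γ m s q p)) := by
        rw [lintegral_const_mul' _ _ (xp_lt_top _).ne,
          lintegral_add_left (by unfold labelExpZ; fun_prop)]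
        exact mul_le_mul' le_rfl (add_le_add (h₂ m p q s) (h₂ m s q p))
    _ = _ := by
        rw [mul_add, ← xp_add, ← xp_add]
        congr 2 <;> ring

/-- From a bound by the outcome of the integrations to a bound by the majorant. -/
lemma norm_le_majorant {ρ σ : Fin 3 → ℝ} {τ κ γ ε κ' δ' : ℝ} {W : Fin 3 → ℝ}
    (h1 : 0 ≤ (κ' - δ') / 2 + ε) (h2 : 0 ≤ δ' + ε)
    (D : Dominated ρ σ τ κ γ W ((κ' - δ') / 2 + ε) (δ' + ε)) (μ : Fin 3 → ℂ) {p q s : Fin 3}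
    (h : Mid (fun i => (μ i).im) p q s) {E : ℂ} {k e K : ℝ}
    (hE : ‖E‖ₑ ≤ xp k * (xp (e + labelMain ρ σ τ κ γ (fun i => (μ i).im) p q s) +
      xp (e + labelMain ρ σ τ κ γ (fun i => (μ i).im) s q p)))
    (hk : k + e ≤ K + rootLin W (fun i => (μ i).im)) :
    ‖E‖ ≤ 2 * Real.exp ((10 + κ' + 3 * ε) * Real.log 2) * Real.exp K * Msym ε κ' δ' μ := by
  have d1 := exp_labelMain_le h1 h2 (D p q s h.pq h.qs h.ps) μ h
  have d2 := exp_labelMain_le h1 h2 (D s q p h.qs.symm h.pq.symm h.ps.symm) μ h.symm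
  have hM : 0 ≤ Msym ε κ' δ' μ := Finset.sum_nonneg fun w _ => by unfold Mpoly; positivity
  rw [← ofReal_norm, mul_add, ← xp_add, ← xp_add, xp, xp,
    ← ENNReal.ofReal_add (Real.exp_pos _).le (Real.exp_pos _).le,
    ENNReal.ofReal_le_ofReal_iff (by positivity)] at hE
  refine hE.trans ?_
  have key : ∀ {L : ℝ}, Real.exp (L + rootLin W (fun i => (μ i).im)) ≤
      Real.exp ((10 + κ' + 3 * ε) * Real.log 2) * Msym ε κ' δ' μ →
      Real.exp (k + (e + L)) ≤
        Real.exp K * (Real.exp ((10 + κ' + 3 * ε) * Real.log 2) * Msym ε κ' δ' μ) := by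
    intro L hL
    calc _ ≤ Real.exp (K + (L + rootLin W (fun i => (μ i).im))) :=
          Real.exp_le_exp.2 (by linarith)
      _ = Real.exp K * Real.exp (L + rootLin W (fun i => (μ i).im)) := Real.exp_add _ _
      _ ≤ _ := by gcongr
  calc _ ≤ _ := add_le_add (key d1) (key d2)
    _ = _ := by ring

lemma exp_mul_ylog {y : ℝ} (hy : y ≠ 0) (a : ℝ) :
    Real.exp (a * ylog y) = Real.exp (a * Real.log (4 * Real.pi ^ 2)) * |y| ^ a := by
  have : 0 < |y| := abs_pos.2 hy
  have hπ := Real.pi_pos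
  rw [ylog, Real.log_mul (by positivity) this.ne', mul_add, Real.exp_add,
    Real.rpow_def_of_pos this, mul_comm (Real.log |y|)]

/-- Separates the factors of fixed size on the contours, the factor G* depending on r only, and the
kernel for which the inner integrals were estimated. -/
lemma coreT_eq (Δ : ℝ) (μ : Fin 3 → ℂ) (u : ℂ × ℂ) (y : ℝ × ℝ) (s₁ s₂ t₁ r₁ r₂ t₂ : ℂ) :
    coreT Δ μ u y s₁ s₂ t₁ r₁ r₂ t₂ = yPow y (s₁, s₂) *
      (2 : ℂ) ^ (r₁ + r₂ + u.1 + u.2) * Gstar (1 + 2 * Δ + r₁, Δ + r₂) (fun i => -μ i) *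
      (kerN2 (sgn y) u (s₁, s₂) (r₁, r₂) t₁ t₂ * Gamma (1 + s₁ - r₂) * Gamma t₁ *
        Gamma (s₁ - u.1 - t₁) * Gamma (s₂ - u.2)) := by
  rw [coreT, core, kerN1, kerR]
  ring

lemma exists_re_eq {μ : Fin 3 → ℂ} {a b : ℝ} (h : μ 0 + μ 1 + μ 2 = 0) (ha : (μ 0).re = a)
    (hb : (μ 1).re = b) : ∀ i, (μ i).re = ![a, b, -a - b] i := by
  have h' := congrArg re h
  simp only [add_re, zero_re, ha, hb] at h'
  intro i
  fin_cases i
  · exact ha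
  · exact hb
  · change (μ 2).re = -a - b
    linarith

end

section

/-! ## The terms with a double residue -/

/-- When u₁ = μ₁, the decay in r₂ - u₁ gained from the inner integrals has the shape of a spectral
weight and can be absorbed into σ. -/
lemma specExp_add_single (Δ : ℝ) (ρ σ : Fin 3 → ℝ) (τ ξ : ℝ) (m : Fin 3 → ℝ) (x z : ℝ) :
    specExp Δ ρ (fun i => σ i + ![ξ, 0, 0] i) τ m x z =
      specExp Δ ρ σ τ m x z - ξ * lg (z - m 0) := by
  simp only [specExp, Fin.sum_univ_three]
  simp
  ring

/-- The integration over the spectral variables and the comparison with the majorant, once the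
integrals over the other variables have been estimated. -/
lemma doubleResidue_bound {δ Δ a₁ a₂ κ ξ ε κ' δ' : ℝ} {η : Fin 3 → ℝ} (hδ : 0 < δ)
    (hΔ0 : 0 ≤ Δ) (hΔ1 : Δ ≤ 1)
    (h1 : ∀ i, gammaRange δ ((1 + 2 * Δ + a₁ + η i) / 2))
    (h2 : ∀ i, gammaRange δ ((Δ + a₂ - η i) / 2))
    (h3 : -1 ≤ (1 + 3 * Δ + a₁ + a₂) / 2) (h4 : (1 + 3 * Δ + a₁ + a₂) / 2 ≤ 3)
    (h5 : ∀ i j, |η i - η j| < 2) (h6 : ∀ i j, |η i - η j| ≠ 1)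
    (r1 : gammaRange δ ((η 0 - η 1) / 2)) (r2 : gammaRange δ ((η 0 - η 2) / 2))
    (r3 : gammaRange δ ((η 2 - η 1) / 2))
    (P : SpecParams (fun i => (a₁ + η i) / 2) (fun i => (1 + η i - a₂) / 2 + ![ξ, 0, 0] i)
      ((a₁ + a₂) / 2) κ 0)
    (hA : 0 ≤ (κ' - δ') / 2 + ε) (hB : 0 ≤ δ' + ε)
    (D : Dominated (fun i => (a₁ + η i) / 2) (fun i => (1 + η i - a₂) / 2 + ![ξ, 0, 0] i)
      ((a₁ + a₂) / 2) κ 0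
      ![1 / 2 + (η 2 - η 1) / 2, 1 / 2 + (η 0 - η 2) / 2, 1 / 2 + (η 0 - η 1) / 2]
      ((κ' - δ') / 2 + ε) (δ' + ε)) (K : ℝ) :
    ∃ C : ℝ, 0 ≤ C ∧ ∀ μ : Fin 3 → ℂ, (∀ i, (μ i).re = η i) → ∀ Y : ℝ, ∀ J : ENNReal,
      ∀ Φ : ℝ → ℝ → ENNReal, J ≤ ∫⁻ z, ∫⁻ x, Φ z x →
      (∀ z x, Φ z x ≤ xp (K + Y - ξ * lg (z - (μ 0).im)) *
        ‖Gstar (1 + 2 * Δ + pt a₁ x, Δ + pt a₂ z) (fun i => -μ i)‖ₑ) →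
      J < ⊤ ∧ ∀ E : ℂ, ‖E‖ₑ ≤ ‖GstarB μ * (kadj Δ μ * c3InvSq μ)‖ₑ * J →
        ‖E‖ ≤ C * Real.exp Y * Msym ε κ' δ' μ := by
  have h5' : ∀ i j, |η i - η j| ≤ 2 := fun i j => (h5 i j).le
  obtain ⟨K₁, k₁⟩ := norm_Gstar_spec_le hδ h1 h2 h3 h4 h5'
  obtain ⟨K₂, k₂⟩ := norm_kadj_mul_c3InvSq_le hΔ0 hΔ1 h5 h6
  obtain ⟨K₃, k₃⟩ := norm_GstarB_le hδ h5' r1 r2 r3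
  obtain ⟨K₄, k₄⟩ := lintegral_spec hΔ0 hΔ1 P
  refine ⟨2 * Real.exp ((10 + κ' + 3 * ε) * Real.log 2) * Real.exp (K + K₁ + K₂ + K₃ + K₄),
    by positivity, fun μ hμ Y J Φ hJ hΦ => ?_⟩
  set m : Fin 3 → ℝ := fun i => (μ i).im with hm
  obtain ⟨p, q, s, hmid⟩ := exists_mid m
  set e : ℝ := K + Y + K₁ + Δ * rootSum m + ((η 0 - η 1) / 2 * lg (m 0 - m 1) +
    (η 0 - η 2) / 2 * lg (m 0 - m 2) + (η 1 - η 2) / 2 * lg (m 1 - m 2)) with he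
  have hJ' := hJ.trans (k₄ m p q s hmid e (fun _ => 0) Φ fun z x => ?_)
  · refine ⟨hJ'.trans_lt (ENNReal.add_lt_top.2 ⟨xp_lt_top _, xp_lt_top _⟩), fun E hE => ?_⟩
    have hpre := enorm_le_xp (z := GstarB μ * (kadj Δ μ * c3InvSq μ)) (a := _) (by
      rw [norm_mul]
      refine (mul_le_mul (k₃ μ hμ) (k₂ μ hμ) (norm_nonneg _) (Real.exp_pos _).le).trans_eq ?_
      rw [← Real.exp_add])
    have hE' := hE.trans (mul_le_mul' hpre hJ')
    -- The root exponents collect as follows: 1 - Δ from `kadj * c3InvSq`, Δ from the normalization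
    -- of `specExp`, the powers of `GstarB`, and (η_i - η_j)/2 from the Λ inside `Gstar`. Δ cancels
    -- and the vector of weights in `D` is left.
    have := norm_le_majorant hA hB D μ hmid hE'
      (K := K + K₁ + K₂ + K₃ + K₄ + Y) (by
        rw [he, rootLin, rootSum]
        simp
        linarith)
    refine this.trans_eq ?_
    rw [Real.exp_add _ Y]
    ring
  · refine (hΦ z x).trans ?_
    have := enorm_le_xp (k₁ μ hμ (pt a₁ x) (pt a₂ z) (pt_re _ _) (pt_re _ _))
    refine (mul_le_mul' le_rfl this).trans ?_
    rw [← xp_add, specExp_add_single]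
    apply xp_mono
    simp only [pt_im, he]
    linarith

end

/-! ### Iterated integrals in the order of the definitions, constant factors, and the simplest
double-residue term. -/

section

lemma lintegral_iter_four {f : ℝ × ℝ × ℝ × ℝ → ENNReal} (hf : Measurable f) :
    ∫⁻ p, f p = ∫⁻ a, ∫⁻ b, ∫⁻ x, ∫⁻ z, f (a, b, x, z) := by
  rw [Measure.volume_eq_prod, lintegral_prod _ hf.aemeasurable]
  refine lintegral_congr fun a => ?_
  have h1 : Measurable fun q => f (a, q) := by fun_prop
  rw [Measure.volume_eq_prod, lintegral_prod _ h1.aemeasurable]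
  refine lintegral_congr fun b => ?_
  have h2 : Measurable fun q => f (a, b, q) := by fun_prop
  rw [Measure.volume_eq_prod, lintegral_prod _ h2.aemeasurable]

lemma lintegral_iter_five {f : ℝ × ℝ × ℝ × ℝ × ℝ → ENNReal} (hf : Measurable f) :
    ∫⁻ p, f p = ∫⁻ a, ∫⁻ b, ∫⁻ x, ∫⁻ z, ∫⁻ t, f (a, b, x, z, t) := by
  rw [Measure.volume_eq_prod, lintegral_prod _ hf.aemeasurable]
  refine lintegral_congr fun a => lintegral_iter_four (by fun_prop)

lemma lintegral_iter_six {f : ℝ × ℝ × ℝ × ℝ × ℝ × ℝ → ENNReal} (hf : Measurable f) :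
    ∫⁻ p, f p = ∫⁻ a, ∫⁻ b, ∫⁻ c, ∫⁻ x, ∫⁻ z, ∫⁻ t, f (a, b, c, x, z, t) := by
  rw [Measure.volume_eq_prod, lintegral_prod _ hf.aemeasurable]
  refine lintegral_congr fun a => lintegral_iter_five (by fun_prop)

lemma norm_const_five_le : ‖3 / (32 * (Real.pi : ℂ) ^ 5 * (2 * Real.pi * I))‖ ≤ 1 := by
  have h := Real.pi_gt_three
  have h5 : (1 : ℝ) ≤ Real.pi ^ 5 := one_le_pow₀ (by linarith)
  simp only [norm_div, norm_mul, norm_pow, Complex.norm_real, Complex.norm_I, Complex.norm_ofNat,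
    Real.norm_eq_abs, abs_of_pos Real.pi_pos]
  rw [div_le_one (by positivity)]
  nlinarith

lemma norm_const_five_sq_le : ‖3 / (32 * (Real.pi : ℂ) ^ 5 * (2 * Real.pi * I) ^ 2)‖ ≤ 1 := by
  have h := Real.pi_gt_three
  have h5 : (1 : ℝ) ≤ Real.pi ^ 5 := one_le_pow₀ (by linarith)
  simp only [norm_div, norm_mul, norm_pow, Complex.norm_real, Complex.norm_I, Complex.norm_ofNat,
    Real.norm_eq_abs, abs_of_pos Real.pi_pos]
  rw [div_le_one (by positivity)]
  nlinarith

lemma enorm_mul_le_xp {y : ℝ × ℝ} (h1 : y.1 ≠ 0) (h2 : y.2 ≠ 0) (s₁ s₂ w g k : ℂ) {b : ℝ}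
    (hk : ‖k‖ ≤ Real.exp b) :
    ‖yPow y (s₁, s₂) * (2 : ℂ) ^ w * g * k‖ₑ ≤
      xp (-s₁.re * ylog y.1 + -s₂.re * ylog y.2 + Real.log 2 * w.re) * ‖g‖ₑ * xp b := by
  rw [enorm_mul, enorm_mul]
  refine mul_le_mul' (mul_le_mul' (enorm_le_xp ?_) le_rfl) (enorm_le_xp hk)
  rw [norm_mul, norm_yPow h1 h2, norm_two_cpow, ← Real.exp_add]

lemma xp_collect (a b c : ℝ) (g : ENNReal) : xp a * g * xp b * xp c = xp (a + b + c) * g := by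
  rw [xp_add, xp_add]
  ring

lemma enorm_prefactor_le {c B Q L : ℂ} {J : ENNReal} (hc : ‖c‖ ≤ 1) (hL : ‖L‖ₑ ≤ J) :
    ‖c * B * Q * L‖ₑ ≤ ‖B * Q‖ₑ * J := by
  rw [mul_assoc c, mul_assoc c, enorm_mul, enorm_mul]
  exact (mul_le_mul' (enorm_le_one_of_norm hc) (mul_le_mul' le_rfl hL)).trans_eq (one_mul _)

/-! ### The sixth error term -/

lemma specParams_six {ε : ℝ} (h0 : 0 < ε) (h1 : ε ≤ 1 / 100000) :
    SpecParams (fun i => (0 + ![-ε, ε, - -ε - ε] i) / 2)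
      (fun i => (1 + ![-ε, ε, - -ε - ε] i - 0) / 2 + ![0, 0, 0] i) ((0 + 0) / 2) (ε / 4) 0 := by
  refine ⟨by norm_num, by norm_num, ?_, ?_, ?_, ?_, ?_, ?_, by linarith, by linarith, le_rfl,
    by norm_num, ?_, ?_⟩
  iterate 4 · intro i; fin_cases i <;> simp <;> linarith
  iterate 4 · intro i j; fin_cases i <;> fin_cases j <;> simp <;> linarith

/-- For each of the six orderings the condition is a list of linear inequalities in ε. -/
lemma dominated_six {ε : ℝ} (h0 : 0 < ε) (h1 : ε ≤ 1 / 100000) :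
    Dominated (fun i => (0 + ![-ε, ε, - -ε - ε] i) / 2)
      (fun i => (1 + ![-ε, ε, - -ε - ε] i - 0) / 2 + ![0, 0, 0] i) ((0 + 0) / 2) (ε / 4) 0
      ![1 / 2 + (![-ε, ε, - -ε - ε] 2 - ![-ε, ε, - -ε - ε] 1) / 2,
        1 / 2 + (![-ε, ε, - -ε - ε] 0 - ![-ε, ε, - -ε - ε] 2) / 2,
        1 / 2 + (![-ε, ε, - -ε - ε] 0 - ![-ε, ε, - -ε - ε] 1) / 2]
      ((2 - 1 / 2) / 2 + ε) (1 / 2 + ε) := by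
  intro p q s h1 h2 h3
  rcases perm_cases h1 h2 h3 with h | h | h | h | h | h <;> obtain ⟨rfl, rfl, rfl⟩ := h <;>
    simp [DominatedAt, abs_le] <;> refine ⟨?_, ?_, ?_, ?_, ?_⟩ <;> linarith

lemma errorTerm_six {Δ ε : ℝ} (hΔ : 0 < Δ) (hΔ1 : Δ < 1 / 10) (h0 : 0 < ε)
    (h1 : ε ≤ Δ / 10000) : ∃ C : ℝ, 0 ≤ C ∧ ∀ μ : Fin 3 → ℂ, μ 0 + μ 1 + μ 2 = 0 →
    (μ 0).re = -ε → (μ 1).re = ε → ∀ y : ℝ × ℝ, y.1 ≠ 0 → y.2 ≠ 0 →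
    absConv6 Δ (contourTable ε 5) μ y ∧ ‖E6 Δ (contourTable ε 5) μ y‖ ≤
      C * Real.exp ((1 / 2 + ε) * ylog y.1 + (1 / 2 + ε) * ylog y.2) * Msym ε 2 (1 / 2) μ := by
  have h2 : ε ≤ 1 / 100000 := by linarith
  obtain ⟨K₁, k₁⟩ := norm_kerD_le h0 h2
  obtain ⟨K₂, k₂⟩ := lintegral_innerD h0 h2
  obtain ⟨C, hC, k₃⟩ := doubleResidue_bound (δ := ε / 4) (Δ := Δ) (a₁ := 0) (a₂ := 0) (κ := ε / 4)
    (ξ := 0) (ε := ε) (κ' := 2) (δ' := 1 / 2) (η := ![-ε, ε, - -ε - ε]) (by linarith) hΔ.le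
    (by linarith)
    (by intro i; fin_cases i <;> simp [gammaRange] <;> left <;> constructor <;> linarith)
    (by intro i; fin_cases i <;> simp [gammaRange] <;> left <;> constructor <;> linarith)
    (by linarith) (by linarith)
    (by intro i j; fin_cases i <;> fin_cases j <;> simp [abs_lt] <;> constructor <;> linarith)
    (by intro i j; apply ne_of_lt
        fin_cases i <;> fin_cases j <;> simp [abs_lt] <;> constructor <;> linarith)
    (by simp [gammaRange]; right; constructor <;> linarith)
    (by simp [gammaRange]; right; constructor <;> linarith)
    (by simp [gammaRange]; right; constructor <;> linarith)
    (specParams_six h0 h2) (by linarith) (by linarith) (dominated_six h0 h2)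
      (K₁ + K₂ + Real.log 2 * (0 + 0 + -ε + -ε))
  refine ⟨C, hC, fun μ hs e0 e1 y y1 y2 => ?_⟩
  have hμ := exists_re_eq hs e0 e1
  have hmeas : Measurable fun p : ℝ × ℝ × ℝ × ℝ × ℝ × ℝ =>
      coreT Δ μ (μ 0, -μ 1) y (pt (-(1 / 2) - ε) p.1) (pt (-(1 / 2) - ε) p.2.1)
        (pt ε p.2.2.1) (pt 0 p.2.2.2.1) (pt 0 p.2.2.2.2.1) (pt ε p.2.2.2.2.2) := by fun_prop
  obtain ⟨hfin, hb⟩ := k₃ μ hμ ((1 / 2 + ε) * ylog y.1 + (1 / 2 + ε) * ylog y.2) _ _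
    (lintegral_order_six hmeas.enorm).le (fun z x => by
      calc _ ≤ ∫⁻ t₂, ∫⁻ t₁, ∫⁻ s₂, ∫⁻ s₁, xp ((1 / 2 + ε) * ylog y.1 + (1 / 2 + ε) * ylog y.2 +
              Real.log 2 * (0 + 0 + -ε + -ε)) *
                ‖Gstar (1 + 2 * Δ + pt 0 x, Δ + pt 0 z) (fun i => -μ i)‖ₑ *
              xp (K₁ + innerD ε (μ 0).im (-μ 1).im s₁ s₂ x z t₁ t₂) := by
            refine lintegral_mono fun t₂ => lintegral_mono fun t₁ => lintegral_mono fun s₂ =>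
              lintegral_mono fun s₁ => ?_
            have := k₁ (sgn y) (μ 0, -μ 1) (pt (-(1 / 2) - ε) s₁, pt (-(1 / 2) - ε) s₂)
              (pt 0 x, pt 0 z) (pt ε t₁) (pt ε t₂) (isSigns_sgn y) e0 (by simp [e1])
              (pt_re _ _) (pt_re _ _) (pt_re _ _) (pt_re _ _) (pt_re _ _) (pt_re _ _)
            dsimp only
            rw [coreT_eq]
            refine (enorm_mul_le_xp y1 y2 _ _ _ _ _ this).trans_eq ?_
            simp [e0, e1]
            ring_nf
        _ ≤ _ := by
            -- G* and the power of y do not depend on the imaginary parts of s and t, so they come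
            -- out of the four inner integrals.
            simp_rw [xp_add K₁, ← mul_assoc]
            have hne : ∀ a b c, xp a * ‖Gstar b c‖ₑ * xp K₁ ≠ ⊤ := fun a b c =>
              ENNReal.mul_ne_top (ENNReal.mul_ne_top (xp_lt_top _).ne enorm_ne_top) (xp_lt_top _).ne
            simp_rw [lintegral_const_mul' _ _ (hne _ _ _)]
            refine (mul_le_mul' le_rfl (k₂ _ _ _ _)).trans_eq ?_
            rw [xp_collect]
            congr 2
            ring)
  refine ⟨⟨hmeas.aestronglyMeasurable, hfin⟩, hb _ ?_⟩
  refine enorm_prefactor_le norm_const_five_sq_le ?_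
  rw [lintegral_iter_six hmeas.enorm]
  refine (enorm_lineInt_le _ _).trans (lintegral_mono fun s₁ => (enorm_lineInt_le _ _).trans
    (lintegral_mono fun s₂ => (enorm_mul_N1_le _ _ _ _ _ _ _).trans_eq ?_))
  simp only [coreT, sub_neg_eq_add]
  rfl

end

section

/-! ### The fourth error term -/

lemma specParams_four {ε : ℝ} (h0 : 0 < ε) (h1 : ε ≤ 1 / 100000) :
    SpecParams (fun i => (-4 * ε + ![-ε, 1 / 2 + 3 * ε, - -ε - (1 / 2 + 3 * ε)] i) / 2)
      (fun i => (1 + ![-ε, 1 / 2 + 3 * ε, - -ε - (1 / 2 + 3 * ε)] i - 100 * ε) / 2 +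
        ![95 * ε, 0, 0] i) ((-4 * ε + 100 * ε) / 2) (ε / 4) 0 := by
  refine ⟨by linarith, by linarith, ?_, ?_, ?_, ?_, ?_, ?_, by linarith, by linarith, le_rfl,
    by norm_num, ?_, ?_⟩
  iterate 4 · intro i; fin_cases i <;> simp <;> linarith
  iterate 4 · intro i j; fin_cases i <;> fin_cases j <;> simp <;> linarith

lemma dominated_four {ε : ℝ} (h0 : 0 < ε) (h1 : ε ≤ 1 / 100000) :
    Dominated (fun i => (-4 * ε + ![-ε, 1 / 2 + 3 * ε, - -ε - (1 / 2 + 3 * ε)] i) / 2)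
      (fun i => (1 + ![-ε, 1 / 2 + 3 * ε, - -ε - (1 / 2 + 3 * ε)] i - 100 * ε) / 2 +
        ![95 * ε, 0, 0] i) ((-4 * ε + 100 * ε) / 2) (ε / 4) 0
      ![1 / 2 + (![-ε, 1 / 2 + 3 * ε, - -ε - (1 / 2 + 3 * ε)] 2 -
        ![-ε, 1 / 2 + 3 * ε, - -ε - (1 / 2 + 3 * ε)] 1) / 2,
        1 / 2 + (![-ε, 1 / 2 + 3 * ε, - -ε - (1 / 2 + 3 * ε)] 0 -
          ![-ε, 1 / 2 + 3 * ε, - -ε - (1 / 2 + 3 * ε)] 2) / 2,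
        1 / 2 + (![-ε, 1 / 2 + 3 * ε, - -ε - (1 / 2 + 3 * ε)] 0 -
          ![-ε, 1 / 2 + 3 * ε, - -ε - (1 / 2 + 3 * ε)] 1) / 2] ((3 / 2 - 0) / 2 + ε) (0 + ε) := by
  intro p q s h1 h2 h3
  rcases perm_cases h1 h2 h3 with h | h | h | h | h | h <;> obtain ⟨rfl, rfl, rfl⟩ := h <;>
    simp [DominatedAt, abs_le] <;> refine ⟨?_, ?_, ?_, ?_, ?_⟩ <;> linarith

lemma errorTerm_four {Δ ε : ℝ} (hΔ : 0 < Δ) (hΔ1 : Δ < 1 / 10) (h0 : 0 < ε)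
    (h1 : ε ≤ Δ / 10000) : ∃ C : ℝ, 0 ≤ C ∧ ∀ μ : Fin 3 → ℂ, μ 0 + μ 1 + μ 2 = 0 →
    (μ 0).re = -ε → (μ 1).re = 1 / 2 + 3 * ε → ∀ y : ℝ × ℝ, y.1 ≠ 0 → y.2 ≠ 0 →
    absConv4 Δ (contourTable ε 3) μ y ∧ ‖E4 Δ (contourTable ε 3) μ y‖ ≤
      C * Real.exp ((1 / 2 + ε) * ylog y.1 + (1 / 2 + 3 * ε) * ylog y.2) *
        Msym ε (3 / 2) 0 μ := by
  have h2 : ε ≤ 1 / 100000 := by linarith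
  obtain ⟨K₁, k₁⟩ := norm_kerB_le h0 h2
  obtain ⟨K₂, k₂⟩ := lintegral_innerB h0 h2
  -- Re r₂ = 100ε lowers every σ by 50ε. The decay 95ε of `lintegral_innerB`, passed on as ξ, makes
  -- up for it: without ξ the sum of all exponents would exceed the permitted 3/2 + 3ε.
  obtain ⟨C, hC, k₃⟩ := doubleResidue_bound (δ := ε / 4) (Δ := Δ) (a₁ := -4 * ε) (a₂ := 100 * ε)
    (κ := ε / 4) (ξ := 95 * ε) (ε := ε) (κ' := 3 / 2) (δ' := 0)
    (η := ![-ε, 1 / 2 + 3 * ε, - -ε - (1 / 2 + 3 * ε)]) (by linarith) hΔ.le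
    (by linarith)
    (by intro i; fin_cases i <;> simp [gammaRange] <;> left <;> constructor <;> linarith)
    (by
      intro i
      fin_cases i <;> simp [gammaRange]
      · left; constructor <;> linarith
      · right; constructor <;> linarith
      · left; constructor <;> linarith)
    (by linarith) (by linarith)
    (by intro i j; fin_cases i <;> fin_cases j <;> simp [abs_lt] <;> constructor <;> linarith)
    (by
      intro i j h
      rcases eq_or_eq_neg_of_abs_eq h with h | h <;> revert h <;> fin_cases i <;> fin_cases j <;>
        simp <;> intro h <;> linarith)
    (by simp [gammaRange]; right; constructor <;> linarith)
    (by simp [gammaRange]; left; constructor <;> linarith)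
    (by simp [gammaRange]; right; constructor <;> linarith)
    (specParams_four h0 h2) (by linarith) (by linarith) (dominated_four h0 h2)
    (K₁ + K₂ + Real.log 2 * (-4 * ε + 100 * ε + -ε + -(1 / 2 + 3 * ε)))
  refine ⟨C, hC, fun μ hs e0 e1 y y1 y2 => ?_⟩
  have hμ := exists_re_eq hs e0 e1
  set Y := (1 / 2 + ε) * ylog y.1 + (1 / 2 + 3 * ε) * ylog y.2 with hY
  set l := Real.log 2 * (-4 * ε + 100 * ε + -ε + -(1 / 2 + 3 * ε)) with hl
  have hmeas : Measurable fun p : ℝ × ℝ × ℝ × ℝ × ℝ =>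
      yPow y (pt (-(1 / 2) - ε) p.1, -μ 1) *
        kerN1 (μ 0, -μ 1) (pt (-(1 / 2) - ε) p.1, -μ 1) (pt ε p.2.1) *
        core Δ μ (sgn y) (μ 0, -μ 1) (pt (-(1 / 2) - ε) p.1, -μ 1) (pt ε p.2.1)
          (pt (-4 * ε) p.2.2.1) (pt (100 * ε) p.2.2.2.1) (pt (1 / 2 - ε) p.2.2.2.2) := by
    fun_prop
  obtain ⟨hfin, hb⟩ := k₃ μ hμ Y _ _ (lintegral_order_five hmeas.enorm).le (fun z x => by
      calc _ ≤ ∫⁻ t₂, ∫⁻ t₁, ∫⁻ s₁, xp (Y + l) *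
              ‖Gstar (1 + 2 * Δ + pt (-4 * ε) x, Δ + pt (100 * ε) z) (fun i => -μ i)‖ₑ *
              xp (K₁ + innerB ε (μ 0).im (-μ 1).im s₁ x z t₁ t₂) := by
            refine lintegral_mono fun t₂ => lintegral_mono fun t₁ => lintegral_mono fun s₁ => ?_
            have := k₁ (sgn y) (μ 0, -μ 1) (pt (-(1 / 2) - ε) s₁, -μ 1)
              (pt (-4 * ε) x, pt (100 * ε) z) (pt ε t₁) (pt (1 / 2 - ε) t₂) (isSigns_sgn y) rfl
              e0 (by simp [e1]; ring) (pt_re _ _) (pt_re _ _) (pt_re _ _) (pt_re _ _) (pt_re _ _)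
            refine le_trans (le_of_eq ?_) ((enorm_mul_le_xp y1 y2 (pt (-(1 / 2) - ε) s₁) (-μ 1)
              (pt (-4 * ε) x + pt (100 * ε) z + μ 0 + -μ 1)
              (Gstar (1 + 2 * Δ + pt (-4 * ε) x, Δ + pt (100 * ε) z) (fun i => -μ i))
              _ this).trans_eq ?_)
            · rw [core, kerN1, kerR]
              ring_nf
            · simp [e0, e1, hl, hY]
              ring_nf
        _ ≤ _ := by
            simp_rw [xp_add K₁, ← mul_assoc]
            have hne : ∀ a b c, xp a * ‖Gstar b c‖ₑ * xp K₁ ≠ ⊤ := fun a b c =>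
              ENNReal.mul_ne_top (ENNReal.mul_ne_top (xp_lt_top _).ne enorm_ne_top) (xp_lt_top _).ne
            simp_rw [lintegral_const_mul' _ _ (hne _ _ _)]
            refine (mul_le_mul' le_rfl (k₂ _ _ _ _)).trans_eq ?_
            rw [xp_collect]
            congr 2
            ring)
  refine ⟨⟨hmeas.aestronglyMeasurable, hfin⟩, hb _ ?_⟩
  refine enorm_prefactor_le norm_const_five_le ?_
  rw [lintegral_iter_five hmeas.enorm]
  exact (enorm_lineInt_le _ _).trans (lintegral_mono fun s₁ => enorm_mul_N1_le _ _ _ _ _ _ _)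

end

section

/-! ## Shifting a line of integration -/

lemma tendsto_exp_neg_lg {a : ℝ} (ha : 0 < a) :
    Filter.Tendsto (fun τ : ℝ => Real.exp (-a * lg τ)) Filter.atTop (nhds 0) := by
  refine Real.tendsto_exp_atBot.comp ?_
  refine Filter.Tendsto.const_mul_atTop_of_neg (by linarith) ?_
  refine Real.tendsto_log_atTop.comp ?_
  exact Filter.tendsto_atTop_add_const_left _ _ Filter.tendsto_abs_atTop_atTop

/-- A vertical line of integration may be moved within a strip of holomorphy in which the
integrand decays. -/
lemma integral_pt_eq {f : ℂ → ℂ} {c d a B : ℝ} (hcd : c ≤ d) (ha : 0 < a)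
    (hf : ∀ z : ℂ, c ≤ z.re → z.re ≤ d → DifferentiableAt ℂ f z)
    (hB : ∀ z : ℂ, c ≤ z.re → z.re ≤ d → ‖f z‖ ≤ B * Real.exp (-a * lg z.im))
    (hc : Integrable fun τ => f (pt c τ)) (hd : Integrable fun τ => f (pt d τ)) :
    ∫ τ, f (pt c τ) = ∫ τ, f (pt d τ) := by
  have key : ∀ T : ℝ, ‖(∫ τ in (-T)..T, f (pt d τ)) - ∫ τ in (-T)..T, f (pt c τ)‖ ≤
      2 * ((d - c) * (B * Real.exp (-a * lg T))) := by
    intro T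
    -- Cauchy's theorem on the rectangle of height 2T. The horizontal edges are bounded by B (1 +
    -- T)^(-a) times the width and vanish in the limit.
    have h := integral_boundary_rect_eq_zero_of_differentiableOn f (c - T * I) (d + T * I)
      (fun z hz => by
        rw [mem_reProdIm] at hz
        simp [Set.uIcc_of_le hcd] at hz
        exact (hf z hz.1.1 hz.1.2).differentiableWithinAt)
    simp only [sub_re, add_re, sub_im, add_im, ofReal_re, ofReal_im, mul_re, mul_im, I_re, I_im,
      mul_zero, mul_one, zero_add, add_zero, sub_zero, zero_sub, smul_eq_mul] at h
    have e1 : ∀ x y : ℝ, (x : ℂ) + y * I = pt x y := fun _ _ => rfl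
    simp only [e1] at h
    have hor : ∀ T' : ℝ, |T'| = |T| → ‖∫ x in c..d, f (pt x T')‖ ≤
        (B * Real.exp (-a * lg T)) * |d - c| := by
      intro T' hT
      refine intervalIntegral.norm_integral_le_of_norm_le_const fun x hx => ?_
      rw [Set.uIoc_of_le hcd] at hx
      have := hB (pt x T') (by simpa using hx.1.le) (by simpa using hx.2)
      rwa [pt_im, show lg T' = lg T by rw [lg, lg, hT]] at this
    have h1 := hor T rfl
    have h2 := hor (-T) (abs_neg T)
    rw [abs_of_nonneg (by linarith)] at h1 h2
    have h3 : I * ((∫ τ in (-T)..T, f (pt d τ)) - ∫ τ in (-T)..T, f (pt c τ)) =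
        (∫ x in c..d, f (pt x T)) - ∫ x in c..d, f (pt x (-T)) := by
      linear_combination h
    calc _ = ‖I * ((∫ τ in (-T)..T, f (pt d τ)) - ∫ τ in (-T)..T, f (pt c τ))‖ := by
          rw [norm_mul, norm_I, one_mul]
      _ ≤ _ := by
          rw [h3]
          refine (norm_sub_le _ _).trans ?_
          linarith
  have l1 := intervalIntegral_tendsto_integral hd Filter.tendsto_neg_atTop_atBot Filter.tendsto_id
  have l2 := intervalIntegral_tendsto_integral hc Filter.tendsto_neg_atTop_atBot Filter.tendsto_id
  have l3 : Filter.Tendsto (fun T : ℝ => 2 * ((d - c) * (B * Real.exp (-a * lg T)))) Filter.atTop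
      (nhds 0) := by
    have := (((tendsto_exp_neg_lg ha).const_mul B).const_mul (d - c)).const_mul 2
    simpa using this
  have l4 := squeeze_zero_norm key l3
  have := tendsto_nhds_unique (l1.sub l2) l4
  exact (sub_eq_zero.1 this).symm

/-- The version of `integral_pt_eq` with parameters. -/
lemma integral_pt_prod_eq {X : Type*} [MeasureSpace X] [SFinite (volume : Measure X)]
    {F : ℂ → X → ℂ} {c d a : ℝ} (hcd : c ≤ d) (ha : 0 < a)
    (hf : ∀ x, ∀ z : ℂ, c ≤ z.re → z.re ≤ d → DifferentiableAt ℂ (fun z => F z x) z)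
    (hB : ∀ x, ∃ B : ℝ, ∀ z : ℂ, c ≤ z.re → z.re ≤ d → ‖F z x‖ ≤ B * Real.exp (-a * lg z.im))
    (hc : Integrable fun p : ℝ × X => F (pt c p.1) p.2)
    (hd : Integrable fun p : ℝ × X => F (pt d p.1) p.2) :
    ∫ p : ℝ × X, F (pt c p.1) p.2 = ∫ p : ℝ × X, F (pt d p.1) p.2 := by
  rw [Measure.volume_eq_prod] at hc hd ⊢
  rw [integral_prod_symm _ hc, integral_prod_symm _ hd]
  refine integral_congr_ae ?_
  filter_upwards [hc.prod_left_ae, hd.prod_left_ae] with x h1 h2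
  obtain ⟨B, hB'⟩ := hB x
  exact integral_pt_eq hcd ha (hf x) hB' h1 h2

lemma differentiableAt_Gamma_comp {f : ℂ → ℂ} {z : ℂ} (hf : DifferentiableAt ℂ f z)
    (h : 0 < (f z).re) : DifferentiableAt ℂ (fun z => Gamma (f z)) z :=
  DifferentiableAt.comp z (differentiableAt_Gamma _ fun m hm => by
    rw [hm] at h
    simp at h
    linarith [(Nat.cast_nonneg m : (0 : ℝ) ≤ m)]) hf

lemma differentiableAt_Gamma_inv_comp {f : ℂ → ℂ} {z : ℂ} (hf : DifferentiableAt ℂ f z) :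
    DifferentiableAt ℂ (fun z => (Gamma (f z))⁻¹) z :=
  DifferentiableAt.comp (g := fun s => (Gamma s)⁻¹) z (differentiable_one_div_Gamma _) hf

lemma differentiableAt_betaFn_comp {f g : ℂ → ℂ} {z : ℂ} (hf : DifferentiableAt ℂ f z)
    (hg : DifferentiableAt ℂ g z) (h1 : 0 < (f z).re)
    (h2 : DifferentiableAt ℂ (fun z => Gamma (g z)) z) :
    DifferentiableAt ℂ (fun z => betaFn (f z) (g z)) z :=
  ((differentiableAt_Gamma_comp hf h1).mul h2).mul (differentiableAt_Gamma_inv_comp (hf.add hg))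

/-- Along s₁ = u₁ + t₁ only five gamma numerators depend on t₁. The hypotheses keep them to the
right of their poles; the denominators enter through the entire function 1/Γ. -/
lemma differentiableAt_core (Δ : ℝ) (μ : Fin 3 → ℂ) (v : ℂ × ℂ) {u₁ u₂ s₂ t₁ r₁ r₂ t₂ : ℂ}
    (h1 : 0 < (t₁ + t₂).re) (h2 : 0 < (1 - r₁ + s₂ - t₁ - t₂).re) (h3 : 0 < (1 + (u₁ + t₁) - r₂).re)
    (h4 : 0 < (r₂ - 2 * (u₁ + t₁) - t₂ + u₁).re) (h5 : 0 < (1 - 2 * t₁ - t₂).re) :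
    DifferentiableAt ℂ (fun t => core Δ μ v (u₁, u₂) (u₁ + t, s₂) t r₁ r₂ t₂) t₁ := by
  unfold core kerR kerN2
  have g1 := differentiableAt_Gamma_comp (f := fun t => t + t₂) (z := t₁) (by fun_prop) h1
  have g2 := differentiableAt_Gamma_comp (f := fun t => 1 - r₁ + s₂ - t - t₂) (z := t₁)
    (by fun_prop) h2
  have g3 := differentiableAt_Gamma_comp (f := fun t => 1 + (u₁ + t) - r₂) (z := t₁)
    (by fun_prop) h3
  have g4 := differentiableAt_betaFn_comp (f := fun t => (r₂ - 2 * (u₁ + t) - t₂ + u₁) / 2)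
    (g := fun _ => (r₁ - r₂ + t₂ - u₁) / 2) (z := t₁) (by fun_prop) (by fun_prop)
    (by rw [div_ofNat_re]; linarith) (by fun_prop)
  have g5 := differentiableAt_betaFn_comp (f := fun t => (1 - 2 * t - t₂) / 2)
    (g := fun _ => (1 - r₁ - u₁) / 2) (z := t₁) (by fun_prop) (by fun_prop)
    (by rw [div_ofNat_re]; linarith) (by fun_prop)
  have hA : DifferentiableAt ℂ (fun t => Awl v (u₁, u₂) (u₁ + t, s₂) (r₁, r₂) t t₂) t₁ := by
    unfold Awl
    fun_prop
  dsimp only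
  refine .mul (.mul (.mul ?_ g3) ?_) (.mul (.mul (.mul (.mul (.mul hA g1) g2) ?_) g4) g5)
  · exact differentiableAt_const _
  · exact differentiableAt_const _
  · exact differentiableAt_const _

lemma differentiableAt_yPow {y : ℝ × ℝ} (h1 : y.1 ≠ 0) (a s₂ t : ℂ) :
    DifferentiableAt ℂ (fun t => yPow y (a + t, s₂)) t := by
  unfold yPow
  dsimp only
  refine DifferentiableAt.mul ?_ (differentiableAt_const _)
  refine DifferentiableAt.const_cpow (by fun_prop) (Or.inl ?_)
  have := abs_pos.2 h1
  have hπ := Real.pi_pos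
  rw [ne_eq, ofReal_eq_zero]
  positivity

lemma integral_iter_three {f : ℝ × ℝ × ℝ → ℂ} (hf : Integrable f) :
    ∫ p, f p = ∫ a, ∫ b, ∫ x, f (a, b, x) := by
  rw [Measure.volume_eq_prod] at hf ⊢
  rw [integral_prod _ hf]
  refine integral_congr_ae ?_
  filter_upwards [hf.prod_right_ae] with a ha
  rw [Measure.volume_eq_prod] at ha ⊢
  exact integral_prod _ ha

lemma integral_iter_four {f : ℝ × ℝ × ℝ × ℝ → ℂ} (hf : Integrable f) :
    ∫ p, f p = ∫ a, ∫ b, ∫ x, ∫ z, f (a, b, x, z) := by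
  rw [Measure.volume_eq_prod] at hf ⊢
  rw [integral_prod _ hf]
  refine integral_congr_ae ?_
  filter_upwards [hf.prod_right_ae] with a ha
  exact integral_iter_three ha

lemma integral_iter_five {f : ℝ × ℝ × ℝ × ℝ × ℝ → ℂ} (hf : Integrable f) :
    ∫ p, f p = ∫ a, ∫ b, ∫ x, ∫ z, ∫ t, f (a, b, x, z, t) := by
  rw [Measure.volume_eq_prod] at hf ⊢
  rw [integral_prod _ hf]
  refine integral_congr_ae ?_
  filter_upwards [hf.prod_right_ae] with a ha
  exact integral_iter_four ha

/-- `R` as an iterated integral of its joint integrand. -/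
lemma mul_R_eq (Δ : ℝ) (c : Contours) (μ : Fin 3 → ℂ) (v u s : ℂ × ℂ) (t₁ a : ℂ) :
    a * R Δ c μ v u s t₁ = 1 / (2 * Real.pi * I) ^ 2 *
      (1 / (2 * (Real.pi : ℂ) ^ 2 * (2 * Real.pi * I))) * I ^ 3 *
      ∫ x, ∫ z, ∫ t, a * core Δ μ v u s t₁ (pt c.r.1 x) (pt c.r.2 z) (pt c.t.2 t) := by
  simp only [R, N2, lineInt, core]
  simp only [← integral_const_mul]
  refine integral_congr_ae (.of_forall fun x => ?_)
  refine integral_congr_ae (.of_forall fun z => ?_)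
  refine integral_congr_ae (.of_forall fun t => ?_)
  dsimp only
  ring

end

/-! ### The term with s = (μ₁ + t₁, -μ₂), estimated on a shifted line. -/

section

lemma norm_mul_le_exp {y : ℝ × ℝ} (h1 : y.1 ≠ 0) (h2 : y.2 ≠ 0) (s₁ s₂ w g k : ℂ) {b : ℝ}
    (hk : ‖k‖ ≤ Real.exp b) :
    ‖yPow y (s₁, s₂) * (2 : ℂ) ^ w * g * k‖ ≤
      Real.exp (-s₁.re * ylog y.1 + -s₂.re * ylog y.2 + Real.log 2 * w.re) * ‖g‖ * Real.exp b := by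
  rw [norm_mul, norm_mul, norm_mul, norm_yPow h1 h2, norm_two_cpow, ← Real.exp_add]
  gcongr

lemma enorm_le_of_norm_le_exp {z g : ℂ} {a b : ℝ} (h : ‖z‖ ≤ Real.exp a * ‖g‖ * Real.exp b) :
    ‖z‖ₑ ≤ xp a * ‖g‖ₑ * xp b := by
  rw [← ofReal_norm, ← ofReal_norm, xp, xp, ← ENNReal.ofReal_mul (Real.exp_pos _).le,
    ← ENNReal.ofReal_mul (by positivity)]
  exact ENNReal.ofReal_le_ofReal h

lemma enorm_R_const_mul_le (z : ℂ) : ‖I * (1 / (2 * Real.pi * I) ^ 2 *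
      (1 / (2 * (Real.pi : ℂ) ^ 2 * (2 * Real.pi * I))) * I ^ 3) * z‖ₑ ≤ ‖z‖ₑ := by
  rw [enorm_mul]
  refine (mul_le_mul' (enorm_le_one_of_norm ?_) le_rfl).trans_eq (one_mul _)
  rw [norm_mul, norm_mul, norm_mul, norm_pow, norm_I, one_mul, one_pow, mul_one]
  exact mul_le_one₀ norm_inv_two_pi_I_sq_le (norm_nonneg _) norm_N2_const_le

/-! ### The seventh error term -/

/-- Discarding the horizontal edges in a shift of the line of t₁ needs nothing but some decay in t₁,
pointwise in the other variables. -/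
lemma innerE_le (u₁ u₂ r₁ r₂ t₁ t₂ : ℝ) : innerE u₁ u₂ r₁ r₂ t₁ t₂ ≤ -(9 / 10) * lg t₁ := by
  rw [innerE, kerExp]
  have := lg_nonneg (u₂ - r₁ - t₁ - t₂)
  have := lg_nonneg (2 * t₁ + t₂)
  have := lg_nonneg (u₁ - u₂ - r₁ - t₂)
  linarith

lemma specParams_seven {ε : ℝ} (h0 : 0 < ε) (h1 : ε ≤ 1 / 100000) :
    SpecParams (fun i => (ε + ![-ε, 1 / 2 + 3 * ε, - -ε - (1 / 2 + 3 * ε)] i) / 2)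
      (fun i => (1 + ![-ε, 1 / 2 + 3 * ε, - -ε - (1 / 2 + 3 * ε)] i - 4 * ε) / 2 + ![0, 0, 0] i)
        ((ε + 4 * ε) / 2) (ε / 4) 0 := by
  refine ⟨by linarith, by linarith, ?_, ?_, ?_, ?_, ?_, ?_, by linarith, by linarith, le_rfl,
    by norm_num, ?_, ?_⟩
  iterate 4 · intro i; fin_cases i <;> simp <;> linarith
  iterate 4 · intro i j; fin_cases i <;> fin_cases j <;> simp <;> linarith

lemma dominated_seven {ε : ℝ} (h0 : 0 < ε) (h1 : ε ≤ 1 / 100000) :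
    Dominated (fun i => (ε + ![-ε, 1 / 2 + 3 * ε, - -ε - (1 / 2 + 3 * ε)] i) / 2)
      (fun i => (1 + ![-ε, 1 / 2 + 3 * ε, - -ε - (1 / 2 + 3 * ε)] i - 4 * ε) / 2 + ![0, 0, 0] i)
        ((ε + 4 * ε) / 2) (ε / 4) 0
      ![1 / 2 + (![-ε, 1 / 2 + 3 * ε, - -ε - (1 / 2 + 3 * ε)] 2 -
        ![-ε, 1 / 2 + 3 * ε, - -ε - (1 / 2 + 3 * ε)] 1) / 2,
        1 / 2 + (![-ε, 1 / 2 + 3 * ε, - -ε - (1 / 2 + 3 * ε)] 0 -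
          ![-ε, 1 / 2 + 3 * ε, - -ε - (1 / 2 + 3 * ε)] 2) / 2,
        1 / 2 + (![-ε, 1 / 2 + 3 * ε, - -ε - (1 / 2 + 3 * ε)] 0 -
          ![-ε, 1 / 2 + 3 * ε, - -ε - (1 / 2 + 3 * ε)] 1) / 2] ((3 / 2 - 0) / 2 + ε) (0 + ε) := by
  intro p q s h1 h2 h3
  rcases perm_cases h1 h2 h3 with h | h | h | h | h | h <;> obtain ⟨rfl, rfl, rfl⟩ := h <;>
    simp [DominatedAt, abs_le] <;> refine ⟨?_, ?_, ?_, ?_, ?_⟩ <;> linarith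

-- On the tabulated line the exponent of |y₁| is 1/2 - 4ε. No pole of the integrand lies in -1/2 ≤
-- Re t₁ ≤ -1/2 + 5ε, so the integral is estimated on Re t₁ = -1/2, where the exponent is 1/2 + ε.
set_option maxHeartbeats 1000000 in
lemma errorTerm_seven {Δ ε : ℝ} (hΔ : 0 < Δ) (hΔ1 : Δ < 1 / 10) (h0 : 0 < ε)
    (h1 : ε ≤ Δ / 10000) : ∃ C : ℝ, 0 ≤ C ∧ ∀ μ : Fin 3 → ℂ, μ 0 + μ 1 + μ 2 = 0 →
    (μ 0).re = -ε → (μ 1).re = 1 / 2 + 3 * ε → ∀ y : ℝ × ℝ, y.1 ≠ 0 → y.2 ≠ 0 →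
    absConv7 Δ (contourTable ε 6) μ y ∧ ‖E7 Δ (contourTable ε 6) μ y‖ ≤
      C * Real.exp ((1 / 2 + ε) * ylog y.1 + (1 / 2 + 3 * ε) * ylog y.2) *
        Msym ε (3 / 2) 0 μ := by
  have h2 : ε ≤ 1 / 100000 := by linarith
  obtain ⟨K₁, k₁⟩ := norm_kerE_le h0 h2
  obtain ⟨K₂, k₂⟩ := lintegral_innerE
  set l := Real.log 2 * (ε + 4 * ε + -ε + -(1 / 2 + 3 * ε)) with hl
  obtain ⟨C, hC, k₃⟩ := doubleResidue_bound (δ := ε / 4) (Δ := Δ) (a₁ := ε) (a₂ := 4 * ε)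
    (κ := ε / 4) (ξ := 0) (ε := ε) (κ' := 3 / 2) (δ' := 0)
    (η := ![-ε, 1 / 2 + 3 * ε, - -ε - (1 / 2 + 3 * ε)]) (by linarith) hΔ.le
    (by linarith)
    (by intro i; fin_cases i <;> simp [gammaRange] <;> left <;> constructor <;> linarith)
    (by
      intro i
      fin_cases i <;> simp [gammaRange]
      · left; constructor <;> linarith
      · right; constructor <;> linarith
      · left; constructor <;> linarith)
    (by linarith) (by linarith)
    (by intro i j; fin_cases i <;> fin_cases j <;> simp [abs_lt] <;> constructor <;> linarith)
    (by
      intro i j h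
      rcases eq_or_eq_neg_of_abs_eq h with h | h <;> revert h <;> fin_cases i <;> fin_cases j <;>
        simp <;> intro h <;> linarith)
    (by simp [gammaRange]; right; constructor <;> linarith)
    (by simp [gammaRange]; left; constructor <;> linarith)
    (by simp [gammaRange]; right; constructor <;> linarith)
    (specParams_seven h0 h2) (by linarith) (by linarith) (dominated_seven h0 h2) (K₁ + K₂ + l)
  refine ⟨C, hC, fun μ hs e0 e1 y y1 y2 => ?_⟩
  have hμ := exists_re_eq hs e0 e1
  set F : ℂ → ℝ × ℝ × ℝ → ℂ := fun t p => yPow y (μ 0 + t, -μ 1) * Gamma t *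
    core Δ μ (sgn y) (μ 0, -μ 1) (μ 0 + t, -μ 1) t (pt ε p.1) (pt (4 * ε) p.2.1)
      (pt (1 - 10 * ε) p.2.2) with hF
  set Y : ℝ → ℝ := fun θ => (ε - θ) * ylog y.1 + (1 / 2 + 3 * ε) * ylog y.2 with hY
  have hN : ∀ t p, -(1 / 2) ≤ t.re → t.re ≤ -(1 / 2) + 5 * ε → ‖F t p‖ ≤ Real.exp (Y t.re + l) *
      ‖Gstar (1 + 2 * Δ + pt ε p.1, Δ + pt (4 * ε) p.2.1) (fun i => -μ i)‖ *
      Real.exp (K₁ + innerE (μ 0).im (-μ 1).im p.1 p.2.1 t.im p.2.2) := by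
    intro t p ht1 ht2
    have := k₁ (sgn y) (μ 0, -μ 1) (μ 0 + t, -μ 1) (pt ε p.1, pt (4 * ε) p.2.1) t
      (pt (1 - 10 * ε) p.2.2) (isSigns_sgn y) rfl rfl e0 (by simp [e1]; ring) (pt_re _ _)
      (pt_re _ _) ht1 ht2 (pt_re _ _)
    refine le_trans (le_of_eq ?_) ((norm_mul_le_exp y1 y2 (μ 0 + t) (-μ 1)
      (pt ε p.1 + pt (4 * ε) p.2.1 + μ 0 + -μ 1)
      (Gstar (1 + 2 * Δ + pt ε p.1, Δ + pt (4 * ε) p.2.1) (fun i => -μ i)) _ this).trans_eq ?_)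
    · simp only [hF, core, kerR]
      ring_nf
    · have e : -(μ 0 + t).re * ylog y.1 + -(-μ 1).re * ylog y.2 +
          Real.log 2 * (pt ε p.1 + pt (4 * ε) p.2.1 + μ 0 + -μ 1).re = Y t.re + l := by
        simp only [add_re, neg_re, pt_re, e0, e1, hl, hY]
        ring
      rw [e]
      simp only [pt_im, neg_im]
  have hmeas : ∀ θ, Measurable fun p : ℝ × ℝ × ℝ × ℝ => F (pt θ p.1) p.2 := fun θ => by
    simp only [hF]
    fun_prop
  have hJ : ∀ θ, -(1 / 2) ≤ θ → θ ≤ -(1 / 2) + 5 * ε → _ := fun θ ht1 ht2 =>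
    k₃ μ hμ (Y θ) _ _ (lintegral_order_four (hmeas θ).enorm).le (fun z x => by
      calc _ ≤ ∫⁻ t₂, ∫⁻ t₁, xp (Y θ + l) *
              ‖Gstar (1 + 2 * Δ + pt ε x, Δ + pt (4 * ε) z) (fun i => -μ i)‖ₑ *
              xp (K₁ + innerE (μ 0).im (-μ 1).im x z t₁ t₂) := by
            refine lintegral_mono fun t₂ => lintegral_mono fun t₁ => ?_
            have := hN (pt θ t₁) (x, z, t₂) (by simpa using ht1) (by simpa using ht2)
            rw [pt_re, pt_im] at this
            exact enorm_le_of_norm_le_exp this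
        _ ≤ _ := by
            simp_rw [xp_add K₁, ← mul_assoc]
            have hne : ∀ a b c, xp a * ‖Gstar b c‖ₑ * xp K₁ ≠ ⊤ := fun a b c =>
              ENNReal.mul_ne_top (ENNReal.mul_ne_top (xp_lt_top _).ne enorm_ne_top) (xp_lt_top _).ne
            simp_rw [lintegral_const_mul' _ _ (hne _ _ _)]
            refine (mul_le_mul' le_rfl (k₂ _ _ _ _)).trans_eq ?_
            rw [xp_collect]
            congr 2
            ring)
  have hint : ∀ θ, -(1 / 2) ≤ θ → θ ≤ -(1 / 2) + 5 * ε →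
      Integrable fun p : ℝ × ℝ × ℝ × ℝ => F (pt θ p.1) p.2 := fun θ ht1 ht2 =>
    ⟨(hmeas θ).aestronglyMeasurable, (hJ θ ht1 ht2).1⟩
  have i1 := hint (-(1 / 2)) le_rfl (by linarith)
  have i2 := hint (-(1 / 2) + 5 * ε) (by linarith) le_rfl
  have hshift := integral_pt_prod_eq (F := F) (a := 9 / 10) (by linarith) (by norm_num)
    (fun p t ht1 ht2 => by
      refine .mul (.mul (differentiableAt_yPow y1 _ _ _) (differentiableAt_Gamma _ fun m hm => ?_))
        (differentiableAt_core _ _ _ ?_ ?_ ?_ ?_ ?_)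
      · have h3 := congrArg re hm
        simp only [neg_re, natCast_re] at h3
        rcases Nat.eq_zero_or_pos m with h4 | h4
        · rw [h4] at h3
          simp at h3
          linarith
        · have : (1 : ℝ) ≤ m := by exact_mod_cast h4
          linarith
      all_goals
        simp [e0, e1]
        linarith)
    (fun p => ⟨Real.exp (1 * |ylog y.1| + (1 / 2 + 3 * ε) * ylog y.2 + l) *
        ‖Gstar (1 + 2 * Δ + pt ε p.1, Δ + pt (4 * ε) p.2.1) (fun i => -μ i)‖ * Real.exp K₁,
      fun t ht1 ht2 => by
        refine (hN t p ht1 ht2).trans ?_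
        rw [mul_assoc _ (Real.exp K₁), ← Real.exp_add]
        gcongr
        · have := mul_le_mul_of_nonneg_right (abs_le.2 ⟨by linarith, by linarith⟩ : |ε - t.re| ≤ 1)
            (abs_nonneg (ylog y.1))
          rw [← abs_mul] at this
          simp only [hY]
          linarith [le_abs_self ((ε - t.re) * ylog y.1)]
        · exact innerE_le _ _ _ _ _ _⟩) i1 i2
  -- Absolute convergence concerns the tabulated line; the size is read off on the shifted one.
  refine ⟨i2, ?_⟩
  have hY2 : Y (-(1 / 2)) = (1 / 2 + ε) * ylog y.1 + (1 / 2 + 3 * ε) * ylog y.2 := by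
    simp only [hY]
    ring
  rw [← hY2]
  refine (hJ (-(1 / 2)) le_rfl (by linarith)).2 _ ?_
  refine enorm_prefactor_le norm_const_five_le ?_
  simp only [lineInt, mul_R_eq]
  rw [integral_const_mul, ← mul_assoc]
  have h4 := integral_iter_four i2
  rw [← hshift] at h4
  exact (enorm_R_const_mul_le _).trans ((congrArg enorm h4.symm).le.trans
    (enorm_integral_le_lintegral_enorm _))

end

/-! ### The term with s₁ = μ₁ + t₁, estimated on a shifted line. -/

section

/-- The joint integrand unfolds with t₂ outside t₁, opposite to the order used in the estimate. -/
lemma lintegral_innerC_swap : ∃ K : ℝ, ∀ u₁ u₂ r₁ r₂ : ℝ,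
    ∫⁻ t₂, ∫⁻ t₁, ∫⁻ s₂, xp (innerC u₁ u₂ s₂ r₁ r₂ t₁ t₂) ≤ xp K := by
  obtain ⟨K, hK⟩ := lintegral_innerC
  refine ⟨K, fun u₁ u₂ r₁ r₂ => le_trans (le_of_eq ?_) (hK u₁ u₂ r₁ r₂)⟩
  refine lintegral_lintegral_swap (Measurable.aemeasurable ?_)
  have : Measurable fun p : (ℝ × ℝ) × ℝ => xp (innerC u₁ u₂ p.2 r₁ r₂ p.1.2 p.1.1) := by
    unfold innerC kerExp
    fun_prop
  exact this.lintegral_prod_right'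

lemma innerC_le (u₁ u₂ s₂ r₁ r₂ t₁ t₂ : ℝ) :
    innerC u₁ u₂ s₂ r₁ r₂ t₁ t₂ ≤ -(2 / 5) * lg t₁ := by
  rw [innerC, kerExp]
  have := lg_nonneg (s₂ - u₂)
  have := lg_nonneg (s₂ - r₁ - t₁ - t₂)
  have := lg_nonneg (2 * t₁ + t₂)
  have := lg_nonneg (u₁ - u₂ - r₁ - t₂)
  have := lg_nonneg (r₂ - 2 * (u₁ + t₁) - t₂ + u₁)
  linarith

/-! ### The fifth error term -/

lemma specParams_five {ε : ℝ} (h0 : 0 < ε) (h1 : ε ≤ 1 / 100000) :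
    SpecParams (fun i => (-3 * ε + ![-(1 / 2) - 3 * ε, ε, -(-(1 / 2) - 3 * ε) - ε] i) / 2)
      (fun i => (1 + ![-(1 / 2) - 3 * ε, ε, -(-(1 / 2) - 3 * ε) - ε] i - 7 * ε) / 2 + ![0, 0, 0] i)
        ((-3 * ε + 7 * ε) / 2) (ε / 4) 0 := by
  refine ⟨by linarith, by linarith, ?_, ?_, ?_, ?_, ?_, ?_, by linarith, by linarith, le_rfl,
    by norm_num, ?_, ?_⟩
  iterate 4 · intro i; fin_cases i <;> simp <;> linarith
  iterate 4 · intro i j; fin_cases i <;> fin_cases j <;> simp <;> linarith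

lemma dominated_five {ε : ℝ} (h0 : 0 < ε) (h1 : ε ≤ 1 / 100000) :
    Dominated (fun i => (-3 * ε + ![-(1 / 2) - 3 * ε, ε, -(-(1 / 2) - 3 * ε) - ε] i) / 2)
      (fun i => (1 + ![-(1 / 2) - 3 * ε, ε, -(-(1 / 2) - 3 * ε) - ε] i - 7 * ε) / 2 + ![0, 0, 0] i)
        ((-3 * ε + 7 * ε) / 2) (ε / 4) 0
      ![1 / 2 + (![-(1 / 2) - 3 * ε, ε, -(-(1 / 2) - 3 * ε) - ε] 2 -
        ![-(1 / 2) - 3 * ε, ε, -(-(1 / 2) - 3 * ε) - ε] 1) / 2,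
        1 / 2 + (![-(1 / 2) - 3 * ε, ε, -(-(1 / 2) - 3 * ε) - ε] 0 -
          ![-(1 / 2) - 3 * ε, ε, -(-(1 / 2) - 3 * ε) - ε] 2) / 2,
        1 / 2 + (![-(1 / 2) - 3 * ε, ε, -(-(1 / 2) - 3 * ε) - ε] 0 -
          ![-(1 / 2) - 3 * ε, ε, -(-(1 / 2) - 3 * ε) - ε] 1) / 2] ((3 / 2 - 0) / 2 + ε)
        (0 + ε) := by
  intro p q s h1 h2 h3
  rcases perm_cases h1 h2 h3 with h | h | h | h | h | h <;> obtain ⟨rfl, rfl, rfl⟩ := h <;>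
    simp [DominatedAt, abs_le] <;> refine ⟨?_, ?_, ?_, ?_, ?_⟩ <;> linarith

-- The tabulated Re t₁ = 6ε would give |y₁| the exponent 1/2 - 3ε. At Re t₁ = 2ε it is 1/2 + ε, and
-- the strip between contains no pole.
set_option maxHeartbeats 1000000 in
lemma errorTerm_five {Δ ε : ℝ} (hΔ : 0 < Δ) (hΔ1 : Δ < 1 / 10) (h0 : 0 < ε)
    (h1 : ε ≤ Δ / 10000) : ∃ C : ℝ, 0 ≤ C ∧ ∀ μ : Fin 3 → ℂ, μ 0 + μ 1 + μ 2 = 0 →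
    (μ 0).re = -(1 / 2) - 3 * ε → (μ 1).re = ε → ∀ y : ℝ × ℝ, y.1 ≠ 0 → y.2 ≠ 0 →
    absConv5 Δ (contourTable ε 4) μ y ∧ ‖E5 Δ (contourTable ε 4) μ y‖ ≤
      C * Real.exp ((1 / 2 + ε) * ylog y.1 + (1 / 2 + ε) * ylog y.2) *
        Msym ε (3 / 2) 0 μ := by
  have h2 : ε ≤ 1 / 100000 := by linarith
  obtain ⟨K₁, k₁⟩ := norm_kerC_le h0 h2
  obtain ⟨K₂, k₂⟩ := lintegral_innerC_swap
  set l := Real.log 2 * (-3 * ε + 7 * ε + (-(1 / 2) - 3 * ε) + -ε) with hl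
  obtain ⟨C, hC, k₃⟩ := doubleResidue_bound (δ := ε / 4) (Δ := Δ) (a₁ := -3 * ε) (a₂ := 7 * ε)
    (κ := ε / 4) (ξ := 0) (ε := ε) (κ' := 3 / 2) (δ' := 0)
    (η := ![-(1 / 2) - 3 * ε, ε, -(-(1 / 2) - 3 * ε) - ε]) (by linarith) hΔ.le
    (by linarith)
    (by intro i; fin_cases i <;> simp [gammaRange] <;> left <;> constructor <;> linarith)
    (by
      intro i
      fin_cases i <;> simp [gammaRange]
      · left; constructor <;> linarith
      · left; constructor <;> linarith
      · right; constructor <;> linarith)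
    (by linarith) (by linarith)
    (by intro i j; fin_cases i <;> fin_cases j <;> simp [abs_lt] <;> constructor <;> linarith)
    (by
      intro i j h
      rcases eq_or_eq_neg_of_abs_eq h with h | h <;> revert h <;> fin_cases i <;> fin_cases j <;>
        simp <;> intro h <;> linarith)
    (by simp [gammaRange]; right; constructor <;> linarith)
    (by simp [gammaRange]; right; constructor <;> linarith)
    (by simp [gammaRange]; left; constructor <;> linarith)
    (specParams_five h0 h2) (by linarith) (by linarith) (dominated_five h0 h2) (K₁ + K₂ + l)
  refine ⟨C, hC, fun μ hs e0 e1 y y1 y2 => ?_⟩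
  have hμ := exists_re_eq hs e0 e1
  set F : ℂ → ℝ × ℝ × ℝ × ℝ → ℂ := fun t p => Gamma (pt (-(1 / 2) - ε) p.1 + μ 1) *
    yPow y (μ 0 + t, pt (-(1 / 2) - ε) p.1) * Gamma t *
    core Δ μ (sgn y) (μ 0, -μ 1) (μ 0 + t, pt (-(1 / 2) - ε) p.1) t (pt (-3 * ε) p.2.1)
      (pt (7 * ε) p.2.2.1) (pt (1 / 2 - 6 * ε) p.2.2.2) with hF
  set Y : ℝ → ℝ := fun θ => (1 / 2 + 3 * ε - θ) * ylog y.1 + (1 / 2 + ε) * ylog y.2 with hY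
  have hN : ∀ t p, 2 * ε ≤ t.re → t.re ≤ 6 * ε → ‖F t p‖ ≤ Real.exp (Y t.re + l) *
      ‖Gstar (1 + 2 * Δ + pt (-3 * ε) p.2.1, Δ + pt (7 * ε) p.2.2.1) (fun i => -μ i)‖ *
      Real.exp (K₁ + innerC (μ 0).im (-μ 1).im p.1 p.2.1 p.2.2.1 t.im p.2.2.2) := by
    intro t p ht1 ht2
    have := k₁ (sgn y) (μ 0, -μ 1) (μ 0 + t, pt (-(1 / 2) - ε) p.1)
      (pt (-3 * ε) p.2.1, pt (7 * ε) p.2.2.1) t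
      (pt (1 / 2 - 6 * ε) p.2.2.2) (isSigns_sgn y) rfl e0 (by simp [e1]) (pt_re _ _)
      (pt_re _ _) (pt_re _ _) ht1 ht2 (pt_re _ _)
    refine le_trans (le_of_eq ?_) ((norm_mul_le_exp y1 y2 (μ 0 + t) (pt (-(1 / 2) - ε) p.1)
      (pt (-3 * ε) p.2.1 + pt (7 * ε) p.2.2.1 + μ 0 + -μ 1)
      (Gstar (1 + 2 * Δ + pt (-3 * ε) p.2.1, Δ + pt (7 * ε) p.2.2.1) (fun i => -μ i)) _
        this).trans_eq ?_)
    · simp only [hF, core, kerR, sub_neg_eq_add]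
      ring_nf
    · have e : -(μ 0 + t).re * ylog y.1 + -(pt (-(1 / 2) - ε) p.1).re * ylog y.2 +
          Real.log 2 * (pt (-3 * ε) p.2.1 + pt (7 * ε) p.2.2.1 + μ 0 + -μ 1).re =
          Y t.re + l := by
        simp only [add_re, neg_re, pt_re, e0, e1, hl, hY]
        ring
      rw [e]
      simp only [pt_im]
  have hmeas : ∀ θ, Measurable fun p : ℝ × ℝ × ℝ × ℝ × ℝ => F (pt θ p.2.1) (p.1, p.2.2) :=
    fun θ => by
      simp only [hF]
      fun_prop
  have hJ : ∀ θ, 2 * ε ≤ θ → θ ≤ 6 * ε → _ := fun θ ht1 ht2 =>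
    k₃ μ hμ (Y θ) _ _ (lintegral_order_five (hmeas θ).enorm).le (fun z x => by
      calc _ ≤ ∫⁻ t₂, ∫⁻ t₁, ∫⁻ s₂, xp (Y θ + l) *
              ‖Gstar (1 + 2 * Δ + pt (-3 * ε) x, Δ + pt (7 * ε) z) (fun i => -μ i)‖ₑ *
              xp (K₁ + innerC (μ 0).im (-μ 1).im s₂ x z t₁ t₂) := by
            refine lintegral_mono fun t₂ => lintegral_mono fun t₁ => lintegral_mono fun s₂ => ?_
            have := hN (pt θ t₁) (s₂, x, z, t₂) (by simpa using ht1) (by simpa using ht2)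
            rw [pt_re, pt_im] at this
            exact enorm_le_of_norm_le_exp this
        _ ≤ _ := by
            simp_rw [xp_add K₁, ← mul_assoc]
            have hne : ∀ a b c, xp a * ‖Gstar b c‖ₑ * xp K₁ ≠ ⊤ := fun a b c =>
              ENNReal.mul_ne_top (ENNReal.mul_ne_top (xp_lt_top _).ne enorm_ne_top) (xp_lt_top _).ne
            simp_rw [lintegral_const_mul' _ _ (hne _ _ _)]
            refine (mul_le_mul' le_rfl (k₂ _ _ _ _)).trans_eq ?_
            rw [xp_collect]
            congr 2
            ring)
  have hint : ∀ θ, 2 * ε ≤ θ → θ ≤ 6 * ε → Integrable fun p : ℝ × ℝ × ℝ × ℝ × ℝ =>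
      F (pt θ p.2.1) (p.1, p.2.2) := fun θ ht1 ht2 =>
    ⟨(hmeas θ).aestronglyMeasurable, (hJ θ ht1 ht2).1⟩
  have i1 := hint (2 * ε) le_rfl (by linarith)
  have i2 := hint (6 * ε) (by linarith) le_rfl
  have hshift : ∫ p : ℝ × ℝ × ℝ × ℝ × ℝ, F (pt (2 * ε) p.2.1) (p.1, p.2.2) =
      ∫ p : ℝ × ℝ × ℝ × ℝ × ℝ, F (pt (6 * ε) p.2.1) (p.1, p.2.2) := by
    -- s₂ stands before t₁ in the joint integrand, so the shift is carried out for almost every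
    -- fixed s₂.
    rw [Measure.volume_eq_prod] at i1 i2 ⊢
    rw [integral_prod _ i1, integral_prod _ i2]
    refine integral_congr_ae ?_
    filter_upwards [i1.prod_right_ae, i2.prod_right_ae] with s₂ j1 j2
    refine integral_pt_prod_eq (F := fun t p => F t (s₂, p)) (a := 2 / 5) (by linarith)
      (by norm_num) (fun p t ht1 ht2 => ?_)
      (fun p => ⟨Real.exp (1 * |ylog y.1| + (1 / 2 + ε) * ylog y.2 + l) *
        ‖Gstar (1 + 2 * Δ + pt (-3 * ε) p.1, Δ + pt (7 * ε) p.2.1) (fun i => -μ i)‖ *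
          Real.exp K₁, fun t ht1 ht2 => ?_⟩) j1 j2
    · refine .mul (.mul (.mul (differentiableAt_const _) (differentiableAt_yPow y1 _ _ _))
        (differentiableAt_Gamma_comp differentiableAt_id ?_))
        (differentiableAt_core _ _ _ ?_ ?_ ?_ ?_ ?_)
      · exact lt_of_lt_of_le (by linarith) ht1
      all_goals
        simp [e0]
        linarith
    · refine (hN t _ ht1 ht2).trans ?_
      rw [mul_assoc _ (Real.exp K₁), ← Real.exp_add]
      gcongr
      · have := mul_le_mul_of_nonneg_right
          (abs_le.2 ⟨by linarith, by linarith⟩ : |1 / 2 + 3 * ε - t.re| ≤ 1)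
          (abs_nonneg (ylog y.1))
        rw [← abs_mul] at this
        simp only [hY]
        linarith [le_abs_self ((1 / 2 + 3 * ε - t.re) * ylog y.1)]
      · exact innerC_le _ _ _ _ _ _ _
  refine ⟨i2, ?_⟩
  have hY2 : Y (2 * ε) = (1 / 2 + ε) * ylog y.1 + (1 / 2 + ε) * ylog y.2 := by
    simp only [hY]
    ring
  rw [← hY2]
  refine (hJ (2 * ε) le_rfl (by linarith)).2 _ ?_
  refine enorm_prefactor_le norm_const_five_sq_le ?_
  have h4 := integral_iter_five i2
  rw [← hshift] at h4
  -- The nested definition is rewritten as one constant times an iterated integral of `F`; only then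
  -- can equality of integrals, rather than of absolute values, be used for the shift.
  have h5 : ∀ s₂ : ℝ, Gamma (pt (-(1 / 2) - ε) s₂ + μ 1) * lineInt (6 * ε) (fun t₁ =>
      yPow y (μ 0 + t₁, pt (-(1 / 2) - ε) s₂) * Gamma t₁ *
        R Δ (contourTable ε 4) μ (sgn y) (μ 0, -μ 1) (μ 0 + t₁, pt (-(1 / 2) - ε) s₂) t₁) =
      I * (1 / (2 * Real.pi * I) ^ 2 *
      (1 / (2 * (Real.pi : ℂ) ^ 2 * (2 * Real.pi * I))) * I ^ 3) *
        ∫ t₁, ∫ x, ∫ z, ∫ t, F (pt (6 * ε) t₁) (s₂, x, z, t) := by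
    intro s₂
    simp only [lineInt, mul_R_eq]
    rw [integral_const_mul, ← mul_assoc I, mul_left_comm]
    congr 1
    simp only [← integral_const_mul]
    refine integral_congr_ae (.of_forall fun t₁ => integral_congr_ae (.of_forall fun x =>
      integral_congr_ae (.of_forall fun z => integral_congr_ae (.of_forall fun t => ?_))))
    simp only [hF, ← mul_assoc]
    rfl
  have h6 : ∀ g : ℝ → ℂ, ∀ k : ℂ, I * ∫ s₂, k * g s₂ = I * (k * ∫ s₂, g s₂) := fun g k => by
    rw [integral_const_mul]
  refine (le_of_eq (congrArg enorm ((congrArg (fun g : ℝ → ℂ => I * ∫ s₂, g s₂)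
    (funext h5)).trans (h6 _ _)))).trans ?_
  rw [enorm_mul, ← ofReal_norm, norm_I, ENNReal.ofReal_one, one_mul]
  exact (enorm_R_const_mul_le _).trans ((congrArg enorm h4.symm).le.trans
    (enorm_integral_le_lintegral_enorm _))

end

section

/-! ## The terms with integrals over `u` -/

/-- The integral over the spectral variables and an outer variable. -/
lemma lintegral_outer {Δ : ℝ} (hΔ0 : 0 ≤ Δ) (hΔ1 : Δ ≤ 1) {ρ σ : Fin 3 → ℝ} {τ κ γ : ℝ}
    (P : SpecParams ρ σ τ κ γ) : ∃ K : ℝ, ∀ m : Fin 3 → ℝ, ∀ p q s : Fin 3, Mid m p q s →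
    ∀ (X : Type) [MeasureSpace X] [SFinite (volume : Measure X)] (w : X → ENNReal) (b : X → ℝ),
      Measurable w → (∀ u, w u ≠ ⊤) → Measurable b → ∀ ξ e : ℝ, ∀ W : ENNReal,
      (∀ z, ∫⁻ u, w u * xp (-(ξ * lg (z - b u))) ≤ W) → ∀ Φ : X → ℝ → ℝ → ENNReal,
      (∀ u z x, Φ u z x ≤ w u * xp (-(ξ * lg (z - b u))) *
        xp (e + specExp Δ ρ σ τ m x z - γ * lg (x - (z + b u)))) →
      ∫⁻ u, ∫⁻ z, ∫⁻ x, Φ u z x ≤ W * (xp (K + e + labelMain ρ σ τ κ γ m p q s) +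
        xp (K + e + labelMain ρ σ τ κ γ m s q p)) := by
  obtain ⟨K₁, h₁⟩ := lintegral_spec_fst hΔ0 hΔ1 P
  obtain ⟨K₂, h₂⟩ := lintegral_spec_snd P
  refine ⟨K₁ + K₂, fun m p q s h X _ _ w b hw hw' hb ξ e W hW Φ hΦ => ?_⟩
  set g : ℝ → ENNReal := fun z => xp (e + K₁) * (xp (labelExpZ ρ σ τ κ γ m p q s z) +
    xp (labelExpZ ρ σ τ κ γ m s q p z)) with hg
  have hgm : Measurable g := by
    simp only [hg]
    unfold labelExpZ
    fun_prop
  have hgt : ∀ z, g z ≠ ⊤ := fun z => ENNReal.mul_ne_top (xp_lt_top _).ne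
    (ENNReal.add_ne_top.2 ⟨(xp_lt_top _).ne, (xp_lt_top _).ne⟩)
  calc ∫⁻ u, ∫⁻ z, ∫⁻ x, Φ u z x
      ≤ ∫⁻ u, ∫⁻ z, w u * xp (-(ξ * lg (z - b u))) * g z := by
        refine lintegral_mono fun u => lintegral_mono fun z => ?_
        have h5 : ∫⁻ x, Φ u z x ≤ ∫⁻ x, w u * xp (-(ξ * lg (z - b u))) * xp e *
            xp (specExp Δ ρ σ τ m x z - γ * lg (x - (z + b u))) := by
          refine lintegral_mono fun x => ?_
          rw [mul_assoc, ← xp_add, ← add_sub_assoc]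
          exact hΦ u z x
        rw [lintegral_const_mul' _ _ (ENNReal.mul_ne_top (ENNReal.mul_ne_top (hw' u)
          (xp_lt_top _).ne) (xp_lt_top e).ne)] at h5
        refine (h5.trans (mul_le_mul' le_rfl (h₁ m p q s h z (z + b u)))).trans (le_of_eq ?_)
        simp only [hg]
        rw [xp_add, xp_add, xp_add, ← mul_add]
        ring
    -- After the x-integral the only link between u and z is the weight in z - b u. Integrating u
    -- first, uniformly in z, separates the two.
    _ = ∫⁻ z, ∫⁻ u, w u * xp (-(ξ * lg (z - b u))) * g z :=
        lintegral_lintegral_swap (by fun_prop)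
    _ = ∫⁻ z, (∫⁻ u, w u * xp (-(ξ * lg (z - b u)))) * g z :=
        lintegral_congr fun z => lintegral_mul_const' _ _ (hgt z)
    _ ≤ ∫⁻ z, W * g z := lintegral_mono fun z => mul_le_mul' (hW z) le_rfl
    _ = W * ∫⁻ z, g z := lintegral_const_mul _ hgm
    _ ≤ W * (xp (e + K₁) * (xp (K₂ + labelMain ρ σ τ κ γ m p q s) +
          xp (K₂ + labelMain ρ σ τ κ γ m s q p))) := by
        refine mul_le_mul' le_rfl ?_
        simp only [hg]
        rw [lintegral_const_mul' _ _ (xp_lt_top _).ne,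
          lintegral_add_left (by unfold labelExpZ; fun_prop)]
        exact mul_le_mul' le_rfl (add_le_add (h₂ m p q s) (h₂ m s q p))
    _ = _ := by
        rw [mul_add, ← xp_add, ← xp_add]
        congr 3 <;> ring

/-- The inner integrals of `T`. -/
lemma lintegral_coreT_le {Δ ε : ℝ} (h0 : 0 < ε) (h1 : ε ≤ 1 / 100000) :
    ∃ K : ℝ, ∀ μ : Fin 3 → ℂ, ∀ u : ℂ × ℂ, u.1.re = -(1 / 2) - 3 * ε → u.2.re = -(1 / 2) - 3 * ε →
    ∀ y : ℝ × ℝ, y.1 ≠ 0 → y.2 ≠ 0 → ∀ z x : ℝ,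
    ∫⁻ t₂, ∫⁻ t₁, ∫⁻ s₂, ∫⁻ s₁, ‖coreT Δ μ u y (pt (-(1 / 2) - ε) s₁) (pt (-(1 / 2) - ε) s₂)
      (pt ε t₁) (pt (1 / 2 - 4 * ε) x) (pt (100 * ε) z) (pt ε t₂)‖ₑ ≤
    xp (K + ((1 / 2 + ε) * ylog y.1 + (1 / 2 + ε) * ylog y.2) - 45 * ε * lg (z - u.1.im) -
      45 * ε * lg (x - (z + u.1.im))) *
      ‖Gstar (1 + 2 * Δ + pt (1 / 2 - 4 * ε) x, Δ + pt (100 * ε) z) (fun i => -μ i)‖ₑ := by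
  obtain ⟨K₁, k₁⟩ := norm_kerA_le h0 h1
  obtain ⟨K₂, k₂⟩ := lintegral_innerA h0 h1
  set l := Real.log 2 * (1 / 2 - 4 * ε + 100 * ε + (-(1 / 2) - 3 * ε) + (-(1 / 2) - 3 * ε)) with hl
  refine ⟨K₁ + K₂ + l, fun μ u e0 e1 y y1 y2 z x => ?_⟩
  set Y := (1 / 2 + ε) * ylog y.1 + (1 / 2 + ε) * ylog y.2 with hY
  set g := Gstar (1 + 2 * Δ + pt (1 / 2 - 4 * ε) x, Δ + pt (100 * ε) z) (fun i => -μ i) with hg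
  calc _ ≤ ∫⁻ t₂, ∫⁻ t₁, ∫⁻ s₂, ∫⁻ s₁, xp (Y + l) * ‖g‖ₑ *
          xp (K₁ + innerA ε u.1.im u.2.im s₁ s₂ x z t₁ t₂) := by
        refine lintegral_mono fun t₂ => lintegral_mono fun t₁ => lintegral_mono fun s₂ =>
          lintegral_mono fun s₁ => ?_
        have := k₁ (sgn y) u (pt (-(1 / 2) - ε) s₁, pt (-(1 / 2) - ε) s₂)
          (pt (1 / 2 - 4 * ε) x, pt (100 * ε) z) (pt ε t₁) (pt ε t₂) (isSigns_sgn y) e0 e1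
          (pt_re _ _) (pt_re _ _) (pt_re _ _) (pt_re _ _) (pt_re _ _) (pt_re _ _)
        dsimp only
        rw [coreT_eq]
        refine (enorm_mul_le_xp y1 y2 _ _ _ _ _ this).trans_eq ?_
        have e : -(pt (-(1 / 2) - ε) s₁).re * ylog y.1 + -(pt (-(1 / 2) - ε) s₂).re * ylog y.2 +
            Real.log 2 * (pt (1 / 2 - 4 * ε) x + pt (100 * ε) z + u.1 + u.2).re = Y + l := by
          simp only [add_re, pt_re, e0, e1, hl, hY]
          ring
        rw [e]
        simp only [pt_im]
        rfl
    _ ≤ _ := by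
        simp_rw [xp_add K₁, ← mul_assoc]
        have hne : xp (Y + l) * ‖g‖ₑ * xp K₁ ≠ ⊤ :=
          ENNReal.mul_ne_top (ENNReal.mul_ne_top (xp_lt_top _).ne enorm_ne_top) (xp_lt_top _).ne
        simp_rw [lintegral_const_mul' _ _ hne]
        refine (mul_le_mul' le_rfl (k₂ _ _ _ _)).trans_eq ?_
        rw [xp_collect]
        congr 2
        ring

/-- Common core of the terms with an integral over u. The decay 45ε in r₂ - u₁ can be kept for the
integral over u₁ (as ξ) or, when u₁ = μ₁ is fixed, be absorbed into the spectral exponents (as ξ₀);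
the decay in r₁ - (r₂ + u₁) enters as γ. -/
lemma lintegral_outer_coreT {Δ ε κ ξ ξ₀ : ℝ} {η : Fin 3 → ℝ} (h0 : 0 < ε) (hε : ε ≤ 1 / 100000)
    (hΔ0 : 0 ≤ Δ) (hΔ1 : Δ ≤ 1)
    (h1 : ∀ i, gammaRange (ε / 4) ((1 + 2 * Δ + (1 / 2 - 4 * ε) + η i) / 2))
    (h2 : ∀ i, gammaRange (ε / 4) ((Δ + 100 * ε - η i) / 2))
    (h5 : ∀ i j, |η i - η j| < 2)
    (P : SpecParams (fun i => (1 / 2 - 4 * ε + η i) / 2)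
      (fun i => (1 + η i - 100 * ε) / 2 + ![ξ₀, 0, 0] i)
      ((1 / 2 - 4 * ε + 100 * ε) / 2) κ (45 * ε)) :
    ∃ K : ℝ, ∀ μ : Fin 3 → ℂ, (∀ i, (μ i).re = η i) → ∀ p q s : Fin 3,
    Mid (fun i => (μ i).im) p q s → ∀ y : ℝ × ℝ, y.1 ≠ 0 → y.2 ≠ 0 →
    ∀ (X : Type) [MeasureSpace X] [SFinite (volume : Measure X)] (w : X → ENNReal) (U : X → ℂ × ℂ),
      Measurable w → (∀ u, w u ≠ ⊤) → Measurable U → (∀ u, (U u).1.re = -(1 / 2) - 3 * ε) →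
      (∀ u, (U u).2.re = -(1 / 2) - 3 * ε) →
      (∀ u z, ξ * lg (z - (U u).1.im) + ξ₀ * lg (z - (μ 0).im) ≤
        45 * ε * lg (z - (U u).1.im)) → ∀ W : ENNReal,
      (∀ z, ∫⁻ u, w u * xp (-(ξ * lg (z - (U u).1.im))) ≤ W) →
      ∫⁻ u, ∫⁻ z, ∫⁻ x, ∫⁻ t₂, ∫⁻ t₁, ∫⁻ s₂, ∫⁻ s₁, w u * ‖coreT Δ μ (U u) y
        (pt (-(1 / 2) - ε) s₁) (pt (-(1 / 2) - ε) s₂) (pt ε t₁) (pt (1 / 2 - 4 * ε) x)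
        (pt (100 * ε) z) (pt ε t₂)‖ₑ ≤
      W * (xp (K + ((1 / 2 + ε) * ylog y.1 + (1 / 2 + ε) * ylog y.2) +
        Δ * rootSum (fun i => (μ i).im) + rootLin ![(η 1 - η 2) / 2, (η 0 - η 2) / 2,
          (η 0 - η 1) / 2] (fun i => (μ i).im) +
        labelMain (fun i => (1 / 2 - 4 * ε + η i) / 2)
          (fun i => (1 + η i - 100 * ε) / 2 + ![ξ₀, 0, 0] i)
          ((1 / 2 - 4 * ε + 100 * ε) / 2) κ (45 * ε) (fun i => (μ i).im) p q s) +
        xp (K + ((1 / 2 + ε) * ylog y.1 + (1 / 2 + ε) * ylog y.2) +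
        Δ * rootSum (fun i => (μ i).im) + rootLin ![(η 1 - η 2) / 2, (η 0 - η 2) / 2,
          (η 0 - η 1) / 2] (fun i => (μ i).im) +
        labelMain (fun i => (1 / 2 - 4 * ε + η i) / 2)
          (fun i => (1 + η i - 100 * ε) / 2 + ![ξ₀, 0, 0] i)
          ((1 / 2 - 4 * ε + 100 * ε) / 2) κ (45 * ε) (fun i => (μ i).im) s q p)) := by
  obtain ⟨K₁, k₁⟩ := norm_Gstar_spec_le (Δ := Δ) (by linarith : 0 < ε / 4) h1 h2 (by linarith)
    (by linarith) (fun i j => (h5 i j).le)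
  obtain ⟨K₂, k₂⟩ := lintegral_outer hΔ0 hΔ1 P
  obtain ⟨K₃, k₃⟩ := lintegral_coreT_le (Δ := Δ) h0 hε
  refine ⟨K₁ + K₂ + K₃, fun μ hμ p q s hmid y y1 y2 X _ _ w U hw hw' hU U1 U2 hsplit W hW => ?_⟩
  set m : Fin 3 → ℝ := fun i => (μ i).im with hm
  set Y := (1 / 2 + ε) * ylog y.1 + (1 / 2 + ε) * ylog y.2 with hY
  set L := rootLin ![(η 1 - η 2) / 2, (η 0 - η 2) / 2, (η 0 - η 1) / 2] m with hL
  refine (k₂ m p q s hmid X w (fun u => (U u).1.im) hw hw' (by fun_prop) ξ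
    (K₁ + K₃ + Y + Δ * rootSum m + L) W hW _ (fun u z x => ?_)).trans_eq ?_
  · simp_rw [lintegral_const_mul' _ _ (hw' u)]
    rw [mul_assoc, ← xp_add]
    refine mul_le_mul' le_rfl ((k₃ μ (U u) (U1 u) (U2 u) y y1 y2 z x).trans ?_)
    have := enorm_le_xp (k₁ μ hμ (pt (1 / 2 - 4 * ε) x) (pt (100 * ε) z) (pt_re _ _) (pt_re _ _))
    refine (mul_le_mul' le_rfl this).trans ?_
    rw [← xp_add, specExp_add_single]
    apply xp_mono
    have h7 := hsplit u z
    have hL' : L = (η 1 - η 2) / 2 * lg ((μ 1).im - (μ 2).im) +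
        (η 0 - η 2) / 2 * lg ((μ 0).im - (μ 2).im) +
        (η 0 - η 1) / 2 * lg ((μ 0).im - (μ 1).im) := by
      simp [hL, rootLin, hm]
      ring
    simp only [pt_im, hL', hY, hm]
    linarith
  · congr 3 <;> ring

end

/-! ### The two terms with a single residue. -/

section

@[fun_prop]
lemma Measurable.GstarR {α : Type*} [MeasurableSpace α] {f : α → ℂ} (hf : Measurable f)
    (μ : Fin 3 → ℂ) : Measurable fun x => GstarR (f x) μ := by
  unfold SL3.GstarR
  fun_prop

@[fun_prop]
lemma Measurable.GstarL {α : Type*} [MeasurableSpace α] {f : α → ℂ} (hf : Measurable f)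
    (μ : Fin 3 → ℂ) : Measurable fun x => GstarL (f x) μ := by
  unfold SL3.GstarL
  fun_prop

lemma norm_const_six_le : ‖-3 * I / (128 * (Real.pi : ℂ) ^ 6)‖ ≤ 1 := by
  have h := Real.pi_gt_three
  have h5 : (1 : ℝ) ≤ Real.pi ^ 6 := one_le_pow₀ (by linarith)
  simp only [norm_div, norm_mul, norm_neg, norm_pow, Complex.norm_real, Complex.norm_I,
    Complex.norm_ofNat, Real.norm_eq_abs, abs_of_pos Real.pi_pos]
  rw [div_le_one (by positivity)]
  linarith

lemma enorm_const_mul_le {c Q L : ℂ} {J : ENNReal} (hc : ‖c‖ ≤ 1) (hL : ‖L‖ₑ ≤ J) :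
    ‖c * Q * L‖ₑ ≤ ‖Q‖ₑ * J := by
  rw [mul_assoc, enorm_mul, enorm_mul]
  exact (mul_le_mul' (enorm_le_one_of_norm hc) (mul_le_mul' le_rfl hL)).trans_eq (one_mul _)

lemma lintegral_seven {f : ℝ × ℝ × ℝ × ℝ × ℝ × ℝ × ℝ → ENNReal} (hf : Measurable f) :
    ∫⁻ p, f p = ∫⁻ u, ∫⁻ p, f (u, p) := by
  rw [Measure.volume_eq_prod, lintegral_prod _ hf.aemeasurable]

/-! ### The first error term -/

lemma specParams_one {ε : ℝ} (h0 : 0 < ε) (h1 : ε ≤ 1 / 100000) :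
    SpecParams (fun i => (1 / 2 - 4 * ε + ![-3 * ε, 1 / 2 + 3 * ε,
      -(-3 * ε) - (1 / 2 + 3 * ε)] i) / 2)
      (fun i => (1 + ![-3 * ε, 1 / 2 + 3 * ε, -(-3 * ε) - (1 / 2 + 3 * ε)] i - 100 * ε) / 2 +
        ![0, 0, 0] i)
      ((1 / 2 - 4 * ε + 100 * ε) / 2) (ε / 4) (45 * ε) := by
  refine ⟨by linarith, by linarith, ?_, ?_, ?_, ?_, ?_, ?_, by linarith, by linarith, by linarith,
    by linarith, ?_, ?_⟩
  iterate 4 · intro i; fin_cases i <;> simp <;> linarith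
  iterate 4 · intro i j; fin_cases i <;> fin_cases j <;> simp <;> linarith

/-- The explicit vector collects the root exponents of `kadj * c3InvSq`, of `GstarR` after its
integration, and of the Λ in the other G*. The sum of all exponents is 2 + 3ε/4 against the
permitted 2 + 3ε, which uses both gains of 45ε. -/
lemma dominated_one {ε : ℝ} (h0 : 0 < ε) (h1 : ε ≤ 1 / 100000) :
    Dominated (fun i => (1 / 2 - 4 * ε + ![-3 * ε, 1 / 2 + 3 * ε,
      -(-3 * ε) - (1 / 2 + 3 * ε)] i) / 2)
      (fun i => (1 + ![-3 * ε, 1 / 2 + 3 * ε, -(-3 * ε) - (1 / 2 + 3 * ε)] i - 100 * ε) / 2 +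
        ![0, 0, 0] i)
      ((1 / 2 - 4 * ε + 100 * ε) / 2) (ε / 4) (45 * ε)
      ![-(3 / 2 * ε), 3 / 4 - (46 + 1 / 2) * ε + ε / 4, 1 / 4 - 3 * ε] ((2 - 0) / 2 + ε)
        (0 + ε) := by
  intro p q s h1 h2 h3
  rcases perm_cases h1 h2 h3 with h | h | h | h | h | h <;> obtain ⟨rfl, rfl, rfl⟩ := h <;>
    simp [DominatedAt, abs_le] <;> refine ⟨?_, ?_, ?_, ?_, ?_⟩ <;> linarith

/-- The weights at Im μ₁, Im μ₃ and z have degrees 3/4, 1/2 + 3ε/2 and 45ε. All that exceeds 1 + ε/4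
is turned into decay in μ₁ - μ₃, uniformly in z. -/
lemma lintegral_GstarR_le {ε : ℝ} (h0 : 0 < ε) (h1 : ε ≤ 1 / 100000) : ∃ K : ℝ,
    ∀ μ : Fin 3 → ℂ, (∀ i, (μ i).re = ![-3 * ε, 1 / 2 + 3 * ε, -(-3 * ε) - (1 / 2 + 3 * ε)] i) →
      ∀ z : ℝ,
    ∫⁻ u, ‖GstarR (pt (-(1 / 2) - 3 * ε) u) μ‖ₑ * xp (-(45 * ε * lg (z - u))) ≤
      xp (K + (-(1 / 2) * lg ((μ 0).im - (μ 1).im) +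
      (-(1 / 2 - 3 * ε) / 2 * 1 - (1 / 4 + (46 + 1 / 2) * ε - ε / 4)) * lg ((μ 0).im - (μ 2).im) +
      (-(3 / 2) - 3 * ε) * lg ((μ 1).im - (μ 2).im))) := by
  obtain ⟨K₁, k₁⟩ := norm_GstarR_le (δ := ε / 4) (a := -(1 / 2) - 3 * ε)
    (η := ![-3 * ε, 1 / 2 + 3 * ε, -(-3 * ε) - (1 / 2 + 3 * ε)]) (by linarith)
    (by intro i j; fin_cases i <;> fin_cases j <;> simp [abs_le] <;> constructor <;> linarith)
    (by simp [gammaRange]; right; constructor <;> linarith)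
    (by simp [gammaRange]; right; constructor <;> linarith)
    (by simp [gammaRange]; right; constructor <;> linarith)
    (by simp [gammaRange]; right; constructor <;> linarith)
  obtain ⟨K₂, k₂⟩ := lintegral_xp_three (c₁ := 3 / 4) (c₂ := 1 / 2 + 3 / 2 * ε) (c₃ := 45 * ε)
    (1 / 4 + (46 + 1 / 2) * ε - ε / 4) 0 0 (by linarith) le_rfl le_rfl (by linarith) (by linarith)
    (by linarith) (by linarith)
  refine ⟨K₁ + K₂, fun μ hμ z => ?_⟩
  refine (lintegral_mono fun u => (mul_le_mul' (enorm_le_xp (k₁ μ hμ _ (pt_re _ u)))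
    le_rfl).trans_eq (xp_add _ _).symm).trans ((k₂ (μ 0).im (μ 2).im z
    (K₁ + (-(1 / 2) * lg ((μ 0).im - (μ 1).im) - (1 / 2 - 3 * ε) / 2 * lg ((μ 0).im - (μ 2).im) +
      (-(3 / 2) - 3 * ε) * lg ((μ 1).im - (μ 2).im))) _ fun u => ?_).trans (xp_mono ?_))
  · simp only [pt_im, lg_sub_comm z u]
    simp
    linarith
  · linarith

set_option maxHeartbeats 400000 in
lemma errorTerm_one {Δ ε : ℝ} (hΔ : 0 < Δ) (hΔ1 : Δ < 1 / 10) (h0 : 0 < ε)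
    (h1 : ε ≤ Δ / 10000) : ∃ C : ℝ, 0 ≤ C ∧ ∀ μ : Fin 3 → ℂ, μ 0 + μ 1 + μ 2 = 0 →
    (μ 0).re = -3 * ε → (μ 1).re = 1 / 2 + 3 * ε → ∀ y : ℝ × ℝ, y.1 ≠ 0 → y.2 ≠ 0 →
    absConv1 Δ (contourTable ε 0) μ y ∧ ‖E1 Δ (contourTable ε 0) μ y‖ ≤
      C * Real.exp ((1 / 2 + ε) * ylog y.1 + (1 / 2 + ε) * ylog y.2) * Msym ε 2 0 μ := by
  have h2 : ε ≤ 1 / 100000 := by linarith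
  have hη : ∀ i j, |![-3 * ε, 1 / 2 + 3 * ε, -(-3 * ε) - (1 / 2 + 3 * ε)] i -
    ![-3 * ε, 1 / 2 + 3 * ε, -(-3 * ε) - (1 / 2 + 3 * ε)] j| < 2 := by
    intro i j
    fin_cases i <;> fin_cases j <;> simp [abs_lt] <;> constructor <;> linarith
  obtain ⟨K₁, k₁⟩ := lintegral_outer_coreT (Δ := Δ) (ξ := 45 * ε) h0 h2 hΔ.le (by linarith)
    (by intro i; fin_cases i <;> simp [gammaRange] <;> left <;> constructor <;> linarith)
    (by
      intro i
      fin_cases i <;> simp [gammaRange]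
      · left; constructor <;> linarith
      · right; constructor <;> linarith
      · left; constructor <;> linarith) hη (specParams_one h0 h2)
  obtain ⟨K₂, k₂⟩ := norm_kadj_mul_c3InvSq_le (Δ := Δ) hΔ.le (by linarith) hη (by
    intro i j h
    rcases eq_or_eq_neg_of_abs_eq h with h | h <;> revert h <;> fin_cases i <;> fin_cases j <;>
      simp <;> intro h <;> linarith)
  obtain ⟨K₃, k₃⟩ := lintegral_GstarR_le h0 h2
  refine ⟨2 * Real.exp ((10 + 2 + 3 * ε) * Real.log 2) * Real.exp (K₁ + K₂ + K₃),
    by positivity, fun μ hs e0 e1 y y1 y2 => ?_⟩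
  have hμ := exists_re_eq hs e0 e1
  obtain ⟨p, q, s, hmid⟩ := exists_mid (fun i => (μ i).im)
  set Y := (1 / 2 + ε) * ylog y.1 + (1 / 2 + ε) * ylog y.2 with hY
  set f : ℝ × ℝ × ℝ × ℝ × ℝ × ℝ × ℝ → ℂ := fun p =>
      GstarR (pt (-(1 / 2) - 3 * ε) p.1) μ * coreT Δ μ (pt (-(1 / 2) - 3 * ε) p.1, -μ 1) y
        (pt (-(1 / 2) - ε) p.2.1) (pt (-(1 / 2) - ε) p.2.2.1) (pt ε p.2.2.2.1)
        (pt (1 / 2 - 4 * ε) p.2.2.2.2.1) (pt (100 * ε) p.2.2.2.2.2.1)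
        (pt ε p.2.2.2.2.2.2) with hf
  have hmeas : Measurable f := (Measurable.GstarR (by fun_prop) μ).mul
    (Measurable.coreT Δ μ y (by fun_prop) (by fun_prop) (by fun_prop) (by fun_prop) (by fun_prop)
      (by fun_prop) (by fun_prop) (by fun_prop))
  have hJ := k₁ μ hμ p q s hmid y y1 y2 ℝ (fun u => ‖GstarR (pt (-(1 / 2) - 3 * ε) u) μ‖ₑ)
    (fun u => (pt (-(1 / 2) - 3 * ε) u, -μ 1))
    (Measurable.GstarR (Measurable.pt _ measurable_id) μ).enorm (fun u => enorm_ne_top)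
    ((Measurable.pt _ measurable_id).prodMk measurable_const)
    (fun u => pt_re _ _) (fun u => by simp [e1]; ring)
    (fun u z => by simp) _ (by simpa using k₃ μ hμ)
  simp_rw [← enorm_mul] at hJ
  have hJ' := le_trans (le_of_eq ((lintegral_seven hmeas.enorm).trans (lintegral_congr fun u =>
    lintegral_order_six (hmeas.enorm.comp (measurable_prodMk_left (x := u)))))) hJ
  refine ⟨⟨hmeas.aestronglyMeasurable, hJ'.trans_lt (ENNReal.mul_lt_top (xp_lt_top _)
    (ENNReal.add_lt_top.2 ⟨xp_lt_top _, xp_lt_top _⟩))⟩, ?_⟩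
  -- The definition and the estimate iterate in different orders; the joint integral of the absolute
  -- value mediates.
  have hE : ∀ B, ∫⁻ p, ‖f p‖ₑ ≤ B →
      ‖E1 Δ (contourTable ε 0) μ y‖ₑ ≤ ‖kadj Δ μ * c3InvSq μ‖ₑ * B := fun B hB => by
    refine enorm_const_mul_le norm_const_six_le (le_trans ?_ hB)
    rw [lintegral_seven hmeas.enorm]
    refine (enorm_lineInt_le _ _).trans (lintegral_mono fun u => ?_)
    exact (enorm_mul_T_le _ _ _ _ _ _).trans_eq
      (lintegral_iter_six (hmeas.enorm.comp (measurable_prodMk_left (x := u)))).symm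
  have hE := hE _ hJ'
  rw [← mul_assoc] at hE
  have hE' := hE.trans (mul_le_mul' (mul_le_mul' (enorm_le_xp (k₂ μ hμ)) le_rfl) le_rfl)
  rw [← xp_add] at hE'
  refine (norm_le_majorant (by linarith) (by linarith) (dominated_one h0 h2) μ hmid hE'
    (K := K₁ + K₂ + K₃ + Y) ?_).trans_eq ?_
  · simp only [rootLin, rootSum]
    simp
    linarith
  · rw [Real.exp_add _ Y]
    ring

/-! ### The second error term -/

lemma specParams_two {ε : ℝ} (h0 : 0 < ε) (h1 : ε ≤ 1 / 100000) :
    SpecParams (fun i => (1 / 2 - 4 * ε + ![-(1 / 2) - 3 * ε, 3 * ε,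
      -(-(1 / 2) - 3 * ε) - 3 * ε] i) / 2)
      (fun i => (1 + ![-(1 / 2) - 3 * ε, 3 * ε, -(-(1 / 2) - 3 * ε) - 3 * ε] i - 100 * ε) / 2 +
        ![45 * ε, 0, 0] i)
      ((1 / 2 - 4 * ε + 100 * ε) / 2) (ε / 4) (45 * ε) := by
  refine ⟨by linarith, by linarith, ?_, ?_, ?_, ?_, ?_, ?_, by linarith, by linarith, by linarith,
    by linarith, ?_, ?_⟩
  iterate 4 · intro i; fin_cases i <;> simp <;> linarith
  iterate 4 · intro i j; fin_cases i <;> fin_cases j <;> simp <;> linarith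

lemma dominated_two {ε : ℝ} (h0 : 0 < ε) (h1 : ε ≤ 1 / 100000) :
    Dominated (fun i => (1 / 2 - 4 * ε + ![-(1 / 2) - 3 * ε, 3 * ε,
      -(-(1 / 2) - 3 * ε) - 3 * ε] i) / 2)
      (fun i => (1 + ![-(1 / 2) - 3 * ε, 3 * ε, -(-(1 / 2) - 3 * ε) - 3 * ε] i - 100 * ε) / 2 +
        ![45 * ε, 0, 0] i)
      ((1 / 2 - 4 * ε + 100 * ε) / 2) (ε / 4) (45 * ε)
      ![3 / 4 - 3 / 2 * ε + ε / 4, -(3 / 2 * ε), 1 / 4 - 3 * ε] ((2 - 0) / 2 + ε) (0 + ε) := by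
  intro p q s h1 h2 h3
  rcases perm_cases h1 h2 h3 with h | h | h | h | h | h <;> obtain ⟨rfl, rfl, rfl⟩ := h <;>
    simp [DominatedAt, abs_le] <;> refine ⟨?_, ?_, ?_, ?_, ?_⟩ <;> linarith

/-- The integration variable is u₂, to which r₂ is not tied, so the last weight is trivial. The
surplus degree becomes decay in μ₂ - μ₃. -/
lemma lintegral_GstarL_le {ε : ℝ} (h0 : 0 < ε) (h1 : ε ≤ 1 / 100000) : ∃ K : ℝ,
    ∀ μ : Fin 3 → ℂ, (∀ i, (μ i).re = ![-(1 / 2) - 3 * ε, 3 * ε, -(-(1 / 2) - 3 * ε) - 3 * ε] i) →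
      ∀ z : ℝ,
    ∫⁻ u, ‖GstarL (pt (-(1 / 2) - 3 * ε) u) μ‖ₑ * xp (-(0 * lg (z - u))) ≤
      xp (K + (-(1 / 2) * lg ((μ 0).im - (μ 1).im) - 1 / 2 * lg ((μ 0).im - (μ 2).im) +
      (-(3 * ε - 1 / 2) / 2 - (1 / 4 + 3 / 2 * ε - ε / 4)) * lg ((μ 1).im - (μ 2).im))) := by
  obtain ⟨K₁, k₁⟩ := norm_GstarL_le (δ := ε / 4) (a := -(1 / 2) - 3 * ε)
    (η := ![-(1 / 2) - 3 * ε, 3 * ε, -(-(1 / 2) - 3 * ε) - 3 * ε]) (by linarith)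
    (by intro i j; fin_cases i <;> fin_cases j <;> simp [abs_le] <;> constructor <;> linarith)
    (by simp [gammaRange]; right; constructor <;> linarith)
    (by simp [gammaRange]; right; constructor <;> linarith)
    (by simp [gammaRange]; right; constructor <;> linarith)
    (by simp [gammaRange]; right; constructor <;> linarith)
  obtain ⟨K₂, k₂⟩ := lintegral_xp_two (c₁ := 3 / 4) (c₂ := 1 / 2 + 3 / 2 * ε)
    (1 / 4 + 3 / 2 * ε - ε / 4) (by linarith) (by linarith) (by linarith) (by linarith)
  refine ⟨K₁ + K₂, fun μ hμ z => ?_⟩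
  refine (lintegral_mono fun u => (mul_le_mul' (enorm_le_xp (k₁ μ hμ _ (pt_re _ u)))
    le_rfl).trans_eq (xp_add _ _).symm).trans ((k₂ (-(μ 1).im) (-(μ 2).im)
    (K₁ + (-(1 / 2) * lg ((μ 0).im - (μ 1).im) - 1 / 2 * lg ((μ 0).im - (μ 2).im) -
      (3 * ε - 1 / 2) / 2 * lg ((μ 1).im - (μ 2).im))) _ fun u => ?_).trans (xp_mono ?_))
  · simp only [pt_im]
    simp
    linarith
  · rw [lg_congr_neg (by ring : -(μ 1).im - -(μ 2).im = -((μ 1).im - (μ 2).im))]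
    linarith

set_option maxHeartbeats 400000 in
lemma errorTerm_two {Δ ε : ℝ} (hΔ : 0 < Δ) (hΔ1 : Δ < 1 / 10) (h0 : 0 < ε)
    (h1 : ε ≤ Δ / 10000) : ∃ C : ℝ, 0 ≤ C ∧ ∀ μ : Fin 3 → ℂ, μ 0 + μ 1 + μ 2 = 0 →
    (μ 0).re = -(1 / 2) - 3 * ε → (μ 1).re = 3 * ε → ∀ y : ℝ × ℝ, y.1 ≠ 0 → y.2 ≠ 0 →
    absConv2 Δ (contourTable ε 1) μ y ∧ ‖E2 Δ (contourTable ε 1) μ y‖ ≤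
      C * Real.exp ((1 / 2 + ε) * ylog y.1 + (1 / 2 + ε) * ylog y.2) * Msym ε 2 0 μ := by
  have h2 : ε ≤ 1 / 100000 := by linarith
  have hη : ∀ i j, |![-(1 / 2) - 3 * ε, 3 * ε, -(-(1 / 2) - 3 * ε) - 3 * ε] i -
    ![-(1 / 2) - 3 * ε, 3 * ε, -(-(1 / 2) - 3 * ε) - 3 * ε] j| < 2 := by
    intro i j
    fin_cases i <;> fin_cases j <;> simp [abs_lt] <;> constructor <;> linarith
  -- Here u₁ = μ₁, so the decay 45ε in r₂ - u₁ goes into the spectral exponents instead of the outer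
  -- integral.
  obtain ⟨K₁, k₁⟩ := lintegral_outer_coreT (Δ := Δ) (ξ := 0) h0 h2 hΔ.le (by linarith)
    (by intro i; fin_cases i <;> simp [gammaRange] <;> left <;> constructor <;> linarith)
    (by
      intro i
      fin_cases i <;> simp [gammaRange]
      · left; constructor <;> linarith
      · left; constructor <;> linarith
      · right; constructor <;> linarith) hη (specParams_two h0 h2)
  obtain ⟨K₂, k₂⟩ := norm_kadj_mul_c3InvSq_le (Δ := Δ) hΔ.le (by linarith) hη (by
    intro i j h
    rcases eq_or_eq_neg_of_abs_eq h with h | h <;> revert h <;> fin_cases i <;> fin_cases j <;>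
      simp <;> intro h <;> linarith)
  obtain ⟨K₃, k₃⟩ := lintegral_GstarL_le h0 h2
  refine ⟨2 * Real.exp ((10 + 2 + 3 * ε) * Real.log 2) * Real.exp (K₁ + K₂ + K₃),
    by positivity, fun μ hs e0 e1 y y1 y2 => ?_⟩
  have hμ := exists_re_eq hs e0 e1
  obtain ⟨p, q, s, hmid⟩ := exists_mid (fun i => (μ i).im)
  set Y := (1 / 2 + ε) * ylog y.1 + (1 / 2 + ε) * ylog y.2 with hY
  set f : ℝ × ℝ × ℝ × ℝ × ℝ × ℝ × ℝ → ℂ := fun p =>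
      GstarL (pt (-(1 / 2) - 3 * ε) p.1) μ * coreT Δ μ (μ 0, pt (-(1 / 2) - 3 * ε) p.1) y
        (pt (-(1 / 2) - ε) p.2.1) (pt (-(1 / 2) - ε) p.2.2.1) (pt ε p.2.2.2.1)
        (pt (1 / 2 - 4 * ε) p.2.2.2.2.1) (pt (100 * ε) p.2.2.2.2.2.1)
        (pt ε p.2.2.2.2.2.2) with hf
  have hmeas : Measurable f := (Measurable.GstarL (by fun_prop) μ).mul
    (Measurable.coreT Δ μ y (by fun_prop) (by fun_prop) (by fun_prop) (by fun_prop) (by fun_prop)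
      (by fun_prop) (by fun_prop) (by fun_prop))
  have hJ := k₁ μ hμ p q s hmid y y1 y2 ℝ (fun u => ‖GstarL (pt (-(1 / 2) - 3 * ε) u) μ‖ₑ)
    (fun u => (μ 0, pt (-(1 / 2) - 3 * ε) u))
    (Measurable.GstarL (Measurable.pt _ measurable_id) μ).enorm (fun u => enorm_ne_top)
    (measurable_const.prodMk (Measurable.pt _ measurable_id))
    (fun u => e0) (fun u => pt_re _ _)
    (fun u z => by simp) _ (by simpa using k₃ μ hμ)
  simp_rw [← enorm_mul] at hJ
  have hJ' := le_trans (le_of_eq ((lintegral_seven hmeas.enorm).trans (lintegral_congr fun u =>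
    lintegral_order_six (hmeas.enorm.comp (measurable_prodMk_left (x := u)))))) hJ
  refine ⟨⟨hmeas.aestronglyMeasurable, hJ'.trans_lt (ENNReal.mul_lt_top (xp_lt_top _)
    (ENNReal.add_lt_top.2 ⟨xp_lt_top _, xp_lt_top _⟩))⟩, ?_⟩
  have hE : ∀ B, ∫⁻ p, ‖f p‖ₑ ≤ B →
      ‖E2 Δ (contourTable ε 1) μ y‖ₑ ≤ ‖kadj Δ μ * c3InvSq μ‖ₑ * B := fun B hB => by
    refine enorm_const_mul_le norm_const_six_le (le_trans ?_ hB)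
    rw [lintegral_seven hmeas.enorm]
    refine (enorm_lineInt_le _ _).trans (lintegral_mono fun u => ?_)
    exact (enorm_mul_T_le _ _ _ _ _ _).trans_eq
      (lintegral_iter_six (hmeas.enorm.comp (measurable_prodMk_left (x := u)))).symm
  have hE := hE _ hJ'
  rw [← mul_assoc] at hE
  have hE' := hE.trans (mul_le_mul' (mul_le_mul' (enorm_le_xp (k₂ μ hμ)) le_rfl) le_rfl)
  rw [← xp_add] at hE'
  refine (norm_le_majorant (by linarith) (by linarith) (dominated_two h0 h2) μ hmid hE'
    (K := K₁ + K₂ + K₃ + Y) ?_).trans_eq ?_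
  · simp only [rootLin, rootSum]
    simp
    linarith
  · rw [Real.exp_add _ Y]
    ring

end

section

/-! ## The double integral over `u` -/

/-- Bounds for the exponents of `G*(u, μ)` on the lines of integration over `u`. -/
structure OuterParams (α β : Fin 3 → ℝ) (θ γ κ : ℝ) : Prop where
  αlo : ∀ i, 7 / 10 ≤ α i
  αhi : ∀ i, α i ≤ 4 / 5
  βlo : ∀ i, 7 / 10 ≤ β i
  βhi : ∀ i, β i ≤ 4 / 5
  θ1 : 1 ≤ θ
  θ2 : θ ≤ 2
  γ0 : 0 ≤ γ
  κ0 : 0 < κ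
  γ1 : γ ≤ 1 / 100
  κ1 : κ ≤ 1 / 100

noncomputable def outerA (α β : Fin 3 → ℝ) (θ : ℝ) (m : Fin 3 → ℝ) (p q s : Fin 3)
    (x z : ℝ) : ℝ :=
  (3 / 5 + θ - α q - β s) * lg (m q - m s) - α p * lg (m p - m s) - 3 / 5 * lg (x + m q) -
    α s * lg (x + m s) - β p * lg (z - m p) - β q * lg (z - m q)

noncomputable def outerB (α β : Fin 3 → ℝ) (θ : ℝ) (m : Fin 3 → ℝ) (p q s : Fin 3)
    (x z : ℝ) : ℝ :=
  (3 / 5 + θ - β q - α p) * lg (m p - m q) - β s * lg (m p - m s) - α q * lg (x + m q) -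
    α s * lg (x + m s) - β p * lg (z - m p) - 3 / 5 * lg (z - m q)

/-- The denominator of G* now contributes growth in x + z, which is charged to the larger of |x +
m_q| and |z - m_q|. The two alternatives keep the exponent 3/5 at that factor. -/
lemma Label.outer_le {α β : Fin 3 → ℝ} {θ γ κ : ℝ} (P : OuterParams α β θ γ κ) {m : Fin 3 → ℝ}
    {p q s : Fin 3} (h1 : p ≠ q) (h2 : q ≠ s) (h3 : p ≠ s) {x z e : ℝ} (L : Label m p q s x z e) :
    -∑ i, α i * lg (x + m i) - ∑ i, β i * lg (z - m i) + θ * lg (x + z) ≤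
      outerA α β θ m p q s x z + 20 * e ∨
    -∑ i, α i * lg (x + m i) - ∑ i, β i * lg (z - m i) + θ * lg (x + z) ≤
      outerB α β θ m p q s x z + 20 * e := by
  have hS := lg_add_le_max (x + m q) (z - m q)
  rw [show x + m q + (z - m q) = x + z by ring] at hS
  rw [outerA, outerB, sum_eq_of_distinct h1 h2 h3, sum_eq_of_distinct h1 h2 h3]
  obtain ⟨c0, c1, c2, c3, c4, c5, c6, c7, c8, c9, c10, c11, c12, c13, c14, c15, c16, c17⟩ := L
  have l2 : 0 < Real.log 2 := Real.log_pos one_lt_two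
  set X := lg (m q - m s)
  set Y := lg (m p - m q)
  set Z := lg (m p - m s)
  set Ap := lg (x + m p)
  set Aq := lg (x + m q)
  set As := lg (x + m s)
  set Bp := lg (z - m p)
  set Bq := lg (z - m q)
  set Bs := lg (z - m s)
  set S := lg (x + z)
  have he0 : 0 ≤ e := by linarith
  have a1 := P.αlo p
  have a2 := P.αhi p
  have a3 := P.αlo q
  have a4 := P.αhi q
  have b1 := P.βlo q
  have b2 := P.βhi q
  have b3 := P.βlo s
  have b4 := P.βhi s
  have t1 := P.θ1
  have t2 := P.θ2
  have m1 : ∀ {a b c : ℝ}, 0 ≤ a → a ≤ c → b * 1 ≤ e → a * b ≤ c * e := fun {a b c} ha hc hb =>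
    (mul_le_mul_of_nonneg_left (by linarith) ha).trans (mul_le_mul_of_nonneg_right hc he0)
  rcases le_total Bq Aq with h | h
  · left
    rw [max_eq_left h] at hS
    have hz : Z - X + Aq ≤ Ap + 3 * e := by
      rcases max_cases X Y with ⟨h, h'⟩ | ⟨h, h'⟩ <;> rw [h] at c14 <;> linarith
    have k1 : θ * (S - Aq) ≤ 2 * e := m1 (by linarith) t2 (by linarith)
    have k2 : α p * ((Z - X + Aq - Ap) / 3) ≤ 1 * e := m1 (by linarith) (by linarith) (by linarith)
    have k3 : (3 / 5 + θ - α q - α p) * (Aq - X) ≤ 2 * e :=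
      m1 (by linarith) (by linarith) (by linarith)
    have k4 : β s * (X - Bs) ≤ 1 * e := m1 (by linarith) (by linarith) (by linarith)
    linarith
  · right
    rw [max_eq_right h] at hS
    have hz : Z - Y + Bq ≤ Bs + 3 * e := by
      rcases max_cases X Y with ⟨h, h'⟩ | ⟨h, h'⟩ <;> rw [h] at c14 <;> linarith
    have k1 : θ * (S - Bq) ≤ 2 * e := m1 (by linarith) t2 (by linarith)
    have k2 : β s * ((Z - Y + Bq - Bs) / 3) ≤ 1 * e := m1 (by linarith) (by linarith) (by linarith)
    have k3 : (3 / 5 + θ - β q - β s) * (Bq - Y) ≤ 2 * e :=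
      m1 (by linarith) (by linarith) (by linarith)
    have k4 : α p * (Y - Ap) ≤ 1 * e := m1 (by linarith) (by linarith) (by linarith)
    linarith

lemma outer_le {α β : Fin 3 → ℝ} {θ γ κ : ℝ} (P : OuterParams α β θ γ κ) :
    ∃ K : ℝ, ∀ m : Fin 3 → ℝ, ∀ p q s : Fin 3, Mid m p q s → ∀ x z : ℝ,
    xp (-∑ i, α i * lg (x + m i) - ∑ i, β i * lg (z - m i) + θ * lg (x + z) -
      Real.pi / 4 * defect m x z) ≤
      xp (K + outerA α β θ m p q s x z) + xp (K + outerB α β θ m p q s x z) +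
      (xp (K + outerA α β θ m s q p x z) + xp (K + outerB α β θ m s q p x z)) := by
  -- As in `specExp_le`, half the defect absorbs the 20 lg D hidden in the error 20e.
  refine ⟨20 * Real.log 2 + (40 * Real.log 40 + 1) / 2, fun m p q s h x z => ?_⟩
  have key : ∀ {p q s : Fin 3}, p ≠ q → q ≠ s → p ≠ s →
      Label m p q s x z (Real.log 2 + lg (defect m x z)) →
      xp (-∑ i, α i * lg (x + m i) - ∑ i, β i * lg (z - m i) + θ * lg (x + z) -
        Real.pi / 4 * defect m x z) ≤
      xp (20 * Real.log 2 + (40 * Real.log 40 + 1) / 2 + outerA α β θ m p q s x z) +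
        xp (20 * Real.log 2 + (40 * Real.log 40 + 1) / 2 + outerB α β θ m p q s x z) := by
    intro p q s h1 h2 h3 L
    have h5 := mul_lg_le (defect m x z) (c := 40) (by norm_num)
    rw [abs_of_nonneg L.defect_nonneg] at h5
    have h6 : 1 / 2 * defect m x z ≤ Real.pi / 4 * defect m x z :=
      mul_le_mul_of_nonneg_right (by linarith [Real.pi_gt_three]) L.defect_nonneg
    rcases L.outer_le P h1 h2 h3 with h4 | h4
    · exact (xp_mono (by linarith)).trans le_self_add
    · exact (xp_mono (by linarith)).trans le_add_self
  rcases label_or h x z with L | L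
  · exact (key h.pq h.qs h.ps L).trans le_self_add
  · exact (key h.qs.symm h.pq.symm h.ps.symm L).trans le_add_self

/-- Exponents of the root sizes left by the integral of `outerA`, indexed by the opposite
coordinate. -/
noncomputable def weightA (α β : Fin 3 → ℝ) (θ γ κ : ℝ) (p q s : Fin 3) (i : Fin 3) : ℝ :=
  if i = p then 1 + κ + θ - γ - α q - α s - β s
  else if i = q then -α p else 1 + κ - β p - β q

/-- Exponents of the root sizes left by the integral of `outerB`. -/
noncomputable def weightB (α β : Fin 3 → ℝ) (θ γ κ : ℝ) (p q s : Fin 3) (i : Fin 3) : ℝ :=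
  if i = p then 1 + κ - γ - α q - α s
  else if i = q then -β s else 1 + κ + θ - β p - β q - α p

/-- In each variable the exchange leaves degree 1 + κ. The weight γ in b - x increases the surplus
spent on m_q - m_s, uniformly in b. -/
lemma lintegral_outerA {α β : Fin 3 → ℝ} {θ γ κ : ℝ} (P : OuterParams α β θ γ κ) {p q s : Fin 3}
    (h1 : p ≠ q) (h2 : q ≠ s) (h3 : p ≠ s) : ∃ K : ℝ, ∀ m : Fin 3 → ℝ, ∀ e b : ℝ,
    ∫⁻ x, ∫⁻ z, xp (e + outerA α β θ m p q s x z - γ * lg (b - x)) ≤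
      xp (K + e + rootLin (weightA α β θ γ κ p q s) m) := by
  have a1 := P.αlo s
  have a2 := P.αhi s
  have b1 := P.βlo q
  have b2 := P.βhi q
  have b3 := P.βlo p
  have b4 := P.βhi p
  have g0 := P.γ0
  have g1 := P.γ1
  have k0 := P.κ0
  have k1 := P.κ1
  obtain ⟨K₁, j₁⟩ := lintegral_xp_three (c₁ := 3 / 5) (c₂ := α s) (c₃ := γ)
    (3 / 5 + α s + γ - 1 - κ) 0 0 (by linarith) le_rfl le_rfl (by linarith) (by linarith)
    (by linarith) (by linarith)
  obtain ⟨K₂, j₂⟩ := lintegral_xp_two (c₁ := β p) (c₂ := β q) (β p + β q - 1 - κ)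
    (by linarith) (by linarith) (by linarith) (by linarith)
  refine ⟨K₁ + K₂, fun m e b => ?_⟩
  refine (lintegral_mono fun x => j₂ (m p) (m q) (e + (3 / 5 + θ - α q - β s) * lg (m q - m s) -
    α p * lg (m p - m s) - 3 / 5 * lg (x + m q) - α s * lg (x + m s) - γ * lg (b - x)) _
    fun z => ?_).trans ?_
  · rw [outerA]
    linarith
  · refine (j₁ (-m q) (-m s) b (K₂ + e + (3 / 5 + θ - α q - β s) * lg (m q - m s) -
      α p * lg (m p - m s) - (β p + β q - 1 - κ) * lg (m p - m q)) _ fun x => ?_).trans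
      (xp_mono ?_)
    · rw [lg_sub_comm b x, sub_neg_eq_add, sub_neg_eq_add]
      linarith
    · rw [rootLin_eq h1 h2 h3, lg_congr_neg (by ring : -m q - -m s = -(m q - m s))]
      simp only [weightA, h1.symm, h2.symm, h3.symm, if_true, if_false]
      linarith

lemma lintegral_outerB {α β : Fin 3 → ℝ} {θ γ κ : ℝ} (P : OuterParams α β θ γ κ) {p q s : Fin 3}
    (h1 : p ≠ q) (h2 : q ≠ s) (h3 : p ≠ s) : ∃ K : ℝ, ∀ m : Fin 3 → ℝ, ∀ e b : ℝ,
    ∫⁻ x, ∫⁻ z, xp (e + outerB α β θ m p q s x z - γ * lg (b - x)) ≤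
      xp (K + e + rootLin (weightB α β θ γ κ p q s) m) := by
  have a1 := P.αlo s
  have a2 := P.αhi s
  have a3 := P.αlo q
  have a4 := P.αhi q
  have b3 := P.βlo p
  have b4 := P.βhi p
  have g0 := P.γ0
  have g1 := P.γ1
  have k0 := P.κ0
  have k1 := P.κ1
  obtain ⟨K₁, j₁⟩ := lintegral_xp_three (c₁ := α q) (c₂ := α s) (c₃ := γ)
    (α q + α s + γ - 1 - κ) 0 0 (by linarith) le_rfl le_rfl (by linarith) (by linarith)
    (by linarith) (by linarith)
  obtain ⟨K₂, j₂⟩ := lintegral_xp_two (c₁ := β p) (c₂ := 3 / 5) (β p + 3 / 5 - 1 - κ)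
    (by linarith) (by linarith) (by linarith) (by linarith)
  refine ⟨K₁ + K₂, fun m e b => ?_⟩
  refine (lintegral_mono fun x => j₂ (m p) (m q) (e + (3 / 5 + θ - β q - α p) * lg (m p - m q) -
    β s * lg (m p - m s) - α q * lg (x + m q) - α s * lg (x + m s) - γ * lg (b - x)) _
    fun z => ?_).trans ?_
  · rw [outerB]
    linarith
  · refine (j₁ (-m q) (-m s) b (K₂ + e + (3 / 5 + θ - β q - α p) * lg (m p - m q) -
      β s * lg (m p - m s) - (β p + 3 / 5 - 1 - κ) * lg (m p - m q)) _ fun x => ?_).trans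
      (xp_mono ?_)
    · rw [lg_sub_comm b x, sub_neg_eq_add, sub_neg_eq_add]
      linarith
    · rw [rootLin_eq h1 h2 h3, lg_congr_neg (by ring : -m q - -m s = -(m q - m s))]
      simp only [weightB, h1.symm, h2.symm, h3.symm, if_true, if_false]
      linarith

lemma rootLin_neg (W m : Fin 3 → ℝ) : rootLin W (fun i => -m i) = rootLin W m := by
  simp only [rootLin]
  rw [lg_congr_neg (by ring : -m 0 - -m 1 = -(m 0 - m 1)),
    lg_congr_neg (by ring : -m 0 - -m 2 = -(m 0 - m 2)),
    lg_congr_neg (by ring : -m 1 - -m 2 = -(m 1 - m 2))]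

/-- The double integral over `u`. -/
lemma lintegral_outer_le {α β : Fin 3 → ℝ} {θ γ κ : ℝ} (P : OuterParams α β θ γ κ) :
    ∃ K : ℝ, ∀ m : Fin 3 → ℝ, ∀ p q s : Fin 3, Mid m p q s → ∀ e b : ℝ,
    ∫⁻ x, ∫⁻ z, xp (e + (-∑ i, α i * lg (x + -m i) - ∑ i, β i * lg (z - -m i) + θ * lg (x + z) -
      Real.pi / 4 * defect (fun i => -m i) x z) - γ * lg (b - x)) ≤
      xp (K + e + rootLin (weightA α β θ γ κ p q s) m) +
        xp (K + e + rootLin (weightB α β θ γ κ p q s) m) +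
      (xp (K + e + rootLin (weightA α β θ γ κ s q p) m) +
        xp (K + e + rootLin (weightB α β θ γ κ s q p) m)) := by
  obtain ⟨K₀, h₀⟩ := outer_le P
  have hA : ∀ p q s : Fin 3, ∃ K : ℝ, p ≠ q → q ≠ s → p ≠ s → ∀ m : Fin 3 → ℝ, ∀ e b : ℝ,
      ∫⁻ x, ∫⁻ z, xp (e + outerA α β θ m p q s x z - γ * lg (b - x)) ≤
        xp (K + e + rootLin (weightA α β θ γ κ p q s) m) := fun p q s => by
    by_cases h : p ≠ q ∧ q ≠ s ∧ p ≠ s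
    · obtain ⟨K, hK⟩ := lintegral_outerA P h.1 h.2.1 h.2.2
      exact ⟨K, fun _ _ _ => hK⟩
    · exact ⟨0, fun a b c => absurd ⟨a, b, c⟩ h⟩
  have hB : ∀ p q s : Fin 3, ∃ K : ℝ, p ≠ q → q ≠ s → p ≠ s → ∀ m : Fin 3 → ℝ, ∀ e b : ℝ,
      ∫⁻ x, ∫⁻ z, xp (e + outerB α β θ m p q s x z - γ * lg (b - x)) ≤
        xp (K + e + rootLin (weightB α β θ γ κ p q s) m) := fun p q s => by
    by_cases h : p ≠ q ∧ q ≠ s ∧ p ≠ s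
    · obtain ⟨K, hK⟩ := lintegral_outerB P h.1 h.2.1 h.2.2
      exact ⟨K, fun _ _ _ => hK⟩
    · exact ⟨0, fun a b c => absurd ⟨a, b, c⟩ h⟩
  choose KA kA using hA
  choose KB kB using hB
  have leA : ∀ p q s, KA p q s ≤ ∑ p, ∑ q, ∑ s, (|KA p q s| + |KB p q s|) := fun p q s =>
    calc KA p q s ≤ |KA p q s| + |KB p q s| := by
          linarith [le_abs_self (KA p q s), abs_nonneg (KB p q s)]
      _ ≤ ∑ s, (|KA p q s| + |KB p q s|) := Finset.single_le_sum
          (f := fun s => |KA p q s| + |KB p q s|) (fun _ _ => by positivity) (Finset.mem_univ s)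
      _ ≤ ∑ q, ∑ s, (|KA p q s| + |KB p q s|) := Finset.single_le_sum
          (f := fun q => ∑ s, (|KA p q s| + |KB p q s|)) (fun _ _ => by positivity)
          (Finset.mem_univ q)
      _ ≤ _ := Finset.single_le_sum
          (f := fun p => ∑ q, ∑ s, (|KA p q s| + |KB p q s|)) (fun _ _ => by positivity)
          (Finset.mem_univ p)
  have leB : ∀ p q s, KB p q s ≤ ∑ p, ∑ q, ∑ s, (|KA p q s| + |KB p q s|) := fun p q s =>
    calc KB p q s ≤ |KA p q s| + |KB p q s| := by
          linarith [le_abs_self (KB p q s), abs_nonneg (KA p q s)]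
      _ ≤ ∑ s, (|KA p q s| + |KB p q s|) := Finset.single_le_sum
          (f := fun s => |KA p q s| + |KB p q s|) (fun _ _ => by positivity) (Finset.mem_univ s)
      _ ≤ ∑ q, ∑ s, (|KA p q s| + |KB p q s|) := Finset.single_le_sum
          (f := fun q => ∑ s, (|KA p q s| + |KB p q s|)) (fun _ _ => by positivity)
          (Finset.mem_univ q)
      _ ≤ _ := Finset.single_le_sum
          (f := fun p => ∑ q, ∑ s, (|KA p q s| + |KB p q s|)) (fun _ _ => by positivity)
          (Finset.mem_univ p)
  set K := ∑ p, ∑ q, ∑ s, (|KA p q s| + |KB p q s|)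
  refine ⟨K₀ + K, fun m p q s h e b => ?_⟩
  -- G*(u, μ) has u₁ - μ_i where the factor in r has r₁ + μ_i, so the labels are applied to -m; the
  -- middle index does not change.
  have hn := h.neg
  have hpt : ∀ x z, xp (e + (-∑ i, α i * lg (x + -m i) - ∑ i, β i * lg (z - -m i) +
      θ * lg (x + z) - Real.pi / 4 * defect (fun i => -m i) x z) - γ * lg (b - x)) ≤
      xp (K₀ + e + outerA α β θ (fun i => -m i) p q s x z - γ * lg (b - x)) +
        xp (K₀ + e + outerB α β θ (fun i => -m i) p q s x z - γ * lg (b - x)) +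
      (xp (K₀ + e + outerA α β θ (fun i => -m i) s q p x z - γ * lg (b - x)) +
        xp (K₀ + e + outerB α β θ (fun i => -m i) s q p x z - γ * lg (b - x))) := by
    intro x z
    have := mul_le_mul' (le_refl (xp (e - γ * lg (b - x)))) (h₀ _ p q s hn x z)
    rw [mul_add, mul_add, mul_add, ← xp_add, ← xp_add, ← xp_add, ← xp_add, ← xp_add] at this
    refine le_trans (le_of_eq ?_) (this.trans (le_of_eq ?_))
    · congr 1
      ring
    · congr 2 <;> congr 1 <;> ring
  have mA : ∀ p q s, Measurable fun x : ℝ × ℝ =>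
      xp (K₀ + e + outerA α β θ (fun i => -m i) p q s x.1 x.2 - γ * lg (b - x.1)) := by
    intro p q s
    unfold outerA
    fun_prop
  have mB : ∀ p q s, Measurable fun x : ℝ × ℝ =>
      xp (K₀ + e + outerB α β θ (fun i => -m i) p q s x.1 x.2 - γ * lg (b - x.1)) := by
    intro p q s
    unfold outerB
    fun_prop
  have cvt : ∀ f : ℝ × ℝ → ENNReal, Measurable f → ∫⁻ x, ∫⁻ z, f (x, z) = ∫⁻ p, f p :=
      fun f hf => by
    rw [Measure.volume_eq_prod, lintegral_prod _ hf.aemeasurable]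
  refine (lintegral_mono fun x => lintegral_mono fun z => hpt x z).trans ?_
  have e4 := cvt (fun x => _ + _ + (_ + _)) (((mA p q s).add (mB p q s)).add
    ((mA s q p).add (mB s q p)))
  dsimp only at e4
  rw [e4, lintegral_add_left (by exact (mA p q s).add (mB p q s)), lintegral_add_left (mA p q s),
    lintegral_add_left (mA s q p), ← cvt _ (mA p q s), ← cvt _ (mB p q s), ← cvt _ (mA s q p),
    ← cvt _ (mB s q p)]
  have fin : ∀ {L V : ℝ}, L ≤ K → xp (L + (K₀ + e) + V) ≤ xp (K₀ + K + e + V) := fun hL =>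
    xp_mono (by linarith)
  refine add_le_add (add_le_add ?_ ?_) (add_le_add ?_ ?_)
  · have := kA p q s h.pq h.qs h.ps (fun i => -m i) (K₀ + e) b
    rw [rootLin_neg] at this
    exact this.trans (fin (leA _ _ _))
  · have := kB p q s h.pq h.qs h.ps (fun i => -m i) (K₀ + e) b
    rw [rootLin_neg] at this
    exact this.trans (fin (leB _ _ _))
  · have := kA s q p h.qs.symm h.pq.symm h.ps.symm (fun i => -m i) (K₀ + e) b
    rw [rootLin_neg] at this
    exact this.trans (fin (leA _ _ _))
  · have := kB s q p h.qs.symm h.pq.symm h.ps.symm (fun i => -m i) (K₀ + e) b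
    rw [rootLin_neg] at this
    exact this.trans (fin (leB _ _ _))

end

/-! ### Comparison with the majorant for four families of outer exponents, and the term with no
residue. -/

section

@[fun_prop]
lemma Measurable.Gstar {α : Type*} [MeasurableSpace α] {f g : α → ℂ} (hf : Measurable f)
    (hg : Measurable g) (μ : Fin 3 → ℂ) : Measurable fun x => Gstar (f x, g x) μ := by
  unfold SL3.Gstar G
  fun_prop

lemma norm_const_seven_le : ‖-3 / (2 ^ 8 * 3 * (Real.pi : ℂ) ^ 7)‖ ≤ 1 := by
  have h := Real.pi_gt_three
  have h5 : (1 : ℝ) ≤ Real.pi ^ 7 := one_le_pow₀ (by linarith)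
  simp only [norm_div, norm_mul, norm_neg, norm_pow, Complex.norm_real,
    Complex.norm_ofNat, Real.norm_eq_abs, abs_of_pos Real.pi_pos]
  rw [div_le_one (by positivity)]
  linarith

lemma lintegral_real_prod {α : Type*} [MeasureSpace α] [SFinite (volume : Measure α)]
    {f : ℝ × α → ENNReal} (hf : Measurable f) : ∫⁻ p, f p = ∫⁻ u, ∫⁻ p, f (u, p) := by
  rw [Measure.volume_eq_prod, lintegral_prod _ hf.aemeasurable]

lemma xp_le_majorant {ρ σ : Fin 3 → ℝ} {τ κ γ ε κ' δ' : ℝ} {W : Fin 3 → ℝ}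
    (h1 : 0 ≤ (κ' - δ') / 2 + ε) (h2 : 0 ≤ δ' + ε) {p q s : Fin 3}
    (D : DominatedAt ρ σ τ κ γ W ((κ' - δ') / 2 + ε) (δ' + ε) p q s) (μ : Fin 3 → ℂ)
    (h : Mid (fun i => (μ i).im) p q s) {k K : ℝ}
    (hk : k ≤ K + rootLin W (fun i => (μ i).im) +
      labelMain ρ σ τ κ γ (fun i => (μ i).im) p q s) :
    xp k ≤ ENNReal.ofReal
      (Real.exp ((10 + κ' + 3 * ε) * Real.log 2) * Real.exp K * Msym ε κ' δ' μ) := by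
  refine ENNReal.ofReal_le_ofReal ?_
  calc _ ≤ Real.exp K * Real.exp (labelMain ρ σ τ κ γ (fun i => (μ i).im) p q s +
        rootLin W (fun i => (μ i).im)) := by
        rw [← Real.exp_add]
        exact Real.exp_le_exp.2 (by linarith)
    _ ≤ Real.exp K * _ :=
        mul_le_mul_of_nonneg_left (exp_labelMain_le h1 h2 D μ h) (Real.exp_pos _).le
    _ = _ := by ring

lemma rootLin_one_add (W m : Fin 3 → ℝ) :
    rootLin (fun i => 1 + W i) m = rootSum m + rootLin W m := by
  simp only [rootLin, rootSum]
  ring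

/-- Version of `norm_le_majorant` for four families of exponents. -/
lemma norm_le_majorant_four {ρ σ : Fin 3 → ℝ} {τ κ γ ε κ' δ' : ℝ} {W : Fin 4 → Fin 3 → ℝ}
    (h1 : 0 ≤ (κ' - δ') / 2 + ε) (h2 : 0 ≤ δ' + ε) {p q s : Fin 3}
    (D₁ : ∀ l, DominatedAt ρ σ τ κ γ (fun i => 1 + W l i) ((κ' - δ') / 2 + ε) (δ' + ε) p q s)
    (D₂ : ∀ l, DominatedAt ρ σ τ κ γ (fun i => 1 + W l i) ((κ' - δ') / 2 + ε) (δ' + ε) s q p)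
    (μ : Fin 3 → ℂ) (h : Mid (fun i => (μ i).im) p q s) {E : ℂ} {k e w K : ℝ}
    (hE : ‖E‖ₑ ≤ xp k * ((xp (w + rootLin (W 0) (fun i => (μ i).im)) +
      xp (w + rootLin (W 1) (fun i => (μ i).im)) +
      (xp (w + rootLin (W 2) (fun i => (μ i).im)) +
        xp (w + rootLin (W 3) (fun i => (μ i).im)))) *
      (xp (e + labelMain ρ σ τ κ γ (fun i => (μ i).im) p q s) +
      xp (e + labelMain ρ σ τ κ γ (fun i => (μ i).im) s q p))))
    (hk : k + w + e ≤ K + rootSum (fun i => (μ i).im)) :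
    ‖E‖ ≤ 8 * Real.exp ((10 + κ' + 3 * ε) * Real.log 2) * Real.exp K * Msym ε κ' δ' μ := by
  have hM : 0 ≤ Msym ε κ' δ' μ := Finset.sum_nonneg fun w _ => by unfold Mpoly; positivity
  set m : Fin 3 → ℝ := fun i => (μ i).im with hm
  set M := Real.exp ((10 + κ' + 3 * ε) * Real.log 2) * Real.exp K * Msym ε κ' δ' μ with hMdef
  have hM' : 0 ≤ M := by positivity
  have b₁ : ∀ l, xp (k + (w + rootLin (W l) m + (e + labelMain ρ σ τ κ γ m p q s))) ≤
      ENNReal.ofReal M := fun l => xp_le_majorant h1 h2 (D₁ l) μ h (by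
    rw [rootLin_one_add]
    linarith)
  have b₂ : ∀ l, xp (k + (w + rootLin (W l) m + (e + labelMain ρ σ τ κ γ m s q p))) ≤
      ENNReal.ofReal M := fun l => xp_le_majorant h1 h2 (D₂ l) μ h.symm (by
    rw [rootLin_one_add]
    linarith)
  rw [← ofReal_norm] at hE
  simp only [add_mul, mul_add, ← xp_add] at hE
  have hE' := hE.trans (add_le_add (add_le_add (add_le_add (b₁ 0) (b₁ 1))
    (add_le_add (b₁ 2) (b₁ 3))) (add_le_add (add_le_add (b₂ 0) (b₂ 1)) (add_le_add (b₂ 2) (b₂ 3))))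
  simp only [← ENNReal.ofReal_add, hM', add_nonneg] at hE'
  rw [← ENNReal.ofReal_add (by positivity) (by positivity),
    ENNReal.ofReal_le_ofReal_iff (by positivity)] at hE'
  linarith

/-! ### The third error term -/

lemma specParams_three {ε : ℝ} (h0 : 0 < ε) (h1 : ε ≤ 1 / 100000) :
    SpecParams (fun i => (1 / 2 - 4 * ε + ![-3 * ε, 3 * ε, -(-3 * ε) - 3 * ε] i) / 2)
      (fun i => (1 + ![-3 * ε, 3 * ε, -(-3 * ε) - 3 * ε] i - 100 * ε) / 2 + ![0, 0, 0] i)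
      ((1 / 2 - 4 * ε + 100 * ε) / 2) (ε / 4) (45 * ε) := by
  refine ⟨by linarith, by linarith, ?_, ?_, ?_, ?_, ?_, ?_, by linarith, by linarith, by linarith,
    by linarith, ?_, ?_⟩
  iterate 4 · intro i; fin_cases i <;> simp <;> linarith
  iterate 4 · intro i j; fin_cases i <;> fin_cases j <;> simp <;> linarith

lemma outerParams_three {ε : ℝ} (h0 : 0 < ε) (h1 : ε ≤ 1 / 100000) :
    OuterParams (fun i => 3 / 4 + 3 / 2 * ε + ![-3 * ε, 3 * ε, -(-3 * ε) - 3 * ε] i / 2)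
      (fun i => 3 / 4 + 3 / 2 * ε - ![-3 * ε, 3 * ε, -(-3 * ε) - 3 * ε] i / 2) (1 + 3 * ε)
      (45 * ε) (ε / 4) := by
  refine ⟨?_, ?_, ?_, ?_, by linarith, by linarith, by linarith, by linarith, by linarith,
    by linarith⟩ <;> intro i <;> fin_cases i <;> simp <;> linarith

/-- The weights of the four terms in `lintegral_outer_le`. -/
noncomputable def outerWeights (α β : Fin 3 → ℝ) (θ γ κ : ℝ) (p q s : Fin 3) :
    Fin 4 → Fin 3 → ℝ :=
  ![weightA α β θ γ κ p q s, weightB α β θ γ κ p q s, weightA α β θ γ κ s q p,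
    weightB α β θ γ κ s q p]

/-- The labellings for u and for r are chosen independently, so each of the four outer weights has
to be combined with both orientations of the spectral label. -/
lemma dominated_three {ε : ℝ} (h0 : 0 < ε) (h1 : ε ≤ 1 / 100000) {p q s p' s' : Fin 3}
    (hpq : p ≠ q) (hqs : q ≠ s) (hps : p ≠ s) (h : p' = p ∧ s' = s ∨ p' = s ∧ s' = p)
    (l : Fin 4) :
    DominatedAt (fun i => (1 / 2 - 4 * ε + ![-3 * ε, 3 * ε, -(-3 * ε) - 3 * ε] i) / 2)
      (fun i => (1 + ![-3 * ε, 3 * ε, -(-3 * ε) - 3 * ε] i - 100 * ε) / 2 + ![0, 0, 0] i)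
      ((1 / 2 - 4 * ε + 100 * ε) / 2) (ε / 4) (45 * ε)
      (fun i => 1 + outerWeights
        (fun i => 3 / 4 + 3 / 2 * ε + ![-3 * ε, 3 * ε, -(-3 * ε) - 3 * ε] i / 2)
        (fun i => 3 / 4 + 3 / 2 * ε - ![-3 * ε, 3 * ε, -(-3 * ε) - 3 * ε] i / 2) (1 + 3 * ε)
        (45 * ε) (ε / 4) p' q s' l i) ((5 / 2 - 1 / 2) / 2 + ε) (1 / 2 + ε) p q s := by
  have hη : ∀ i, -3 * ε ≤ ![-3 * ε, 3 * ε, -(-3 * ε) - 3 * ε] i ∧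
      ![-3 * ε, 3 * ε, -(-3 * ε) - 3 * ε] i ≤ 3 * ε := by
    intro i
    fin_cases i <;> simp <;> linarith
  have hs : ![-3 * ε, 3 * ε, -(-3 * ε) - 3 * ε] p + ![-3 * ε, 3 * ε, -(-3 * ε) - 3 * ε] q +
      ![-3 * ε, 3 * ε, -(-3 * ε) - 3 * ε] s = 0 := by
    have := sum_eq_of_distinct hpq hqs hps ![-3 * ε, 3 * ε, -(-3 * ε) - 3 * ε]
    rw [← this, Fin.sum_univ_three]
    simp
  have hz : ∀ i, ![(0 : ℝ), 0, 0] i = 0 := by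
    intro i
    fin_cases i <;> simp
  -- Only |η_i| ≤ 3ε and Σ η_i = 0 matter, which avoids a case distinction over the orderings.
  generalize ![-3 * ε, 3 * ε, -(-3 * ε) - 3 * ε] = η at *
  have ap := hη p
  have aq := hη q
  have as := hη s
  rcases h with ⟨rfl, rfl⟩ | ⟨rfl, rfl⟩ <;> fin_cases l <;>
    simp [DominatedAt, outerWeights, weightA, weightB, hpq, hqs, hps, hpq.symm, hqs.symm,
      hps.symm, abs_le, hz] <;> refine ⟨?_, ?_, ?_, ?_, ?_⟩ <;> linarith

/-- The subtracted `rootLin` is the contribution of Λ. The weight in z - u₁ takes part in the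
u₁-integral, with a result uniform in z. -/
lemma lintegral_Gstar_le {ε : ℝ} (h0 : 0 < ε) (h1 : ε ≤ 1 / 100000) : ∃ K : ℝ,
    ∀ μ : Fin 3 → ℂ, (∀ i, (μ i).re = ![-3 * ε, 3 * ε, -(-3 * ε) - 3 * ε] i) →
    ∀ p q s : Fin 3, Mid (fun i => (μ i).im) p q s → ∀ z : ℝ,
    ∫⁻ u : ℝ × ℝ, ‖Gstar (pt (-(1 / 2) - 3 * ε) u.1, pt (-(1 / 2) - 3 * ε) u.2) μ‖ₑ *
        xp (-(45 * ε * lg (z - u.1))) ≤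
      ∑ l, xp (K - rootLin ![3 / 2 * ε, -(3 / 2 * ε), -3 * ε] (fun i => (μ i).im) +
        rootLin (outerWeights
        (fun i => 3 / 4 + 3 / 2 * ε + ![-3 * ε, 3 * ε, -(-3 * ε) - 3 * ε] i / 2)
        (fun i => 3 / 4 + 3 / 2 * ε - ![-3 * ε, 3 * ε, -(-3 * ε) - 3 * ε] i / 2) (1 + 3 * ε)
        (45 * ε) (ε / 4) p q s l) (fun i => (μ i).im)) := by
  obtain ⟨K₁, k₁⟩ := norm_Gstar_le (δ := ε / 4) (by linarith)
  obtain ⟨K₂, k₂⟩ := lintegral_outer_le (outerParams_three h0 h1)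
  refine ⟨K₂ + K₁, fun μ hμ p q s hmid z => ?_⟩
  have hm : Measurable fun u : ℝ × ℝ =>
      ‖Gstar (pt (-(1 / 2) - 3 * ε) u.1, pt (-(1 / 2) - 3 * ε) u.2) μ‖ₑ *
        xp (-(45 * ε * lg (z - u.1))) := by fun_prop
  rw [lintegral_real_prod hm]
  refine (lintegral_mono fun x => lintegral_mono fun y => ?_).trans ((k₂ (fun i => (μ i).im) p q s
    hmid (K₁ - rootLin ![3 / 2 * ε, -(3 / 2 * ε), -3 * ε] (fun i => (μ i).im)) z).trans
    (le_of_eq ?_))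
  · refine (mul_le_mul' (enorm_le_xp (k₁ _ μ ?_ ?_ ?_ ?_ ?_)) le_rfl).trans_eq ?_
    · intro i
      right
      simp only [sub_re, pt_re, hμ]
      constructor <;> fin_cases i <;> simp <;> linarith
    · intro i
      right
      simp only [add_re, pt_re, hμ]
      constructor <;> fin_cases i <;> simp <;> linarith
    · simp only [add_re, pt_re]
      linarith
    · simp only [add_re, pt_re]
      linarith
    · intro i j
      rw [hμ, hμ, abs_le]
      constructor <;> fin_cases i <;> fin_cases j <;> simp <;> linarith
    · rw [← xp_add]
      congr 1
      simp only [specExp, pt_re, pt_im, hμ, rootLin, Fin.sum_univ_three]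
      simp
      ring
  · rw [Fin.sum_univ_four]
    simp only [outerWeights]
    simp [add_assoc, add_sub_assoc]

/-- The iterated integral of the absolute values controls `E3`. -/
lemma E3_of_lintegral_le {Δ : ℝ} {c : Contours} {μ : Fin 3 → ℂ} {y : ℝ × ℝ} {B : ENNReal}
    (hB : ∫⁻ u : ℝ × ℝ, ∫⁻ z, ∫⁻ x, ∫⁻ t₂, ∫⁻ t₁, ∫⁻ s₂, ∫⁻ s₁,
      ‖Gstar (pt c.u.1 u.1, pt c.u.2 u.2) μ‖ₑ * ‖coreT Δ μ (pt c.u.1 u.1, pt c.u.2 u.2) y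
        (pt c.s.1 s₁) (pt c.s.2 s₂) (pt c.t.1 t₁) (pt c.r.1 x) (pt c.r.2 z) (pt c.t.2 t₂)‖ₑ ≤ B)
    (hB' : B < ⊤) :
    absConv3 Δ c μ y ∧ ‖E3 Δ c μ y‖ₑ ≤ ‖kadj Δ μ * c3InvSq μ‖ₑ * B := by
  simp_rw [← enorm_mul] at hB
  set f : ℝ × ℝ × ℝ × ℝ × ℝ × ℝ × ℝ × ℝ → ℂ := fun p =>
      Gstar (pt c.u.1 p.1, pt c.u.2 p.2.1) μ *
      coreT Δ μ (pt c.u.1 p.1, pt c.u.2 p.2.1) y (pt c.s.1 p.2.2.1) (pt c.s.2 p.2.2.2.1)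
        (pt c.t.1 p.2.2.2.2.1) (pt c.r.1 p.2.2.2.2.2.1) (pt c.r.2 p.2.2.2.2.2.2.1)
        (pt c.t.2 p.2.2.2.2.2.2.2) with hf
  have hmeas : Measurable f := (Measurable.Gstar (by fun_prop) (by fun_prop) μ).mul
    (Measurable.coreT Δ μ y (by fun_prop) (by fun_prop) (by fun_prop) (by fun_prop) (by fun_prop)
      (by fun_prop) (by fun_prop) (by fun_prop))
  have hm₁ : ∀ u, Measurable fun p => ‖f (u, p)‖ₑ := fun u =>
    hmeas.enorm.comp measurable_prodMk_left
  have hm₂ : ∀ u₁ u₂, Measurable fun p => ‖f (u₁, u₂, p)‖ₑ := fun u₁ u₂ =>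
    (hm₁ u₁).comp measurable_prodMk_left
  have hm₃ : Measurable fun u : ℝ × ℝ => ∫⁻ p, ‖f (u.1, u.2, p)‖ₑ :=
    (hmeas.enorm.comp (by fun_prop : Measurable fun x : (ℝ × ℝ) × ℝ × ℝ × ℝ × ℝ × ℝ × ℝ =>
      (x.1.1, x.1.2, x.2))).lintegral_prod_right'
  have hiter : ∫⁻ p, ‖f p‖ₑ = ∫⁻ u₁, ∫⁻ u₂, ∫⁻ p, ‖f (u₁, u₂, p)‖ₑ :=
    (lintegral_real_prod hmeas.enorm).trans (lintegral_congr fun u => lintegral_real_prod (hm₁ u))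
  have hB₁ : ∫⁻ p, ‖f p‖ₑ ≤ B := by
    rw [hiter]
    refine le_trans (le_of_eq ((lintegral_real_prod hm₃).symm.trans ?_)) hB
    exact lintegral_congr fun u => lintegral_order_six (hm₂ u.1 u.2)
  refine ⟨⟨hmeas.aestronglyMeasurable, hB₁.trans_lt hB'⟩, ?_⟩
  refine enorm_const_mul_le norm_const_seven_le (le_trans ?_ hB₁)
  rw [hiter]
  refine (enorm_lineInt_le _ _).trans (lintegral_mono fun u₁ =>
    (enorm_lineInt_le _ _).trans (lintegral_mono fun u₂ => ?_))
  exact (enorm_mul_T_le _ _ _ _ _ _).trans_eq (lintegral_iter_six (hm₂ u₁ u₂)).symm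

end

section

lemma errorTerm_three {Δ ε : ℝ} (hΔ : 0 < Δ) (hΔ1 : Δ < 1 / 10) (h0 : 0 < ε)
    (h1 : ε ≤ Δ / 10000) : ∃ C : ℝ, 0 ≤ C ∧ ∀ μ : Fin 3 → ℂ, μ 0 + μ 1 + μ 2 = 0 →
    (μ 0).re = -3 * ε → (μ 1).re = 3 * ε → ∀ y : ℝ × ℝ, y.1 ≠ 0 → y.2 ≠ 0 →
    absConv3 Δ (contourTable ε 2) μ y ∧ ‖E3 Δ (contourTable ε 2) μ y‖ ≤
      C * Real.exp ((1 / 2 + ε) * ylog y.1 + (1 / 2 + ε) * ylog y.2) *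
        Msym ε (5 / 2) (1 / 2) μ := by
  have h2 : ε ≤ 1 / 100000 := by linarith
  have hη : ∀ i j, |![-3 * ε, 3 * ε, -(-3 * ε) - 3 * ε] i -
      ![-3 * ε, 3 * ε, -(-3 * ε) - 3 * ε] j| < 1 := by
    intro i j
    rw [abs_lt]
    constructor <;> fin_cases i <;> fin_cases j <;> simp <;> linarith
  obtain ⟨K₁, k₁⟩ := lintegral_outer_coreT (Δ := Δ) (ξ := 45 * ε) h0 h2 hΔ.le (by linarith)
    (by
      intro i
      left
      constructor <;> fin_cases i <;> simp <;> linarith)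
    (by
      intro i
      left
      constructor <;> fin_cases i <;> simp <;> linarith) (fun i j => (hη i j).trans one_lt_two)
      (specParams_three h0 h2)
  obtain ⟨K₂, k₂⟩ := norm_kadj_mul_c3InvSq_le (Δ := Δ) hΔ.le (by linarith)
    (fun i j => (hη i j).trans one_lt_two) (fun i j h => absurd h (hη i j).ne)
  obtain ⟨K₃, k₃⟩ := lintegral_Gstar_le h0 h2
  refine ⟨8 * Real.exp ((10 + 5 / 2 + 3 * ε) * Real.log 2) * Real.exp (K₁ + K₂ + K₃),
    by positivity, fun μ hs e0 e1 y y1 y2 => ?_⟩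
  have hμ := exists_re_eq hs e0 e1
  obtain ⟨p, q, s, hmid⟩ := exists_mid (fun i => (μ i).im)
  set Y := (1 / 2 + ε) * ylog y.1 + (1 / 2 + ε) * ylog y.2 with hY
  have hJ := k₁ μ hμ p q s hmid y y1 y2 (ℝ × ℝ)
    (fun u => ‖Gstar (pt (-(1 / 2) - 3 * ε) u.1, pt (-(1 / 2) - 3 * ε) u.2) μ‖ₑ)
    (fun u => (pt (-(1 / 2) - 3 * ε) u.1, pt (-(1 / 2) - 3 * ε) u.2)) (by fun_prop)
    (fun u => enorm_ne_top) (by fun_prop) (fun u => pt_re _ _) (fun u => pt_re _ _)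
    (fun u z => by simp) _ (fun z => (le_of_eq (by simp only [pt_im])).trans (k₃ μ hμ p q s hmid z))
  obtain ⟨hA, hE⟩ := E3_of_lintegral_le (c := contourTable ε 2) hJ (ENNReal.mul_lt_top
    (ENNReal.sum_lt_top.2 fun _ _ => xp_lt_top _)
    (ENNReal.add_lt_top.2 ⟨xp_lt_top _, xp_lt_top _⟩))
  refine ⟨hA, ?_⟩
  have hE' := hE.trans (mul_le_mul' (enorm_le_xp (k₂ μ hμ)) le_rfl)
  rw [Fin.sum_univ_four, add_assoc (_ + _)] at hE'
  have D₁ := dominated_three h0 h2 hmid.pq hmid.qs hmid.ps (.inl ⟨rfl, rfl⟩)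
  have D₂ := dominated_three h0 h2 hmid.qs.symm hmid.pq.symm hmid.ps.symm (.inr ⟨rfl, rfl⟩)
  -- The two G* factors are taken at μ and at -μ, so their Λ exponents cancel; Δ cancels as before,
  -- and exactly one `rootSum` is left.
  have key := norm_le_majorant_four (by linarith) (by linarith) D₁ D₂ μ hmid hE'
    (K := K₁ + K₂ + K₃ + Y) (by
      simp only [rootLin, rootSum]
      simp
      linarith)
  rw [Real.exp_add _ Y] at key
  refine key.trans_eq ?_
  ring

end

section

/-! ## Uniform form of the bounds -/

/-- The indices 3 and 6 are the terms with s₂ = -μ₂, where |y₂| carries the exponent Re μ₂ = 1/2 +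
3ε. -/
lemma exists_bound {Δ ε : ℝ} (hΔ : 0 < Δ) (hΔ1 : Δ < 1 / 10) (h0 : 0 < ε)
    (h1 : ε ≤ Δ / 10000) (j : Fin 7) : ∃ C : ℝ, 0 ≤ C ∧ ∀ μ : Fin 3 → ℂ, μ 0 + μ 1 + μ 2 = 0 →
    (μ 0).re = (contourTable ε j).η.1 → (μ 1).re = (contourTable ε j).η.2 →
    ∀ y : ℝ × ℝ, y.1 ≠ 0 → y.2 ≠ 0 → absConv Δ ε j μ y ∧ ‖errorTerm Δ ε j μ y‖ ≤
      C * Real.exp ((1 / 2 + ε) * ylog y.1 +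
        (if j = 3 ∨ j = 6 then 1 / 2 + 3 * ε else 1 / 2 + ε) * ylog y.2) *
        Msym ε (majorantParams j).1 (majorantParams j).2 μ := by
  fin_cases j
  · exact errorTerm_one hΔ hΔ1 h0 h1
  · exact errorTerm_two hΔ hΔ1 h0 h1
  · exact errorTerm_three hΔ hΔ1 h0 h1
  · exact errorTerm_four hΔ hΔ1 h0 h1
  · exact errorTerm_five hΔ hΔ1 h0 h1
  · exact errorTerm_six hΔ hΔ1 h0 h1
  · exact errorTerm_seven hΔ hΔ1 h0 h1

lemma exp_ylog_add_ylog {y : ℝ × ℝ} (y1 : y.1 ≠ 0) (y2 : y.2 ≠ 0) (a b : ℝ) :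
    Real.exp (a * ylog y.1 + b * ylog y.2) =
      Real.exp ((a + b) * Real.log (4 * Real.pi ^ 2)) * (|y.1| ^ a * |y.2| ^ b) := by
  rw [Real.exp_add, exp_mul_ylog y1, exp_mul_ylog y2, add_mul, Real.exp_add]
  ring

lemma one_le_four_mul_pi_sq : 1 ≤ 4 * Real.pi ^ 2 := by
  nlinarith [Real.pi_gt_three]

end

end SL3

theorem mainTheorem6 :
    ∃ Δ₀ : ℝ, 0 < Δ₀ ∧ ∃ c : ℝ, 0 < c ∧
      ∀ Δ : ℝ, 0 < Δ → Δ < Δ₀ → ∀ ε : ℝ, 0 < ε → ε ≤ c * Δ →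
        ∃ C : ℝ, ∀ j : Fin 7, ∀ μ : Fin 3 → ℂ, μ 0 + μ 1 + μ 2 = 0 →
          (μ 0).re = (SL3.contourTable ε j).η.1 → (μ 1).re = (SL3.contourTable ε j).η.2 →
          ∀ y : ℝ × ℝ, y.1 ≠ 0 → y.2 ≠ 0 →
            SL3.absConv Δ ε j μ y ∧
            ((j ≠ 3 ∧ j ≠ 6) ∨ |y.2| ≤ 1 →
              ‖SL3.errorTerm Δ ε j μ y‖ ≤
                C * (|y.1| ^ (1 / 2 + ε) * |y.2| ^ (1 / 2 + ε)) *
                  SL3.Msym ε (SL3.majorantParams j).1 (SL3.majorantParams j).2 μ) ∧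
            (j = 3 ∨ j = 6 →
              ‖SL3.errorTerm Δ ε j μ y‖ ≤
                C * (|y.1| ^ (1 / 2 + ε) * |y.2| ^ (1 / 2 + 3 * ε)) *
                  SL3.Msym ε (SL3.majorantParams j).1 (SL3.majorantParams j).2 μ) := by
  -- ε must be small against Δ so that the arguments (Δ + r₂ - μ_i)/2 stay on the correct side of
  -- the pole 0; Δ < 1/10 then gives ε ≤ 1/100000.
  refine ⟨1 / 10, by norm_num, 1 / 10000, by norm_num, fun Δ hΔ hΔ1 ε h0 h1 => ?_⟩
  choose C hC hC' using SL3.exists_bound hΔ hΔ1 h0 (by linarith : ε ≤ Δ / 10000)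
  -- The power of 4π² from |4π²y|, taken with the larger exponent so that it serves all seven terms.
  set c := Real.exp ((1 / 2 + ε + (1 / 2 + 3 * ε)) * Real.log (4 * Real.pi ^ 2)) with hc
  refine ⟨(∑ j, C j) * c, fun j μ hs e0 e1 y y1 y2 => ?_⟩
  obtain ⟨hA, hE⟩ := hC' j μ hs e0 e1 y y1 y2
  have hM : 0 ≤ SL3.Msym ε (SL3.majorantParams j).1 (SL3.majorantParams j).2 μ :=
    Finset.sum_nonneg fun w _ => by
      unfold SL3.Mpoly
      positivity
  have hL := Real.log_nonneg SL3.one_le_four_mul_pi_sq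
  have hCj : C j ≤ ∑ j, C j := Finset.single_le_sum (fun j _ => hC j) (Finset.mem_univ j)
  have hpos := (hC j).trans hCj
  rw [SL3.exp_ylog_add_ylog y1 y2, ← mul_assoc] at hE
  by_cases hj : j = 3 ∨ j = 6
  · rw [if_pos hj, ← hc] at hE
    have h3 : ‖SL3.errorTerm Δ ε j μ y‖ ≤
        (∑ j, C j) * c * (|y.1| ^ (1 / 2 + ε) * |y.2| ^ (1 / 2 + 3 * ε)) *
          SL3.Msym ε (SL3.majorantParams j).1 (SL3.majorantParams j).2 μ :=
      hE.trans (by gcongr)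
    refine ⟨hA, fun h => ?_, fun _ => h3⟩
    have hy : |y.2| ≤ 1 := by
      rcases h with h | h
      · exact absurd hj (by tauto)
      · exact h
    refine h3.trans ?_
    -- For |y₂| ≤ 1 lowering the exponent from 1/2 + 3ε to 1/2 + ε increases the bound.
    have := Real.rpow_le_rpow_of_exponent_ge (abs_pos.2 y2) hy
      (by linarith : 1 / 2 + ε ≤ 1 / 2 + 3 * ε)
    gcongr
  · rw [if_neg hj] at hE
    refine ⟨hA, fun _ => hE.trans ?_, fun h => absurd h hj⟩
    have : Real.exp ((1 / 2 + ε + (1 / 2 + ε)) * Real.log (4 * Real.pi ^ 2)) ≤ c :=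
      Real.exp_le_exp.2 (mul_le_mul_of_nonneg_right (by linarith) hL)
    gcongr
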